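/- **Loops and measures.** For a Riemann surface $S$ (connected, Hausdorff) let $\mathrm{Loop}(S)$ be the set of compact subsets of $S$ homeomorphic to $S^1$, with the Vietoris topology and its Borel $\sigma$-algebra. Let $\{\mu_S\}$ be a family of positive Borel measures $\mu_S$ on $\mathrm{Loop}(S)$, one for each Riemann surface, which satisfies conformal restriction (for each conformal embedding $S_1\to S_2$, the restriction of $\mu_{S_2}$ to $\mathrm{Loop}(S_1)$ equals $\mu_{S_1}$) and is nontrivial (for some $0<a<A$ the set of loops surrounding $0$ that lie in $\{0<|z|<A\}$ but not in $\{|z|<a\}$ has finite and positive $\mu_{\mathbb C}$-measure). Let $\mu_0$ be the restriction of $\mu_{\mathbb C}$ to the set $\mathrm{Loop}^1(\mathbb C\setminus\{0\})$ of loops in the plane that surround $0$. **Coordinates.** For $\gamma\in\mathrm{Loop}^1(\mathbb C\setminus\{0\})$ let $U_+\ni 0$ and $U_-\ni\infty$ be the components of $(\mathbb C\cup\{\infty\})\setminus\gamma$, and let $\phi_+:\{|z|<1\}\to U_+$ and $\phi_-:\{|z|>1\}\cup\{\infty\}\to U_-$ be the conformal isomorphisms normalized by $\phi_+(0)=0$,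 $\phi_+'(0)=\rho_0(\gamma)>0$, $\phi_-(\infty)=\infty$, $\lim_{z\to\infty}\phi_-(z)/z=\rho_\infty(\gamma)>0$. Define $u_n=u_n(\gamma)$, $l_n=l_n(\gamma)$, $n\ge1$, by $$\phi_+(z)=\rho_0 z\Big(1+\sum_{n\ge1}u_nz^n\Big),\qquad \frac1{\phi_-(1/w)}=\frac1{\rho_\infty}w\Big(1+\sum_{n\ge1}l_nw^n\Big).$$ A test function is a function $$F(\gamma)=p(u_1,\bar u_1,u_2,\bar u_2,\dots;l_1,\bar l_1,l_2,\bar l_2,\dots)\,f(\rho_0,\rho_\infty),$$ where $p$ is a polynomial with complex coefficients in finitely many of the variables and $f:\mathbb R^+\times\mathbb R^+\to\mathbb C$ is $C^1$ with compact support in $\mathbb R^+\times\mathbb R^+$. **Action of the Witt algebra.** For a Laurent polynomial $v\in\mathbb C[z,z^{-1}]$ let $\exp(t\vec v)$, $t\in\mathbb R$, be the local flow on $\mathbb C\setminus\{0\}$ of $\dot z=v(z)$, and put $$(\vec v\cdot F)(\gamma)=\frac{d}{dt}\Big|_{t=0}F\big(\exp(-t\vec v)(\gamma)\big).$$ The Witt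 algebra $\mathcal W$ consists of the vector fields $v(z)\frac{\partial}{\partial z}$, and $\overline{\mathcal W}$ of their conjugates $\overline{w(z)}\frac{\partial}{\partial\bar z}$, with $v,w$ Laurent polynomials. The element $L=v\frac{\partial}{\partial z}+\overline w\frac{\partial}{\partial\bar z}$ of $\mathcal W\times\overline{\mathcal W}$ acts by $$L(F)=\tfrac12\big(\vec v\cdot F-i\,\overrightarrow{iv}\cdot F\big)+\tfrac12\big(\vec w\cdot F+i\,\overrightarrow{iw}\cdot F\big).$$ **Proposition (infinitesimal conformal invariance of $\mu_0$).** Let $F$ be a test function. For every Laurent polynomial $x$ and every $\gamma\in\mathrm{Loop}^1(\mathbb C\setminus\{0\})$ the function $t\mapsto F(\exp(-t\vec x)(\gamma))$ is differentiable at $t=0$, so that $L(F)$ is defined, and for every $L\in\mathcal W\times\overline{\mathcal W}$ the function $L(F)$ is $\mu_0$-integrable and $$\int L(F)\,d\mu_0=0 .$$ -/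

import Mathlib

open Set Filter Topology MeasureTheory
open scoped Manifold LaurentPolynomial

noncomputable section

namespace LoopMeasure

/-! ## Loops on a surface and families of loop measures -/

/-- Self-avoiding loops on `S`: compact subsets of `S` homeomorphic to the circle. -/
def Loop (S : Type*) [TopologicalSpace S] : Type _ :=
  {K : TopologicalSpace.Compacts S // Nonempty (K ≃ₜ Circle)}

/-- The topology induced by the Vietoris topology on compact sets. -/
instance (S : Type*) [TopologicalSpace S] : TopologicalSpace (Loop S) :=
  inferInstanceAs
    (TopologicalSpace {K : TopologicalSpace.Compacts S // Nonempty (K ≃ₜ Circle)})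

/-- The Borel σ-algebra of that topology. -/
instance (S : Type*) [TopologicalSpace S] : MeasurableSpace (Loop S) := borel (Loop S)

instance (S : Type*) [TopologicalSpace S] : BorelSpace (Loop S) := ⟨rfl⟩

/-- The point set of a loop. -/
def Loop.toSet {S : Type*} [TopologicalSpace S] (γ : Loop S) : Set S :=
  ((γ.1 : TopologicalSpace.Compacts S) : Set S)

/-- The image of a loop under a continuous injective map into a Hausdorff space. -/
def Loop.map {S T : Type*} [TopologicalSpace S] [TopologicalSpace T] [T2Space T]
    (f : S → T) (hf : Continuous f) (hinj : Function.Injective f) (γ : Loop S) : Loop T :=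
  ⟨γ.1.map f hf, by
    obtain ⟨e⟩ := γ.2
    have : CompactSpace (γ.1 : TopologicalSpace.Compacts S) :=
      isCompact_iff_compactSpace.mp γ.1.isCompact
    let g : (γ.1 : TopologicalSpace.Compacts S) → (γ.1.map f hf) :=
      fun x => ⟨f x.1, ⟨x.1, x.2, rfl⟩⟩
    have hg : Continuous g := (hf.comp continuous_subtype_val).subtype_mk _
    have hb : Function.Bijective g := by
      constructor
      · intro x y hxy
        exact Subtype.ext (hinj (congrArg Subtype.val hxy))
      · rintro ⟨y, x, hx, rfl⟩
        exact ⟨⟨x, hx⟩, rfl⟩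
    exact ⟨(Continuous.homeoOfEquivCompactToT2 (f := Equiv.ofBijective g hb) hg).symm.trans e⟩⟩

theorem Loop.toSet_map {S T : Type*} [TopologicalSpace S] [TopologicalSpace T] [T2Space T]
    (f : S → T) (hf : Continuous f) (hinj : Function.Injective f) (γ : Loop S) :
    (γ.map f hf hinj).toSet = f '' γ.toSet := rfl

theorem Loop.continuous_map {S T : Type*} [TopologicalSpace S] [TopologicalSpace T] [T2Space T]
    (f : S → T) (hf : Continuous f) (hinj : Function.Injective f) :
    Continuous (Loop.map f hf hinj) :=
  (hf.compacts_map.comp continuous_subtype_val).subtype_mk _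

/-- A family consisting of one (positive) Borel measure on `Loop S` for every Riemann surface `S`.
A Riemann surface is a connected Hausdorff one-dimensional complex manifold (the transition maps are
complex `C¹`, that is, holomorphic). -/
def LoopMeasureFamily : Type 1 :=
  ∀ (S : Type) [TopologicalSpace S] [T2Space S] [ConnectedSpace S] [ChartedSpace ℂ S]
    [IsManifold 𝓘(ℂ) 1 S], Measure (Loop S)

/-- Conformal restriction: for each conformal embedding `f : S₁ → S₂`, the restriction of the
measure of `S₂` to the loops lying in the image of `S₁` is the (transported) measure of `S₁`. -/
def LoopMeasureFamily.ConformalRestriction (μ : LoopMeasureFamily) : Prop :=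
  ∀ (S₁ S₂ : Type)
    [TopologicalSpace S₁] [T2Space S₁] [ConnectedSpace S₁] [ChartedSpace ℂ S₁]
    [IsManifold 𝓘(ℂ) 1 S₁]
    [TopologicalSpace S₂] [T2Space S₂] [ConnectedSpace S₂] [ChartedSpace ℂ S₂]
    [IsManifold 𝓘(ℂ) 1 S₂]
    (f : S₁ → S₂) (hf : MDifferentiable 𝓘(ℂ) 𝓘(ℂ) f) (hinj : Function.Injective f),
    (μ S₁).map (Loop.map f hf.continuous hinj)
      = (μ S₂).restrict (range (Loop.map f hf.continuous hinj))

/-- A subset of the plane surrounds `0`: it avoids `0`, and `0` lies in a bounded component of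
its complement. -/
def SurroundsZero (K : Set ℂ) : Prop :=
  0 ∉ K ∧ Bornology.IsBounded (connectedComponentIn Kᶜ 0)

/-- Loops in the plane that surround `0`. -/
def loopsAroundZero : Set (Loop ℂ) := {γ | SurroundsZero γ.toSet}

/-- For some `0 < a < A`, the set of loops surrounding `0` that are contained in
`{0 < |z| < A}` but not in `{|z| < a}` has finite and positive measure. -/
def LoopMeasureFamily.IsNontrivial (μ : LoopMeasureFamily) : Prop :=
  ∃ a A : ℝ, 0 < a ∧ a < A ∧
    0 < μ ℂ {γ | γ.toSet ⊆ {z | 0 < ‖z‖ ∧ ‖z‖ < A} ∧ ¬ γ.toSet ⊆ {z | ‖z‖ < a} ∧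
      SurroundsZero γ.toSet} ∧
    μ ℂ {γ | γ.toSet ⊆ {z | 0 < ‖z‖ ∧ ‖z‖ < A} ∧ ¬ γ.toSet ⊆ {z | ‖z‖ < a} ∧
      SurroundsZero γ.toSet} < ⊤

/-- `μ₀`: the restriction of the measure of the plane to the loops that surround `0`. -/
def LoopMeasureFamily.muZero (μ : LoopMeasureFamily) : Measure (Loop ℂ) :=
  (μ ℂ).restrict loopsAroundZero

/-! ## Normalized uniformizations and their coefficients

These functionals are written for arbitrary plane sets `K`; they are meaningful (the
uniformizations exist and are unique) when `K` is a loop surrounding `0`. -/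

/-- `U₊`, the component of the complement of `K` containing `0`. -/
def interiorDomain (K : Set ℂ) : Set ℂ := connectedComponentIn Kᶜ 0

/-- `U₋ ∖ {∞}`, the unbounded part of the complement of `K`. -/
def exteriorDomain (K : Set ℂ) : Set ℂ :=
  {z | z ∈ Kᶜ ∧ ¬ Bornology.IsBounded (connectedComponentIn Kᶜ z)}

/-- `φ` maps the unit disc conformally onto `U`, with `φ 0 = 0` and `φ' 0 > 0`. -/
structure IsInteriorMap (U : Set ℂ) (φ : ℂ → ℂ) : Prop where
  differentiableOn : DifferentiableOn ℂ φ (Metric.ball 0 1)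
  injOn : InjOn φ (Metric.ball 0 1)
  image_eq : φ '' Metric.ball 0 1 = U
  map_zero : φ 0 = 0
  deriv_pos : ∃ ρ : ℝ, 0 < ρ ∧ deriv φ 0 = ρ

/-- `φ` maps `{|z| > 1}` conformally onto `V`, with `φ z ∼ ρ z` at infinity for some `ρ > 0`. -/
structure IsExteriorMap (V : Set ℂ) (φ : ℂ → ℂ) : Prop where
  differentiableOn : DifferentiableOn ℂ φ {z | 1 < ‖z‖}
  injOn : InjOn φ {z | 1 < ‖z‖}
  image_eq : φ '' {z | 1 < ‖z‖} = V
  tendsto : ∃ ρ : ℝ, 0 < ρ ∧ Tendsto (fun z => φ z / z) (Bornology.cobounded ℂ) (𝓝 (ρ : ℂ))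

/-- The normalized uniformization `φ₊` of the inside. -/
def phiPlus (K : Set ℂ) : ℂ → ℂ := Classical.epsilon (IsInteriorMap (interiorDomain K))

/-- The normalized uniformization `φ₋` of the outside. -/
def phiMinus (K : Set ℂ) : ℂ → ℂ := Classical.epsilon (IsExteriorMap (exteriorDomain K))

/-- The conformal radius `ρ₀ = φ₊'(0)`. -/
def rhoZero (K : Set ℂ) : ℝ := (deriv (phiPlus K) 0).re

/-- The transfinite diameter `ρ_∞ = lim φ₋(z) / z` as `z → ∞`. -/
def rhoInfty (K : Set ℂ) : ℝ :=
  (limUnder (Bornology.cobounded ℂ) (fun z => phiMinus K z / z)).re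

/-- The coefficient `u_n` in `φ₊(z) = ρ₀ z (1 + ∑_{n ≥ 1} u_n z ^ n)`. -/
def uCoeff (n : ℕ+) (K : Set ℂ) : ℂ :=
  iteratedDeriv (n + 1) (phiPlus K) 0 / (Nat.factorial (n + 1) : ℂ) / (rhoZero K : ℂ)

/-- `w ↦ 1 / φ₋(1 / w)`, with the value `0` at `w = 0`. -/
def phiMinusInv (K : Set ℂ) (w : ℂ) : ℂ := if w = 0 then 0 else (phiMinus K w⁻¹)⁻¹

/-- The coefficient `l_n` in `1 / φ₋(1 / w) = ρ_∞⁻¹ w (1 + ∑_{n ≥ 1} l_n w ^ n)`. -/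
def lCoeff (n : ℕ+) (K : Set ℂ) : ℂ :=
  iteratedDeriv (n + 1) (phiMinusInv K) 0 / (Nat.factorial (n + 1) : ℂ) * (rhoInfty K : ℂ)

/-! ## Test functions -/

/-- Names for the variables `u_n`, `conj u_n`, `l_n`, `conj l_n`, `n ≥ 1`. -/
inductive CoeffVar : Type
  | u (n : ℕ+)
  | uBar (n : ℕ+)
  | l (n : ℕ+)
  | lBar (n : ℕ+)

/-- The value of such a variable at `K`. -/
def CoeffVar.value (K : Set ℂ) : CoeffVar → ℂ
  | .u n => uCoeff n K
  | .uBar n => starRingEnd ℂ (uCoeff n K)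
  | .l n => lCoeff n K
  | .lBar n => starRingEnd ℂ (lCoeff n K)

/-- `F = p(u, ū, l, l̄) f(ρ₀, ρ_∞)`. -/
def testFunction (p : MvPolynomial CoeffVar ℂ) (f : ℝ × ℝ → ℂ) (K : Set ℂ) : ℂ :=
  MvPolynomial.eval (CoeffVar.value K) p * f (rhoZero K, rhoInfty K)

/-! ## The action of the Witt algebra on functions of a loop

A Laurent polynomial `v` stands for the vector field `v(z) ∂/∂z`, so that
`L_n = - z ^ (n + 1) ∂/∂z` is `-T (n + 1)`. -/

/-- The value `v(z)`, for `z ≠ 0`. -/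
def fieldAt (v : ℂ[T;T⁻¹]) (z : ℂ) : ℂ := v.coeff.sum fun n c => c * z ^ n

/-- `exp(t v) z = w`: some integral curve of `v` in `ℂ ∖ {0}`, defined for all times between `0`
and `t`, goes from `z` at time `0` to `w` at time `t`. -/
def FlowsTo (v : ℂ[T;T⁻¹]) (t : ℝ) (z w : ℂ) : Prop :=
  ∃ x : ℝ → ℂ, x 0 = z ∧ x t = w ∧
    ∀ s ∈ uIcc 0 t, x s ≠ 0 ∧ HasDerivWithinAt x (fieldAt v (x s)) (uIcc 0 t) s

/-- `exp(t v) K`. For a compact `K ⊆ ℂ ∖ {0}` the flow is defined on all of `K` if `|t|` is small. -/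
def flowImage (v : ℂ[T;T⁻¹]) (t : ℝ) (K : Set ℂ) : Set ℂ := {w | ∃ z ∈ K, FlowsTo v t z w}

/-- The action of the real vector field of `v`:
`(v · F)(K) = d/dt F(exp(- t v) K)` at `t = 0`. -/
def realAction (v : ℂ[T;T⁻¹]) (F : Set ℂ → ℂ) (K : Set ℂ) : ℂ :=
  deriv (fun t : ℝ => F (flowImage v (-t) K)) 0

/-- The associated complex action of `v ∂/∂z`. -/
def holAction (v : ℂ[T;T⁻¹]) (F : Set ℂ → ℂ) (K : Set ℂ) : ℂ :=
  (1 / 2 : ℂ) * (realAction v F K - Complex.I * realAction (Complex.I • v) F K)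

/-- The associated complex action of the conjugate field `conj w ∂/∂z̄`. -/
def antiholAction (w : ℂ[T;T⁻¹]) (F : Set ℂ → ℂ) (K : Set ℂ) : ℂ :=
  (1 / 2 : ℂ) * (realAction w F K + Complex.I * realAction (Complex.I • w) F K)

/-- The action of the element `v ∂/∂z + conj w ∂/∂z̄` of `𝒲 × 𝒲̄`. Every element of this product
arises from exactly one pair `(v, w)`. -/
def wittAction (v w : ℂ[T;T⁻¹]) (F : Set ℂ → ℂ) (K : Set ℂ) : ℂ :=
  holAction v F K + antiholAction w F K

end LoopMeasure

end

open LoopMeasure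

/-! Conformal restriction makes the measure of the plane invariant under the flow of a holomorphic
vector field, as far as that flow is defined. A test function `F` lives on loops in some annulus `m
≤ |z| ≤ R`. On a slightly larger annulus `A` the flow at time `-t` is, for small `t`, a conformal
embedding into the plane. Restriction applied to this embedding shows that the integral of
`F(exp(-tv)γ)` over the loops of `A` does not depend on `t` (with `F` extended by zero to loops that
do not surround `0`). Differentiating under the integral sign at `t = 0` gives integral zero for the
action of each real field (`integrable_realAction`), and `L(F)` is a complex linear combination of
four such actions.

Four facts make this legitimate. The loops around `0` in an annulus have finite measure, by scale
invariance and nontriviality (`measure_loops_lt_top`). A lower bound on `ρ₀` and an upper bound on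
`ρ_∞` confine a loop to a fixed annulus (`exists_annulus_of_rho`). The coordinates are continuous in
the Vietoris topology, by Carathéodory's kernel theorem (`tendsto_iteratedDeriv_phiPlus`), which
gives measurability. Finally `F` is differentiable along flows, with bounds uniform over an annulus
(`isFlowRegular_testFunction`).

The last fact is the main work. With `φ = φ₊`, write `v(φ(ζ)) = ζ φ'(ζ) (x(ζ) - Y(ζ))`, where `x`
may have a pole at `0` but is imaginary on the unit circle, so that `ζ x` is tangent to the circle
and only reparametrizes it, and where `Y` is holomorphic in the disc with `Y(0)` real. The first
variation of `φ` is then `-ζ φ' Y`. Since the loop has no regularity, this is proved by comparison.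
Let `ψ` be the inverse of `φ`. Well inside, `ψ exp(t Y(ψ))` approximates the inverse uniformization
of the moved loop; near the boundary, `ω exp(t x(ω))` with `ω = ψ ∘ exp(-tv)` does. On a shell the
two agree up to a factor `exp(O(t²))` (`exists_overlap`). Splitting the exponent by Cauchy
transforms (`exists_splitting`) glues them into one holomorphic function with modulus `exp(O(t²))`
at the moved boundary, and the Borel–Carathéodory inequality identifies it with the exact inverse up
to `exp(O(t²))` (`exists_eq_mul_exp`, `exists_variation_bound`). Cauchy estimates pass to Taylor
coefficients. The outside reduces to the inside by `z ↦ 1/z`: `ρ_∞` and `l_n` of `K` are `1/ρ₀` and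
`u_n` of `1/K`.

All of this works for compact connected sets that surround `0` (`IsEnclosing`). Connectedness of the
set provides logarithms on its inside, hence the Riemann map, and the Jordan curve theorem is not
needed. -/

namespace LoopMeasure

/-! ## The inside of a continuum surrounding the origin -/

/-- A plane continuum that surrounds the origin. -/
structure IsEnclosing (K : Set ℂ) : Prop where
  isCompact : IsCompact K
  isConnected : IsConnected K
  surrounds : SurroundsZero K

theorem Loop.isConnected {γ : Loop ℂ} : IsConnected γ.toSet := by
  obtain ⟨e⟩ := γ.2
  have hc : ConnectedSpace Circle := Subtype.connectedSpace
    (isConnected_sphere (by rw [Complex.rank_real_complex]; norm_num) 0 zero_le_one)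
  have : ConnectedSpace (γ.1 : TopologicalSpace.Compacts ℂ) :=
    e.symm.surjective.connectedSpace e.symm.continuous
  exact isConnected_iff_connectedSpace.2 this

theorem Loop.isEnclosing {γ : Loop ℂ} (h : γ ∈ loopsAroundZero) : IsEnclosing γ.toSet :=
  ⟨γ.1.isCompact, Loop.isConnected, h⟩

section Components

variable {K : Set ℂ}

theorem isOpen_interiorDomain (hK : IsClosed K) : IsOpen (interiorDomain K) :=
  hK.isOpen_compl.connectedComponentIn

theorem interiorDomain_subset : interiorDomain K ⊆ Kᶜ := connectedComponentIn_subset _ _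

theorem isPreconnected_interiorDomain : IsPreconnected (interiorDomain K) :=
  isPreconnected_connectedComponentIn

theorem subset_interiorDomain {S : Set ℂ} (hS : IsPreconnected S) (h0 : 0 ∈ S) (h : Disjoint S K) :
    S ⊆ interiorDomain K :=
  hS.subset_connectedComponentIn h0 h.subset_compl_right

/-- A point off `K` has an open component of its own; if it lies in the closure of another
component, the two meet and hence coincide. -/
theorem closure_connectedComponentIn_compl_subset (hK : IsClosed K) (a : ℂ) :
    closure (connectedComponentIn Kᶜ a) ⊆ connectedComponentIn Kᶜ a ∪ K := by
  intro z hz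
  by_cases hzK : z ∈ K
  · exact Or.inr hzK
  · left
    have h1 : IsOpen (connectedComponentIn Kᶜ z) := hK.isOpen_compl.connectedComponentIn
    obtain ⟨w, hw1, hw2⟩ := mem_closure_iff.1 hz _ h1 (mem_connectedComponentIn hzK)
    have e1 := connectedComponentIn_eq hw1
    have e2 := connectedComponentIn_eq hw2
    rw [e2, ← e1]
    exact mem_connectedComponentIn hzK

theorem ball_subset_interiorDomain {m : ℝ} (hm : ∀ z ∈ K, m ≤ ‖z‖) : Metric.ball (0 : ℂ) m ⊆ interiorDomain K := by
  rcases le_or_gt m 0 with h0 | h0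
  · rw [Metric.ball_eq_empty.2 h0]
    exact empty_subset _
  · refine subset_interiorDomain (convex_ball _ _).isPreconnected (by simpa using h0) ?_
    rw [Set.disjoint_left]
    intro z hz hzK
    have := hm z hzK
    rw [mem_ball_zero_iff] at hz
    linarith

namespace IsEnclosing

variable (h : IsEnclosing K)
include h

theorem isOpen : IsOpen (interiorDomain K) := isOpen_interiorDomain h.isCompact.isClosed

theorem zero_mem : (0 : ℂ) ∈ interiorDomain K := mem_connectedComponentIn h.surrounds.1

theorem isBounded : Bornology.IsBounded (interiorDomain K) := h.surrounds.2

theorem closure_subset : closure (interiorDomain K) ⊆ interiorDomain K ∪ K :=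
  closure_connectedComponentIn_compl_subset h.isCompact.isClosed 0

theorem exists_ball_subset : ∃ m > 0, Metric.ball (0 : ℂ) m ⊆ interiorDomain K :=
  Metric.isOpen_iff.1 h.isOpen 0 h.zero_mem

/-- The inside is contained in every disc about the origin that contains the continuum. -/
theorem norm_lt {R : ℝ} (hR : ∀ z ∈ K, ‖z‖ < R) : ∀ z ∈ interiorDomain K, ‖z‖ < R := by
  by_contra! hcon
  obtain ⟨z, hz, hzR⟩ := hcon
  have hz0 : z ≠ 0 := by
    rintro rfl
    obtain ⟨w, hw⟩ := h.isConnected.nonempty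
    have := hR w hw
    have := norm_nonneg w
    rw [norm_zero] at hzR
    linarith
  -- The ray from `z` to infinity has norm at least `R`, so it misses `K` and would be an unbounded
  -- part of the bounded inside.
  have hpre : IsPreconnected ((fun t : ℝ => (t : ℂ) * z) '' Ici 1) :=
    isPreconnected_Ici.image _ (by fun_prop)
  have hdisj : (fun t : ℝ => (t : ℂ) * z) '' Ici 1 ⊆ Kᶜ := by
    rintro _ ⟨t, ht, rfl⟩ hK
    have h1 := hR _ hK
    rw [norm_mul, Complex.norm_real, Real.norm_of_nonneg (zero_le_one.trans ht)] at h1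
    nlinarith [norm_nonneg z, show (1 : ℝ) ≤ t from ht]
  have hsub : (fun t : ℝ => (t : ℂ) * z) '' Ici 1 ⊆ interiorDomain K := by
    have := hpre.subset_connectedComponentIn (x := z) ⟨1, self_mem_Ici, by simp⟩ hdisj
    rwa [← connectedComponentIn_eq hz] at this
  obtain ⟨C, hC⟩ := h.isBounded.exists_norm_le
  have hzpos : 0 < ‖z‖ := norm_pos_iff.2 hz0
  have hmem : (fun t : ℝ => (t : ℂ) * z) (max 1 ((C + 1) / ‖z‖)) ∈ interiorDomain K :=
    hsub ⟨_, mem_Ici.2 (le_max_left _ _), rfl⟩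
  have h2 := hC _ hmem
  simp only [norm_mul, Complex.norm_real] at h2
  rw [Real.norm_of_nonneg (zero_le_one.trans (le_max_left _ _))] at h2
  have h3 : (C + 1) / ‖z‖ * ‖z‖ = C + 1 := by field_simp
  nlinarith [le_max_right 1 ((C + 1) / ‖z‖)]

theorem exists_pos_le_norm : ∃ m > 0, ∀ z ∈ K, m ≤ ‖z‖ := by
  obtain ⟨m, hm, hmb⟩ := h.exists_ball_subset
  refine ⟨m, hm, fun z hz => ?_⟩
  by_contra! hlt
  exact interiorDomain_subset (hmb (mem_ball_zero_iff.2 hlt)) hz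

end IsEnclosing

end Components

/-! ## Locally uniform limits of holomorphic functions -/

theorem norm_sub_le_of_bounded_on_ball {f : ℂ → ℂ} {z w : ℂ} {r M : ℝ}
    (hf : DifferentiableOn ℂ f (Metric.ball z r)) (hM : ∀ x ∈ Metric.ball z r, ‖f x‖ ≤ M)
    (hw : w ∈ Metric.ball z r) : ‖f w - f z‖ ≤ 2 * M / r * ‖w - z‖ := by
  have hr : 0 < r := Metric.pos_of_mem_ball hw
  have h1 : MapsTo f (Metric.ball z r) (Metric.closedBall (f z) (2 * M)) := by
    intro x hx
    rw [mem_closedBall_iff_norm]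
    calc ‖f x - f z‖ ≤ ‖f x‖ + ‖f z‖ := norm_sub_le _ _
      _ ≤ 2 * M := by linarith [hM x hx, hM z (Metric.mem_ball_self hr)]
  have h2 := Complex.dist_le_div_mul_dist_of_mapsTo_ball hf h1 hw
  rwa [dist_eq_norm, dist_eq_norm] at h2

/-- Montel's theorem along an ultrafilter: compactness gives pointwise limits without passing to
subsequences, and the Schwarz lemma gives the equicontinuity that makes them locally uniform. The
functions need only be holomorphic near each point eventually, so domains that vary with the index
are allowed. -/
theorem exists_limit_of_locally_bounded {ι : Type*} (l : Ultrafilter ι) {F : ι → ℂ → ℂ}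
    {U : Set ℂ} (hU : ∀ z ∈ U, ∃ r > 0, ∃ M, ∀ᶠ i in (l : Filter ι),
      DifferentiableOn ℂ (F i) (Metric.ball z r) ∧ ∀ w ∈ Metric.ball z r, ‖F i w‖ ≤ M) :
    ∃ f : ℂ → ℂ, TendstoLocallyUniformlyOn F f l U := by
  have hlim : ∀ z, ∃ a, z ∈ U → Tendsto (fun i => F i z) l (𝓝 a) := by
    intro z
    by_cases hz : z ∈ U
    · obtain ⟨r, hr, M, hM⟩ := hU z hz
      have h1 : Metric.closedBall (0 : ℂ) M ∈ l.map (fun i => F i z) := by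
        refine hM.mono fun i hi => ?_
        refine mem_closedBall_zero_iff.2 ?_
        exact hi.2 z (Metric.mem_ball_self hr)
      obtain ⟨a, -, ha⟩ := (isCompact_closedBall (0 : ℂ) M).ultrafilter_le_nhds'
        (l.map (fun i => F i z)) h1
      exact ⟨a, fun _ => ha⟩
    · exact ⟨0, fun h => absurd h hz⟩
  choose f hf using hlim
  refine ⟨f, Metric.tendstoLocallyUniformlyOn_iff.2 fun ε hε x hx => ?_⟩
  obtain ⟨r, hr, M, hM⟩ := hU x hx
  have hM0 : 0 ≤ M := by
    obtain ⟨i, hi⟩ := hM.exists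
    exact (norm_nonneg _).trans (hi.2 x (Metric.mem_ball_self hr))
  -- Makes the oscillation on the `δ`-ball at most `ε / 4`; the `+ 1` guards against `M = 0`.
  set δ := min r (ε / 4 / (2 * M / r + 1)) with hδ
  have hδ0 : 0 < δ := lt_min hr (by positivity)
  have key : ∀ᶠ i in (l : Filter ι), ∀ y ∈ Metric.ball x δ, ‖F i y - F i x‖ ≤ ε / 4 := by
    refine hM.mono fun i hi y hy => ?_
    have hy' : y ∈ Metric.ball x r := Metric.ball_subset_ball (min_le_left _ _) hy
    refine (norm_sub_le_of_bounded_on_ball hi.1 hi.2 hy').trans ?_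
    have h3 : ‖y - x‖ ≤ ε / 4 / (2 * M / r + 1) :=
      (mem_ball_iff_norm.1 hy).le.trans (min_le_right _ _)
    have h4 : 0 ≤ 2 * M / r := by positivity
    calc 2 * M / r * ‖y - x‖ ≤ (2 * M / r + 1) * (ε / 4 / (2 * M / r + 1)) := by gcongr; linarith
      _ = ε / 4 := by field_simp
  refine ⟨Metric.ball x δ ∩ U, ?_, ?_⟩
  · exact inter_mem (mem_nhdsWithin_of_mem_nhds (Metric.ball_mem_nhds x hδ0)) self_mem_nhdsWithin
  have hfx : ∀ᶠ i in (l : Filter ι), ‖F i x - f x‖ < ε / 4 := by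
    have := (Metric.tendsto_nhds.1 (hf x hx)) (ε / 4) (by positivity)
    simpa [dist_eq_norm] using this
  filter_upwards [key, hfx] with i h1 h2 y hy
  have h5 : ‖f y - f x‖ ≤ ε / 4 := by
    have ht : Tendsto (fun i => ‖F i y - F i x‖) l (𝓝 ‖f y - f x‖) :=
      ((hf y hy.2).sub (hf x hx)).norm
    exact le_of_tendsto ht (key.mono fun i hi => hi y hy.1)
  rw [dist_eq_norm]
  have h6 : f y - F i y = (f y - f x) - (F i x - f x) - (F i y - F i x) := by ring
  rw [h6]
  have h7 := norm_sub_le ((f y - f x) - (F i x - f x)) (F i y - F i x)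
  have h8 := norm_sub_le (f y - f x) (F i x - f x)
  linarith [h1 y hy.1]

theorem differentiableOn_of_tendstoLocallyUniformlyOn {ι : Type*} {l : Filter ι} [l.NeBot]
    {F : ι → ℂ → ℂ} {f : ℂ → ℂ} {U : Set ℂ} (hUo : IsOpen U)
    (hF : TendstoLocallyUniformlyOn F f l U)
    (h : ∀ z ∈ U, ∃ r > 0, ∀ᶠ i in l, DifferentiableOn ℂ (F i) (Metric.ball z r)) :
    DifferentiableOn ℂ f U := by
  intro z hz
  obtain ⟨r, hr, hrd⟩ := h z hz
  obtain ⟨s, hs, hsU⟩ := Metric.isOpen_iff.1 hUo z hz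
  have h1 : DifferentiableOn ℂ f (Metric.ball z (min r s)) :=
    (hF.mono ((Metric.ball_subset_ball (min_le_right _ _)).trans hsU)).differentiableOn
      (hrd.mono fun i hi => hi.mono (Metric.ball_subset_ball (min_le_left _ _))) Metric.isOpen_ball
  exact (h1.differentiableAt (Metric.ball_mem_nhds z (lt_min hr hs))).differentiableWithinAt

theorem tendstoLocallyUniformlyOn_iteratedDeriv {ι : Type*} {l : Filter ι} [l.NeBot]
    {F : ι → ℂ → ℂ} {f : ℂ → ℂ} {U : Set ℂ} (hUo : IsOpen U)
    (hF : TendstoLocallyUniformlyOn F f l U) (h : ∀ᶠ i in l, DifferentiableOn ℂ (F i) U) (n : ℕ) :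
    TendstoLocallyUniformlyOn (fun i => iteratedDeriv n (F i)) (iteratedDeriv n f) l U ∧
      ∀ᶠ i in l, DifferentiableOn ℂ (iteratedDeriv n (F i)) U := by
  induction n with
  | zero => simpa using ⟨hF, h⟩
  | succ n ih =>
    simp only [iteratedDeriv_succ]
    exact ⟨ih.1.deriv ih.2 hUo, ih.2.mono fun i hi => hi.deriv hUo⟩

/-- **Hurwitz's theorem**: a zero of a locally uniform limit of nonvanishing holomorphic functions
is not isolated. -/
theorem eventually_eq_zero_of_limit_nonvanishing {ι : Type*} {l : Filter ι} [l.NeBot]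
    {F : ι → ℂ → ℂ} {f : ℂ → ℂ} {U : Set ℂ} (hUo : IsOpen U)
    (hF : TendstoLocallyUniformlyOn F f l U) (h : ∀ᶠ i in l, DifferentiableOn ℂ (F i) U)
    (hne : ∀ᶠ i in l, ∀ z ∈ U, F i z ≠ 0) {a : ℂ} (ha : a ∈ U) (hfa : f a = 0) :
    ∀ᶠ z in 𝓝 a, f z = 0 := by
  have hfd : DifferentiableOn ℂ f U := hF.differentiableOn h hUo
  have hfan : AnalyticAt ℂ f a := hfd.analyticAt (hUo.mem_nhds ha)
  rcases hfan.eventually_eq_zero_or_eventually_ne_zero with h0 | h0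
  · exact h0
  exfalso
  obtain ⟨s, hs, hsU⟩ := Metric.isOpen_iff.1 hUo a ha
  obtain ⟨t, ht, htne⟩ := Metric.mem_nhdsWithin_iff.1 h0
  set r := min s t / 2 with hr
  have hst : 0 < min s t := lt_min hs ht
  have hr0 : 0 < r := by positivity
  have hrs : r < s := by have := min_le_left s t; linarith
  have hrt : r < t := by have := min_le_right s t; linarith
  have hsphU : Metric.closedBall a r ⊆ U := (Metric.closedBall_subset_ball hrs).trans hsU
  have hsne : ∀ z ∈ Metric.sphere a r, f z ≠ 0 := fun z hz => htne ⟨by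
      rw [Metric.mem_ball, Metric.mem_sphere.1 hz]; exact hrt, by
      rintro rfl
      rw [Metric.mem_sphere, dist_self] at hz
      exact hr0.ne hz⟩
  obtain ⟨z0, hz0, hmin⟩ := (isCompact_sphere a r).exists_isMinOn
    (NormedSpace.sphere_nonempty.2 hr0.le)
    ((hfd.continuousOn.mono (Metric.sphere_subset_closedBall.trans hsphU)).norm)
  set m := ‖f z0‖ with hm
  have hm0 : 0 < m := norm_pos_iff.2 (hsne z0 hz0)
  have hunif : TendstoUniformlyOn F f l (Metric.sphere a r) :=
    (tendstoLocallyUniformlyOn_iff_forall_isCompact hUo).1 hF _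
      (Metric.sphere_subset_closedBall.trans hsphU) (isCompact_sphere a r)
  have h1 := Metric.tendstoUniformlyOn_iff.1 hunif (m / 2) (by positivity)
  -- The maximum principle for `1 / F i` carries the lower bound from the circle to the centre; in
  -- the limit it contradicts `f a = 0`.
  have h2 : ∀ᶠ i in l, m / 2 ≤ ‖F i a‖ := by
    filter_upwards [h, hne, h1] with i hd hn h1
    have hb : ∀ z ∈ frontier (Metric.ball a r), ‖(F i z)⁻¹‖ ≤ (m / 2)⁻¹ := by
      intro z hz
      have hz' : z ∈ Metric.sphere a r := Metric.frontier_ball_subset_sphere hz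
      rw [norm_inv]
      apply inv_anti₀ (by positivity)
      have h3 := h1 z hz'
      rw [dist_eq_norm] at h3
      have h4 : m ≤ ‖f z‖ := hmin hz'
      have h5 := norm_sub_norm_le (f z) (F i z)
      linarith
    have hdc : DiffContOnCl ℂ (fun z => (F i z)⁻¹) (Metric.ball a r) := by
      apply DifferentiableOn.diffContOnCl
      refine DifferentiableOn.inv (hd.mono ?_) fun z hz => hn z ?_
      · exact Metric.closure_ball_subset_closedBall.trans hsphU
      · exact hsphU (Metric.closure_ball_subset_closedBall hz)
    have h6 := Complex.norm_le_of_forall_mem_frontier_norm_le Metric.isBounded_ball hdc hb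
      (subset_closure (Metric.mem_ball_self hr0))
    rw [norm_inv] at h6
    exact (inv_le_inv₀ (norm_pos_iff.2 (hn a ha)) (by positivity)).1 h6
  have h3 : Tendsto (fun i => ‖F i a‖) l (𝓝 ‖f a‖) := (hF.tendsto_at ha).norm
  have h4 := ge_of_tendsto h3 h2
  rw [hfa, norm_zero] at h4
  linarith

/-- If `f a = f b` with `a ≠ b`, Hurwitz applied to `F i - F i b` on `U \ {b}` makes `f` constant
near `a`, hence on `U`, against `deriv f c ≠ 0`. -/
theorem injOn_of_tendstoLocallyUniformlyOn {ι : Type*} {l : Filter ι} [l.NeBot]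
    {F : ι → ℂ → ℂ} {f : ℂ → ℂ} {U : Set ℂ} (hUo : IsOpen U) (hUc : IsPreconnected U)
    (hF : TendstoLocallyUniformlyOn F f l U) (h : ∀ᶠ i in l, DifferentiableOn ℂ (F i) U)
    (hinj : ∀ᶠ i in l, InjOn (F i) U) {c : ℂ} (hc : c ∈ U) (hfc : deriv f c ≠ 0) : InjOn f U := by
  intro a ha b hb hab
  by_contra hne
  have hfd : DifferentiableOn ℂ f U := hF.differentiableOn h hUo
  have hb' : TendstoUniformlyOn (fun i (_ : ℂ) => F i b) (fun _ => f b) l (U \ {b}) := by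
    rw [Metric.tendstoUniformlyOn_iff]
    intro ε hε
    filter_upwards [Metric.tendsto_nhds.1 (hF.tendsto_at hb) ε hε] with i hi x _
    rwa [dist_comm]
  have h1 : TendstoLocallyUniformlyOn (fun i z => F i z - F i b) (fun z => f z - f b) l (U \ {b}) :=
    (hF.mono sdiff_subset).sub hb'.tendstoLocallyUniformlyOn
  have h2 := eventually_eq_zero_of_limit_nonvanishing (hUo.sdiff isClosed_singleton) h1
    (h.mono fun i hi => (hi.mono sdiff_subset).sub_const _)
    (hinj.mono fun i hi z hz => sub_ne_zero.2 fun e => hz.2 (hi hz.1 hb e))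
    (a := a) ⟨ha, hne⟩ (sub_eq_zero.2 hab)
  have h3 : EqOn f (fun _ => f b) U :=
    (hfd.analyticOnNhd hUo).eqOn_of_preconnected_of_eventuallyEq analyticOnNhd_const hUc ha
      (h2.mono fun z hz => sub_eq_zero.1 hz)
  apply hfc
  have h4 : f =ᶠ[𝓝 c] fun _ => f b := h3.eventuallyEq_of_mem (hUo.mem_nhds hc)
  rw [h4.deriv_eq]
  simp

/-! ## The Cauchy–Pompeiu formula -/

/-- The Wirtinger derivative `∂̄ G`. -/
noncomputable def dbar (G : ℂ → ℂ) (w : ℂ) : ℂ :=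
  (1 / 2 : ℂ) * (fderiv ℝ G w 1 + Complex.I * fderiv ℝ G w Complex.I)

theorem continuous_dbar {G : ℂ → ℂ} (hG : ContDiff ℝ 1 G) : Continuous (dbar G) := by
  have := hG.continuous_fderiv one_ne_zero
  unfold dbar
  fun_prop

/-- In polar coordinates `r ∂̄g / w = (∂_r g + (i/r) ∂_θ g) / 2`, so the Jacobian removes the
singularity. The radial term integrates to `-g 0` along each ray, and the angular term to zero by
periodicity. Below, `A` is `∂_r g` and `B` is `(1/r) ∂_θ g`. -/
theorem integral_dbar_div_polar {g : ℂ → ℂ} (hg : ContDiff ℝ 1 g) (hc : HasCompactSupport g) :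
    ∫ w, dbar g w / w = -Real.pi * g 0 := by
  rw [← Complex.integral_comp_polarCoord_symm]
  have hcont := hg.continuous_fderiv one_ne_zero
  have hdiff : Differentiable ℝ g := hg.differentiable one_ne_zero
  obtain ⟨R, hR⟩ := hc.isCompact.isBounded.exists_norm_le
  set e : ℝ → ℂ := fun θ => Complex.exp (θ * Complex.I) with he
  have hec : Continuous e := by fun_prop
  have hen : ∀ θ, ‖e θ‖ = 1 := fun θ => Complex.norm_exp_ofReal_mul_I θ
  set A : ℝ × ℝ → ℂ := fun p => fderiv ℝ g (p.1 * e p.2) (e p.2) with hA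
  set B : ℝ × ℝ → ℂ := fun p => fderiv ℝ g (p.1 * e p.2) (Complex.I * e p.2) with hB
  have hAc : Continuous A := by
    have h1 : Continuous fun p : ℝ × ℝ => fderiv ℝ g (p.1 * e p.2) := hcont.comp (by fun_prop)
    exact h1.clm_apply (by fun_prop)
  have hBc : Continuous B := by
    have h1 : Continuous fun p : ℝ × ℝ => fderiv ℝ g (p.1 * e p.2) := hcont.comp (by fun_prop)
    exact h1.clm_apply (by fun_prop)
  have hzero : ∀ p : ℝ × ℝ, R < p.1 → fderiv ℝ g (p.1 * e p.2) = 0 := by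
    intro p hp
    by_contra hne
    have h1 : (p.1 * e p.2 : ℂ) ∈ tsupport g :=
      support_fderiv_subset ℝ (f := g) (Function.mem_support.2 hne)
    have h2 := hR _ h1
    rw [norm_mul, hen, Complex.norm_real, mul_one] at h2
    linarith [le_abs_self p.1, Real.norm_eq_abs p.1]
  have hint : ∀ C : ℝ × ℝ → ℂ, Continuous C → (∀ p : ℝ × ℝ, R < p.1 → C p = 0) →
      IntegrableOn C (Ioi 0 ×ˢ Ioo (-Real.pi) Real.pi) (volume.prod volume) := by
    intro C hC hC0
    have h1 : IntegrableOn C (Icc 0 R ×ˢ Icc (-Real.pi) Real.pi) (volume.prod volume) :=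
      hC.continuousOn.integrableOn_compact (isCompact_Icc.prod isCompact_Icc)
    refine h1.of_forall_sdiff_eq_zero (measurableSet_Ioi.prod measurableSet_Ioo) ?_
    rintro ⟨r, θ⟩ ⟨⟨hr, hθ⟩, hn⟩
    apply hC0
    by_contra! hle
    exact hn ⟨⟨le_of_lt hr, hle⟩, Ioo_subset_Icc_self hθ⟩
  have hAint := hint A hAc fun p hp => by simp [hA, hzero p hp]
  have hBint := hint B hBc fun p hp => by simp [hB, hzero p hp]
  have hstep : ∫ p in polarCoord.target, p.1 • (fun w => dbar g w / w) (Complex.polarCoord.symm p)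
      = ∫ p in Ioi (0 : ℝ) ×ˢ Ioo (-Real.pi) Real.pi,
          ((1 / 2 : ℂ) * A p + (Complex.I / 2) * B p) ∂(volume.prod volume) := by
    refine setIntegral_congr_fun (measurableSet_Ioi.prod measurableSet_Ioo) ?_
    rintro ⟨r, θ⟩ ⟨hr, -⟩
    have hr0 : (r : ℂ) ≠ 0 := by exact_mod_cast (ne_of_gt hr)
    have hsym : Complex.polarCoord.symm (r, θ) = r * e θ := by
      rw [Complex.polarCoord_symm_apply, he]
      simp only [Complex.exp_mul_I, Complex.ofReal_cos, Complex.ofReal_sin]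
    have hlin : ∀ c : ℂ, fderiv ℝ g (r * e θ) c
        = c.re * fderiv ℝ g (r * e θ) 1 + c.im * fderiv ℝ g (r * e θ) Complex.I := by
      intro c
      conv_lhs => rw [← Complex.re_add_im c]
      rw [map_add, show (c.re : ℂ) = c.re • (1 : ℂ) by simp,
        show (c.im : ℂ) * Complex.I = c.im • Complex.I by simp, map_smul, map_smul]
      simp
    have hee : e θ = Real.cos θ + Real.sin θ * Complex.I := by
      simp only [he, Complex.exp_mul_I, Complex.ofReal_cos, Complex.ofReal_sin]
    have hne : e θ ≠ 0 := Complex.exp_ne_zero _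
    have h1 : (e θ).re = Real.cos θ := by rw [hee]; simp [-Complex.ofReal_cos, -Complex.ofReal_sin]
    have h2 : (e θ).im = Real.sin θ := by rw [hee]; simp [-Complex.ofReal_cos, -Complex.ofReal_sin]
    have h3 : (e θ) * (Real.cos θ - Real.sin θ * Complex.I) = 1 := by
      rw [hee]
      have h4 : (Real.cos θ : ℂ) ^ 2 + (Real.sin θ : ℂ) ^ 2 = 1 := by
        exact_mod_cast Real.cos_sq_add_sin_sq θ
      linear_combination h4 - (Real.sin θ : ℂ) ^ 2 * Complex.I_sq
    change (r : ℝ) • (dbar g (Complex.polarCoord.symm (r, θ)) / Complex.polarCoord.symm (r, θ)) = _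
    rw [hsym]
    simp only [hA, hB, dbar]
    rw [hlin (e θ), hlin (Complex.I * e θ), Complex.I_mul_re, Complex.I_mul_im, h1, h2,
      Complex.real_smul, ← mul_div_assoc, mul_div_mul_left _ _ hr0, div_eq_iff hne]
    rw [Complex.ofReal_neg]
    linear_combination (-(1 / 2 : ℂ) * (fderiv ℝ g (r * e θ) 1
      + Complex.I * fderiv ℝ g (r * e θ) Complex.I)) * h3
      - (1 / 2 : ℂ) * (e θ) * (Real.sin θ) * fderiv ℝ g (r * e θ) Complex.I * Complex.I_sq
  rw [hstep, integral_add (hAint.const_mul _) (hBint.const_mul _), integral_const_mul,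
    integral_const_mul]
  have hI1 : ∫ p in Ioi (0 : ℝ) ×ˢ Ioo (-Real.pi) Real.pi, A p ∂(volume.prod volume)
      = -(2 * Real.pi) * g 0 := by
    rw [IntegrableOn, ← Measure.prod_restrict] at hAint
    rw [← Measure.prod_restrict]
    rw [integral_prod_symm _ hAint]
    have hin : ∀ θ : ℝ, ∫ r in Ioi (0 : ℝ), A (r, θ) = - g 0 := by
      intro θ
      have hd : ∀ r : ℝ, HasDerivAt (fun r : ℝ => g (r * e θ)) (A (r, θ)) r := by
        intro r
        have h1 : HasDerivAt (fun r : ℝ => (r : ℂ) * e θ) (e θ) r := by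
          simpa using (Complex.ofRealCLM.hasDerivAt (x := r)).mul_const (e θ)
        exact (hdiff _).hasFDerivAt.comp_hasDerivAt r h1
      have hcd : ContDiff ℝ 1 fun r : ℝ => g (r * e θ) :=
        hg.comp (Complex.ofRealCLM.contDiff.mul contDiff_const)
      have hcs : HasCompactSupport fun r : ℝ => g (r * e θ) := by
        refine HasCompactSupport.intro (isCompact_closedBall (0 : ℝ) R) fun r hr => ?_
        by_contra hne
        apply hr
        have := hR _ (subset_tsupport g (Function.mem_support.2 hne))
        rw [norm_mul, hen, Complex.norm_real, mul_one] at this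
        exact mem_closedBall_zero_iff.2 this
      have := hcs.integral_Ioi_deriv_eq hcd 0
      rw [show deriv (fun r : ℝ => g (r * e θ)) = fun r => A (r, θ) from
        funext fun r => (hd r).deriv] at this
      simpa using this
    simp only [hin]
    rw [setIntegral_const, Real.volume_real_Ioo_of_le (by linarith [Real.pi_pos])]
    simp only [Complex.real_smul]
    push_cast
    ring
  have hI2 : ∫ p in Ioi (0 : ℝ) ×ˢ Ioo (-Real.pi) Real.pi, B p ∂(volume.prod volume) = 0 := by
    rw [setIntegral_prod _ hBint]
    refine setIntegral_eq_zero_of_forall_eq_zero fun r hr => ?_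
    have hr0 : (r : ℂ) ≠ 0 := by exact_mod_cast (ne_of_gt hr)
    have hd : ∀ θ ∈ uIcc (-Real.pi) Real.pi,
        HasDerivAt (fun θ : ℝ => (r : ℂ)⁻¹ * g (r * e θ)) (B (r, θ)) θ := by
      intro θ _
      have h1 : HasDerivAt (fun θ : ℝ => (r : ℂ) * e θ) ((r : ℝ) • (Complex.I * e θ)) θ := by
        have h2 : HasDerivAt (fun θ : ℝ => (θ : ℂ) * Complex.I) Complex.I θ := by
          simpa using (Complex.ofRealCLM.hasDerivAt (x := θ)).mul_const Complex.I
        have h3 := (h2.cexp).const_mul (r : ℂ)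
        convert! h3 using 1
        rw [Complex.real_smul]
        ring
      have h4 := ((hdiff _).hasFDerivAt.comp_hasDerivAt θ h1).const_mul (r : ℂ)⁻¹
      convert! h4 using 1
      rw [map_smul, Complex.real_smul, inv_mul_cancel_left₀ hr0]
    have h5 := intervalIntegral.integral_eq_sub_of_hasDerivAt hd
      ((hBc.comp (by fun_prop : Continuous fun θ : ℝ => (r, θ))).intervalIntegrable _ _)
    rw [intervalIntegral.integral_of_le (by linarith [Real.pi_pos]),
      integral_Ioc_eq_integral_Ioo] at h5
    rw [h5, sub_eq_zero]
    have : e Real.pi = e (-Real.pi) := by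
      simp only [he]
      rw [Complex.ofReal_neg, neg_mul, Complex.exp_pi_mul_I, Complex.exp_neg, Complex.exp_pi_mul_I]
      norm_num
    rw [this]
  rw [hI1, hI2]
  ring

theorem integral_dbar_div_sub {G : ℂ → ℂ} (hG : ContDiff ℝ 1 G) (hc : HasCompactSupport G) (z : ℂ) :
    ∫ w, dbar G w / (w - z) = -Real.pi * G z := by
  have h1 := integral_dbar_div_polar (g := fun w => G (w + z)) (hG.comp (by fun_prop))
    (hc.comp_homeomorph (Homeomorph.addRight z))
  have h2 : ∀ w, dbar (fun w => G (w + z)) w = dbar G (w + z) := fun w => by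
    simp only [dbar, fderiv_comp_add_right]
  rw [zero_add] at h1
  rw [← h1, ← integral_add_right_eq_self (fun w => dbar G w / (w - z)) z]
  simp only [h2, add_sub_cancel_right]

theorem dbar_eq_zero {f : ℂ → ℂ} {w : ℂ} (h : DifferentiableAt ℂ f w) : dbar f w = 0 := by
  have h1 := h.fderiv_restrictScalars ℝ
  simp only [dbar, h1, ContinuousLinearMap.coe_restrictScalars']
  rw [show fderiv ℂ f w Complex.I = Complex.I * fderiv ℂ f w 1 by
    rw [← smul_eq_mul, ← map_smul, smul_eq_mul, mul_one]]
  linear_combination (1 / 2) * fderiv ℂ f w 1 * Complex.I_sq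

/-- A holomorphic function is, on a compact set, the Cauchy transform of a density which is
supported off that set. -/
theorem exists_cauchy_density {O C : Set ℂ} (hO : IsOpen O) (hC : IsCompact C) (hCO : C ⊆ O) :
    ∃ k : ℂ → ℂ, Continuous k ∧ HasCompactSupport k ∧ tsupport k ⊆ O \ C ∧
      ∀ D : ℂ → ℂ, DifferentiableOn ℂ D O → ∀ z ∈ C, D z = ∫ w, k w * D w / (w - z) := by
  obtain ⟨t, htc, hCt, htO⟩ := exists_compact_between hC hO hCO
  obtain ⟨χ, hχ1, hχ0, -⟩ := exists_contMDiffMap_one_nhds_of_subset_interior 𝓘(ℝ, ℂ) (n := 1)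
    hC.isClosed hCt
  have hχd : ContDiff ℝ 1 χ := χ.contMDiff.contDiff
  have hχs : Function.support χ ⊆ t := fun w hw => by
    by_contra hn
    exact hw (hχ0 w hn)
  have hχt : tsupport χ ⊆ t := closure_minimal hχs htc.isClosed
  have hχC : ContDiff ℝ 1 fun w => (χ w : ℂ) := Complex.ofRealCLM.contDiff.comp hχd
  have hts : tsupport (fun w => (χ w : ℂ)) ⊆ t := by
    refine closure_minimal (fun w hw => hχs ?_) htc.isClosed
    rw [Function.mem_support] at hw ⊢
    exact_mod_cast hw
  have hsupp : Function.support (dbar fun w => (χ w : ℂ)) ⊆ tsupport fun w => (χ w : ℂ) := by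
    intro w hw
    by_contra hn
    have h1 : fderiv ℝ (fun w => (χ w : ℂ)) w = 0 := by
      by_contra hne
      exact hn (support_fderiv_subset ℝ (Function.mem_support.2 hne))
    exact hw (by simp [dbar, h1])
  -- Where `D` is holomorphic, `∂̄(χ D) = D ∂̄χ`. The Cauchy–Pompeiu formula for `χ D`, which equals
  -- `D` on `C`, therefore has this density; it vanishes near `C` because `χ = 1` there.
  set k : ℂ → ℂ := fun w => -(Real.pi : ℂ)⁻¹ * dbar (fun w => (χ w : ℂ)) w with hk
  have hkt : tsupport k ⊆ t := by
    refine (closure_minimal ?_ (isClosed_tsupport _)).trans hts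
    intro w hw
    exact hsupp fun h0 => hw (by simp [hk, h0])
  refine ⟨k, continuous_const.mul (continuous_dbar hχC), htc.of_isClosed_subset (isClosed_tsupport _) hkt, ?_, ?_⟩
  · refine subset_sdiff.2 ⟨hkt.trans htO, ?_⟩
    rw [Set.disjoint_right]
    intro z hz hzk
    have h1 : ∀ᶠ x in 𝓝 z, χ x = 1 := hχ1.filter_mono (nhds_le_nhdsSet hz)
    have h2 : k =ᶠ[𝓝 z] 0 := by
      filter_upwards [h1.eventually_nhds] with x hx
      have h3 : (fun w => (χ w : ℂ)) =ᶠ[𝓝 x] fun _ => 1 := hx.mono fun y hy => by simp [hy]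
      simp [hk, dbar, h3.fderiv_eq]
    exact notMem_tsupport_iff_eventuallyEq.2 h2 hzk
  · intro D hD z hz
    have hG : ContDiff ℝ 1 fun w => (χ w : ℂ) * D w := by
      rw [contDiff_iff_contDiffAt]
      intro w
      by_cases hw : w ∈ O
      · refine hχC.contDiffAt.mul ?_
        exact ((hD.contDiffOn (n := 1) hO).contDiffAt (hO.mem_nhds hw)).restrict_scalars ℝ
      · have h1 : (fun w => (χ w : ℂ) * D w) =ᶠ[𝓝 w] fun _ => 0 := by
          filter_upwards [htc.isClosed.isOpen_compl.mem_nhds fun h => hw (htO h)] with y hy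
          simp [hχ0 y hy]
        exact contDiffAt_const.congr_of_eventuallyEq h1
    have hGc : HasCompactSupport fun w => (χ w : ℂ) * D w :=
      HasCompactSupport.mul_right (htc.of_isClosed_subset (isClosed_tsupport _) hts)
    have h1 := integral_dbar_div_sub hG hGc z
    have hχz : χ z = 1 := (hχ1.filter_mono (nhds_le_nhdsSet hz)).self_of_nhds
    have h2 : ∀ w, dbar (fun w => (χ w : ℂ) * D w) w = dbar (fun w => (χ w : ℂ)) w * D w := by
      intro w
      by_cases hw : w ∈ O
      · have hDw : DifferentiableAt ℂ D w := hD.differentiableAt (hO.mem_nhds hw)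
        have h3 := dbar_eq_zero hDw
        have h4 : fderiv ℝ (fun w => (χ w : ℂ) * D w) w = _ :=
          fderiv_fun_mul ((hχC.differentiable one_ne_zero) w) (hDw.restrictScalars ℝ)
        simp only [dbar] at h3 ⊢
        rw [h4]
        simp only [add_apply, smul_apply, smul_eq_mul]
        linear_combination (χ w : ℂ) * h3
      · have h3 : (fun w => (χ w : ℂ) * D w) =ᶠ[𝓝 w] fun _ => 0 := by
          filter_upwards [htc.isClosed.isOpen_compl.mem_nhds fun h => hw (htO h)] with y hy
          simp [hχ0 y hy]
        have h4 : (fun w => (χ w : ℂ)) =ᶠ[𝓝 w] fun _ => 0 := by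
          filter_upwards [htc.isClosed.isOpen_compl.mem_nhds fun h => hw (htO h)] with y hy
          simp [hχ0 y hy]
        simp [dbar, h3.fderiv_eq, h4.fderiv_eq]
    simp only [h2, hχz, Complex.ofReal_one, one_mul] at h1
    have hpi : (Real.pi : ℂ) ≠ 0 := by exact_mod_cast Real.pi_ne_zero
    have h5 : ∀ w, k w * D w / (w - z)
        = -(Real.pi : ℂ)⁻¹ * (dbar (fun w => (χ w : ℂ)) w * D w / (w - z)) := fun w => by
      simp only [hk]; ring
    simp only [h5]
    rw [integral_const_mul, h1]
    field_simp

/-! ## Cauchy transforms of integrable densities -/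

theorem norm_cauchyTransform_le {κ : ℂ → ℂ} (hκ : Integrable κ) {z : ℂ} {δ : ℝ} (hδ : 0 < δ)
    (h : ∀ w, κ w ≠ 0 → δ ≤ ‖w - z‖) : ‖∫ w, κ w / (w - z)‖ ≤ δ⁻¹ * ∫ w, ‖κ w‖ := by
  rw [← integral_const_mul]
  refine norm_integral_le_of_norm_le (hκ.norm.const_mul _) (Eventually.of_forall fun w => ?_)
  by_cases hw : κ w = 0
  · simp [hw]
  · rw [norm_div, div_eq_inv_mul]
    gcongr
    exact h w hw

/-- The density keeps distance `δ` from `z`, so on the ball of radius `δ / 2` the differentiated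
kernel is dominated by a constant multiple of `‖κ‖`. -/
theorem differentiableAt_cauchyTransform {κ : ℂ → ℂ} (hκ : Integrable κ) {z : ℂ} {δ : ℝ}
    (hδ : 0 < δ) (h : ∀ w, κ w ≠ 0 → δ ≤ ‖w - z‖) :
    DifferentiableAt ℂ (fun z => ∫ w, κ w / (w - z)) z := by
  have hmeas : ∀ y : ℂ, AEStronglyMeasurable (fun w => κ w / (w - y)) volume := fun y => by
    have : AEStronglyMeasurable (fun w : ℂ => (w - y)⁻¹) volume :=
      (measurable_id.sub_const y).inv.aestronglyMeasurable
    simp only [div_eq_mul_inv]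
    exact hκ.aestronglyMeasurable.mul this
  have hfar : ∀ w, κ w ≠ 0 → ∀ y ∈ Metric.ball z (δ / 2), δ / 2 ≤ ‖w - y‖ := by
    intro w hw y hy
    have h1 := h w hw
    have h2 := mem_ball_iff_norm.1 hy
    have h3 := norm_add_le (w - y) (y - z)
    rw [sub_add_sub_cancel] at h3
    linarith
  have key := hasDerivAt_integral_of_dominated_loc_of_deriv_le (𝕜 := ℂ) (μ := volume)
    (F := fun y w => κ w / (w - y)) (F' := fun y w => κ w / (w - y) ^ 2) (x₀ := z)
    (s := Metric.ball z (δ / 2)) (bound := fun w => ‖κ w‖ * (δ / 2)⁻¹ ^ 2)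
    (Metric.ball_mem_nhds z (half_pos hδ)) (Eventually.of_forall hmeas) ?_ ?_ ?_
    (hκ.norm.mul_const _) ?_
  · exact key.2.differentiableAt
  · refine (hκ.norm.const_mul δ⁻¹).mono' (hmeas z) (Eventually.of_forall fun w => ?_)
    by_cases hw : κ w = 0
    · simp [hw]
    · rw [norm_div, div_eq_inv_mul]
      gcongr
      exact h w hw
  · have : AEStronglyMeasurable (fun w : ℂ => ((w - z) ^ 2)⁻¹) volume :=
      ((measurable_id.sub_const z).pow_const 2).inv.aestronglyMeasurable
    simp only [div_eq_mul_inv]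
    exact hκ.aestronglyMeasurable.mul this
  · refine Eventually.of_forall fun w y hy => ?_
    by_cases hw : κ w = 0
    · simp [hw]
    · rw [norm_div, norm_pow, div_eq_mul_inv, ← inv_pow]
      have h1 := hfar w hw y hy
      gcongr
  · refine Eventually.of_forall fun w y hy => ?_
    by_cases hw : κ w = 0
    · simp [hw, hasDerivAt_const]
    · have h1 := hfar w hw y hy
      have hne : w - y ≠ 0 := by
        intro h0
        rw [h0, norm_zero] at h1
        linarith
      have h2 := ((hasDerivAt_id y).const_sub w).inv hne
      have h3 := h2.const_mul (κ w)
      simp only [id] at h3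
      convert! h3 using 1
      field_simp

/-! ## Univalent functions -/

section Univalent

variable {U : Set ℂ} {f : ℂ → ℂ}

theorem not_eventually_const_of_injOn (hU : IsOpen U) (hf : InjOn f U) {z : ℂ} (hz : z ∈ U) :
    ¬ ∀ᶠ w in 𝓝 z, f w = f z := by
  intro h
  have h1 : ∀ᶠ w in 𝓝[≠] z, w = z := by
    filter_upwards [nhdsWithin_le_nhds h, nhdsWithin_le_nhds (hU.mem_nhds hz)] with w hw hwU
    exact hf hwU hz hw
  obtain ⟨w, hw1, hw2⟩ := (h1.and self_mem_nhdsWithin).exists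
  exact hw2 hw1

theorem nhds_le_map_of_injOn (hU : IsOpen U) (hd : DifferentiableOn ℂ f U) (hf : InjOn f U) {z : ℂ}
    (hz : z ∈ U) : 𝓝 (f z) ≤ map f (𝓝 z) :=
  (hd.analyticAt (hU.mem_nhds hz)).eventually_constant_or_nhds_le_map_nhds.resolve_left
    (not_eventually_const_of_injOn hU hf hz)

theorem isOpen_image_of_injOn (hU : IsOpen U) (hd : DifferentiableOn ℂ f U) (hf : InjOn f U) :
    IsOpen (f '' U) := by
  rw [isOpen_iff_mem_nhds]
  rintro _ ⟨z, hz, rfl⟩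
  exact nhds_le_map_of_injOn hU hd hf hz (image_mem_map (hU.mem_nhds hz))

/-- The open mapping theorem makes the inverse continuous. Away from the isolated zeros of `deriv f`
it is differentiable, and continuity removes the remaining singularities. Nonvanishing of `deriv f`
is not assumed; it is deduced from this. -/
theorem analyticAt_leftInverse (hU : IsOpen U) (hd : DifferentiableOn ℂ f U) {g : ℂ → ℂ}
    (hg : LeftInvOn g f U) {z : ℂ} (hz : z ∈ U) : AnalyticAt ℂ g (f z) := by
  have hf : InjOn f U := hg.injOn
  have hcont : ∀ w ∈ U, ContinuousAt g (f w) := by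
    intro w hw N hN
    rw [hg hw] at hN
    have h1 := nhds_le_map_of_injOn hU hd hf hw (image_mem_map (inter_mem hN (hU.mem_nhds hw)))
    change g ⁻¹' N ∈ 𝓝 (f w)
    refine mem_of_superset h1 ?_
    rintro _ ⟨x, hx, rfl⟩
    rw [mem_preimage, hg hx.2]
    exact hx.1
  have hopen := isOpen_image_of_injOn hU hd hf
  refine Complex.analyticAt_of_differentiable_on_punctured_nhds_of_continuousAt ?_ (hcont z hz)
  have hda : AnalyticAt ℂ (deriv f) z := (hd.analyticAt (hU.mem_nhds hz)).deriv
  rcases hda.eventually_eq_zero_or_eventually_ne_zero with h0 | h0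
  · exfalso
    apply not_eventually_const_of_injOn hU hf hz
    obtain ⟨r, hr, hrs⟩ := Metric.mem_nhds_iff.1 (h0.and (hU.mem_nhds hz))
    filter_upwards [Metric.ball_mem_nhds z hr] with w hw
    exact Metric.isOpen_ball.is_const_of_deriv_eq_zero (convex_ball z r).isPreconnected
      (hd.mono fun x hx => (hrs hx).2) (fun x hx => (hrs hx).1) hw (Metric.mem_ball_self hr)
  · have h1 : Tendsto g (𝓝[≠] (f z)) (𝓝[≠] z) := by
      refine tendsto_nhdsWithin_iff.2 ⟨?_, ?_⟩
      · have := (hcont z hz).tendsto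
        rw [hg hz] at this
        exact this.mono_left nhdsWithin_le_nhds
      · filter_upwards [self_mem_nhdsWithin, nhdsWithin_le_nhds (hopen.mem_nhds ⟨z, hz, rfl⟩)]
        rintro _ hne ⟨x, hx, rfl⟩
        rw [mem_compl_singleton_iff, hg hx]
        rintro rfl
        exact hne rfl
    filter_upwards [h1.eventually h0, nhdsWithin_le_nhds (hopen.mem_nhds ⟨z, hz, rfl⟩)]
    rintro _ hne ⟨x, hx, rfl⟩
    rw [hg hx] at hne
    have h2 : HasDerivAt f (deriv f x) (g (f x)) := by
      rw [hg hx]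
      exact (hd.differentiableAt (hU.mem_nhds hx)).hasDerivAt
    refine (h2.of_local_left_inverse (hcont x hx) hne ?_).differentiableAt
    filter_upwards [hopen.mem_nhds ⟨x, hx, rfl⟩]
    rintro _ ⟨y, hy, rfl⟩
    rw [hg hy]

theorem deriv_ne_zero_of_injOn (hU : IsOpen U) (hd : DifferentiableOn ℂ f U) (hf : InjOn f U) {z : ℂ}
    (hz : z ∈ U) : deriv f z ≠ 0 := by
  have hg : LeftInvOn (Function.invFunOn f U) f U := hf.leftInvOn_invFunOn
  have h1 := (analyticAt_leftInverse hU hd hg hz).differentiableAt.hasDerivAt.comp z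
    (hd.differentiableAt (hU.mem_nhds hz)).hasDerivAt
  have h2 : (Function.invFunOn f U ∘ f) =ᶠ[𝓝 z] id := by
    filter_upwards [hU.mem_nhds hz] with w hw
    exact hg hw
  have h3 := (h1.congr_of_eventuallyEq h2.symm).unique (hasDerivAt_id z)
  intro h0
  rw [h0, mul_zero] at h3
  exact zero_ne_one h3

end Univalent

/-! ## Primitives on the inside of a continuum -/

namespace IsEnclosing

variable {K : Set ℂ} (h : IsEnclosing K)
include h

/-- A limit of points of the inside is either inside or on `K`, and a positive distance to `K`
excludes the latter. -/
theorem isCompact_core (ε : ℝ) (hε : 0 < ε) :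
    IsCompact {z | z ∈ interiorDomain K ∧ ε ≤ Metric.infDist z K} := by
  have h1 : {z | z ∈ interiorDomain K ∧ ε ≤ Metric.infDist z K}
      = closure (interiorDomain K) ∩ {z | ε ≤ Metric.infDist z K} := by
    ext z
    constructor
    · exact fun hz => ⟨subset_closure hz.1, hz.2⟩
    · rintro ⟨hz, hz2⟩
      refine ⟨(h.closure_subset hz).resolve_right fun hzK => ?_, hz2⟩
      have h3 := Metric.infDist_zero_of_mem hzK
      have h4 : ε ≤ Metric.infDist z K := hz2
      linarith
  rw [h1]
  exact h.isBounded.isCompact_closure.inter_right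
    (isClosed_le continuous_const (Metric.continuous_infDist_pt K))

theorem isOpen_core (ε : ℝ) : IsOpen {z | z ∈ interiorDomain K ∧ ε < Metric.infDist z K} :=
  h.isOpen.inter (isOpen_lt continuous_const (Metric.continuous_infDist_pt K))

/-- The place where connectedness of `K` replaces simple connectivity. For a point `q` of `K` of
maximal modulus the inside lies in `|z| ≤ |q|`, so `log((q - z)/q)` is a primitive with the
principal branch. For `a`, `b` in `K` at distance less than `ε`, the principal `log((z - a)/(z -
b))` is a primitive of the difference on the core. The relation between `a` and `b` is transitive,
and connectedness chains it from `q` to `p`. -/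
theorem exists_primitive_inv_sub {ε : ℝ} (hε : 0 < ε) {p : ℂ} (hp : p ∈ K) :
    ∃ g : ℂ → ℂ, ∀ z, z ∈ interiorDomain K → ε < Metric.infDist z K →
      HasDerivAt g ((z - p)⁻¹) z := by
  have hdist : ∀ z, ε < Metric.infDist z K → ∀ q ∈ K, ε < ‖z - q‖ := fun z hz q hq => by
    rw [← dist_eq_norm]
    exact hz.trans_le (Metric.infDist_le_dist_of_mem hq)
  obtain ⟨q, hq, hmax⟩ := h.isCompact.exists_isMaxOn h.isConnected.nonempty
    continuous_norm.continuousOn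
  have hq0 : q ≠ 0 := fun h0 => h.surrounds.1 (h0 ▸ hq)
  have hqg : ∃ g : ℂ → ℂ, ∀ z, z ∈ interiorDomain K → ε < Metric.infDist z K →
      HasDerivAt g ((z - q)⁻¹) z := by
    refine ⟨fun z => Complex.log ((q - z) / q), fun z hz hzε => ?_⟩
    have hle : ‖z‖ ≤ ‖q‖ := by
      refine le_of_forall_gt fun R hR => h.norm_lt (fun w hw => ?_) z hz
      have h3 : ‖w‖ ≤ ‖q‖ := hmax hw
      exact h3.trans_lt hR
    have hne : z ≠ q := fun h0 => interiorDomain_subset hz (h0 ▸ hq)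
    have hslit : (q - z) / q ∈ Complex.slitPlane := by
      left
      rw [sub_div, div_self hq0, Complex.sub_re, Complex.one_re, sub_pos]
      have h1 : ‖z / q‖ ≤ 1 := by
        rw [norm_div]
        exact div_le_one_of_le₀ hle (norm_nonneg _)
      refine lt_of_le_of_ne ((Complex.re_le_norm _).trans h1) fun h2 => hne ?_
      have h3 : Complex.normSq (z / q) ≤ 1 := by
        rw [Complex.normSq_eq_norm_sq]
        exact pow_le_one₀ (norm_nonneg _) h1
      rw [Complex.normSq_apply, h2] at h3
      have h4 : (z / q).im = 0 := by nlinarith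
      have h5 : z / q = 1 := Complex.ext h2 h4
      rwa [div_eq_one_iff_eq hq0] at h5
    have h1 : HasDerivAt (fun z => (q - z) / q) (-1 / q) z :=
      ((hasDerivAt_id z).const_sub q).div_const q
    have h2 := h1.clog hslit
    have h3 : q - z ≠ 0 := sub_ne_zero.2 (Ne.symm hne)
    have h4 : z - q ≠ 0 := sub_ne_zero.2 hne
    convert! h2 using 1
    field_simp
    ring
  have hrel : ∃ g : ℂ → ℂ, ∀ z, z ∈ interiorDomain K → ε < Metric.infDist z K →
      HasDerivAt g ((z - p)⁻¹ - (z - q)⁻¹) z := by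
    refine h.isConnected.isPreconnected.induction₂' (fun a b => ∃ g : ℂ → ℂ, ∀ z,
      z ∈ interiorDomain K → ε < Metric.infDist z K →
      HasDerivAt g ((z - a)⁻¹ - (z - b)⁻¹) z) ?_ ?_ hp hq
    · intro a ha
      have hsym : ∀ a b : ℂ, (∃ g : ℂ → ℂ, ∀ z, z ∈ interiorDomain K → ε < Metric.infDist z K →
          HasDerivAt g ((z - a)⁻¹ - (z - b)⁻¹) z) → ∃ g : ℂ → ℂ, ∀ z, z ∈ interiorDomain K →
          ε < Metric.infDist z K → HasDerivAt g ((z - b)⁻¹ - (z - a)⁻¹) z := by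
        rintro a b ⟨g, hg⟩
        refine ⟨fun z => - g z, fun z hz hzε => ?_⟩
        convert! (hg z hz hzε).neg using 1
        ring
      have hnear : ∀ᶠ b in 𝓝[K] a, ∃ g : ℂ → ℂ, ∀ z, z ∈ interiorDomain K →
          ε < Metric.infDist z K → HasDerivAt g ((z - a)⁻¹ - (z - b)⁻¹) z := by
        filter_upwards [nhdsWithin_le_nhds (Metric.ball_mem_nhds a hε), self_mem_nhdsWithin]
          with b hb hbK
        refine ⟨fun z => Complex.log ((z - a) / (z - b)), fun z hz hzε => ?_⟩
        have h1 := hdist z hzε b hbK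
        have h2 := hdist z hzε a ha
        have hb0 : z - b ≠ 0 := norm_pos_iff.1 (hε.trans h1)
        have ha0 : z - a ≠ 0 := norm_pos_iff.1 (hε.trans h2)
        have hslit : (z - a) / (z - b) ∈ Complex.slitPlane := by
          apply Complex.mem_slitPlane_of_norm_lt_one (z := (b - a) / (z - b)) ?_ |> fun h => ?_
          · rw [norm_div, div_lt_one (hε.trans h1)]
            exact (mem_ball_iff_norm.1 hb).trans h1
          · convert h using 1
            field_simp
            ring
        have h3 : HasDerivAt (fun z => (z - a) / (z - b))
            ((1 * (z - b) - (z - a) * 1) / (z - b) ^ 2) z :=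
          ((hasDerivAt_id z).sub_const a).div ((hasDerivAt_id z).sub_const b) hb0
        convert! h3.clog hslit using 1
        field_simp
      exact hnear.mono fun b hb => ⟨hb, hsym _ _ hb⟩
    · rintro a b c - - - ⟨g1, hg1⟩ ⟨g2, hg2⟩
      refine ⟨fun z => g1 z + g2 z, fun z hz hzε => ?_⟩
      convert! (hg1 z hz hzε).add (hg2 z hz hzε) using 1
      ring
  obtain ⟨g1, hg1⟩ := hqg
  obtain ⟨g2, hg2⟩ := hrel
  refine ⟨fun z => g2 z + g1 z, fun z hz hzε => ?_⟩
  convert! (hg2 z hz hzε).add (hg1 z hz hzε) using 1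
  ring

/-- Each pole `w` is compared with `p`: since `‖w - p‖ < 2ε` and `‖z - p‖ > 5ε`, the quotient `(z -
w)/(z - p)` is within `1/2` of `1` and has a principal logarithm. Integrating these logarithms
against `κ` leaves a multiple of `1/(z - p)`, which has the primitive `g`. -/
theorem exists_primitive_cauchyTransform_ball {ε : ℝ} (hε : 0 < ε) {p : ℂ} (hp : p ∈ K)
    {κ : ℂ → ℂ} (hκ : Integrable κ) (hs : ∀ w, κ w ≠ 0 → ‖w - p‖ < 2 * ε) :
    ∃ g : ℂ → ℂ, ∀ z, z ∈ interiorDomain K → 5 * ε < Metric.infDist z K →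
      HasDerivAt g (∫ w, κ w / (w - z)) z := by
  obtain ⟨g, hg⟩ := h.exists_primitive_inv_sub (ε := 5 * ε) (by positivity) hp
  refine ⟨fun z => -(∫ w, κ w * Complex.log ((z - w) / (z - p))) - (∫ w, κ w) * g z,
    fun z hz hzε => ?_⟩
  have hopen := h.isOpen_core (5 * ε)
  obtain ⟨r, hr, hrs⟩ := Metric.isOpen_iff.1 hopen z ⟨hz, hzε⟩
  have hp5 : ∀ y, 5 * ε < Metric.infDist y K → 5 * ε < ‖y - p‖ := fun y hy => by
    rw [← dist_eq_norm]
    exact hy.trans_le (Metric.infDist_le_dist_of_mem hp)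
  have hw3 : ∀ y w, 5 * ε < Metric.infDist y K → κ w ≠ 0 → 3 * ε < ‖y - w‖ := by
    intro y w hy hw
    have h1 := hp5 y hy
    have h2 := hs w hw
    have h3 := norm_add_le (y - w) (w - p)
    rw [sub_add_sub_cancel] at h3
    linarith
  have hratio : ∀ y w, 5 * ε < Metric.infDist y K → κ w ≠ 0 →
      ‖(p - w) / (y - p)‖ < 1 / 2 := by
    intro y w hy hw
    have h1 := hp5 y hy
    rw [norm_div, div_lt_iff₀ (by linarith), norm_sub_rev]
    have := hs w hw
    linarith
  have heq : ∀ y w, 5 * ε < Metric.infDist y K → (y - w) / (y - p) = 1 + (p - w) / (y - p) := by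
    intro y w hy
    have h1 : y - p ≠ 0 := norm_pos_iff.1 ((by positivity : 0 < 5 * ε).trans (hp5 y hy))
    field_simp
    ring
  have hslit : ∀ y w, 5 * ε < Metric.infDist y K → κ w ≠ 0 →
      (y - w) / (y - p) ∈ Complex.slitPlane := by
    intro y w hy hw
    rw [heq y w hy]
    exact Complex.mem_slitPlane_of_norm_lt_one ((hratio y w hy hw).trans (by norm_num))
  have hmeas : ∀ y : ℂ, AEStronglyMeasurable (fun w => κ w * Complex.log ((y - w) / (y - p)))
      volume := fun y => by
    have : AEStronglyMeasurable (fun w : ℂ => Complex.log ((y - w) / (y - p))) volume :=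
      (((measurable_const.sub measurable_id).div_const _).clog).aestronglyMeasurable
    exact hκ.aestronglyMeasurable.mul this
  have hderiv : ∀ y w, 5 * ε < Metric.infDist y K → κ w ≠ 0 →
      HasDerivAt (fun y => κ w * Complex.log ((y - w) / (y - p)))
        (κ w * ((y - w)⁻¹ - (y - p)⁻¹)) y := by
    intro y w hy hw
    have h1 : y - p ≠ 0 := norm_pos_iff.1 ((by positivity : 0 < 5 * ε).trans (hp5 y hy))
    have h2 : y - w ≠ 0 := norm_pos_iff.1 ((by positivity : 0 < 3 * ε).trans (hw3 y w hy hw))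
    have h3 : HasDerivAt (fun y => (y - w) / (y - p))
        ((1 * (y - p) - (y - w) * 1) / (y - p) ^ 2) y :=
      ((hasDerivAt_id y).sub_const w).div ((hasDerivAt_id y).sub_const p) h1
    convert! (h3.clog (hslit y w hy hw)).const_mul (κ w) using 1
    field_simp
  have hmeas' : AEStronglyMeasurable (fun w => κ w * ((z - w)⁻¹ - (z - p)⁻¹)) volume := by
    have : AEStronglyMeasurable (fun w : ℂ => (z - w)⁻¹ - (z - p)⁻¹) volume :=
      ((measurable_const.sub measurable_id).inv.sub_const _).aestronglyMeasurable
    exact hκ.aestronglyMeasurable.mul this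
  have hbound : ∀ w, ∀ y ∈ Metric.ball z r,
      ‖κ w * ((y - w)⁻¹ - (y - p)⁻¹)‖ ≤ ‖κ w‖ * ((3 * ε)⁻¹ + (5 * ε)⁻¹) := by
    intro w y hy
    by_cases hw : κ w = 0
    · simp [hw]
    rw [norm_mul]
    gcongr
    refine (norm_sub_le _ _).trans ?_
    rw [norm_inv, norm_inv]
    have h1 := hw3 y w (hrs hy).2 hw
    have h2 := hp5 y (hrs hy).2
    gcongr
  have key := hasDerivAt_integral_of_dominated_loc_of_deriv_le (𝕜 := ℂ) (μ := volume)
    (F := fun y w => κ w * Complex.log ((y - w) / (y - p)))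
    (F' := fun y w => κ w * ((y - w)⁻¹ - (y - p)⁻¹)) (x₀ := z)
    (s := Metric.ball z r) (bound := fun w => ‖κ w‖ * ((3 * ε)⁻¹ + (5 * ε)⁻¹))
    (Metric.ball_mem_nhds z hr) (Eventually.of_forall hmeas) ?_ hmeas'
    (Eventually.of_forall hbound) (hκ.norm.mul_const _) ?_
  · have h1 := (key.2.neg).sub ((hg z hz hzε).const_mul (∫ w, κ w))
    convert! h1 using 1
    rw [← integral_mul_const, ← integral_neg, ← integral_sub]
    · refine integral_congr_ae (Eventually.of_forall fun w => ?_)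
      by_cases hw : κ w = 0
      · simp [hw]
      · have h2 : z - w ≠ 0 := norm_pos_iff.1 ((by positivity : 0 < 3 * ε).trans (hw3 z w hzε hw))
        have h3 : w - z = -(z - w) := by ring
        simp only [h3, div_neg]
        ring
    · exact key.1.neg
    · exact hκ.mul_const _
  · refine (hκ.norm.mul_const 2).mono' (hmeas z) (Eventually.of_forall fun w => ?_)
    by_cases hw : κ w = 0
    · simp [hw]
    rw [norm_mul]
    gcongr
    have h2 := (hratio z w hzε hw)
    rw [heq z w hzε]
    have h3 := Complex.norm_log_one_add_half_le_self h2.le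
    linarith
  · refine Eventually.of_forall fun w y hy => ?_
    by_cases hw : κ w = 0
    · simp [hw, hasDerivAt_const]
    · exact hderiv y w (hrs hy).2 hw

/-- Induction on the number of balls: the part of the density in one ball is split off and treated
alone. -/
theorem exists_primitive_cauchyTransform {ε : ℝ} (hε : 0 < ε) (s : Finset ℂ) (hs : ↑s ⊆ K) :
    ∀ {κ : ℂ → ℂ}, Integrable κ → (∀ w, κ w ≠ 0 → ∃ p ∈ s, ‖w - p‖ < 2 * ε) →
    ∃ g : ℂ → ℂ, ∀ z, z ∈ interiorDomain K → 5 * ε < Metric.infDist z K →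
      HasDerivAt g (∫ w, κ w / (w - z)) z := by
  classical
  induction s using Finset.induction_on with
  | empty =>
    intro κ _ h0
    have h1 : ∀ w, κ w = 0 := fun w => by
      by_contra hw
      obtain ⟨p, hp, -⟩ := h0 w hw
      simp at hp
    exact ⟨fun _ => 0, fun z _ _ => by simp [h1, hasDerivAt_const]⟩
  | insert p s _ ih =>
    intro κ hκ h0
    have hmb : MeasurableSet (Metric.ball p (2 * ε)) := Metric.isOpen_ball.measurableSet
    obtain ⟨g1, hg1⟩ := h.exists_primitive_cauchyTransform_ball hε (p := p) (hs (by simp))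
      (hκ.indicator hmb) (fun w hw => mem_ball_iff_norm.1 (by
        by_contra hn
        exact hw (indicator_of_notMem hn _)))
    obtain ⟨g2, hg2⟩ := ih (fun x hx => hs (by simp [Finset.mem_coe.1 hx]))
      (hκ.indicator hmb.compl) (fun w hw => by
        have hw1 : w ∉ Metric.ball p (2 * ε) := by
          by_contra hn
          exact hw (indicator_of_notMem (by simpa using hn) _)
        have hw2 : κ w ≠ 0 := fun hn => hw (by simp [indicator, hn])
        obtain ⟨q, hq, hqw⟩ := h0 w hw2
        rcases Finset.mem_insert.1 hq with rfl | hq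
        · exact absurd (mem_ball_iff_norm.2 hqw) hw1
        · exact ⟨q, hq, hqw⟩)
    refine ⟨fun z => g1 z + g2 z, fun z hz hzε => ?_⟩
    convert! (hg1 z hz hzε).add (hg2 z hz hzε) using 1
    have hfar : ∀ w, κ w ≠ 0 → ε ≤ ‖w - z‖ := by
      intro w hw
      obtain ⟨q, hq, hqw⟩ := h0 w hw
      have h2 : 5 * ε < ‖z - q‖ := by
        rw [← dist_eq_norm]
        exact hzε.trans_le (Metric.infDist_le_dist_of_mem (hs hq))
      have h3 := norm_add_le (z - w) (w - q)
      rw [sub_add_sub_cancel, norm_sub_rev z w] at h3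
      linarith
    have hint : ∀ {κ' : ℂ → ℂ}, Integrable κ' → (∀ w, κ' w ≠ 0 → ε ≤ ‖w - z‖) →
        Integrable fun w => κ' w / (w - z) := by
      intro κ' hκ' hf
      have hm : AEStronglyMeasurable (fun w : ℂ => (w - z)⁻¹) volume :=
        (measurable_id.sub_const z).inv.aestronglyMeasurable
      refine (hκ'.norm.const_mul ε⁻¹).mono' ?_ (Eventually.of_forall fun w => ?_)
      · simp only [div_eq_mul_inv]
        exact hκ'.aestronglyMeasurable.mul hm
      · by_cases hw : κ' w = 0
        · simp [hw]
        · rw [norm_div, div_eq_inv_mul]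
          gcongr
          exact hf w hw
    have hne : ∀ (S : Set ℂ) w, S.indicator κ w ≠ 0 → κ w ≠ 0 := fun S w hw hn =>
      hw (by simp [indicator, hn])
    rw [← integral_add (hint (hκ.indicator hmb) fun w hw => hfar w (hne _ w hw))
      (hint (hκ.indicator hmb.compl) fun w hw => hfar w (hne _ w hw))]
    congr 1
    ext w
    rw [← add_div, indicator_self_add_compl_apply]

/-- On the core, `f` is a Cauchy transform of a density carried by the inside points at distance
less than `ε` from `K`. A finite subcover of `K` by `ε`-balls puts each of them within `2ε` of a
chosen point of `K`. -/
theorem exists_primitive_core {f : ℂ → ℂ} (hf : DifferentiableOn ℂ f (interiorDomain K)) {ε : ℝ}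
    (hε : 0 < ε) : ∃ g : ℂ → ℂ, ∀ z, z ∈ interiorDomain K → 5 * ε < Metric.infDist z K →
      HasDerivAt g (f z) z := by
  obtain ⟨k, hkc, hks, hkt, hk⟩ := exists_cauchy_density h.isOpen (h.isCompact_core ε hε)
    (fun z hz => hz.1)
  obtain ⟨s, hs⟩ := h.isCompact.elim_nhds_subcover' (fun p _ => Metric.ball p ε)
    fun p _ => Metric.ball_mem_nhds p hε
  have hκ : Integrable fun w => k w * f w := by
    have hc : Continuous fun w => k w * f w := by
      rw [continuous_iff_continuousAt]
      intro w
      by_cases hw : w ∈ tsupport k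
      · exact hkc.continuousAt.mul (hf.differentiableAt (h.isOpen.mem_nhds (hkt hw).1)).continuousAt
      · have h1 : (fun w => k w * f w) =ᶠ[𝓝 w] fun _ => 0 := by
          filter_upwards [notMem_tsupport_iff_eventuallyEq.1 hw] with y hy
          simp [hy]
        exact continuousAt_const.congr h1.symm
    exact hc.integrable_of_hasCompactSupport hks.mul_right
  classical
  obtain ⟨g, hg⟩ := h.exists_primitive_cauchyTransform hε (s.image Subtype.val) (by
    intro x hx
    simp only [Finset.coe_image, mem_image] at hx
    obtain ⟨y, -, rfl⟩ := hx
    exact y.2) hκ (by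
    intro w hw
    have hwk : w ∈ tsupport k := subset_tsupport k fun h0 => hw (by simp [h0])
    have hwd : Metric.infDist w K < ε := by
      by_contra! hle
      exact (hkt hwk).2 ⟨(hkt hwk).1, hle⟩
    obtain ⟨p, hp, hpw⟩ := (Metric.infDist_lt_iff h.isConnected.nonempty).1 hwd
    obtain ⟨q, hq, hqp⟩ := mem_iUnion₂.1 (hs hp)
    refine ⟨q, Finset.mem_image_of_mem _ hq, ?_⟩
    rw [← dist_eq_norm]
    have h1 := dist_triangle w p q
    have h2 := Metric.mem_ball.1 hqp
    linarith)
  refine ⟨g, fun z hz hzε => ?_⟩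
  rw [hk f hf z ⟨hz, by linarith⟩]
  exact hg z hz hzε

end IsEnclosing

/-- For a primitive `g` of the logarithmic derivative, `exp(-g) f` is a nonzero constant, whose
logarithm corrects `g`. -/
theorem exists_log_of_primitive {U : Set ℂ} (hU : IsOpen U) (hUc : IsPreconnected U) {f g : ℂ → ℂ}
    (hf : DifferentiableOn ℂ f U) (hne : ∀ z ∈ U, f z ≠ 0)
    (hg : ∀ z ∈ U, HasDerivAt g (deriv f z / f z) z) :
    ∃ L : ℂ → ℂ, DifferentiableOn ℂ L U ∧ ∀ z ∈ U, Complex.exp (L z) = f z := by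
  rcases U.eq_empty_or_nonempty with rfl | ⟨p, hp⟩
  · exact ⟨0, differentiableOn_empty, fun z hz => hz.elim⟩
  have hfd : ∀ z ∈ U, HasDerivAt f (deriv f z) z := fun z hz =>
    (hf.differentiableAt (hU.mem_nhds hz)).hasDerivAt
  have hq : ∀ z ∈ U, HasDerivAt (fun z => Complex.exp (-g z) * f z) 0 z := by
    intro z hz
    convert! ((hg z hz).neg.cexp).mul (hfd z hz) using 1
    have := hne z hz
    field_simp
    ring
  set c := Complex.exp (-g p) * f p with hc
  have hc0 : c ≠ 0 := mul_ne_zero (Complex.exp_ne_zero _) (hne p hp)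
  have hconst : ∀ z ∈ U, Complex.exp (-g z) * f z = c := fun z hz =>
    hU.is_const_of_deriv_eq_zero hUc
      (fun w hw => (hq w hw).differentiableAt.differentiableWithinAt)
      (fun w hw => (hq w hw).deriv) hz hp
  refine ⟨fun z => g z + Complex.log c, fun z hz =>
    ((hg z hz).differentiableAt.add_const _).differentiableWithinAt, fun z hz => ?_⟩
  rw [Complex.exp_add, Complex.exp_log hc0, ← hconst z hz, ← mul_assoc, ← Complex.exp_add]
  simp

/-! ### Global primitives, logarithms and square roots -/

namespace IsEnclosing

variable {K : Set ℂ} (h : IsEnclosing K)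
include h

theorem exists_pos_lt_infDist {S : Set ℂ} (hS : IsCompact S) (hSU : S ⊆ interiorDomain K) :
    ∃ d > 0, ∀ z ∈ S, d ≤ Metric.infDist z K := by
  rcases S.eq_empty_or_nonempty with rfl | hne
  · exact ⟨1, one_pos, by simp⟩
  obtain ⟨z0, hz0, hmin⟩ := hS.exists_isMinOn hne (Metric.continuous_infDist_pt K).continuousOn
  refine ⟨Metric.infDist z0 K, ?_, fun z hz => hmin hz⟩
  exact (h.isCompact.isClosed.notMem_iff_infDist_pos h.isConnected.nonempty).1
    (interiorDomain_subset (hSU hz0))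

/-- The components of `0` in the cores increase to the inside, since a path from `0` keeps a
positive distance from `K`. Normalized to vanish at `0`, the primitives on these components agree
and glue. -/
theorem exists_primitive {f : ℂ → ℂ} (hf : DifferentiableOn ℂ f (interiorDomain K)) :
    ∃ g : ℂ → ℂ, ∀ z ∈ interiorDomain K, HasDerivAt g (f z) z := by
  set V : ℕ → Set ℂ := fun n => {z | z ∈ interiorDomain K ∧ 5 * (1 / ((n : ℝ) + 1)) < Metric.infDist z K}
    with hV
  set C : ℕ → Set ℂ := fun n => connectedComponentIn (V n) 0 with hC
  have hVo : ∀ n, IsOpen (V n) := fun n => h.isOpen_core _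
  have hCo : ∀ n, IsOpen (C n) := fun n => (hVo n).connectedComponentIn
  have hVm : ∀ {m n : ℕ}, m ≤ n → V m ⊆ V n := by
    intro m n hmn z hz
    refine ⟨hz.1, lt_of_le_of_lt ?_ hz.2⟩
    gcongr
  have hCm : ∀ {m n : ℕ}, m ≤ n → C m ⊆ C n := fun hmn => connectedComponentIn_mono _ (hVm hmn)
  have hC0 : ∀ {n z}, z ∈ C n → (0 : ℂ) ∈ C n := by
    intro n z hz
    have h1 := connectedComponentIn_nonempty_iff.1 ⟨z, hz⟩
    exact mem_connectedComponentIn h1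
  have hcover : ∀ z ∈ interiorDomain K, ∃ n, z ∈ C n := by
    intro z hz
    have hpc : IsPathConnected (interiorDomain K) :=
      h.isOpen.isConnected_iff_isPathConnected.1 ⟨⟨0, h.zero_mem⟩, isPreconnected_interiorDomain⟩
    obtain ⟨γ, hγ⟩ := hpc.joinedIn 0 h.zero_mem z hz
    have hcomp : IsCompact (range γ) := isCompact_range γ.continuous
    obtain ⟨d, hd, hdm⟩ := h.exists_pos_lt_infDist hcomp (range_subset_iff.2 hγ)
    obtain ⟨n, hn⟩ := exists_nat_one_div_lt (show 0 < d / 5 by positivity)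
    refine ⟨n, ?_⟩
    have hsub : range γ ⊆ V n := by
      rintro _ ⟨t, rfl⟩
      refine ⟨hγ t, lt_of_lt_of_le ?_ (hdm _ ⟨t, rfl⟩)⟩
      linarith
    exact (isPreconnected_range γ.continuous).subset_connectedComponentIn ⟨0, γ.source⟩ hsub
      ⟨1, γ.target⟩
  have hprim : ∀ n : ℕ, ∃ g : ℂ → ℂ, ∀ z ∈ V n, HasDerivAt g (f z) z := by
    intro n
    obtain ⟨g, hg⟩ := h.exists_primitive_core hf (show (0 : ℝ) < 1 / ((n : ℝ) + 1) by positivity)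
    exact ⟨g, fun z hz => hg z hz.1 hz.2⟩
  choose g hg using hprim
  have hCV : ∀ {n z}, z ∈ C n → z ∈ V n := fun hz => connectedComponentIn_subset _ _ hz
  have hagree : ∀ {m n : ℕ} {z : ℂ}, m ≤ n → z ∈ C m → g m z - g m 0 = g n z - g n 0 := by
    intro m n z hmn hz
    refine (hCo m).eqOn_of_deriv_eq (f := fun z => g m z - g m 0) (g := fun z => g n z - g n 0)
      isPreconnected_connectedComponentIn ?_ ?_ ?_ (hC0 hz) (by simp) hz
    · exact fun w hw => ((hg m w (hCV hw)).sub_const _).differentiableAt.differentiableWithinAt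
    · exact fun w hw =>
        ((hg n w (hVm hmn (hCV hw))).sub_const _).differentiableAt.differentiableWithinAt
    · intro w hw
      rw [((hg m w (hCV hw)).sub_const _).deriv, ((hg n w (hVm hmn (hCV hw))).sub_const _).deriv]
  choose! N hN using hcover
  refine ⟨fun z => g (N z) z - g (N z) 0, fun z hz => ?_⟩
  refine ((hg (N z) z (hCV (hN z hz))).sub_const (g (N z) 0)).congr_of_eventuallyEq ?_
  filter_upwards [(hCo (N z)).mem_nhds (hN z hz)] with w hw
  have hwU : w ∈ interiorDomain K := (hCV hw).1
  rcases le_total (N z) (N w) with hle | hle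
  · exact (hagree hle hw).symm
  · exact hagree hle (hN w hwU)

theorem exists_log {f : ℂ → ℂ} (hf : DifferentiableOn ℂ f (interiorDomain K))
    (hne : ∀ z ∈ interiorDomain K, f z ≠ 0) :
    ∃ L : ℂ → ℂ, DifferentiableOn ℂ L (interiorDomain K) ∧
      ∀ z ∈ interiorDomain K, Complex.exp (L z) = f z := by
  obtain ⟨g, hg⟩ := h.exists_primitive (f := fun z => deriv f z / f z)
    ((hf.deriv h.isOpen).div hf hne)
  exact exists_log_of_primitive h.isOpen isPreconnected_interiorDomain hf hne hg

theorem exists_sqrt {f : ℂ → ℂ} (hf : DifferentiableOn ℂ f (interiorDomain K))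
    (hne : ∀ z ∈ interiorDomain K, f z ≠ 0) :
    ∃ g : ℂ → ℂ, DifferentiableOn ℂ g (interiorDomain K) ∧
      ∀ z ∈ interiorDomain K, g z ^ 2 = f z := by
  obtain ⟨L, hL, hLf⟩ := h.exists_log hf hne
  refine ⟨fun z => Complex.exp (L z / 2), (hL.div_const 2).cexp, fun z hz => ?_⟩
  rw [← Complex.exp_nat_mul, ← hLf z hz]
  congr 1
  push_cast
  ring

end IsEnclosing

/-! ## The Riemann mapping theorem -/

section Blaschke

/-- The automorphism of the unit disc that maps `a` to `0`. -/
noncomputable def blaschke (a z : ℂ) : ℂ := (z - a) / (1 - starRingEnd ℂ a * z)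

variable {a z : ℂ}

theorem blaschke_denom_ne_zero (ha : ‖a‖ < 1) (hz : ‖z‖ < 1) : 1 - starRingEnd ℂ a * z ≠ 0 := by
  intro h0
  have h1 : ‖starRingEnd ℂ a * z‖ = 1 := by
    rw [← sub_eq_zero.1 h0, norm_one]
  rw [norm_mul, RCLike.norm_conj] at h1
  nlinarith [norm_nonneg a, norm_nonneg z]

theorem norm_blaschke_lt_one (ha : ‖a‖ < 1) (hz : ‖z‖ < 1) : ‖blaschke a z‖ < 1 := by
  rw [blaschke, norm_div, div_lt_one (norm_pos_iff.2 (blaschke_denom_ne_zero ha hz)),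
    ← sq_lt_sq₀ (norm_nonneg _) (norm_nonneg _), ← Complex.normSq_eq_norm_sq,
    ← Complex.normSq_eq_norm_sq]
  have h1 : Complex.normSq a < 1 := by
    rw [Complex.normSq_eq_norm_sq]; nlinarith [norm_nonneg a]
  have h2 : Complex.normSq z < 1 := by
    rw [Complex.normSq_eq_norm_sq]; nlinarith [norm_nonneg z]
  rw [Complex.normSq_apply] at h1 h2 ⊢
  rw [Complex.normSq_apply]
  simp only [Complex.sub_re, Complex.sub_im, Complex.one_re, Complex.one_im, Complex.mul_re,
    Complex.mul_im, Complex.conj_re, Complex.conj_im]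
  nlinarith [mul_pos (sub_pos.2 h1) (sub_pos.2 h2)]

theorem hasDerivAt_blaschke (ha : ‖a‖ < 1) (hz : ‖z‖ < 1) :
    HasDerivAt (blaschke a) ((1 - starRingEnd ℂ a * a) / (1 - starRingEnd ℂ a * z) ^ 2) z := by
  have hne := blaschke_denom_ne_zero ha hz
  have h1 := ((hasDerivAt_id z).sub_const a).div
    (((hasDerivAt_id z).const_mul (starRingEnd ℂ a)).const_sub 1) hne
  convert! h1 using 1
  simp only [id]
  congr 1
  ring

theorem blaschke_injOn (ha : ‖a‖ < 1) : InjOn (blaschke a) (Metric.ball 0 1) := by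
  intro z hz w hw h
  rw [mem_ball_zero_iff] at hz hw
  have h1 := blaschke_denom_ne_zero ha hz
  have h2 := blaschke_denom_ne_zero ha hw
  rw [blaschke, blaschke, div_eq_div_iff h1 h2] at h
  have h3 := blaschke_denom_ne_zero ha ha
  have h4 : (z - w) * (1 - starRingEnd ℂ a * a) = 0 := by linear_combination h
  exact sub_eq_zero.1 ((mul_eq_zero.1 h4).resolve_right h3)

end Blaschke

namespace IsEnclosing

variable {K : Set ℂ} (h : IsEnclosing K)
include h

/-- Koebe's extremal argument: among injective holomorphic maps into the disc that fix `0`, one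
maximizing `|ψ'(0)|` exists, and it is onto because the square-root trick would otherwise increase
the derivative. -/
theorem exists_riemann_map : ∃ ψ : ℂ → ℂ, DifferentiableOn ℂ ψ (interiorDomain K) ∧
    InjOn ψ (interiorDomain K) ∧ ψ '' interiorDomain K = Metric.ball 0 1 ∧ ψ 0 = 0 := by
  set U := interiorDomain K with hU
  set P : (ℂ → ℂ) → Prop := fun ψ => DifferentiableOn ℂ ψ U ∧ InjOn ψ U ∧
    MapsTo ψ U (Metric.ball 0 1) ∧ ψ 0 = 0 with hP
  set A : Set ℝ := {r | ∃ ψ, P ψ ∧ r = ‖deriv ψ 0‖} with hA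
  obtain ⟨m, hm, hmU⟩ := h.exists_ball_subset
  obtain ⟨R, hR, hRU⟩ : ∃ R > 0, ∀ z ∈ U, ‖z‖ < R := by
    obtain ⟨R, hR⟩ := h.isBounded.exists_norm_le
    have h0 := hR 0 h.zero_mem
    rw [norm_zero] at h0
    exact ⟨R + 1, by linarith, fun z hz => by linarith [hR z hz]⟩
  have hAb : BddAbove A := by
    refine ⟨1 / m, ?_⟩
    rintro _ ⟨ψ, ⟨hd, -, hmaps, h0⟩, rfl⟩
    refine Complex.norm_deriv_le_div_of_mapsTo_ball (hd.mono hmU) ?_ hm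
    intro z hz
    rw [h0]
    exact Metric.ball_subset_closedBall (hmaps (hmU hz))
  have hscale : R⁻¹ ∈ A := by
    refine ⟨fun z => (R : ℂ)⁻¹ * z, ⟨by fun_prop, ?_, ?_, by simp⟩, ?_⟩
    · intro z _ w _ hzw
      exact mul_left_cancel₀ (inv_ne_zero (by exact_mod_cast hR.ne')) hzw
    · intro z hz
      rw [mem_ball_zero_iff, norm_mul, norm_inv, Complex.norm_real, Real.norm_of_nonneg hR.le,
        inv_mul_lt_one₀ hR]
      exact hRU z hz
    · have hd : HasDerivAt (fun z : ℂ => (R : ℂ)⁻¹ * z) ((R : ℂ)⁻¹ * 1) 0 :=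
        (hasDerivAt_id (0 : ℂ)).const_mul (R : ℂ)⁻¹
      rw [hd.deriv, mul_one, norm_inv, Complex.norm_real,
        Real.norm_of_nonneg hR.le]
  set S := sSup A with hS
  have hS0 : 0 < S := (inv_pos.2 hR).trans_le (le_csSup hAb hscale)
  obtain ⟨a, -, ha, haA⟩ := exists_seq_tendsto_sSup ⟨_, hscale⟩ hAb
  choose F hF hFa using haA
  -- The limit along a free ultrafilter attains the supremum, since derivatives converge too;
  -- Hurwitz keeps it injective.
  obtain ⟨f, hf⟩ := exists_limit_of_locally_bounded (hyperfilter ℕ) (F := F) (U := U) (by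
    intro z hz
    obtain ⟨r, hr, hrU⟩ := Metric.isOpen_iff.1 h.isOpen z hz
    refine ⟨r, hr, 1, Eventually.of_forall fun i => ⟨(hF i).1.mono hrU, fun w hw => ?_⟩⟩
    exact (mem_ball_zero_iff.1 ((hF i).2.2.1 (hrU hw))).le)
  have hFd : ∀ᶠ i in (hyperfilter ℕ : Filter ℕ), DifferentiableOn ℂ (F i) U :=
    Eventually.of_forall fun i => (hF i).1
  have hfd : DifferentiableOn ℂ f U := hf.differentiableOn hFd h.isOpen
  have hf0 : f 0 = 0 := by
    have h1 := hf.tendsto_at h.zero_mem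
    simp only [(hF _).2.2.2] at h1
    exact tendsto_nhds_unique h1 tendsto_const_nhds
  have hfder : ‖deriv f 0‖ = S := by
    have h1 := ((hf.deriv hFd h.isOpen).tendsto_at h.zero_mem).norm
    simp only [Function.comp_apply, ← hFa] at h1
    refine tendsto_nhds_unique h1 (ha.mono_left ?_)
    exact Nat.hyperfilter_le_atTop
  have hfder0 : deriv f 0 ≠ 0 := norm_pos_iff.1 (hfder ▸ hS0)
  have hfinj : InjOn f U := injOn_of_tendstoLocallyUniformlyOn h.isOpen
    isPreconnected_interiorDomain hf hFd (Eventually.of_forall fun i => (hF i).2.1) h.zero_mem hfder0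
  have hfle : ∀ z ∈ U, ‖f z‖ ≤ 1 := fun z hz =>
    le_of_tendsto (hf.tendsto_at hz).norm
      (Eventually.of_forall fun i => (mem_ball_zero_iff.1 ((hF i).2.2.1 hz)).le)
  have hflt : ∀ z ∈ U, ‖f z‖ < 1 := by
    intro z hz
    refine lt_of_le_of_ne (hfle z hz) fun h1 => hfder0 ?_
    have h2 := Complex.eqOn_of_isPreconnected_of_isMaxOn_norm isPreconnected_interiorDomain
      h.isOpen hfd hz (fun w hw => by
        simp only [Function.comp_apply, mem_ofPred_eq, h1]
        exact hfle w hw)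
    rw [(h2.eventuallyEq_of_mem (h.isOpen.mem_nhds h.zero_mem)).deriv_eq]
    exact deriv_const _ _
  refine ⟨f, hfd, hfinj, Subset.antisymm (image_subset_iff.2 fun z hz =>
    mem_ball_zero_iff.2 (hflt z hz)) ?_, hf0⟩
  intro c hc
  rw [mem_ball_zero_iff] at hc
  by_contra hcf
  have hc0 : c ≠ 0 := fun h0 => hcf ⟨0, h.zero_mem, by rw [hf0, h0]⟩
  have hgd : DifferentiableOn ℂ (fun z => blaschke c (f z)) U := fun z hz =>
    ((hasDerivAt_blaschke hc (hflt z hz)).differentiableAt.comp z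
      (hfd.differentiableAt (h.isOpen.mem_nhds hz))).differentiableWithinAt
  -- If `c` is omitted by `f`, then `blaschke c ∘ f` has no zero and has a square root `g`, which is
  -- still injective; composing with `blaschke (g 0)` restores the value `0` at `0`.
  obtain ⟨g, hg, hg2⟩ := h.exists_sqrt hgd (fun z hz => by
    refine div_ne_zero (sub_ne_zero.2 fun h0 => hcf ⟨z, hz, h0⟩) (blaschke_denom_ne_zero hc (hflt z hz)))
  have hglt : ∀ z ∈ U, ‖g z‖ < 1 := by
    intro z hz
    have h1 := norm_blaschke_lt_one hc (hflt z hz)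
    rw [← hg2 z hz, norm_pow] at h1
    by_contra! h2
    nlinarith
  have hg0 := hglt 0 h.zero_mem
  have hginj : InjOn g U := by
    intro z hz w hw hzw
    refine hfinj hz hw (blaschke_injOn hc (mem_ball_zero_iff.2 (hflt z hz))
      (mem_ball_zero_iff.2 (hflt w hw)) ?_)
    rw [← hg2 z hz, ← hg2 w hw, hzw]
  have hgd0 : HasDerivAt g (deriv g 0) 0 :=
    (hg.differentiableAt (h.isOpen.mem_nhds h.zero_mem)).hasDerivAt
  have hsq0 : g 0 ^ 2 = -c := by
    rw [hg2 0 h.zero_mem, hf0, blaschke]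
    simp
  have hder : 2 * g 0 * deriv g 0 = (1 - starRingEnd ℂ c * c) * deriv f 0 := by
    have h1 : HasDerivAt (fun z => g z ^ 2) (2 * g 0 * deriv g 0) 0 := by
      convert! hgd0.pow 2 using 1
      simp
    have h2 : HasDerivAt (fun z => blaschke c (f z)) ((1 - starRingEnd ℂ c * c) /
        (1 - starRingEnd ℂ c * f 0) ^ 2 * deriv f 0) 0 :=
      (hasDerivAt_blaschke hc (hflt 0 h.zero_mem)).comp 0
        (hfd.differentiableAt (h.isOpen.mem_nhds h.zero_mem)).hasDerivAt
    have h3 : (fun z => blaschke c (f z)) =ᶠ[𝓝 0] fun z => g z ^ 2 := by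
      filter_upwards [h.isOpen.mem_nhds h.zero_mem] with z hz
      rw [hg2 z hz]
    have h4 := (h1.congr_of_eventuallyEq h3).unique h2
    rw [hf0] at h4
    simpa using h4
  have hψder : HasDerivAt (fun z => blaschke (g 0) (g z))
      ((1 - starRingEnd ℂ (g 0) * g 0) / (1 - starRingEnd ℂ (g 0) * g 0) ^ 2 * deriv g 0) 0 :=
    (hasDerivAt_blaschke hg0 hg0).comp 0 hgd0
  have hmem : ‖deriv (fun z => blaschke (g 0) (g z)) 0‖ ∈ A := by
    refine ⟨_, ⟨fun z hz => ((hasDerivAt_blaschke hg0 (hglt z hz)).differentiableAt.comp z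
      (hg.differentiableAt (h.isOpen.mem_nhds hz))).differentiableWithinAt, ?_, ?_, ?_⟩, rfl⟩
    · intro z hz w hw hzw
      exact hginj hz hw (blaschke_injOn hg0 (mem_ball_zero_iff.2 (hglt z hz))
        (mem_ball_zero_iff.2 (hglt w hw)) hzw)
    · exact fun z hz => mem_ball_zero_iff.2 (norm_blaschke_lt_one hg0 (hglt z hz))
    · simp [blaschke]
  have hle := le_csSup hAb hmem
  rw [hψder.deriv] at hle
  have hcc : ∀ w : ℂ, 1 - starRingEnd ℂ w * w = ((1 - ‖w‖ ^ 2 : ℝ) : ℂ) := by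
    intro w
    rw [mul_comm, Complex.mul_conj, Complex.normSq_eq_norm_sq]
    push_cast
    ring
  set s := ‖g 0‖ with hs
  have hsc : s ^ 2 = ‖c‖ := by rw [hs, ← norm_pow, hsq0, norm_neg]
  have hspos : 0 < s := by
    have : 0 < ‖c‖ := norm_pos_iff.2 hc0
    rw [← hsc] at this
    exact (norm_nonneg _).lt_of_ne fun h0 => by
      rw [hs, ← h0] at this
      norm_num at this
  have h5 : 2 * s * ‖deriv g 0‖ = (1 - s ^ 4) * S := by
    have h6 := congrArg norm hder
    rw [norm_mul, norm_mul, hcc, norm_mul, Complex.norm_real, hfder, Real.norm_of_nonneg, ← hsc] at h6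
    · rw [Complex.norm_two] at h6
      rw [h6]
      ring
    · nlinarith [norm_nonneg c]
  have h7 : ‖(1 - starRingEnd ℂ (g 0) * g 0) / (1 - starRingEnd ℂ (g 0) * g 0) ^ 2 * deriv g 0‖
      = ‖deriv g 0‖ / (1 - s ^ 2) := by
    have h8 : 0 < 1 - s ^ 2 := by nlinarith
    rw [hcc, norm_mul, norm_div, norm_pow, Complex.norm_real, Real.norm_of_nonneg h8.le]
    field_simp
  rw [h7, div_le_iff₀ (by nlinarith)] at hle
  -- The new map has derivative of modulus `S (1 + s²) / (2 s)`, with `s = √|c| < 1`. This exceeds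
  -- `S` by the factor `1 + (1 - s)² / (2 s)`.
  have h9 : (1 - s ^ 4) * S ≤ 2 * s * (S * (1 - s ^ 2)) := by
    rw [← h5]
    gcongr
  have h10 : 0 < S * (1 - s ^ 2) * (1 - s) ^ 2 := by
    have : 0 < 1 - s := by linarith
    have : 0 < 1 - s ^ 2 := by nlinarith
    positivity
  nlinarith

theorem exists_isInteriorMap : ∃ φ, IsInteriorMap (interiorDomain K) φ := by
  obtain ⟨ψ, hd, hinj, himg, h0⟩ := h.exists_riemann_map
  set g := Function.invFunOn ψ (interiorDomain K) with hg
  have hleft : LeftInvOn g ψ (interiorDomain K) := hinj.leftInvOn_invFunOn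
  have hne := deriv_ne_zero_of_injOn h.isOpen hd hinj h.zero_mem
  have hgd : DifferentiableOn ℂ g (Metric.ball 0 1) := by
    rw [← himg]
    rintro _ ⟨z, hz, rfl⟩
    exact (analyticAt_leftInverse h.isOpen hd hleft hz).differentiableAt.differentiableWithinAt
  have hgmaps : MapsTo g (Metric.ball 0 1) (interiorDomain K) := by
    rw [← himg]
    rintro _ ⟨z, hz, rfl⟩
    rwa [hleft hz]
  have hright : ∀ w ∈ Metric.ball (0 : ℂ) 1, ψ (g w) = w := by
    rw [← himg]
    rintro _ ⟨z, hz, rfl⟩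
    rw [hleft hz]
  have hg0 : g 0 = 0 := by
    have := hleft h.zero_mem
    rwa [h0] at this
  have hb0 : (0 : ℂ) ∈ Metric.ball (0 : ℂ) 1 := by simp
  have hgder : deriv g 0 ≠ 0 := by
    refine deriv_ne_zero_of_injOn Metric.isOpen_ball hgd (fun z hz w hw hzw => ?_) hb0
    rw [← hright z hz, ← hright w hw, hzw]
  -- A rotation of the disc that makes the derivative at `0` positive.
  set u : ℂ := (‖deriv g 0‖ : ℂ) / deriv g 0 with hu
  have hnu : ‖u‖ = 1 := by
    rw [hu, norm_div, Complex.norm_real, norm_norm, div_self (norm_ne_zero_iff.2 hgder)]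
  have hu0 : u ≠ 0 := norm_ne_zero_iff.1 (by rw [hnu]; exact one_ne_zero)
  have hmaps : MapsTo (fun z => u * z) (Metric.ball (0 : ℂ) 1) (Metric.ball 0 1) := by
    intro z hz
    rw [mem_ball_zero_iff, norm_mul, hnu, one_mul]
    exact mem_ball_zero_iff.1 hz
  refine ⟨fun z => g (u * z), ⟨hgd.comp (by fun_prop) hmaps, ?_, ?_, by simp [hg0], ?_⟩⟩
  · intro z hz w hw hzw
    have h1 := congrArg ψ hzw
    simp only [hright _ (hmaps hz), hright _ (hmaps hw)] at h1
    exact mul_left_cancel₀ hu0 h1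
  · apply Subset.antisymm
    · rintro _ ⟨z, hz, rfl⟩
      exact hgmaps (hmaps hz)
    · intro z hz
      have hψz : ψ z ∈ Metric.ball (0 : ℂ) 1 := himg ▸ mem_image_of_mem ψ hz
      refine ⟨u⁻¹ * ψ z, ?_, ?_⟩
      · rw [mem_ball_zero_iff, norm_mul, norm_inv, hnu, inv_one, one_mul]
        exact mem_ball_zero_iff.1 hψz
      · simp only [mul_inv_cancel_left₀ hu0]
        exact hleft hz
  · refine ⟨‖deriv g 0‖, norm_pos_iff.2 hgder, ?_⟩
    have h1 : HasDerivAt g (deriv g 0) (u * 0) := by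
      rw [mul_zero]
      exact (hgd.differentiableAt (Metric.isOpen_ball.mem_nhds hb0)).hasDerivAt
    have h2 := h1.comp (0 : ℂ) ((hasDerivAt_id (0 : ℂ)).const_mul u)
    have h3 : deriv (fun z => g (u * z)) 0 = deriv g 0 * (u * 1) := h2.deriv
    rw [h3, hu]
    field_simp

end IsEnclosing

/-! ## Normalized interior maps -/

namespace IsInteriorMap

variable {U : Set ℂ} {φ : ℂ → ℂ} (hφ : IsInteriorMap U φ)
include hφ

theorem isOpen : IsOpen U := by
  rw [← hφ.image_eq]
  exact isOpen_image_of_injOn Metric.isOpen_ball hφ.differentiableOn hφ.injOn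

theorem mapsTo : MapsTo φ (Metric.ball 0 1) U := fun _ hz => hφ.image_eq ▸ mem_image_of_mem φ hz

theorem deriv_ne_zero {z : ℂ} (hz : z ∈ Metric.ball (0 : ℂ) 1) : deriv φ z ≠ 0 :=
  deriv_ne_zero_of_injOn Metric.isOpen_ball hφ.differentiableOn hφ.injOn hz

theorem hasDerivAt {z : ℂ} (hz : z ∈ Metric.ball (0 : ℂ) 1) : HasDerivAt φ (deriv φ z) z :=
  (hφ.differentiableOn.differentiableAt (Metric.isOpen_ball.mem_nhds hz)).hasDerivAt

theorem exists_inverse : ∃ ψ : ℂ → ℂ, DifferentiableOn ℂ ψ U ∧ MapsTo ψ U (Metric.ball 0 1) ∧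
    (∀ z ∈ Metric.ball (0 : ℂ) 1, ψ (φ z) = z) ∧ (∀ w ∈ U, φ (ψ w) = w) ∧ ψ 0 = 0 := by
  have hl : LeftInvOn (Function.invFunOn φ (Metric.ball 0 1)) φ (Metric.ball 0 1) :=
    hφ.injOn.leftInvOn_invFunOn
  refine ⟨Function.invFunOn φ (Metric.ball 0 1), ?_, ?_, fun z hz => hl hz, ?_, ?_⟩
  · rw [← hφ.image_eq]
    rintro _ ⟨z, hz, rfl⟩
    exact (analyticAt_leftInverse Metric.isOpen_ball hφ.differentiableOn hl
      hz).differentiableAt.differentiableWithinAt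
  · rw [← hφ.image_eq]
    rintro _ ⟨z, hz, rfl⟩
    rwa [hl hz]
  · rw [← hφ.image_eq]
    rintro _ ⟨z, hz, rfl⟩
    rw [hl hz]
  · have := hl (Metric.mem_ball_self one_pos : (0 : ℂ) ∈ _)
    rwa [hφ.map_zero] at this

/-- The Schwarz lemma for `ψ' ∘ φ` and for `ψ ∘ φ'` shows that `ψ' ∘ φ` preserves the modulus, so it
is a rotation; both derivatives at `0` being positive, the rotation is trivial. -/
theorem eqOn {φ' : ℂ → ℂ} (hφ' : IsInteriorMap U φ') : EqOn φ φ' (Metric.ball 0 1) := by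
  obtain ⟨ψ, hψd, hψm, hψl, hψr, hψ0⟩ := hφ.exists_inverse
  obtain ⟨ψ', hψd', hψm', hψl', hψr', hψ0'⟩ := hφ'.exists_inverse
  have hd : DifferentiableOn ℂ (ψ' ∘ φ) (Metric.ball 0 1) := hψd'.comp hφ.differentiableOn hφ.mapsTo
  have hd' : DifferentiableOn ℂ (ψ ∘ φ') (Metric.ball 0 1) :=
    hψd.comp hφ'.differentiableOn hφ'.mapsTo
  have hle : ∀ z ∈ Metric.ball (0 : ℂ) 1, ‖ψ' (φ z)‖ ≤ ‖z‖ := fun z hz =>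
    Complex.norm_le_norm_of_mapsTo_ball (f := ψ' ∘ φ) hd
      (fun w hw => Metric.ball_subset_closedBall (hψm' (hφ.mapsTo hw)))
      (by simp [hφ.map_zero, hψ0']) (mem_ball_zero_iff.1 hz)
  have hle' : ∀ z ∈ Metric.ball (0 : ℂ) 1, ‖ψ (φ' z)‖ ≤ ‖z‖ := fun z hz =>
    Complex.norm_le_norm_of_mapsTo_ball (f := ψ ∘ φ') hd'
      (fun w hw => Metric.ball_subset_closedBall (hψm (hφ'.mapsTo hw)))
      (by simp [hφ'.map_zero, hψ0]) (mem_ball_zero_iff.1 hz)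
  have heq : ∀ z ∈ Metric.ball (0 : ℂ) 1, ‖ψ' (φ z)‖ = ‖z‖ := by
    intro z hz
    refine le_antisymm (hle z hz) ?_
    have h1 := hle' _ (hψm' (hφ.mapsTo hz))
    rwa [hψr' _ (hφ.mapsTo hz), hψl z hz] at h1
  have hb0 : (0 : ℂ) ∈ Metric.ball (0 : ℂ) 1 := by simp
  have hhalf : (1 / 2 : ℂ) ∈ Metric.ball (0 : ℂ) 1 := by
    rw [mem_ball_zero_iff]; norm_num
  have h0 : (ψ' ∘ φ) 0 = 0 := by simp [hφ.map_zero, hψ0']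
  have haff := Complex.affine_of_mapsTo_ball_of_norm_dslope_eq_div (f := ψ' ∘ φ) (c := 0) (R₁ := 1)
    (R₂ := 1) hd (fun w hw => by
      rw [h0]
      exact Metric.ball_subset_closedBall (hψm' (hφ.mapsTo hw))) hhalf (by
      rw [dslope_of_ne _ (by norm_num), slope_def_module, norm_smul, h0, sub_zero, sub_zero,
        Function.comp_apply, heq _ hhalf]
      norm_num)
  set c := dslope (ψ' ∘ φ) 0 (1 / 2) with hc
  have haff' : ∀ z ∈ Metric.ball (0 : ℂ) 1, ψ' (φ z) = z * c := by
    intro z hz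
    have := haff hz
    simpa [hφ.map_zero, hψ0'] using this
  have hrel : ∀ z ∈ Metric.ball (0 : ℂ) 1, φ z = φ' (z * c) := fun z hz => by
    rw [← haff' z hz, hψr' _ (hφ.mapsTo hz)]
  have hnc : ‖c‖ = 1 := by
    have h1 := heq _ hhalf
    rw [haff' _ hhalf, norm_mul] at h1
    exact mul_left_cancel₀ (norm_ne_zero_iff.2 (by norm_num)) (h1.trans (mul_one _).symm)
  obtain ⟨ρ, hρ, hρd⟩ := hφ.deriv_pos
  obtain ⟨ρ', hρ', hρd'⟩ := hφ'.deriv_pos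
  have hder : deriv φ 0 = deriv φ' 0 * c := by
    have h1 : φ =ᶠ[𝓝 0] fun z => φ' (z * c) := by
      filter_upwards [Metric.isOpen_ball.mem_nhds hb0] with z hz
      exact hrel z hz
    have h2 : HasDerivAt φ' (deriv φ' 0) (0 * c) := by
      rw [zero_mul]; exact hφ'.hasDerivAt hb0
    have h3 := h2.comp (0 : ℂ) ((hasDerivAt_id (0 : ℂ)).mul_const c)
    rw [h1.deriv_eq]
    have h4 : deriv (fun z => φ' (z * c)) 0 = deriv φ' 0 * (1 * c) := h3.deriv
    rw [h4, one_mul]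
  have hc1 : c = 1 := by
    have h1 : c = ((ρ / ρ' : ℝ) : ℂ) := by
      rw [hρd, hρd'] at hder
      have : (ρ' : ℂ) ≠ 0 := by exact_mod_cast hρ'.ne'
      push_cast
      rw [hder]
      field_simp
    have h2 : ρ / ρ' = 1 := by
      rw [h1, Complex.norm_real, Real.norm_of_nonneg (by positivity)] at hnc
      exact hnc
    rw [h1, h2, Complex.ofReal_one]
  intro z hz
  rw [hrel z hz, hc1, mul_one]

end IsInteriorMap

theorem IsEnclosing.isInteriorMap_phiPlus {K : Set ℂ} (h : IsEnclosing K) :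
    IsInteriorMap (interiorDomain K) (phiPlus K) :=
  Classical.epsilon_spec h.exists_isInteriorMap

/-! ## Laurent polynomial vector fields -/

section Field

variable (v : ℂ[T;T⁻¹])

theorem fieldAt_neg (z : ℂ) : fieldAt (-v) z = -fieldAt v z := by
  simp only [fieldAt, AddMonoidAlgebra.coeff_neg]
  rw [Finsupp.sum_neg_index (by simp), Finsupp.sum, Finsupp.sum, ← Finset.sum_neg_distrib]
  simp

theorem differentiableAt_fieldAt {z : ℂ} (hz : z ≠ 0) : DifferentiableAt ℂ (fieldAt v) z := by
  unfold fieldAt Finsupp.sum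
  refine DifferentiableAt.fun_sum fun n _ => ?_
  exact (differentiableAt_const _).mul (differentiableAt_zpow.2 (Or.inl hz))

theorem differentiableOn_fieldAt : DifferentiableOn ℂ (fieldAt v) {0}ᶜ := fun _ hz =>
  (differentiableAt_fieldAt v hz).differentiableWithinAt

theorem exists_lipschitzOnWith_fieldAt {C : Set ℂ} (hC : IsCompact C) (h0 : (0 : ℂ) ∉ C) :
    ∃ L, LipschitzOnWith L (fieldAt v) C := by
  refine LocallyLipschitzOn.exists_lipschitzOnWith_of_compact hC fun z hz => ?_
  have hz0 : z ∈ ({0}ᶜ : Set ℂ) := fun h => h0 (h ▸ hz)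
  have h1 : ContDiffAt ℂ 1 (fieldAt v) z :=
    ((differentiableOn_fieldAt v).contDiffOn isOpen_compl_singleton).contDiffAt
      (isOpen_compl_singleton.mem_nhds hz0)
  obtain ⟨L, t, ht, hL⟩ := h1.exists_lipschitzOnWith
  exact ⟨L, t, mem_nhdsWithin_of_mem_nhds ht, hL⟩

/-- The closed annulus `a ≤ |z| ≤ b`. -/
def closedAnnulus (a b : ℝ) : Set ℂ := {z | a ≤ ‖z‖ ∧ ‖z‖ ≤ b}

theorem isCompact_closedAnnulus (a b : ℝ) : IsCompact (closedAnnulus a b) := by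
  have : closedAnnulus a b = Metric.closedBall 0 b ∩ {z | a ≤ ‖z‖} := by
    ext z
    simp [closedAnnulus, and_comm]
  rw [this]
  exact (isCompact_closedBall 0 b).inter_right (isClosed_le continuous_const continuous_norm)

theorem zero_notMem_closedAnnulus {a b : ℝ} (ha : 0 < a) : (0 : ℂ) ∉ closedAnnulus a b := by
  rintro ⟨h, -⟩
  rw [norm_zero] at h
  linarith

theorem exists_fieldAt_bounds {a b : ℝ} (ha : 0 < a) : ∃ M : NNReal, 0 < M ∧
    LipschitzOnWith M (fieldAt v) (closedAnnulus a b) ∧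
    ∀ z ∈ closedAnnulus a b, ‖fieldAt v z‖ ≤ M := by
  obtain ⟨L, hL⟩ := exists_lipschitzOnWith_fieldAt v (isCompact_closedAnnulus a b)
    (zero_notMem_closedAnnulus ha)
  obtain ⟨C, hC⟩ := (isCompact_closedAnnulus a b).exists_bound_of_continuousOn hL.continuousOn
  refine ⟨max L (max C.toNNReal 1), by simp, hL.weaken (le_max_left _ _), fun z hz => ?_⟩
  refine (hC z hz).trans ((Real.le_coe_toNNReal C).trans ?_)
  exact_mod_cast (le_max_left _ _).trans (le_max_right _ _)

end Field

/-! ## Quadratic remainder of a bounded holomorphic function -/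

/-- The Schwarz lemma of second order, applied to `f` minus its linear part. The `4 M` is `2 M` for
`f w - f x` plus `2 M` for the linear term. -/
theorem norm_sub_sub_deriv_le {f : ℂ → ℂ} {x y : ℂ} {r M : ℝ}
    (hf : DifferentiableOn ℂ f (Metric.ball x r)) (hM : ∀ w ∈ Metric.ball x r, ‖f w‖ ≤ M)
    (hy : y ∈ Metric.ball x r) : ‖f y - f x - deriv f x * (y - x)‖ ≤ 4 * M / r ^ 2 * ‖y - x‖ ^ 2 := by
  have hr : 0 < r := Metric.pos_of_mem_ball hy
  have hM0 : 0 ≤ M := (norm_nonneg _).trans (hM x (Metric.mem_ball_self hr))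
  have hfx : HasDerivAt f (deriv f x) x :=
    (hf.differentiableAt (Metric.ball_mem_nhds x hr)).hasDerivAt
  have hd : ‖deriv f x‖ ≤ 2 * M / r := by
    refine Complex.norm_deriv_le_div_of_mapsTo_ball hf (fun w hw => ?_) hr
    rw [mem_closedBall_iff_norm]
    exact (norm_sub_le _ _).trans (by linarith [hM w hw, hM x (Metric.mem_ball_self hr)])
  set g : ℂ → ℂ := fun w => f w - deriv f x * (w - x) with hg
  have hgx : g x = f x := by simp [hg]
  have hgd : DifferentiableOn ℂ g (Metric.ball x r) := hf.sub (by fun_prop)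
  have h1 := Complex.dist_le_mul_div_pow_of_mapsTo_ball_of_isLittleO (n := 1) (R₂ := 4 * M) hgd
    (fun w hw => by
      rw [mem_closedBall_iff_norm, hgx]
      have h2 : g w - f x = f w - f x - deriv f x * (w - x) := by simp only [hg]; ring
      rw [h2]
      refine (norm_sub_le _ _).trans ?_
      have h3 : ‖deriv f x * (w - x)‖ ≤ 2 * M / r * r := by
        rw [norm_mul]
        have := (mem_ball_iff_norm.1 hw).le
        gcongr
      have h4 : 2 * M / r * r = 2 * M := by field_simp
      have h5 := norm_sub_le (f w) (f x)
      linarith [hM w hw, hM x (Metric.mem_ball_self hr)]) (by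
      have h6 := (hasDerivAt_iff_isLittleO.1 hfx).norm_right
      simp only [pow_one]
      refine h6.congr_left fun w => ?_
      simp only [hg, smul_eq_mul]
      ring) hy
  rw [dist_eq_norm, dist_eq_norm, hgx] at h1
  have h2 : f y - f x - deriv f x * (y - x) = g y - f x := by simp only [hg]; ring
  rw [h2]
  refine h1.trans_eq ?_
  rw [show 1 + 1 = 2 from rfl, div_pow]
  ring

/-! ## The flow of a vector field -/

section Flow

variable {v : ℂ[T;T⁻¹]}

theorem FlowsTo.neg {t : ℝ} {z w : ℂ} (h : FlowsTo v t z w) : FlowsTo (-v) (-t) z w := by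
  obtain ⟨x, hx0, hxt, hx⟩ := h
  refine ⟨fun s => x (-s), by simpa using hx0, by simpa using hxt, fun s hs => ?_⟩
  have hmap : MapsTo (fun s : ℝ => -s) (uIcc 0 (-t)) (uIcc 0 t) := by
    intro r hr
    rw [mem_uIcc] at hr ⊢
    rcases hr with h | h
    · right; constructor <;> linarith [h.1, h.2]
    · left; constructor <;> linarith [h.1, h.2]
  refine ⟨(hx _ (hmap hs)).1, ?_⟩
  rw [fieldAt_neg]
  have h2 : HasDerivWithinAt (fun s : ℝ => -s) (-1) (uIcc 0 (-t)) s :=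
    (hasDerivAt_neg s).hasDerivWithinAt
  have h1 := HasDerivWithinAt.scomp s (hx _ (hmap hs)).2 h2 hmap
  have h3 : HasDerivWithinAt (fun s => x (-s)) ((-1 : ℝ) • fieldAt v (x (-s))) (uIcc 0 (-t)) s := h1
  simpa using h3

/-- Both orbits sweep out compact subsets of the punctured plane, on whose union the field is
Lipschitz, so the uniqueness theorem for ODEs applies. Negative times reduce to this by reversing
the field. -/
theorem FlowsTo.unique_of_nonneg {t : ℝ} (ht : 0 ≤ t) {z w w' : ℂ} (h : FlowsTo v t z w)
    (h' : FlowsTo v t z w') : w = w' := by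
  obtain ⟨x, hx0, hxt, hx⟩ := h
  obtain ⟨y, hy0, hyt, hy⟩ := h'
  rw [uIcc_of_le ht] at hx hy
  have hxc : ContinuousOn x (Icc 0 t) := fun s hs => (hx s hs).2.continuousWithinAt
  have hyc : ContinuousOn y (Icc 0 t) := fun s hs => (hy s hs).2.continuousWithinAt
  obtain ⟨L, hL⟩ := exists_lipschitzOnWith_fieldAt v
    ((isCompact_Icc.image_of_continuousOn hxc).union (isCompact_Icc.image_of_continuousOn hyc)) (by
      rintro (⟨s, hs, h0⟩ | ⟨s, hs, h0⟩)
      · exact (hx s hs).1 h0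
      · exact (hy s hs).1 h0)
  have h1 := ODE_solution_unique_of_mem_Icc_right (v := fun _ => fieldAt v) (K := L)
    (s := fun _ => x '' Icc 0 t ∪ y '' Icc 0 t) (fun _ _ => hL) hxc
    (fun s hs => (hx s (Ico_subset_Icc_self hs)).2.mono_of_mem_nhdsWithin (Icc_mem_nhdsGE_of_mem hs))
    (fun s hs => Or.inl ⟨s, Ico_subset_Icc_self hs, rfl⟩) hyc
    (fun s hs => (hy s (Ico_subset_Icc_self hs)).2.mono_of_mem_nhdsWithin (Icc_mem_nhdsGE_of_mem hs))
    (fun s hs => Or.inr ⟨s, Ico_subset_Icc_self hs, rfl⟩) (hx0.trans hy0.symm)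
  rw [← hxt, ← hyt]
  exact h1 (right_mem_Icc.2 ht)

theorem FlowsTo.unique {t : ℝ} {z w w' : ℂ} (h : FlowsTo v t z w) (h' : FlowsTo v t z w') :
    w = w' := by
  rcases le_total 0 t with ht | ht
  · exact h.unique_of_nonneg ht h'
  · exact h.neg.unique_of_nonneg (by linarith) h'.neg

theorem FlowsTo.symm {t : ℝ} {z w : ℂ} (h : FlowsTo v t z w) : FlowsTo v (-t) w z := by
  obtain ⟨x, hx0, hxt, hx⟩ := h
  refine ⟨fun s => x (t + s), by simpa using hxt, by simpa using hx0, fun s hs => ?_⟩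
  have hmap : MapsTo (fun s => t + s) (uIcc 0 (-t)) (uIcc 0 t) := by
    intro r hr
    rw [mem_uIcc] at hr ⊢
    rcases hr with h | h
    · right; constructor <;> linarith [h.1, h.2]
    · left; constructor <;> linarith [h.1, h.2]
  refine ⟨(hx _ (hmap hs)).1, ?_⟩
  have h2 : HasDerivWithinAt (fun s : ℝ => t + s) 1 (uIcc 0 (-t)) s :=
    ((hasDerivAt_id s).const_add t).hasDerivWithinAt
  have h1 := HasDerivWithinAt.scomp s (hx _ (hmap hs)).2 h2 hmap
  have h3 : HasDerivWithinAt (fun s => x (t + s)) ((1 : ℝ) • fieldAt v (x (t + s))) (uIcc 0 (-t)) s :=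
    h1
  simpa using h3

/-- Segments of an integral curve. -/
theorem flowsTo_of_integralCurve {x : ℝ → ℂ} {ε s t : ℝ}
    (hx : ∀ τ, |τ| < ε → x τ ≠ 0 ∧ HasDerivAt x (fieldAt v (x τ)) τ) (hs : |s| < ε)
    (ht : |s + t| < ε) : FlowsTo v t (x s) (x (s + t)) := by
  refine ⟨fun τ => x (s + τ), by simp, rfl, fun τ hτ => ?_⟩
  have h1 : |s + τ| < ε := by
    rw [abs_lt] at hs ht ⊢
    rw [mem_uIcc] at hτ
    rcases hτ with h | h
    · constructor <;> linarith [h.1, h.2]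
    · constructor <;> linarith [h.1, h.2]
  refine ⟨(hx _ h1).1, ?_⟩
  have h2 := (hx _ h1).2.scomp τ ((hasDerivAt_id τ).const_add s)
  have h3 : HasDerivAt (fun τ => x (s + τ)) (fieldAt v (x (s + τ))) τ := by simpa using! h2
  exact h3.hasDerivWithinAt

/-- The time `t` flow of `v`. -/
noncomputable def flowMap (v : ℂ[T;T⁻¹]) (t : ℝ) (z : ℂ) : ℂ := Classical.epsilon (FlowsTo v t z)

theorem FlowsTo.flowMap_eq {t : ℝ} {z w : ℂ} (h : FlowsTo v t z w) : flowMap v t z = w :=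
  (Classical.epsilon_spec ⟨w, h⟩ : FlowsTo v t z (flowMap v t z)).unique h

/-- Picard–Lindelöf: at speed at most `M`, a curve needs time at least `a / M` to leave the ball of
radius `a`. The fixed point lives on the closed time interval, so two-sided derivatives are
available on the open one. -/
theorem exists_integralCurve {a : ℝ} {M : NNReal} {z : ℂ} (ha : 0 < a) (hM : 0 < M)
    (hL : LipschitzOnWith M (fieldAt v) (Metric.closedBall z a))
    (hB : ∀ w ∈ Metric.closedBall z a, ‖fieldAt v w‖ ≤ M) :
    ∃ x : ℝ → ℂ, x 0 = z ∧ ∀ t, |t| < a / M → x t ∈ Metric.closedBall z a ∧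
      HasDerivAt x (fieldAt v (x t)) t := by
  lift a to NNReal using ha.le
  have hM' : (0 : ℝ) < M := by exact_mod_cast hM
  have hT : 0 < a / (M : ℝ) := by positivity
  have h0 : (0 : ℝ) ∈ Icc (-(a / M : ℝ)) (a / M : ℝ) := ⟨by linarith, hT.le⟩
  have hpl : IsPicardLindelof (fun _ => fieldAt v) (⟨0, h0⟩ : Icc (-(a / M : ℝ)) (a / M : ℝ)) z
      a 0 M M := by
    refine ⟨fun _ _ => hL, fun _ _ => continuousOn_const, fun _ _ w hw => hB w hw, ?_⟩
    simp only [sub_zero, zero_sub, neg_neg, max_self, NNReal.coe_zero]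
    rw [mul_div_cancel₀ _ hM'.ne']
  obtain ⟨α, hα⟩ := ODE.FunSpace.exists_isFixedPt_next hpl
    (Metric.mem_closedBall_self (NNReal.coe_nonneg 0))
  refine ⟨α.compProj, ?_, fun t ht => ?_⟩
  · have h1 : α.compProj 0 = α ⟨0, h0⟩ := ODE.FunSpace.compProj_of_mem h0
    rw [h1, ← hα, ODE.FunSpace.next_apply₀]
  · have hmem : ∀ s, α.compProj s ∈ Metric.closedBall z a := fun s =>
      α.compProj_mem_closedBall hpl.mul_max_le
    refine ⟨hmem t, ?_⟩
    rw [abs_lt] at ht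
    have hd := ODE.hasDerivWithinAt_picard_Icc (⟨0, h0⟩ : Icc (-(a / M : ℝ)) (a / M : ℝ)).2
      hpl.continuousOn_uncurry α.continuous_compProj.continuousOn (fun _ _ => hmem _) z
      (Ioo_subset_Icc_self ht)
    have hd' : HasDerivWithinAt α.compProj (fieldAt v (α.compProj t)) (Icc (-(a / M : ℝ)) (a / M : ℝ)) t := by
      refine hd.congr_of_mem ?_ (Ioo_subset_Icc_self ht)
      intro t' ht'
      nth_rw 1 [← hα]
      rw [ODE.FunSpace.compProj_of_mem ht', ODE.FunSpace.next_apply]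
    exact hd'.hasDerivAt (Icc_mem_nhds ht.1 ht.2)

/-- The flow of `v` exists on a closed annulus for a uniform time. -/
theorem exists_flow (v : ℂ[T;T⁻¹]) {a : ℝ} (b : ℝ) (ha : 0 < a) :
    ∃ ε > 0, ∃ M : NNReal, 0 < M ∧
      LipschitzOnWith M (fieldAt v) (closedAnnulus (a / 2) (b + a / 2)) ∧
      (∀ z ∈ closedAnnulus (a / 2) (b + a / 2), ‖fieldAt v z‖ ≤ M) ∧ ∀ z ∈ closedAnnulus a b,
      flowMap v 0 z = z ∧
      (∀ t, |t| < ε → HasDerivAt (fun s => flowMap v s z) (fieldAt v (flowMap v t z)) t ∧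
        flowMap v t z ∈ closedAnnulus (a / 2) (b + a / 2) ∧ ‖flowMap v t z - z‖ ≤ M * |t|) ∧
      ∀ s t, |s| < ε → |s + t| < ε → FlowsTo v t (flowMap v s z) (flowMap v (s + t) z) := by
  obtain ⟨M, hM, hL, hB⟩ := exists_fieldAt_bounds v (b := b + a / 2) (half_pos ha)
  have hM' : (0 : ℝ) < M := by exact_mod_cast hM
  refine ⟨a / 2 / M, by positivity, M, hM, hL, hB, fun z hz => ?_⟩
  have hsub : Metric.closedBall z (a / 2) ⊆ closedAnnulus (a / 2) (b + a / 2) := by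
    intro w hw
    rw [mem_closedBall_iff_norm] at hw
    have h1 := norm_sub_norm_le z w
    have h2 := norm_sub_norm_le w z
    rw [norm_sub_rev] at h1
    exact ⟨by linarith [hz.1], by linarith [hz.2]⟩
  obtain ⟨x, hx0, hx⟩ := exists_integralCurve (half_pos ha) hM (hL.mono hsub)
    fun w hw => hB w (hsub hw)
  have hxne : ∀ τ, |τ| < a / 2 / M → x τ ≠ 0 ∧ HasDerivAt x (fieldAt v (x τ)) τ := by
    refine fun τ hτ => ⟨fun h0 => ?_, (hx τ hτ).2⟩
    have := hsub (hx τ hτ).1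
    rw [h0] at this
    exact zero_notMem_closedAnnulus (half_pos ha) this
  have h00 : |(0 : ℝ)| < a / 2 / M := by
    rw [abs_zero]; positivity
  have hflow : ∀ τ, |τ| < a / 2 / M → flowMap v τ z = x τ := by
    intro τ hτ
    have h1 := flowsTo_of_integralCurve (v := v) hxne (s := 0) (t := τ) h00 (by simpa using hτ)
    rw [hx0, zero_add] at h1
    exact h1.flowMap_eq
  refine ⟨by rw [hflow 0 h00, hx0], fun t ht => ?_, fun s t hs hst => ?_⟩
  · have h1 : HasDerivAt (fun s => flowMap v s z) (fieldAt v (flowMap v t z)) t := by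
      rw [hflow t ht]
      refine (hx t ht).2.congr_of_eventuallyEq ?_
      filter_upwards [(isOpen_lt continuous_abs continuous_const).mem_nhds ht] with s hs
      exact hflow s hs
    refine ⟨h1, by rw [hflow t ht]; exact hsub (hx t ht).1, ?_⟩
    rw [hflow t ht]
    have h2 : ∀ τ ∈ Metric.ball (0 : ℝ) (a / 2 / M), |τ| < a / 2 / M := fun τ hτ => by
      simpa using hτ
    have h3 := (convex_ball (0 : ℝ) (a / 2 / M)).norm_image_sub_le_of_norm_hasDerivWithin_le
      (f := x) (f' := fun τ => fieldAt v (x τ)) (C := M)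
      (fun τ hτ => (hx τ (h2 τ hτ)).2.hasDerivWithinAt) (fun τ hτ => hB _ (hsub (hx τ (h2 τ hτ)).1))
      (Metric.mem_ball_self (by positivity)) (show t ∈ _ by simpa using ht)
    simpa [hx0] using h3
  · rw [hflow s hs, hflow _ hst]
    exact flowsTo_of_integralCurve hxne hs hst

/-- The closed annulus `a ≤ |z| ≤ b` is moved by the flow of `v` during the times `|t| < ε`. -/
structure IsFlowBox (v : ℂ[T;T⁻¹]) (a b ε : ℝ) (M : NNReal) : Prop where
  pos : 0 < a
  time_pos : 0 < ε
  bound_pos : 0 < M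
  lipschitzOnWith : LipschitzOnWith M (fieldAt v) (closedAnnulus (a / 2) (b + a / 2))
  norm_le : ∀ z ∈ closedAnnulus (a / 2) (b + a / 2), ‖fieldAt v z‖ ≤ M
  flowMap_zero : ∀ z ∈ closedAnnulus a b, flowMap v 0 z = z
  hasDerivAt : ∀ z ∈ closedAnnulus a b, ∀ t, |t| < ε →
    HasDerivAt (fun s => flowMap v s z) (fieldAt v (flowMap v t z)) t
  mem : ∀ z ∈ closedAnnulus a b, ∀ t, |t| < ε → flowMap v t z ∈ closedAnnulus (a / 2) (b + a / 2)
  norm_sub_le : ∀ z ∈ closedAnnulus a b, ∀ t, |t| < ε → ‖flowMap v t z - z‖ ≤ M * |t|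
  flowsTo : ∀ z ∈ closedAnnulus a b, ∀ s t, |s| < ε → |s + t| < ε →
    FlowsTo v t (flowMap v s z) (flowMap v (s + t) z)

theorem exists_isFlowBox (v : ℂ[T;T⁻¹]) {a : ℝ} (b : ℝ) (ha : 0 < a) :
    ∃ ε M, IsFlowBox v a b ε M := by
  obtain ⟨ε, hε, M, hM, hL, hB, h⟩ := exists_flow v b ha
  exact ⟨ε, M, ha, hε, hM, hL, hB, fun z hz => (h z hz).1, fun z hz t ht => ((h z hz).2.1 t ht).1,
    fun z hz t ht => ((h z hz).2.1 t ht).2.1, fun z hz t ht => ((h z hz).2.1 t ht).2.2,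
    fun z hz => (h z hz).2.2⟩

namespace IsFlowBox

variable {a b ε : ℝ} {M : NNReal} (h : IsFlowBox v a b ε M)

include h

theorem flowsTo_flowMap {z : ℂ} (hz : z ∈ closedAnnulus a b) {t : ℝ} (ht : |t| < ε) :
    FlowsTo v t z (flowMap v t z) := by
  have h1 := h.flowsTo z hz 0 t (by simpa using h.time_pos) (by simpa using ht)
  rwa [h.flowMap_zero z hz, zero_add] at h1

theorem flowMap_neg_flowMap {z : ℂ} (hz : z ∈ closedAnnulus a b) {t : ℝ} (ht : |t| < ε) :
    flowMap v (-t) (flowMap v t z) = z :=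
  (h.flowsTo_flowMap hz ht).symm.flowMap_eq

theorem injOn {t : ℝ} (ht : |t| < ε) : InjOn (flowMap v t) (closedAnnulus a b) := by
  intro z hz w hw hzw
  rw [← h.flowMap_neg_flowMap hz ht, hzw, h.flowMap_neg_flowMap hw ht]

theorem flowImage_eq {K : Set ℂ} (hK : K ⊆ closedAnnulus a b) {t : ℝ} (ht : |t| < ε) :
    flowImage v t K = flowMap v t '' K := by
  ext w
  constructor
  · rintro ⟨z, hz, hw⟩
    exact ⟨z, hz, hw.flowMap_eq⟩
  · rintro ⟨z, hz, rfl⟩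
    exact ⟨z, hz, h.flowsTo_flowMap (hK hz) ht⟩

theorem flowImage_zero {K : Set ℂ} (hK : K ⊆ closedAnnulus a b) : flowImage v 0 K = K := by
  rw [h.flowImage_eq hK (by simpa using h.time_pos)]
  exact (image_congr fun z hz => h.flowMap_zero z (hK hz)).trans (image_id' _)

theorem flowImage_add {K : Set ℂ} (hK : K ⊆ closedAnnulus a b) {s t : ℝ} (hs : |s| < ε)
    (hst : |s + t| < ε) : flowImage v t (flowImage v s K) = flowImage v (s + t) K := by
  ext w
  constructor
  · rintro ⟨y, ⟨z, hz, hy⟩, hw⟩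
    have h1 := hy.unique (h.flowsTo_flowMap (hK hz) hs)
    subst h1
    have h2 := hw.unique (h.flowsTo z (hK hz) s t hs hst)
    subst h2
    exact ⟨z, hz, h.flowsTo_flowMap (hK hz) hst⟩
  · rintro ⟨z, hz, hw⟩
    have h1 := hw.unique (h.flowsTo_flowMap (hK hz) hst)
    subst h1
    exact ⟨flowMap v s z, ⟨z, hz, h.flowsTo_flowMap (hK hz) hs⟩, h.flowsTo z (hK hz) s t hs hst⟩

/-- The difference of two orbits, by variation of constants. -/
theorem flowMap_sub_eq {z w : ℂ} (hz : z ∈ closedAnnulus a b) (hw : w ∈ closedAnnulus a b)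
    (hne : w ≠ z) {t : ℝ} (ht : |t| < ε) :
    flowMap v t w - flowMap v t z = (w - z) * Complex.exp (∫ s in (0 : ℝ)..t,
      (fieldAt v (flowMap v s w) - fieldAt v (flowMap v s z)) / (flowMap v s w - flowMap v s z)) := by
  set g : ℝ → ℂ := fun s =>
    (fieldAt v (flowMap v s w) - fieldAt v (flowMap v s z)) / (flowMap v s w - flowMap v s z)
  have hsub : ∀ s, |s| < ε → flowMap v s w - flowMap v s z ≠ 0 := fun s hs h0 =>
    hne (h.injOn hs hw hz (sub_eq_zero.1 h0))
  have hcont : ∀ s, |s| < ε → ContinuousAt g s := fun s hs => by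
    have h1 : ∀ y ∈ closedAnnulus a b,
        ContinuousAt (fun r => fieldAt v (flowMap v r y)) s := fun y hy => by
      have h2 : flowMap v s y ≠ 0 := fun h0 => zero_notMem_closedAnnulus (half_pos h.pos)
        (h0 ▸ h.mem y hy s hs)
      exact ContinuousAt.comp' (f := fun r => flowMap v r y)
        (differentiableAt_fieldAt v h2).continuousAt (h.hasDerivAt y hy s hs).continuousAt
    exact ((h1 w hw).sub (h1 z hz)).div ((h.hasDerivAt w hw s hs).continuousAt.sub
      (h.hasDerivAt z hz s hs).continuousAt) (hsub s hs)
  have hball : ∀ s, s ∈ Metric.ball (0 : ℝ) ε ↔ |s| < ε := fun s => by simp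
  have hint : ∀ s, |s| < ε → HasDerivAt (fun r => ∫ τ in (0 : ℝ)..r, g τ) (g s) s := fun s hs => by
    refine intervalIntegral.integral_hasDerivAt_right ?_ ?_ (hcont s hs)
    · refine ContinuousOn.intervalIntegrable fun r hr => (hcont r ?_).continuousWithinAt
      exact (by simpa using abs_sub_left_of_mem_uIcc hr : |r| ≤ |s|).trans_lt hs
    · refine ContinuousOn.stronglyMeasurableAtFilter Metric.isOpen_ball (s := Metric.ball 0 ε)
        (fun r hr => (hcont r ((hball r).1 hr)).continuousWithinAt) s ((hball s).2 hs)
  set E : ℝ → ℂ := fun r => Complex.exp (∫ τ in (0 : ℝ)..r, g τ)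
  have hE : ∀ s, |s| < ε → HasDerivAt E (E s * g s) s := fun s hs => (hint s hs).cexp
  have hE0 : ∀ s, E s ≠ 0 := fun s => Complex.exp_ne_zero _
  -- The difference of two orbits solves the linear equation `d' = g d`, where `g` is the divided
  -- difference of the field, so its quotient by `exp ∫ g` is constant.
  have hq : ∀ s, |s| < ε →
      HasDerivAt (fun r => (flowMap v r w - flowMap v r z) / E r) 0 s := fun s hs => by
    have h1 := ((h.hasDerivAt w hw s hs).sub (h.hasDerivAt z hz s hs)).div (hE s hs) (hE0 s)
    refine h1.congr_deriv ?_
    have h2 : (flowMap v s w - flowMap v s z) * g s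
        = fieldAt v (flowMap v s w) - fieldAt v (flowMap v s z) := mul_div_cancel₀ _ (hsub s hs)
    have h3 := hE0 s
    simp only [Pi.sub_apply]
    field_simp
    linear_combination - h2
  have hconst := (convex_ball (0 : ℝ) ε).is_const_of_fderivWithin_eq_zero (𝕜 := ℝ)
    (f := fun r => (flowMap v r w - flowMap v r z) / E r)
    (fun s hs => (hq s ((hball s).1 hs)).differentiableAt.differentiableWithinAt)
    (fun s hs => by
      rw [fderivWithin_of_isOpen Metric.isOpen_ball hs, (hq s ((hball s).1 hs)).hasFDerivAt.fderiv]
      simp)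
    ((hball t).2 ht) (Metric.mem_ball_self h.time_pos)
  simp only [h.flowMap_zero z hz, h.flowMap_zero w hw] at hconst
  have h4 : E 0 = 1 := by simp [E]
  rw [h4, div_one, div_eq_iff (hE0 t)] at hconst
  exact hconst

theorem norm_divided_difference_le {z w : ℂ} (hz : z ∈ closedAnnulus a b)
    (hw : w ∈ closedAnnulus a b) {s : ℝ} (hs : |s| < ε) :
    ‖(fieldAt v (flowMap v s w) - fieldAt v (flowMap v s z)) /
      (flowMap v s w - flowMap v s z)‖ ≤ M := by
  rw [norm_div]
  refine div_le_of_le_mul₀ (norm_nonneg _) M.2 ?_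
  have := h.lipschitzOnWith.dist_le_mul _ (h.mem w hw s hs) _ (h.mem z hz s hs)
  rwa [dist_eq_norm, dist_eq_norm] at this

theorem norm_flowMap_sub_le {z w : ℂ} (hz : z ∈ closedAnnulus a b) (hw : w ∈ closedAnnulus a b)
    {t : ℝ} (ht : |t| < ε) :
    ‖flowMap v t w - flowMap v t z‖ ≤ Real.exp (M * |t|) * ‖w - z‖ := by
  rcases eq_or_ne w z with rfl | hne
  · simp
  rw [h.flowMap_sub_eq hz hw hne ht, norm_mul, mul_comm, Complex.norm_exp]
  gcongr
  refine (Complex.re_le_norm _).trans ?_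
  refine (intervalIntegral.norm_integral_le_of_norm_le_const (C := M) fun s hs => ?_).trans_eq
    (by simp)
  refine h.norm_divided_difference_le hz hw (lt_of_le_of_lt ?_ ht)
  simpa using abs_sub_left_of_mem_uIcc (uIoc_subset_uIcc hs)

/-- The flow is holomorphic. -/
theorem differentiableAt_flowMap {z : ℂ} (hz : closedAnnulus a b ∈ 𝓝 z) {t : ℝ} (ht : |t| < ε) :
    DifferentiableAt ℂ (flowMap v t) z := by
  have hzA : z ∈ closedAnnulus a b := mem_of_mem_nhds hz
  have habs : ∀ s ∈ uIoc 0 t, |s| < ε := fun s hs => lt_of_le_of_lt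
    (by simpa using abs_sub_left_of_mem_uIcc (uIoc_subset_uIcc hs)) ht
  have hev : ∀ᶠ w in 𝓝[≠] z, w ∈ closedAnnulus a b ∧ w ≠ z :=
    (eventually_nhdsWithin_of_eventually_nhds hz).and eventually_mem_nhdsWithin
  have hlim : ∀ s, |s| < ε → Tendsto (fun w => flowMap v s w) (𝓝[≠] z) (𝓝 (flowMap v s z)) := by
    intro s hs
    rw [tendsto_iff_norm_sub_tendsto_zero]
    refine squeeze_zero' (Eventually.of_forall fun w => norm_nonneg _)
      (hev.mono fun w hw => h.norm_flowMap_sub_le hzA hw.1 hs) ?_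
    have : Tendsto (fun w : ℂ => Real.exp (M * |s|) * ‖w - z‖) (𝓝 z)
        (𝓝 (Real.exp (M * |s|) * ‖z - z‖)) := by
      apply Continuous.tendsto; fun_prop
    rw [sub_self, norm_zero, mul_zero] at this
    exact this.mono_left nhdsWithin_le_nhds
  -- The slope of the flow map is the exponential of this integral. The divided differences are
  -- bounded by the Lipschitz constant and converge to the derivative of the field along the orbit.
  have hint : Tendsto (fun w => ∫ s in (0 : ℝ)..t,
      (fieldAt v (flowMap v s w) - fieldAt v (flowMap v s z)) / (flowMap v s w - flowMap v s z))
      (𝓝[≠] z) (𝓝 (∫ s in (0 : ℝ)..t, deriv (fieldAt v) (flowMap v s z))) := by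
    refine intervalIntegral.tendsto_integral_filter_of_dominated_convergence (fun _ => (M : ℝ))
      ?_ ?_ intervalIntegrable_const ?_
    · filter_upwards [hev] with w hw
      refine ContinuousOn.aestronglyMeasurable (fun s hs => ?_) measurableSet_uIoc
      have hs' := habs s hs
      have h1 : ∀ y ∈ closedAnnulus a b,
          ContinuousAt (fun r => fieldAt v (flowMap v r y)) s := fun y hy => by
        have h2 : flowMap v s y ≠ 0 := fun h0 => zero_notMem_closedAnnulus (half_pos h.pos)
          (h0 ▸ h.mem y hy s hs')
        exact ContinuousAt.comp' (f := fun r => flowMap v r y)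
          (differentiableAt_fieldAt v h2).continuousAt (h.hasDerivAt y hy s hs').continuousAt
      exact (((h1 w hw.1).sub (h1 z hzA)).div ((h.hasDerivAt w hw.1 s hs').continuousAt.sub
        (h.hasDerivAt z hzA s hs').continuousAt) (fun h0 => hw.2
          (h.injOn hs' hw.1 hzA (sub_eq_zero.1 h0)))).continuousWithinAt
    · filter_upwards [hev] with w hw
      exact Eventually.of_forall fun s hs => h.norm_divided_difference_le hzA hw.1 (habs s hs)
    · refine Eventually.of_forall fun s hs => ?_
      have hs' := habs s hs
      have h0 : flowMap v s z ≠ 0 := fun h0 => zero_notMem_closedAnnulus (half_pos h.pos)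
        (h0 ▸ h.mem z hzA s hs')
      have h1 := hasDerivAt_iff_tendsto_slope.1 (differentiableAt_fieldAt v h0).hasDerivAt
      have h2 : Tendsto (fun w => flowMap v s w) (𝓝[≠] z) (𝓝[≠] (flowMap v s z)) :=
        tendsto_nhdsWithin_iff.2 ⟨hlim s hs', hev.mono fun w hw h0 =>
          hw.2 (h.injOn hs' hw.1 hzA h0)⟩
      refine (h1.comp h2).congr fun w => ?_
      simp [slope_def_field]
  refine HasDerivAt.differentiableAt (hasDerivAt_iff_tendsto_slope.2
    ((Complex.continuous_exp.tendsto _).comp hint |>.congr' ?_))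
  filter_upwards [hev] with w hw
  rw [slope_def_field, h.flowMap_sub_eq hzA hw.1 hw.2 ht,
    mul_div_cancel_left₀ _ (sub_ne_zero.2 hw.2)]
  rfl

/-- The flow is `z + t v(z) + O(t²)`, uniformly. -/
theorem norm_flowMap_sub_sub_le {z : ℂ} (hz : z ∈ closedAnnulus a b) {t : ℝ} (ht : |t| < ε) :
    ‖flowMap v t z - z - t * fieldAt v z‖ ≤ M * M * t ^ 2 := by
  have hzm : z ∈ closedAnnulus (a / 2) (b + a / 2) := by
    have := h.pos
    exact ⟨by linarith [hz.1], by linarith [hz.2]⟩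
  have hsub : ∀ τ ∈ Metric.closedBall (0 : ℝ) |t|, |τ| ≤ |t| := fun τ hτ => by simpa using hτ
  have h3 := (convex_closedBall (0 : ℝ) |t|).norm_image_sub_le_of_norm_hasDerivWithin_le
    (f := fun s => flowMap v s z - z - s * fieldAt v z)
    (f' := fun τ => fieldAt v (flowMap v τ z) - fieldAt v z) (C := M * (M * |t|))
    (fun τ hτ => by
      have h4 := h.hasDerivAt z hz τ ((hsub τ hτ).trans_lt ht)
      have h5 : HasDerivAt (fun s : ℝ => (s : ℂ) * fieldAt v z) (fieldAt v z) τ := by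
        simpa using (Complex.ofRealCLM.hasDerivAt (x := τ)).mul_const (fieldAt v z)
      exact ((h4.sub_const z).sub h5).hasDerivWithinAt)
    (fun τ hτ => by
      have h4 := (hsub τ hτ).trans_lt ht
      have h5 := h.lipschitzOnWith.dist_le_mul _ (h.mem z hz τ h4) _ hzm
      rw [dist_eq_norm, dist_eq_norm] at h5
      refine h5.trans ?_
      gcongr
      refine (h.norm_sub_le z hz τ h4).trans ?_
      exact mul_le_mul_of_nonneg_left (hsub τ hτ) M.2)
    (Metric.mem_closedBall_self (abs_nonneg t)) (show t ∈ _ by simp)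
  simp only [h.flowMap_zero z hz] at h3
  simp only [sub_self, Complex.ofReal_zero, zero_mul, sub_zero, Real.norm_eq_abs] at h3
  refine h3.trans_eq ?_
  rw [← sq_abs]
  ring

end IsFlowBox

end Flow

/-! ## Holomorphic functions on the unit disc -/

theorem exists_log_ball {f : ℂ → ℂ} (hf : DifferentiableOn ℂ f (Metric.ball 0 1))
    (hne : ∀ z ∈ Metric.ball (0 : ℂ) 1, f z ≠ 0) :
    ∃ L : ℂ → ℂ, DifferentiableOn ℂ L (Metric.ball 0 1) ∧
      ∀ z ∈ Metric.ball (0 : ℂ) 1, Complex.exp (L z) = f z := by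
  obtain ⟨g, hg⟩ := ((hf.deriv Metric.isOpen_ball).div hf hne).isExactOn_ball
  exact exists_log_of_primitive Metric.isOpen_ball (convex_ball _ _).isPreconnected hf hne hg

theorem norm_le_of_norm_le_sphere {f : ℂ → ℂ} {r C : ℝ} (hr : 0 < r)
    (hf : DifferentiableOn ℂ f (Metric.closedBall 0 r)) (hC : ∀ z, ‖z‖ = r → ‖f z‖ ≤ C) {z : ℂ}
    (hz : ‖z‖ ≤ r) : ‖f z‖ ≤ C := by
  rw [← closure_ball (0 : ℂ) hr.ne'] at hf
  refine Complex.norm_le_of_forall_mem_frontier_norm_le (U := Metric.ball 0 r) Metric.isBounded_ball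
    hf.diffContOnCl (fun w hw => hC w ?_) ?_
  · rw [frontier_ball _ hr.ne'] at hw
    simpa using hw
  · rw [closure_ball _ hr.ne']
    simpa using hz

/-- A bound near the boundary of the disc, up to arbitrarily small errors, holds inside. -/
theorem norm_le_of_boundary {f : ℂ → ℂ} {C : ℝ} (hf : DifferentiableOn ℂ f (Metric.ball 0 1))
    (hC : ∀ C' > C, ∃ r < 1, ∀ z, r < ‖z‖ → ‖z‖ < 1 → ‖f z‖ ≤ C') {z : ℂ}
    (hz : z ∈ Metric.ball (0 : ℂ) 1) : ‖f z‖ ≤ C := by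
  refine le_of_forall_gt_imp_ge_of_dense fun C' hC' => ?_
  obtain ⟨r, hr, h⟩ := hC C' hC'
  rw [mem_ball_zero_iff] at hz
  obtain ⟨s, hs, hs1⟩ := exists_between (max_lt hr hz)
  rw [max_lt_iff] at hs
  exact norm_le_of_norm_le_sphere ((norm_nonneg _).trans_lt hs.2)
    (hf.mono (Metric.closedBall_subset_ball hs1)) (fun w hw => h w (hw ▸ hs.1) (hw ▸ hs1)) hs.2.le

/-- A holomorphic function on the disc with a single simple zero at `0`, with modulus almost `1` at
the boundary and derivative almost positive at `0`, is close to the identity. -/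
theorem exists_eq_mul_exp_of_boundary {f : ℂ → ℂ} {η ρ : ℝ} {d : ℂ} (hη : 0 < η)
    (hf : DifferentiableOn ℂ f (Metric.ball 0 1)) (h0 : f 0 = 0)
    (hne : ∀ z ∈ Metric.ball (0 : ℂ) 1, z ≠ 0 → f z ≠ 0) (hρ : 0 < ρ) (hd : ‖d‖ ≤ η)
    (hderiv : deriv f 0 = ρ * Complex.exp d)
    (hbd : ∀ η' > η, ∃ r < 1, ∀ z, r < ‖z‖ → ‖z‖ < 1 →
      Real.exp (-η') ≤ ‖f z‖ ∧ ‖f z‖ ≤ Real.exp η') {z : ℂ} (hz : ‖z‖ ≤ 1 / 2) :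
    ∃ L, ‖L‖ ≤ 7 * η ∧ f z = z * Complex.exp L := by
  -- Dividing out the simple zero leaves a nonvanishing function, and `|f| → 1` and `|g| → 1` at the
  -- boundary are the same up to the tolerance.
  set g := dslope f 0 with hg
  have hgd : DifferentiableOn ℂ g (Metric.ball 0 1) :=
    (Complex.differentiableOn_dslope (Metric.ball_mem_nhds 0 one_pos)).2 hf
  have hg0 : g 0 = ρ * Complex.exp d := by rw [hg, dslope_same, hderiv]
  have hgz : ∀ w, w ≠ 0 → g w = f w / w := fun w hw => by
    rw [hg, dslope_of_ne _ hw, slope_def_field, h0]; simp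
  have hgne : ∀ w ∈ Metric.ball (0 : ℂ) 1, g w ≠ 0 := fun w hw => by
    rcases eq_or_ne w 0 with rfl | hw0
    · rw [hg0]
      exact mul_ne_zero (by exact_mod_cast hρ.ne') (Complex.exp_ne_zero _)
    · rw [hgz w hw0]
      exact div_ne_zero (hne w hw hw0) hw0
  obtain ⟨L, hL, hLg⟩ := exists_log_ball hgd hgne
  -- The maximum principle for both `g` and `1 / g` turns the two-sided boundary bound into a bound
  -- on the real part of the logarithm.
  have hre : ∀ w ∈ Metric.ball (0 : ℂ) 1, |(L w).re| ≤ η := by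
    have key : ∀ C' > Real.exp η, ∃ r < 1, ∀ w : ℂ, r < ‖w‖ → ‖w‖ < 1 →
        ‖g w‖ ≤ C' ∧ ‖(g w)⁻¹‖ ≤ C' := by
      intro C' hC'
      have hC0 : 0 < C' := (Real.exp_pos _).trans hC'
      obtain ⟨η', h1, h2⟩ := exists_between ((Real.lt_log_iff_exp_lt hC0).2 hC')
      obtain ⟨r, hr, h⟩ := hbd η' h1
      have h3 : Real.exp η' < C' := by rwa [← Real.lt_log_iff_exp_lt hC0]
      refine ⟨max r (Real.exp η' / C'), max_lt hr ((div_lt_one hC0).2 h3), fun w hw hw1 => ?_⟩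
      rw [max_lt_iff] at hw
      have hw0 : 0 < ‖w‖ := (div_pos (Real.exp_pos _) hC0).trans hw.2
      obtain ⟨h4, h5⟩ := h w hw.1 hw1
      rw [hgz w (norm_pos_iff.1 hw0), norm_inv, norm_div, inv_div]
      have h6 : 0 < ‖f w‖ := (Real.exp_pos _).trans_le h4
      constructor
      · rw [div_le_iff₀ hw0]
        rw [div_lt_iff₀ hC0] at hw
        linarith
      · rw [div_le_iff₀ h6]
        rw [Real.exp_neg, inv_le_iff_one_le_mul₀' (Real.exp_pos _)] at h4
        nlinarith
    intro w hw
    have h1 := norm_le_of_boundary hgd (fun C' hC' => by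
      obtain ⟨r, hr, h⟩ := key C' hC'
      exact ⟨r, hr, fun z h1 h2 => (h z h1 h2).1⟩) hw
    have h2 := norm_le_of_boundary (hgd.inv hgne) (fun C' hC' => by
      obtain ⟨r, hr, h⟩ := key C' hC'
      exact ⟨r, hr, fun z h1 h2 => (h z h1 h2).2⟩) hw
    rw [← hLg w hw, Complex.norm_exp, Real.exp_le_exp] at h1
    rw [Pi.inv_apply, ← hLg w hw, ← Complex.exp_neg, Complex.norm_exp, Real.exp_le_exp, Complex.neg_re] at h2
    exact abs_le.2 ⟨by linarith, h1⟩
  have h01 : (0 : ℂ) ∈ Metric.ball (0 : ℂ) 1 := Metric.mem_ball_self one_pos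
  have hz1 : z ∈ Metric.ball (0 : ℂ) 1 := by rw [mem_ball_zero_iff]; linarith
  -- Borel–Carathéodory with real part at most `2 η`; for `|z| ≤ 1/2` it yields `4 η`.
  have hbc : ‖L z - L 0‖ ≤ 2 * (2 * η) * ‖z‖ / (1 - ‖z‖) := by
    refine Complex.borelCaratheodory_zero (f := fun w => L w - L 0) (by linarith)
      (hL.sub_const _) (fun w hw => ?_) one_pos hz1 (sub_self _)
    have h1 := abs_le.1 (hre w hw)
    have h2 := abs_le.1 (hre 0 h01)
    simp only [mem_ofPred_eq, Complex.sub_re]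
    linarith [h1.2, h2.1]
  have hbc' : ‖L z - L 0‖ ≤ 4 * η := by
    refine hbc.trans ?_
    rw [div_le_iff₀ (by linarith)]
    nlinarith
  -- The imaginary part of `L 0` is known only modulo `2π`, so `L 0` is replaced by the exponent
  -- `(Re L 0 - Re d) + d`, which has the same exponential because `ρ > 0`. Its size is at most `3
  -- η`, which with `4 η` makes the `7 η`.
  have hρe : (ρ : ℂ) = Complex.exp (((L 0).re - d.re : ℝ) : ℂ) := by
    have h1 := congrArg norm ((hLg 0 h01).trans hg0)
    rw [norm_mul, Complex.norm_exp, Complex.norm_exp, Complex.norm_real, Real.norm_of_nonneg hρ.le] at h1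
    rw [← Complex.ofReal_exp, Real.exp_sub, h1, mul_div_cancel_right₀ _ (Real.exp_pos _).ne']
  refine ⟨L z - L 0 + ((((L 0).re - d.re : ℝ) : ℂ) + d), ?_, ?_⟩
  · refine (norm_add_le _ _).trans ?_
    have h1 := norm_add_le ((((L 0).re - d.re : ℝ) : ℂ)) d
    have h2 : ‖(((L 0).re - d.re : ℝ) : ℂ)‖ ≤ η + η := by
      rw [Complex.norm_real]
      refine (norm_sub_le _ _).trans (add_le_add (hre 0 h01) ?_)
      exact (Complex.abs_re_le_norm d).trans hd
    linarith
  · have h1 : Complex.exp (L z - L 0 + ((((L 0).re - d.re : ℝ) : ℂ) + d)) = g z := by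
      rw [Complex.exp_add, Complex.exp_add, ← hρe, Complex.exp_sub, hLg z hz1, hLg 0 h01, hg0]
      have := Complex.exp_ne_zero d
      have : (ρ : ℂ) ≠ 0 := by exact_mod_cast hρ.ne'
      field_simp
    rw [h1]
    rcases eq_or_ne z 0 with rfl | hz0
    · rw [h0, zero_mul]
    · rw [hgz z hz0, mul_div_cancel₀ _ hz0]

/-- Splitting of a meromorphic vector field of the disc with a pole at `0` into one tangent to the
circle and one holomorphic in the disc. -/
theorem exists_tangent_add_holomorphic (N : ℕ) {r : ℝ} (hr : 0 < r) (hr1 : r < 1) : ∃ C, 0 ≤ C ∧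
    ∀ (A : ℂ → ℂ) (B : ℝ), DifferentiableOn ℂ A (Metric.ball 0 1) → (∀ z, ‖z‖ ≤ r → ‖A z‖ ≤ B) →
      ∃ x Y : ℂ → ℂ, DifferentiableOn ℂ x {0}ᶜ ∧ (∀ z, ‖z‖ = 1 → (x z).re = 0) ∧
        DifferentiableOn ℂ Y (Metric.ball 0 1) ∧ (Y 0).im = 0 ∧ (∀ z, ‖z‖ ≤ r → ‖Y z‖ ≤ C * B) ∧
        ∀ z ∈ Metric.ball (0 : ℂ) 1, z ≠ 0 → Y z = x z - A z / z ^ N := by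
  induction N with
  | zero =>
    -- Without a pole, the imaginary constant `i Im A(0)` is enough: it makes `Y(0) = -Re A(0)`
    -- real.
    refine ⟨2, zero_le_two, fun A B hA hB => ⟨fun _ => ((A 0).im : ℂ) * Complex.I,
      fun z => ((A 0).im : ℂ) * Complex.I - A z, differentiableOn_const _, fun z _ => by simp,
      (hA.const_sub _), by simp, fun z hz => ?_, fun z _ _ => by simp⟩⟩
    refine (norm_sub_le _ _).trans ?_
    have h1 : ‖((A 0).im : ℂ) * Complex.I‖ ≤ B := by
      rw [norm_mul, Complex.norm_I, mul_one, Complex.norm_real]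
      exact (Complex.abs_im_le_norm _).trans (hB 0 (by simpa using hr.le))
    linarith [hB z hz]
  | succ N ih =>
    obtain ⟨C, hC0, hC⟩ := ih
    refine ⟨C * (2 / r) + 1, by positivity, fun A B hA hB => ?_⟩
    have hB0 : 0 ≤ B := (norm_nonneg _).trans (hB 0 (by simpa using hr.le))
    have hA1 : DifferentiableOn ℂ (dslope A 0) (Metric.ball 0 1) :=
      (Complex.differentiableOn_dslope (Metric.ball_mem_nhds 0 one_pos)).2 hA
    obtain ⟨x, Y, hx, hxr, hY, hY0, hYB, hYx⟩ := hC (dslope A 0) (2 / r * B) hA1 (by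
      intro z hz
      refine norm_le_of_norm_le_sphere hr (hA1.mono (Metric.closedBall_subset_ball hr1))
        (fun w hw => ?_) hz
      have hw0 : w ≠ 0 := fun h => by rw [h, norm_zero] at hw; exact hr.ne hw
      rw [dslope_of_ne _ hw0, slope_def_field, norm_div, sub_zero, hw, div_mul_eq_mul_div]
      gcongr
      refine (norm_sub_le _ _).trans ?_
      linarith [hB w hw.le, hB 0 (by simpa using hr.le)])
    -- The leading pole `A(0) / z ^ (N + 1)` is completed by `-conj(A(0)) z ^ (N + 1)`, its negative
    -- conjugate on the unit circle, so the sum is imaginary there; the added term is holomorphic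
    -- and goes into `Y`. The rest of `A` is `z` times `dslope A 0` and has one pole order less.
    refine ⟨fun z => x z + (A 0 * (z ^ (N + 1))⁻¹ - starRingEnd ℂ (A 0) * z ^ (N + 1)),
      fun z => Y z - starRingEnd ℂ (A 0) * z ^ (N + 1), ?_, ?_, ?_, ?_, ?_, ?_⟩
    · refine hx.add (DifferentiableOn.sub (DifferentiableOn.const_mul (DifferentiableOn.inv
        (by fun_prop) fun z hz => pow_ne_zero _ hz) _) (by fun_prop))
    · intro z hz
      have h1 : (z ^ (N + 1))⁻¹ = starRingEnd ℂ (z ^ (N + 1)) := by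
        rw [Complex.inv_def, Complex.normSq_eq_norm_sq, norm_pow, hz]; simp
      have h2 : A 0 * (z ^ (N + 1))⁻¹ = starRingEnd ℂ (starRingEnd ℂ (A 0) * z ^ (N + 1)) := by
        rw [h1, map_mul, Complex.conj_conj]
      dsimp only
      rw [h2, Complex.add_re, Complex.sub_re, Complex.conj_re, hxr z hz]
      ring
    · exact hY.sub (by fun_prop)
    · simp [hY0]
    · intro z hz
      refine (norm_sub_le _ _).trans ?_
      have h1 : ‖starRingEnd ℂ (A 0) * z ^ (N + 1)‖ ≤ B * 1 := by
        rw [norm_mul, RCLike.norm_conj, norm_pow]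
        exact mul_le_mul (hB 0 (by simpa using hr.le))
          (pow_le_one₀ (norm_nonneg _) (hz.trans hr1.le)) (by positivity) hB0
      have h2 := hYB z hz
      calc ‖Y z‖ + _ ≤ C * (2 / r * B) + B * 1 := add_le_add h2 h1
        _ = _ := by ring
    · intro z hz hz0
      dsimp only
      rw [hYx z hz hz0, dslope_of_ne _ hz0, slope_def_field, sub_zero]
      field_simp
      ring

/-! ## Uniformizations with their inverses -/

/-- A normalized conformal map `φ` of the disc onto `U`, together with its inverse `ψ`. -/
structure IsUniformization (U : Set ℂ) (φ ψ : ℂ → ℂ) : Prop extends IsInteriorMap U φ where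
  inv_differentiableOn : DifferentiableOn ℂ ψ U
  inv_mapsTo : MapsTo ψ U (Metric.ball 0 1)
  left_inv : ∀ z ∈ Metric.ball (0 : ℂ) 1, ψ (φ z) = z
  right_inv : ∀ w ∈ U, φ (ψ w) = w
  inv_zero : ψ 0 = 0

theorem IsInteriorMap.exists_isUniformization {U : Set ℂ} {φ : ℂ → ℂ} (h : IsInteriorMap U φ) :
    ∃ ψ, IsUniformization U φ ψ := by
  obtain ⟨ψ, h1, h2, h3, h4, h5⟩ := h.exists_inverse
  exact ⟨ψ, h, h1, h2, h3, h4, h5⟩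

namespace IsUniformization

variable {U : Set ℂ} {φ ψ : ℂ → ℂ} (h : IsUniformization U φ ψ)
include h

theorem isOpen : IsOpen U := h.toIsInteriorMap.isOpen

theorem zero_mem : (0 : ℂ) ∈ U := h.map_zero ▸ h.toIsInteriorMap.mapsTo (Metric.mem_ball_self one_pos)

theorem norm_inv_lt {z : ℂ} (hz : z ∈ U) : ‖ψ z‖ < 1 := mem_ball_zero_iff.1 (h.inv_mapsTo hz)

theorem inv_ne_zero {z : ℂ} (hz : z ∈ U) (h0 : z ≠ 0) : ψ z ≠ 0 := fun h1 => h0 (by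
  rw [← h.right_inv z hz, h1, h.map_zero])

theorem image_closedBall {s : ℝ} (hs : s < 1) :
    φ '' Metric.closedBall 0 s = {z | z ∈ U ∧ ‖ψ z‖ ≤ s} := by
  ext z
  constructor
  · rintro ⟨w, hw, rfl⟩
    have hw1 := Metric.closedBall_subset_ball hs hw
    refine ⟨h.toIsInteriorMap.mapsTo hw1, ?_⟩
    rw [h.left_inv w hw1]
    simpa using hw
  · rintro ⟨hz, hs⟩
    exact ⟨ψ z, by simpa using hs, h.right_inv z hz⟩

theorem isCompact_sublevel {s : ℝ} (hs : s < 1) : IsCompact {z | z ∈ U ∧ ‖ψ z‖ ≤ s} := by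
  rw [← h.image_closedBall hs]
  exact (isCompact_closedBall 0 s).image_of_continuousOn
    (h.differentiableOn.continuousOn.mono (Metric.closedBall_subset_ball hs))

theorem isOpen_preimage {V : Set ℂ} (hV : IsOpen V) : IsOpen {z | z ∈ U ∧ ψ z ∈ V} :=
  h.inv_differentiableOn.continuousOn.isOpen_inter_preimage h.isOpen hV

theorem isOpen_sublevel (s : ℝ) : IsOpen {z | z ∈ U ∧ ‖ψ z‖ < s} :=
  h.isOpen_preimage (isOpen_lt continuous_norm continuous_const)

theorem isOpen_superlevel (s : ℝ) : IsOpen {z | z ∈ U ∧ s < ‖ψ z‖} :=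
  h.isOpen_preimage (isOpen_lt continuous_const continuous_norm)

theorem isOpen_shell (s t : ℝ) : IsOpen {z | z ∈ U ∧ s < ‖ψ z‖ ∧ ‖ψ z‖ < t} :=
  h.isOpen_preimage ((isOpen_lt continuous_const continuous_norm).inter
    (isOpen_lt continuous_norm continuous_const))

theorem isCompact_shell (s : ℝ) {t : ℝ} (ht : t < 1) :
    IsCompact {z | z ∈ U ∧ s ≤ ‖ψ z‖ ∧ ‖ψ z‖ ≤ t} := by
  have : {z | z ∈ U ∧ s ≤ ‖ψ z‖ ∧ ‖ψ z‖ ≤ t}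
      = {z | z ∈ U ∧ ‖ψ z‖ ≤ t} \ {z | z ∈ U ∧ ‖ψ z‖ < s} := by
    ext z
    simp only [mem_ofPred_eq, Set.mem_sdiff]
    constructor
    · rintro ⟨h1, h2, h3⟩
      exact ⟨⟨h1, h3⟩, fun h4 => absurd h4.2 (not_lt.2 h2)⟩
    · rintro ⟨⟨h1, h3⟩, h4⟩
      exact ⟨h1, not_lt.1 fun h5 => h4 ⟨h1, h5⟩, h3⟩
  rw [this]
  exact (h.isCompact_sublevel ht).diff (h.isOpen_sublevel s)

theorem hasDerivAt_inv {z : ℂ} (hz : z ∈ U) : HasDerivAt ψ (deriv ψ z) z :=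
  (h.inv_differentiableOn.differentiableAt (h.isOpen.mem_nhds hz)).hasDerivAt

theorem deriv_mul_deriv_inv {z : ℂ} (hz : z ∈ U) : deriv φ (ψ z) * deriv ψ z = 1 := by
  have h1 : HasDerivAt φ (deriv φ (ψ z)) (ψ z) := h.toIsInteriorMap.hasDerivAt (h.inv_mapsTo hz)
  have h2 := h1.comp z (h.hasDerivAt_inv hz)
  refine h2.unique ((hasDerivAt_id z).congr_of_eventuallyEq ?_)
  filter_upwards [h.isOpen.mem_nhds hz] with w hw
  exact h.right_inv w hw

/-- A holomorphic function on a shell is the difference of a function holomorphic inside and one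
holomorphic outside, with bounds. -/
theorem exists_splitting {s₁ c₁ c₂ s₂ : ℝ} (h1 : s₁ < c₁) (hc : c₁ < c₂) (h2 : c₂ < s₂)
    (h3 : s₂ < 1) : ∃ B, 0 ≤ B ∧ ∀ (D : ℂ → ℂ) (η : ℝ),
      DifferentiableOn ℂ D {z | z ∈ U ∧ s₁ < ‖ψ z‖ ∧ ‖ψ z‖ < s₂} →
      (∀ z ∈ U, s₁ < ‖ψ z‖ → ‖ψ z‖ < s₂ → ‖D z‖ ≤ η) →
      ∃ d e : ℂ → ℂ,
        (∀ z ∈ U, ‖ψ z‖ ≤ c₂ → DifferentiableAt ℂ d z ∧ ‖d z‖ ≤ B * η) ∧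
        (∀ z, ¬ (z ∈ U ∧ ‖ψ z‖ < c₁) → DifferentiableAt ℂ e z ∧ ‖e z‖ ≤ B * η) ∧
        ∀ z ∈ U, c₁ ≤ ‖ψ z‖ → ‖ψ z‖ ≤ c₂ → D z = d z - e z := by
  set O := {z | z ∈ U ∧ s₁ < ‖ψ z‖ ∧ ‖ψ z‖ < s₂} with hO
  set C := {z | z ∈ U ∧ c₁ ≤ ‖ψ z‖ ∧ ‖ψ z‖ ≤ c₂} with hC
  -- The Cauchy density lives in the open shell but off the closed shell `c₁ ≤ ‖ψ‖ ≤ c₂`, so it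
  -- falls into two pieces. The outer piece has a transform holomorphic inside, the inner piece one
  -- holomorphic outside. Their distances to those regions depend only on `k`, not on `D`, hence the
  -- uniform `B`.
  obtain ⟨k, hkc, hks, hkO, hk⟩ := exists_cauchy_density (h.isOpen_shell s₁ s₂)
    (h.isCompact_shell c₁ (h2.trans h3))
    (fun z hz => ⟨hz.1, h1.trans_le hz.2.1, hz.2.2.trans_lt h2⟩ : C ⊆ O)
  have hkT : IsCompact (tsupport k) := hks
  have hkint : Integrable k := hkc.integrable_of_hasCompactSupport hks
  -- the outer part of the support
  have houter : ∃ δ > 0, ∀ w ∈ tsupport k, c₂ < ‖ψ w‖ → ∀ z ∈ U, ‖ψ z‖ ≤ c₂ → δ ≤ ‖w - z‖ := by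
    have hcl : IsClosed (tsupport k \ {z | z ∈ U ∧ ‖ψ z‖ < c₁}) :=
      (isClosed_tsupport k).sdiff (h.isOpen_sublevel c₁)
    obtain ⟨δ, hδ, hdis⟩ := (h.isCompact_sublevel (h2.trans h3)).exists_thickening_subset_open
      (hcl.isOpen_compl) (fun z hz hw => (hkO hw.1).2 ⟨hz.1, not_lt.1 fun h5 => hw.2 ⟨hz.1, h5⟩, hz.2⟩)
    refine ⟨δ, hδ, fun w hw hw2 z hz hz2 => not_lt.1 fun hlt => ?_⟩
    refine hdis (Metric.mem_thickening_iff.2 ⟨z, ⟨hz, hz2⟩, by rwa [dist_eq_norm]⟩) ⟨hw, fun h5 => ?_⟩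
    exact absurd h5.2 (not_lt.2 (hc.trans hw2).le)
  have hinner : ∃ δ > 0, ∀ w ∈ tsupport k, ‖ψ w‖ ≤ c₂ → ∀ z, ¬ (z ∈ U ∧ ‖ψ z‖ < c₁) →
      δ ≤ ‖w - z‖ := by
    have hcpt : IsCompact (tsupport k \ {z | z ∈ U ∧ c₂ < ‖ψ z‖}) :=
      hkT.diff (h.isOpen_superlevel c₂)
    obtain ⟨δ, hδ, hdis⟩ := hcpt.exists_thickening_subset_open (h.isOpen_sublevel c₁)
      (fun w hw => by
        have hwO := hkO hw.1
        refine ⟨hwO.1.1, not_le.1 fun h5 => hwO.2 ⟨hwO.1.1, h5, not_lt.1 fun h6 => ?_⟩⟩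
        exact hw.2 ⟨hwO.1.1, h6⟩)
    refine ⟨δ, hδ, fun w hw hw2 z hz => not_lt.1 fun hlt => hz ?_⟩
    refine hdis (Metric.mem_thickening_iff.2 ⟨w, ⟨hw, fun h5 => absurd h5.2 (not_lt.2 hw2)⟩, ?_⟩)
    rwa [dist_comm, dist_eq_norm]
  obtain ⟨δ₁, hδ₁, hout⟩ := houter
  obtain ⟨δ₂, hδ₂, hin⟩ := hinner
  have hI : 0 ≤ ∫ w, ‖k w‖ := integral_nonneg fun _ => norm_nonneg _
  refine ⟨max δ₁⁻¹ δ₂⁻¹ * ∫ w, ‖k w‖, by positivity, fun D η hD hη => ?_⟩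
  have hkU : ∀ w, k w ≠ 0 → w ∈ tsupport k := fun w hw => subset_tsupport _ hw
  have hkDc : Continuous fun w => k w * D w := by
    refine continuous_iff_continuousAt.2 fun w => ?_
    by_cases hw : w ∈ O
    · exact hkc.continuousAt.mul (hD.differentiableAt ((h.isOpen_shell s₁ s₂).mem_nhds hw)).continuousAt
    · have h5 : (fun w => k w * D w) =ᶠ[𝓝 w] fun _ => 0 := by
        filter_upwards [(isClosed_tsupport k).isOpen_compl.mem_nhds fun h6 => hw (hkO h6).1] with y hy
        rw [image_eq_zero_of_notMem_tsupport hy, zero_mul]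
      exact h5.continuousAt
  have hkD : Integrable fun w => k w * D w :=
    hkDc.integrable_of_hasCompactSupport hks.mul_right
  have hkDn : ∀ w, ‖k w * D w‖ ≤ ‖k w‖ * η := fun w => by
    by_cases hw : k w = 0
    · simp [hw]
    · rw [norm_mul]
      have hwO := (hkO (hkU w hw)).1
      exact mul_le_mul_of_nonneg_left (hη w hwO.1 hwO.2.1 hwO.2.2) (norm_nonneg _)
  set T := {z | z ∈ U ∧ c₂ < ‖ψ z‖} with hT
  have hTm : MeasurableSet T := (h.isOpen_superlevel c₂).measurableSet
  set κ₁ := T.indicator fun w => k w * D w with hκ₁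
  set κ₂ := Tᶜ.indicator fun w => k w * D w with hκ₂
  have hi₁ : Integrable κ₁ := hkD.indicator hTm
  have hi₂ : Integrable κ₂ := hkD.indicator hTm.compl
  have hbound : ∀ (V : Set ℂ), ∫ w, ‖V.indicator (fun w => k w * D w) w‖ ≤ (∫ w, ‖k w‖) * η := by
    intro V
    rw [← integral_mul_const]
    refine integral_mono_of_nonneg (Eventually.of_forall fun _ => norm_nonneg _)
      (hkint.norm.mul_const _) (Eventually.of_forall fun w => ?_)
    exact (norm_indicator_le_norm_self _ _).trans (hkDn w)
  have hne₁ : ∀ w, κ₁ w ≠ 0 → w ∈ tsupport k ∧ c₂ < ‖ψ w‖ := fun w hw => by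
    have hwT : w ∈ T := mem_of_indicator_ne_zero hw
    rw [hκ₁, indicator_of_mem hwT] at hw
    exact ⟨hkU w (left_ne_zero_of_mul hw), hwT.2⟩
  have hne₂ : ∀ w, κ₂ w ≠ 0 → w ∈ tsupport k ∧ ‖ψ w‖ ≤ c₂ := fun w hw => by
    have hwT : w ∈ Tᶜ := mem_of_indicator_ne_zero hw
    rw [hκ₂, indicator_of_mem hwT] at hw
    have hwk := hkU w (left_ne_zero_of_mul hw)
    exact ⟨hwk, not_lt.1 fun h5 => hwT ⟨(hkO hwk).1.1, h5⟩⟩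
  -- The sign of `η` is known only where the density sees a point of the shell.
  have hη0 : ∀ w, k w ≠ 0 → 0 ≤ η := fun w hw =>
    (norm_nonneg _).trans (hη w (hkO (hkU w hw)).1.1 (hkO (hkU w hw)).1.2.1 (hkO (hkU w hw)).1.2.2)
  have hIη : 0 ≤ (∫ w, ‖k w‖) * η := by
    rw [← integral_mul_const]
    refine integral_nonneg fun w => ?_
    by_cases hw : k w = 0
    · simp [hw]
    · exact mul_nonneg (norm_nonneg _) (hη0 w hw)
  have hfin : ∀ (δ : ℝ) (V : Set ℂ), 0 < δ → δ⁻¹ ≤ max δ₁⁻¹ δ₂⁻¹ →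
      δ⁻¹ * ∫ w, ‖V.indicator (fun w => k w * D w) w‖ ≤ max δ₁⁻¹ δ₂⁻¹ * (∫ w, ‖k w‖) * η := by
    intro δ V hδ hle
    rw [mul_assoc]
    exact (mul_le_mul_of_nonneg_left (hbound V) (by positivity)).trans
      (mul_le_mul_of_nonneg_right hle hIη)
  refine ⟨fun z => ∫ w, κ₁ w / (w - z), fun z => -∫ w, κ₂ w / (w - z), fun z hz hz2 => ?_,
    fun z hz => ?_, fun z hz hz1 hz2 => ?_⟩
  · have h5 : ∀ w, κ₁ w ≠ 0 → δ₁ ≤ ‖w - z‖ := fun w hw =>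
      hout w (hne₁ w hw).1 (hne₁ w hw).2 z hz hz2
    exact ⟨differentiableAt_cauchyTransform hi₁ hδ₁ h5,
      (norm_cauchyTransform_le hi₁ hδ₁ h5).trans (hfin δ₁ T hδ₁ (le_max_left _ _))⟩
  · have h5 : ∀ w, κ₂ w ≠ 0 → δ₂ ≤ ‖w - z‖ := fun w hw =>
      hin w (hne₂ w hw).1 (hne₂ w hw).2 z hz
    refine ⟨(differentiableAt_cauchyTransform hi₂ hδ₂ h5).neg, ?_⟩
    rw [norm_neg]
    exact (norm_cauchyTransform_le hi₂ hδ₂ h5).trans (hfin δ₂ Tᶜ hδ₂ (le_max_right _ _))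
  · have hi : ∀ κ : ℂ → ℂ, Integrable κ → ∀ δ > 0, (∀ w, κ w ≠ 0 → δ ≤ ‖w - z‖) →
        Integrable fun w => κ w / (w - z) := by
      intro κ hκ δ hδ hw
      refine (hκ.norm.const_mul δ⁻¹).mono' ?_ (Eventually.of_forall fun w => ?_)
      · simp only [div_eq_mul_inv]
        exact hκ.aestronglyMeasurable.mul (measurable_id.sub_const z).inv.aestronglyMeasurable
      · by_cases hw0 : κ w = 0
        · simp [hw0]
        · rw [norm_div, div_eq_inv_mul]
          gcongr
          exact hw w hw0
    rw [hk D hD z ⟨hz, hz1, hz2⟩, sub_neg_eq_add, ← integral_add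
      (hi κ₁ hi₁ δ₁ hδ₁ fun w hw => hout w (hne₁ w hw).1 (hne₁ w hw).2 z hz hz2)
      (hi κ₂ hi₂ δ₂ hδ₂ fun w hw => hin w (hne₂ w hw).1 (hne₂ w hw).2 z
        fun h5 => absurd h5.2 (not_lt.2 hz1))]
    refine integral_congr_ae (Eventually.of_forall fun w => ?_)
    have h5 : κ₁ w + κ₂ w = k w * D w := congrFun (indicator_self_add_compl T _) w
    change k w * D w / (w - z) = κ₁ w / (w - z) + κ₂ w / (w - z)
    rw [← add_div, h5]

end IsUniformization

/-! ## Holomorphic functions along a flow -/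

/-- The second-order expansion of the flow is combined with the quadratic remainder of `f`,
uniformly because `S` has a compact neighbourhood in `V`. -/
theorem IsFlowBox.exists_taylor_bound {v : ℂ[T;T⁻¹]} {a b ε : ℝ} {M : NNReal}
    (h : IsFlowBox v a b ε M) {V S : Set ℂ} (hV : IsOpen V) (hS : IsCompact S) (hSV : S ⊆ V)
    (hSa : S ⊆ closedAnnulus a b) {f : ℂ → ℂ} (hf : DifferentiableOn ℂ f V) :
    ∃ C, 0 ≤ C ∧ ∃ δ > 0, δ ≤ ε ∧ ∀ t, |t| < δ → ∀ z ∈ S, flowMap v t z ∈ V ∧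
      ‖f (flowMap v t z) - f z - t * (deriv f z * fieldAt v z)‖ ≤ C * t ^ 2 ∧
      ‖f (flowMap v t z) - f z‖ ≤ C * |t| := by
  obtain ⟨r, hr, hrV⟩ := hS.exists_cthickening_subset_open hV hSV
  have hcpt : IsCompact (Metric.cthickening r S) := hS.cthickening
  obtain ⟨B, hB⟩ := hcpt.exists_bound_of_continuousOn (hf.continuousOn.mono hrV)
  have hball : ∀ z ∈ S, Metric.ball z r ⊆ Metric.cthickening r S := fun z hz =>
    (Metric.ball_subset_thickening hz r).trans (Metric.thickening_subset_cthickening r S)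
  obtain ⟨B', hB'⟩ := hS.exists_bound_of_continuousOn
    (f := fun z => deriv f z) ((hf.deriv hV).continuousOn.mono hSV)
  have hM : (0 : ℝ) < M := by exact_mod_cast h.bound_pos
  set B₁ := max B 0
  set B₂ := max B' 0
  set C := 4 * B₁ / r ^ 2 * (M : ℝ) ^ 2 + B₂ * (M * M) with hC
  have hB₁ : 0 ≤ B₁ := le_max_right _ _
  have hB₂ : 0 ≤ B₂ := le_max_right _ _
  have hC0 : 0 ≤ C := by positivity
  refine ⟨C + B₂ * M, by positivity, min ε (min (r / M) 1), by
    have := h.time_pos; positivity, min_le_left _ _, fun t ht z hz => ?_⟩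
  rw [lt_min_iff, lt_min_iff, lt_div_iff₀ hM] at ht
  obtain ⟨htε, htr, ht1⟩ := ht
  have hza := hSa hz
  have hd : ‖flowMap v t z - z‖ ≤ M * |t| := h.norm_sub_le z hza t htε
  have hmem : flowMap v t z ∈ Metric.ball z r := by
    rw [mem_ball_iff_norm]
    linarith
  have h2 := h.norm_flowMap_sub_sub_le hza htε
  have h3 := norm_sub_sub_deriv_le (hf.mono ((hball z hz).trans hrV))
    (fun w hw => (hB w (hball z hz hw)).trans (le_max_left B 0)) hmem
  have h4 : ‖deriv f z‖ ≤ B₂ := (hB' z hz).trans (le_max_left _ _)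
  have hv : ‖fieldAt v z‖ ≤ M := h.norm_le z (by
    have := h.pos
    exact ⟨by linarith [hza.1], by linarith [hza.2]⟩)
  have h5 : ‖f (flowMap v t z) - f z - t * (deriv f z * fieldAt v z)‖ ≤ C * t ^ 2 := by
    have e : f (flowMap v t z) - f z - t * (deriv f z * fieldAt v z)
        = (f (flowMap v t z) - f z - deriv f z * (flowMap v t z - z))
          + deriv f z * (flowMap v t z - z - t * fieldAt v z) := by ring
    rw [e]
    refine (norm_add_le _ _).trans ?_
    rw [norm_mul]
    calc _ ≤ 4 * B₁ / r ^ 2 * (M * |t|) ^ 2 + B₂ * (M * M * t ^ 2) := by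
          refine add_le_add (h3.trans ?_) ?_
          · gcongr
          · gcongr
      _ = C * t ^ 2 := by rw [mul_pow, sq_abs]; ring
  have ht2 : t ^ 2 ≤ |t| := by
    rw [← sq_abs]; nlinarith [abs_nonneg t]
  refine ⟨hrV (hball z hz hmem), h5.trans (by gcongr; exact le_add_of_nonneg_right (by positivity)), ?_⟩
  have e : f (flowMap v t z) - f z = (f (flowMap v t z) - f z - t * (deriv f z * fieldAt v z))
      + t * (deriv f z * fieldAt v z) := by ring
  rw [e]
  refine (norm_add_le _ _).trans ?_
  rw [norm_mul, norm_mul, Complex.norm_real, Real.norm_eq_abs]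
  calc _ ≤ C * |t| + |t| * (B₂ * M) := by
        refine add_le_add (h5.trans (by gcongr)) ?_
        gcongr
    _ = _ := by ring

/-! ## Approximate uniformization after a short time of the flow -/

theorem norm_log_one_add_sub_le {u : ℂ} (hu : ‖u‖ ≤ 1 / 2) :
    ‖Complex.log (1 + u) - u‖ ≤ ‖u‖ ^ 2 := by
  refine (Complex.norm_log_one_add_sub_self_le (by linarith)).trans ?_
  have h1 : (1 - ‖u‖)⁻¹ ≤ 2 := by
    rw [inv_le_comm₀ (by linarith) two_pos]; linarith
  nlinarith [sq_nonneg ‖u‖]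

/-- On a shell, the inner and the outer approximations of the uniformization after time `t` agree
up to a factor `1 + O(t²)`. -/
theorem IsUniformization.exists_overlap {U : Set ℂ} {φ ψ : ℂ → ℂ} (h : IsUniformization U φ ψ)
    {v : ℂ[T;T⁻¹]} {a b ε : ℝ} {M : NNReal} (hbox : IsFlowBox v a b ε M) {s₁ s₂ : ℝ} (hs₁ : 0 < s₁)
    (hs₂ : s₂ < 1) (hS : ∀ z ∈ U, s₁ ≤ ‖ψ z‖ → ‖ψ z‖ ≤ s₂ → closedAnnulus a b ∈ 𝓝 z)
    {x Y : ℂ → ℂ} (hx : DifferentiableOn ℂ x {0}ᶜ) (hY : DifferentiableOn ℂ Y (Metric.ball 0 1))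
    (hE : ∀ ζ ∈ Metric.ball (0 : ℂ) 1, ζ ≠ 0 →
      fieldAt v (φ ζ) = ζ * deriv φ ζ * (x ζ - Y ζ)) :
    ∃ C, 0 ≤ C ∧ ∃ δ > 0, δ ≤ ε ∧ ∀ t, |t| < δ → ∃ D : ℂ → ℂ,
      DifferentiableOn ℂ D {z | z ∈ U ∧ s₁ < ‖ψ z‖ ∧ ‖ψ z‖ < s₂} ∧
      ∀ z ∈ U, s₁ ≤ ‖ψ z‖ → ‖ψ z‖ ≤ s₂ → ‖D z‖ ≤ C * t ^ 2 ∧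
        ψ (flowMap v (-t) z) * Complex.exp (t * x (ψ (flowMap v (-t) z)))
          = ψ z * Complex.exp (t * Y (ψ z)) * Complex.exp (D z) := by
  set S := {z | z ∈ U ∧ s₁ ≤ ‖ψ z‖ ∧ ‖ψ z‖ ≤ s₂} with hSdef
  have hSc : IsCompact S := h.isCompact_shell s₁ hs₂
  have hSa : S ⊆ closedAnnulus a b := fun z hz => mem_of_mem_nhds (hS z hz.1 hz.2.1 hz.2.2)
  have hψ0 : ∀ z ∈ U, z ≠ 0 → ψ z ≠ 0 := fun z hz => h.inv_ne_zero hz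
  have hU0 : IsOpen (U \ {0}) := h.isOpen.sdiff isClosed_singleton
  have hSU0 : S ⊆ U \ {0} := fun z hz => ⟨hz.1, fun h0 => by
    have h1 := hz.2.1
    rw [show z = 0 from h0, h.inv_zero, norm_zero] at h1
    linarith⟩
  have hxψ : DifferentiableOn ℂ (fun z => x (ψ z)) (U \ {0}) :=
    hx.comp (h.inv_differentiableOn.mono sdiff_subset) fun z hz => hψ0 z hz.1 hz.2
  obtain ⟨C₁, hC₁, δ₁, hδ₁, hδ₁ε, H₁⟩ := hbox.exists_taylor_bound h.isOpen hSc (fun z hz => hz.1) hSa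
    h.inv_differentiableOn
  obtain ⟨C₂, hC₂, δ₂, hδ₂, -, H₂⟩ := hbox.exists_taylor_bound hU0 hSc hSU0 hSa hxψ
  set δ := min δ₁ (min δ₂ (s₁ / (2 * (C₁ + 1)))) with hδ
  refine ⟨(C₁ / s₁) ^ 2 + C₁ / s₁ + C₂, by positivity, δ, by positivity,
    (min_le_left _ _).trans hδ₁ε, fun t ht => ?_⟩
  have ht' : |-t| < δ := by rwa [abs_neg]
  rw [hδ, lt_min_iff, lt_min_iff, lt_div_iff₀ (by positivity)] at ht'
  obtain ⟨ht1, ht2, ht3⟩ := ht'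
  rw [abs_neg] at ht3
  -- `D` is the logarithm of the quotient of the two approximations; `1 + u` is the part of the
  -- quotient coming from `ψ` alone, close enough to `1` for the principal branch.
  set u : ℂ → ℂ := fun z => ψ (flowMap v (-t) z) / ψ z - 1 with hu
  set D : ℂ → ℂ := fun z => Complex.log (1 + u z) + t * x (ψ (flowMap v (-t) z)) - t * Y (ψ z)
  have hSψ : ∀ z ∈ S, ψ z ≠ 0 := fun z hz => hψ0 z hz.1 (hSU0 hz).2
  have hbnd : ∀ z ∈ S, ‖u z‖ ≤ C₁ / s₁ * |t| ∧ ‖u z‖ ≤ 1 / 2 := fun z hz => by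
    have h1 := (H₁ (-t) ht1 z hz).2.2
    rw [abs_neg] at h1
    have h2 : u z = (ψ (flowMap v (-t) z) - ψ z) / ψ z := by
      rw [sub_div, div_self (hSψ z hz)]
    have h3 : ‖u z‖ ≤ C₁ / s₁ * |t| := by
      rw [h2, norm_div, div_mul_eq_mul_div]
      exact div_le_div₀ (by positivity) h1 hs₁ hz.2.1
    refine ⟨h3, h3.trans ?_⟩
    rw [div_mul_eq_mul_div, div_le_iff₀ hs₁]
    nlinarith [abs_nonneg t]
  refine ⟨D, fun z hz => ?_, fun z hz h1 h2 => ?_⟩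
  · have hzS : z ∈ S := ⟨hz.1, hz.2.1.le, hz.2.2.le⟩
    have hw := (H₁ (-t) ht1 z hzS).1
    have hw0 := (H₂ (-t) ht2 z hzS).1
    have hq : DifferentiableAt ℂ (flowMap v (-t)) z :=
      hbox.differentiableAt_flowMap (hS z hz.1 hz.2.1.le hz.2.2.le) (ht1.trans_le hδ₁ε)
    have hψq : DifferentiableAt ℂ (fun z => ψ (flowMap v (-t) z)) z :=
      DifferentiableAt.fun_comp' z
        (h.inv_differentiableOn.differentiableAt (h.isOpen.mem_nhds hw)) hq
    have hψz : DifferentiableAt ℂ ψ z := (h.hasDerivAt_inv hz.1).differentiableAt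
    have hxq : DifferentiableAt ℂ (fun z => x (ψ (flowMap v (-t) z))) z :=
      DifferentiableAt.fun_comp' (f := fun z => ψ (flowMap v (-t) z)) z
        (hx.differentiableAt (isOpen_compl_singleton.mem_nhds (hψ0 _ hw0.1 hw0.2))) hψq
    have hYz : DifferentiableAt ℂ (fun z => Y (ψ z)) z := DifferentiableAt.fun_comp' z
        (hY.differentiableAt (Metric.isOpen_ball.mem_nhds (h.inv_mapsTo hz.1))) hψz
    have hud : DifferentiableAt ℂ (fun z => 1 + u z) z :=
      ((hψq.div hψz (hSψ z hzS)).sub_const 1).const_add 1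
    refine DifferentiableAt.differentiableWithinAt ?_
    refine ((hud.clog ?_).add (hxq.const_mul _)).sub (hYz.const_mul _)
    refine Complex.mem_slitPlane_of_norm_lt_one ?_
    linarith [(hbnd z hzS).2]
  · have hzS : z ∈ S := ⟨hz, h1, h2⟩
    constructor
    · have hEz : deriv ψ z * fieldAt v z = ψ z * (x (ψ z) - Y (ψ z)) := by
        have h3 := hE (ψ z) (h.inv_mapsTo hz) (hSψ z hzS)
        rw [h.right_inv z hz] at h3
        rw [h3]
        linear_combination (ψ z * (x (ψ z) - Y (ψ z))) * h.deriv_mul_deriv_inv hz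
      -- The first-order terms cancel by `hEz`: the motion of `ψ` contributes `t (Y - x)`, which is
      -- compensated by the exponents. Three quadratic remainders are left.
      have h4 : D z = (Complex.log (1 + u z) - u z)
          + (ψ (flowMap v (-t) z) - ψ z - ((-t : ℝ) : ℂ) * (deriv ψ z * fieldAt v z)) / ψ z
          + t * (x (ψ (flowMap v (-t) z)) - x (ψ z)) := by
        simp only [D, hu]
        rw [hEz]
        have := hSψ z hzS
        push_cast
        field_simp
        ring
      have h5 := norm_log_one_add_sub_le (hbnd z hzS).2
      have h6 := (H₁ (-t) ht1 z hzS).2.1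
      have h7 := (H₂ (-t) ht2 z hzS).2.2
      rw [abs_neg] at h7
      rw [neg_sq] at h6
      rw [h4]
      refine (norm_add₃_le).trans ?_
      rw [norm_div, norm_mul, Complex.norm_real, Real.norm_eq_abs]
      calc _ ≤ (C₁ / s₁ * |t|) ^ 2 + C₁ * t ^ 2 / s₁ + |t| * (C₂ * |t|) := by
            refine add_le_add (add_le_add (h5.trans ?_) ?_) ?_
            · have := (hbnd z hzS).1
              gcongr
            · exact div_le_div₀ (by positivity) h6 hs₁ h1
            · gcongr
        _ = _ := by rw [mul_pow, sq_abs, ← sq_abs t]; ring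
    · have h3 : 1 + u z ≠ 0 := by
        refine Complex.slitPlane_ne_zero (Complex.mem_slitPlane_of_norm_lt_one ?_)
        linarith [(hbnd z hzS).2]
      simp only [D]
      rw [Complex.exp_sub, Complex.exp_add, Complex.exp_log h3]
      have := hSψ z hzS
      have := Complex.exp_ne_zero (t * Y (ψ z))
      simp only [hu]
      field_simp
      ring

/-! ## The moved continuum -/

/-- After a short time of the flow, the interior of the moved continuum is covered by an inner part
of the old interior and the moved outer part of the old interior. -/
theorem IsEnclosing.exists_cover {K : Set ℂ} (hK : IsEnclosing K) {φ ψ : ℂ → ℂ}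
    (h : IsUniformization (interiorDomain K) φ ψ) {v : ℂ[T;T⁻¹]} {a b ε : ℝ} {M : NNReal}
    (hbox : IsFlowBox v a b ε M) {s₁ σ₁ σ₂ s₂ : ℝ} (h0 : 0 < s₁) (h1 : s₁ < σ₁) (hσ : σ₁ < σ₂)
    (h2 : σ₂ < s₂) (h3 : s₂ < 1) (hKa : K ⊆ closedAnnulus a b)
    (hS : ∀ z ∈ interiorDomain K, s₁ ≤ ‖ψ z‖ → closedAnnulus a b ∈ 𝓝 z) :
    ∃ δ > 0, δ ≤ ε ∧ ∀ t, |t| < δ → IsEnclosing (flowMap v t '' K) ∧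
      (∀ z ∈ interiorDomain K, ‖ψ z‖ ≤ σ₂ → z ∉ flowMap v t '' K) ∧
      (∀ y ∈ interiorDomain K, σ₁ < ‖ψ y‖ →
        ¬ (flowMap v t y ∈ interiorDomain K ∧ ‖ψ (flowMap v t y)‖ ≤ s₁)) ∧
      (∀ z ∈ interiorDomain (flowMap v t '' K), (z ∈ interiorDomain K ∧ ‖ψ z‖ < σ₂) ∨
        ∃ y ∈ interiorDomain K, σ₁ < ‖ψ y‖ ∧ flowMap v t y = z) := by
  set U := interiorDomain K
  set S := {z | z ∈ U ∧ s₁ ≤ ‖ψ z‖ ∧ ‖ψ z‖ ≤ s₂} with hSdef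
  have hSc : IsCompact S := h.isCompact_shell s₁ h3
  have hSa : S ⊆ closedAnnulus a b := fun z hz => mem_of_mem_nhds (hS z hz.1 hz.2.1)
  obtain ⟨C, hC, δ₀, hδ₀, hδ₀ε, H⟩ := hbox.exists_taylor_bound h.isOpen hSc (fun z hz => hz.1) hSa
    h.inv_differentiableOn
  have hM : (0 : ℝ) < M := by exact_mod_cast hbox.bound_pos
  obtain ⟨r, hr, hr1⟩ := (h.isCompact_sublevel (h2.trans h3)).exists_thickening_subset_open
    hK.isCompact.isClosed.isOpen_compl (fun z hz => interiorDomain_subset hz.1)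
  obtain ⟨r', hr', hr'1⟩ := (h.isCompact_sublevel
    ((h1.trans (hσ.trans h2)).trans h3)).exists_thickening_subset_open
    (h.isOpen_sublevel σ₁) (fun z hz => ⟨hz.1, hz.2.trans_lt h1⟩)
  -- The bounds with `r` and `r'` keep displaced points from crossing between `K` and the
  -- `σ₂`-sublevel, and between the levels `s₁` and `σ₁`. The last bound keeps the change of `‖ψ‖`
  -- below `σ₂ - σ₁`.
  refine ⟨min δ₀ (min (min (r / M) (r' / M)) ((σ₂ - σ₁) / (C + 1))), by
    have := sub_pos.2 hσ; positivity, (min_le_left _ _).trans hδ₀ε, fun t ht => ?_⟩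
  rw [lt_min_iff, lt_min_iff, lt_min_iff, lt_div_iff₀ hM, lt_div_iff₀ hM,
    lt_div_iff₀ (by positivity)] at ht
  obtain ⟨ht0, ⟨htr, htr'⟩, htσ⟩ := ht
  have htε : |t| < ε := ht0.trans_le hδ₀ε
  set q := flowMap v t with hq
  have hTa : ∀ z ∈ U, s₁ ≤ ‖ψ z‖ → z ∈ closedAnnulus a b := fun z hz hz1 =>
    mem_of_mem_nhds (hS z hz hz1)
  have hqc : ∀ V ⊆ closedAnnulus a b, ContinuousOn q V := fun V hV => by
    refine (LipschitzOnWith.continuousOn (K := Real.toNNReal (Real.exp (M * |t|))) ?_).mono hV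
    refine LipschitzOnWith.of_dist_le_mul fun z hz w hw => ?_
    rw [dist_eq_norm, dist_eq_norm, Real.coe_toNNReal _ (Real.exp_pos _).le]
    exact hbox.norm_flowMap_sub_le hw hz htε
  have hgap : ∀ z ∈ S, q z ∈ U ∧ ‖ψ (q z)‖ < ‖ψ z‖ + (σ₂ - σ₁) := fun z hz => by
    obtain ⟨e1, -, e2⟩ := H t ht0 z hz
    refine ⟨e1, ?_⟩
    have := norm_sub_norm_le (ψ (q z)) (ψ z)
    nlinarith [abs_nonneg t]
  have hgap' : ∀ z ∈ S, flowMap v (-t) z ∈ U ∧ ‖ψ z‖ - (σ₂ - σ₁) < ‖ψ (flowMap v (-t) z)‖ :=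
    fun z hz => by
    obtain ⟨e1, -, e2⟩ := H (-t) (by rwa [abs_neg]) z hz
    refine ⟨e1, ?_⟩
    have := norm_sub_norm_le (ψ z) (ψ (flowMap v (-t) z))
    rw [norm_sub_rev] at this
    rw [abs_neg] at e2
    nlinarith [abs_nonneg t]
  set Wi := {z | z ∈ U ∧ ‖ψ z‖ < σ₂} with hWi
  set T := {z | z ∈ U ∧ σ₁ < ‖ψ z‖} with hT
  have hTsub : T ⊆ closedAnnulus a b := fun z hz => hTa z hz.1 (h1.trans hz.2).le
  have hWo : IsOpen (q '' T) := isOpen_image_of_injOn (h.isOpen_superlevel σ₁)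
    (fun z hz => (hbox.differentiableAt_flowMap (hS z hz.1 (h1.trans hz.2).le)
      htε).differentiableWithinAt) ((hbox.injOn htε).mono hTsub)
  -- `W` is open, and its closure adds only points of the moved continuum: the edge `‖ψ‖ = σ₂` of
  -- the inner piece is covered by the moved outer piece, and the edge `‖ψ‖ = σ₁` of the outer piece
  -- is moved into the inner piece. The connected inside of the moved continuum meets `W` at `0`, so
  -- it cannot leave `W`.
  set W := Wi ∪ q '' T with hW
  have hWopen : IsOpen W := (h.isOpen_sublevel σ₂).union hWo
  have hclWi : closure Wi ⊆ W := by
    have e1 : closure Wi ⊆ {z | z ∈ U ∧ ‖ψ z‖ ≤ σ₂} := closure_minimal (fun z hz => ⟨hz.1, hz.2.le⟩)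
      (h.isCompact_sublevel (h2.trans h3)).isClosed
    intro z hz
    obtain ⟨hzU, hzσ⟩ := e1 hz
    rcases hzσ.lt_or_eq with hlt | heq
    · exact Or.inl ⟨hzU, hlt⟩
    · right
      have hzS : z ∈ S := ⟨hzU, by linarith, by linarith⟩
      obtain ⟨e2, e3⟩ := hgap' z hzS
      refine ⟨flowMap v (-t) z, ⟨e2, by linarith⟩, ?_⟩
      have := hbox.flowMap_neg_flowMap (hSa hzS) (t := -t) (by rwa [abs_neg])
      rwa [neg_neg] at this
  have hclWo : closure (q '' T) ⊆ W ∪ q '' K := by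
    -- A compact set containing `T`; its image is closed, which bounds the closure of the image of
    -- `T` without any inverse of the flow near `K`.
    set T' := (U ∪ K) \ {z | z ∈ U ∧ ‖ψ z‖ < σ₁} with hT'
    have hUKc : IsCompact (U ∪ K) := by
      have e1 : closure U ∪ K = U ∪ K := by
        refine subset_antisymm (union_subset hK.closure_subset subset_union_right)
          (union_subset_union_left _ subset_closure)
      rw [← e1]
      exact hK.isBounded.isCompact_closure.union hK.isCompact
    have hT'c : IsCompact T' := hUKc.diff (h.isOpen_sublevel σ₁)
    have hT'a : T' ⊆ closedAnnulus a b := by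
      rintro z ⟨hz | hz, hz1⟩
      · exact hTa z hz (h1.le.trans (not_lt.1 fun h5 => hz1 ⟨hz, h5⟩))
      · exact hKa hz
    have e2 : closure (q '' T) ⊆ q '' T' := closure_minimal
      (image_mono fun z hz => ⟨Or.inl hz.1, fun h5 => absurd h5.2 (not_lt.2 hz.2.le)⟩)
      (hT'c.image_of_continuousOn (hqc T' hT'a)).isClosed
    intro z hz
    obtain ⟨y, ⟨hy | hy, hy1⟩, rfl⟩ := e2 hz
    · left
      rcases (not_lt.1 fun h5 => hy1 ⟨hy, h5⟩ : σ₁ ≤ ‖ψ y‖).lt_or_eq with hlt | heq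
      · exact Or.inr ⟨y, ⟨hy, hlt⟩, rfl⟩
      · obtain ⟨e3, e4⟩ := hgap y ⟨hy, by linarith, by linarith⟩
        exact Or.inl ⟨e3, by linarith⟩
    · exact Or.inr ⟨y, hy, rfl⟩
  have h0W : (0 : ℂ) ∈ W := Or.inl ⟨hK.zero_mem, by
    rw [h.inv_zero, norm_zero]; linarith⟩
  have h0K : (0 : ℂ) ∉ q '' K := by
    rintro ⟨z, hz, hz0⟩
    have := hbox.mem z (hKa hz) t htε
    rw [← hq, hz0] at this
    exact zero_notMem_closedAnnulus (half_pos hbox.pos) this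
  have hsub : interiorDomain (q '' K) ⊆ W := by
    refine isPreconnected_interiorDomain.subset_of_closure_inter_subset hWopen
      ⟨0, mem_connectedComponentIn h0K, h0W⟩ ?_
    rintro z ⟨hz, hzt⟩
    rw [hW, closure_union] at hz
    rcases hz with hz | hz
    · exact hclWi hz
    · exact (hclWo hz).resolve_right (interiorDomain_subset hzt)
  have hWb : Bornology.IsBounded W := by
    refine (hK.isBounded.subset fun z hz => hz.1).union ?_
    refine (isCompact_closedAnnulus (a / 2) (b + a / 2)).isBounded.subset ?_
    rintro _ ⟨z, hz, rfl⟩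
    exact hbox.mem z (hTsub hz) t htε
  refine ⟨⟨hK.isCompact.image_of_continuousOn (hqc K hKa), hK.isConnected.image q (hqc K hKa),
    h0K, hWb.subset hsub⟩, ?_, ?_, ?_⟩
  · rintro z hz hzσ ⟨y, hy, rfl⟩
    refine hr1 (Metric.mem_thickening_iff.2 ⟨q y, ⟨hz, hzσ⟩, ?_⟩) hy
    rw [dist_comm, dist_eq_norm]
    have := hbox.norm_sub_le y (hKa hy) t htε
    linarith
  · rintro y hy hyσ ⟨hz, hz1⟩
    have h5 := hr'1 (Metric.mem_thickening_iff.2 ⟨q y, ⟨hz, hz1⟩, by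
      rw [dist_comm, dist_eq_norm]
      have := hbox.norm_sub_le y (hTa y hy (h1.trans hyσ).le) t htε
      linarith⟩)
    exact absurd h5.2 (not_lt.2 hyσ.le)
  · intro z hz
    rcases hsub hz with h5 | ⟨y, hy, rfl⟩
    · exact Or.inl h5
    · exact Or.inr ⟨y, hy.1, hy.2, rfl⟩

/-! ### Comparison of the exact and the approximate uniformization -/

/-- Compactness of the circle gives a uniform collar. It is applied to `log‖ω‖ + t Re x(ω)`, the
logarithm of the modulus of the outer approximation, which vanishes on the circle because `x` is
imaginary there. -/
theorem exists_radius_abs_lt {g : ℂ → ℝ} (hg : ContinuousOn g {0}ᶜ) (h1 : ∀ z, ‖z‖ = 1 → g z = 0)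
    {κ : ℝ} (hκ : 0 < κ) : ∃ s < 1, ∀ z, s < ‖z‖ → ‖z‖ < 1 → |g z| < κ := by
  have hV : IsOpen ({0}ᶜ ∩ g ⁻¹' {y | |y| < κ}) := hg.isOpen_inter_preimage
    isOpen_compl_singleton (isOpen_lt continuous_abs continuous_const)
  obtain ⟨r, hr, hrV⟩ := (isCompact_sphere (0 : ℂ) 1).exists_thickening_subset_open hV (by
    intro z hz
    have hz1 : ‖z‖ = 1 := by simpa using hz
    refine ⟨fun h0 => ?_, ?_⟩
    · rw [show z = 0 from h0, norm_zero] at hz1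
      exact zero_ne_one hz1
    · simpa [h1 z hz1] using hκ)
  refine ⟨max (1 - r) 0, max_lt (by linarith) one_pos, fun z hz hz1 => ?_⟩
  rw [max_lt_iff] at hz
  have hz0 : (‖z‖ : ℂ) ≠ 0 := by exact_mod_cast hz.2.ne'
  refine (hrV (Metric.mem_thickening_iff.2 ⟨z / ‖z‖, ?_, ?_⟩)).2
  · rw [mem_sphere_zero_iff_norm, norm_div, Complex.norm_real, norm_norm, div_self hz.2.ne']
  · have e : z - z / ‖z‖ = z / ‖z‖ * ((‖z‖ - 1 : ℝ) : ℂ) := by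
      push_cast
      field_simp
    rw [dist_eq_norm, e, norm_mul, norm_div, Complex.norm_real, Complex.norm_real, norm_norm,
      div_self hz.2.ne', one_mul, Real.norm_eq_abs, abs_of_neg (by linarith)]
    linarith

/-- Comparison of the uniformization of the moved continuum with the approximate one. -/
theorem IsUniformization.exists_eq_mul_exp {K : Set ℂ} {φ ψ : ℂ → ℂ}
    (h : IsUniformization (interiorDomain K) φ ψ) {v : ℂ[T;T⁻¹]} {a b ε : ℝ} {M : NNReal}
    (hbox : IsFlowBox v a b ε M) (hKa : K ⊆ closedAnnulus a b)
    (hS : ∀ z ∈ interiorDomain K, 6 / 10 ≤ ‖ψ z‖ → closedAnnulus a b ∈ 𝓝 z) {t : ℝ} (ht : |t| < ε)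
    (hK' : IsEnclosing (flowMap v t '' K))
    (hin : ∀ z ∈ interiorDomain K, ‖ψ z‖ ≤ 8 / 10 → z ∉ flowMap v t '' K)
    (hout : ∀ y ∈ interiorDomain K, 7 / 10 < ‖ψ y‖ →
      ¬ (flowMap v t y ∈ interiorDomain K ∧ ‖ψ (flowMap v t y)‖ ≤ 6 / 10))
    (hcov : ∀ z ∈ interiorDomain (flowMap v t '' K), (z ∈ interiorDomain K ∧ ‖ψ z‖ < 8 / 10) ∨
        ∃ y ∈ interiorDomain K, 7 / 10 < ‖ψ y‖ ∧ flowMap v t y = z)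
    {x Y : ℂ → ℂ} (hx : DifferentiableOn ℂ x {0}ᶜ) (hxr : ∀ z, ‖z‖ = 1 → (x z).re = 0)
    (hY : DifferentiableOn ℂ Y (Metric.ball 0 1)) (hY0 : (Y 0).im = 0) {d e : ℂ → ℂ} {η X : ℝ}
    (hη : 0 < η)
    (hd : ∀ z ∈ interiorDomain K, ‖ψ z‖ ≤ 9 / 10 → DifferentiableAt ℂ d z ∧ ‖d z‖ ≤ η)
    (he : ∀ z, ¬ (z ∈ interiorDomain K ∧ ‖ψ z‖ < 6 / 10) → DifferentiableAt ℂ e z ∧ ‖e z‖ ≤ η)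
    (hde : ∀ z ∈ interiorDomain K, 6 / 10 ≤ ‖ψ z‖ → ‖ψ z‖ ≤ 9 / 10 →
      ψ (flowMap v (-t) z) * Complex.exp (t * x (ψ (flowMap v (-t) z))) * Complex.exp (e z)
        = ψ z * Complex.exp (t * Y (ψ z)) * Complex.exp (d z))
    (hX : ∀ ω : ℂ, 7 / 10 ≤ ‖ω‖ → ‖ω‖ ≤ 1 → |(x ω).re| ≤ X) (hsmall : |t| * X + 8 * η ≤ 1 / 10)
    {φ' : ℂ → ℂ} (hφ' : IsInteriorMap (interiorDomain (flowMap v t '' K)) φ') {ζ : ℂ}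
    (hζ : ‖ζ‖ ≤ 1 / 2) :
    φ' ζ ∈ interiorDomain K ∧ ‖ψ (φ' ζ)‖ < 8 / 10 ∧ ∃ L, ‖L‖ ≤ 8 * η ∧
      ψ (φ' ζ) * Complex.exp (t * Y (ψ (φ' ζ))) = ζ * Complex.exp L := by
  classical
  set U := interiorDomain K
  set q := flowMap v t
  set U' := interiorDomain (q '' K)
  set T := {z | z ∈ U ∧ 7 / 10 < ‖ψ z‖} with hT
  have hTA : ∀ z ∈ T, closedAnnulus a b ∈ 𝓝 z := fun z hz => hS z hz.1 (by linarith [hz.2])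
  have hTa : T ⊆ closedAnnulus a b := fun z hz => mem_of_mem_nhds (hTA z hz)
  have hTo : IsOpen T := h.isOpen_superlevel _
  have hqd : DifferentiableOn ℂ q T := fun z hz =>
    (hbox.differentiableAt_flowMap (hTA z hz) ht).differentiableWithinAt
  have hqi : InjOn q T := (hbox.injOn ht).mono hTa
  have hpq : LeftInvOn (flowMap v (-t)) q T := fun z hz => hbox.flowMap_neg_flowMap (hTa hz) ht
  set inner : ℂ → ℂ := fun z => ψ z * Complex.exp (t * Y (ψ z)) * Complex.exp (d z) with hinner
  set outer : ℂ → ℂ := fun z => ψ (flowMap v (-t) z) *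
    Complex.exp (t * x (ψ (flowMap v (-t) z))) * Complex.exp (e z) with houter
  -- The corrections `exp(d)` and `exp(e)` make the inner and the outer approximation equal on the
  -- overlap, so `Ψ` is holomorphic on the whole moved inside.
  set Ψ : ℂ → ℂ := fun z => if z ∈ U ∧ ‖ψ z‖ < 8 / 10 then inner z else outer z with hΨ
  have hΨin : ∀ z, z ∈ U ∧ ‖ψ z‖ < 8 / 10 → Ψ z = inner z := fun z hz => if_pos hz
  have hnot : ∀ y ∈ T, ¬ (q y ∈ U ∧ ‖ψ (q y)‖ < 6 / 10) := fun y hy h5 =>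
    hout y hy.1 hy.2 ⟨h5.1, h5.2.le⟩
  have hΨout : ∀ y ∈ T, Ψ (q y) = outer (q y) := fun y hy => by
    by_cases h5 : q y ∈ U ∧ ‖ψ (q y)‖ < 8 / 10
    · rw [hΨin _ h5]
      have h6 : 6 / 10 < ‖ψ (q y)‖ := not_le.1 fun h7 => hout y hy.1 hy.2 ⟨h5.1, h7⟩
      exact (hde _ h5.1 h6.le (by linarith [h5.2])).symm
    · exact if_neg h5
  have houtq : ∀ y ∈ T, outer (q y) = ψ y * Complex.exp (t * x (ψ y)) * Complex.exp (e (q y)) :=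
    fun y hy => by simp only [houter, hpq hy]
  have hdin : ∀ z, z ∈ U ∧ ‖ψ z‖ < 8 / 10 → DifferentiableAt ℂ inner z := fun z hz => by
    have h1 := (h.hasDerivAt_inv hz.1).differentiableAt
    have h2 : DifferentiableAt ℂ (fun z => Y (ψ z)) z := DifferentiableAt.fun_comp' z
      (hY.differentiableAt (Metric.isOpen_ball.mem_nhds (h.inv_mapsTo hz.1))) h1
    exact (h1.mul (h2.const_mul _).cexp).mul (hd z hz.1 (by linarith [hz.2])).1.cexp
  have hdout : ∀ y ∈ T, DifferentiableAt ℂ outer (q y) := fun y hy => by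
    have h0 : DifferentiableAt ℂ (flowMap v (-t)) (q y) :=
      (analyticAt_leftInverse hTo hqd hpq hy).differentiableAt
    have h1 : DifferentiableAt ℂ ψ (flowMap v (-t) (q y)) := by
      rw [hpq hy]
      exact (h.hasDerivAt_inv hy.1).differentiableAt
    have h2 : DifferentiableAt ℂ (fun z => ψ (flowMap v (-t) z)) (q y) :=
      DifferentiableAt.fun_comp' _ h1 h0
    have h3 : DifferentiableAt ℂ (fun z => x (ψ (flowMap v (-t) z))) (q y) := by
      refine DifferentiableAt.fun_comp' (f := fun z => ψ (flowMap v (-t) z)) (q y) ?_ h2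
      refine hx.differentiableAt (isOpen_compl_singleton.mem_nhds ?_)
      rw [hpq hy]
      intro h4
      have := hy.2
      rw [show ψ y = 0 from h4, norm_zero] at this
      linarith
    exact (h2.mul (h3.const_mul _).cexp).mul (he _ (hnot y hy)).1.cexp
  have hΨd : ∀ z ∈ U', DifferentiableAt ℂ Ψ z := by
    intro z hz
    rcases hcov z hz with h5 | ⟨y, hy, hyσ, rfl⟩
    · refine (hdin z h5).congr_of_eventuallyEq ?_
      filter_upwards [(h.isOpen_sublevel (8 / 10)).mem_nhds h5] with w hw
      exact hΨin w hw
    · refine (hdout y ⟨hy, hyσ⟩).congr_of_eventuallyEq ?_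
      filter_upwards [(isOpen_image_of_injOn hTo hqd hqi).mem_nhds
        (mem_image_of_mem q (⟨hy, hyσ⟩ : y ∈ T))] with w hw
      obtain ⟨y', hy', rfl⟩ := hw
      exact hΨout y' hy'
  have h00 : (0 : ℂ) ∈ U ∧ ‖ψ 0‖ < 8 / 10 := ⟨h.zero_mem, by rw [h.inv_zero]; norm_num⟩
  have hΨ0 : Ψ 0 = 0 := by rw [hΨin 0 h00, hinner]; simp [h.inv_zero]
  have hΨne : ∀ z ∈ U', z ≠ 0 → Ψ z ≠ 0 := by
    intro z hz hz0
    rcases hcov z hz with h5 | ⟨y, hy, hyσ, rfl⟩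
    · rw [hΨin z h5]
      exact mul_ne_zero (mul_ne_zero (h.inv_ne_zero h5.1 hz0) (Complex.exp_ne_zero _))
        (Complex.exp_ne_zero _)
    · rw [hΨout y ⟨hy, hyσ⟩, houtq y ⟨hy, hyσ⟩]
      refine mul_ne_zero (mul_ne_zero (fun h6 => ?_) (Complex.exp_ne_zero _)) (Complex.exp_ne_zero _)
      rw [h6, norm_zero] at hyσ
      linarith
  obtain ⟨ψ', h'⟩ := hφ'.exists_isUniformization
  have hb01 : (0 : ℂ) ∈ Metric.ball (0 : ℂ) 1 := Metric.mem_ball_self one_pos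
  -- the derivative at the origin
  obtain ⟨ρ, hρ, hρd⟩ := h.deriv_pos
  obtain ⟨ρ', hρ', hρ'd⟩ := hφ'.deriv_pos
  have hψ'0 : deriv ψ 0 = (ρ : ℂ)⁻¹ := by
    have h1 := h.deriv_mul_deriv_inv h.zero_mem
    rw [h.inv_zero, hρd] at h1
    exact eq_inv_of_mul_eq_one_right h1
  -- Both normalized derivatives are positive and `Y 0` is real, so `exp(d 0)` is the only possible
  -- deviation from a positive derivative.
  have hderiv : deriv (fun z => Ψ (φ' z)) 0
      = ((ρ' / ρ * Real.exp (t * (Y 0).re) : ℝ) : ℂ) * Complex.exp (d 0) := by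
    have e1 : deriv Ψ 0 = (ρ : ℂ)⁻¹ * Complex.exp (t * Y 0) * Complex.exp (d 0) := by
      have e2 : Ψ =ᶠ[𝓝 0] inner := by
        filter_upwards [(h.isOpen_sublevel (8 / 10)).mem_nhds h00] with w hw
        exact hΨin w hw
      rw [e2.deriv_eq]
      have hg : DifferentiableAt ℂ (fun z => Complex.exp (t * Y (ψ z)) * Complex.exp (d z)) 0 := by
        have h1 := (h.hasDerivAt_inv h.zero_mem).differentiableAt
        have h2 : DifferentiableAt ℂ (fun z => Y (ψ z)) 0 := DifferentiableAt.fun_comp' 0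
          (hY.differentiableAt (Metric.isOpen_ball.mem_nhds (h.inv_mapsTo h.zero_mem))) h1
        exact (h2.const_mul _).cexp.mul (hd 0 h.zero_mem (by rw [h.inv_zero]; norm_num)).1.cexp
      have e3 := (h.hasDerivAt_inv h.zero_mem).mul hg.hasDerivAt
      have e4 : inner = ψ * fun z => Complex.exp (t * Y (ψ z)) * Complex.exp (d z) := by
        funext z
        simp [hinner, mul_assoc]
      rw [e4, e3.deriv, h.inv_zero, hψ'0]
      ring
    have e5 : HasDerivAt (fun z => Ψ (φ' z)) (deriv Ψ (φ' 0) * deriv φ' 0) 0 := by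
      exact (hΨd _ (hφ'.mapsTo hb01)).hasDerivAt.comp (0 : ℂ) (hφ'.hasDerivAt hb01)
    rw [e5.deriv, hφ'.map_zero, e1, hρ'd]
    have e6 : Y 0 = ((Y 0).re : ℂ) := by
      apply Complex.ext <;> simp [hY0]
    rw [e6]
    push_cast
    simp only [Complex.ofReal_re]
    field_simp
  have hxc : ∀ ω : ℂ, ω ≠ 0 → ‖ω * Complex.exp (t * x ω)‖ = Real.exp (Real.log ‖ω‖ + t * (x ω).re) :=
    fun ω hω => by
    rw [norm_mul, Complex.norm_exp, Real.exp_add, Real.exp_log (norm_pos_iff.2 hω)]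
    simp
  have hexpe : ∀ y ∈ T, Real.exp (-η) ≤ ‖Complex.exp (e (q y))‖ ∧
      ‖Complex.exp (e (q y))‖ ≤ Real.exp η := fun y hy => by
    rw [Complex.norm_exp]
    have h1 := abs_le.1 ((Complex.abs_re_le_norm _).trans (he _ (hnot y hy)).2)
    exact ⟨Real.exp_le_exp.2 h1.1, Real.exp_le_exp.2 h1.2⟩
  -- boundary behaviour
  have hbd : ∀ η' > η, ∃ r < 1, ∀ z, r < ‖z‖ → ‖z‖ < 1 →
      Real.exp (-η') ≤ ‖Ψ (φ' z)‖ ∧ ‖Ψ (φ' z)‖ ≤ Real.exp η' := by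
    intro η' hη'
    obtain ⟨s, hs1, hs⟩ := exists_radius_abs_lt (g := fun ω => Real.log ‖ω‖ + t * (x ω).re)
      (ContinuousOn.add (continuous_norm.continuousOn.log fun z hz => (norm_pos_iff.2 hz).ne')
        (continuousOn_const.mul (Complex.continuous_re.comp_continuousOn hx.continuousOn)))
      (fun z hz => by simp [hz, hxr z hz]) (sub_pos.2 hη')
    -- `Q` is compact and misses the moved continuum, so its trace in the moved inside is compact.
    -- Points `φ' z` with `|z|` near `1` therefore avoid it and must come from `y` with `‖ψ y‖ > s`,
    -- where the outer formula controls the modulus.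
    set Q := {z | z ∈ U ∧ ‖ψ z‖ ≤ 8 / 10} ∪ q '' {z | z ∈ U ∧ 7 / 10 ≤ ‖ψ z‖ ∧ ‖ψ z‖ ≤ s}
    have hQ1 : {z | z ∈ U ∧ 7 / 10 ≤ ‖ψ z‖ ∧ ‖ψ z‖ ≤ s} ⊆ closedAnnulus a b := fun z hz =>
      mem_of_mem_nhds (hS z hz.1 (by linarith [hz.2.1]))
    have hQc : IsCompact Q := (h.isCompact_sublevel (by norm_num)).union
      ((h.isCompact_shell _ hs1).image_of_continuousOn fun z hz =>
        (hbox.differentiableAt_flowMap (hS z hz.1 (by linarith [hz.2.1]))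
          ht).continuousAt.continuousWithinAt)
    have hQK : ∀ z ∈ Q, z ∉ q '' K := by
      rintro z (hz | ⟨y, hy, rfl⟩)
      · exact hin z hz.1 hz.2
      · rintro ⟨k, hk, hky⟩
        have := hbox.injOn ht (hKa hk) (hQ1 hy) hky
        exact interiorDomain_subset hy.1 (this ▸ hk)
    have hQU : IsCompact (closure U' ∩ Q) := hQc.inter_left isClosed_closure
    have hQU' : closure U' ∩ Q ⊆ U' := fun z hz =>
      (hK'.closure_subset hz.1).resolve_right (hQK z hz.2)
    obtain ⟨r, hr1, hr⟩ : ∃ r < 1, ∀ z ∈ closure U' ∩ Q, ‖ψ' z‖ ≤ r := by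
      rcases (closure U' ∩ Q).eq_empty_or_nonempty with h0 | hne
      · exact ⟨0, one_pos, fun z hz => by rw [h0] at hz; exact hz.elim⟩
      · obtain ⟨z, hz, hmax⟩ := hQU.exists_isMaxOn hne
          (h'.inv_differentiableOn.continuousOn.mono hQU').norm
        exact ⟨‖ψ' z‖, h'.norm_inv_lt (hQU' hz), fun w hw => hmax hw⟩
    refine ⟨r, hr1, fun z hz hz1 => ?_⟩
    have hzb : z ∈ Metric.ball (0 : ℂ) 1 := mem_ball_zero_iff.2 hz1
    have hzU := hφ'.mapsTo hzb
    have hzQ : φ' z ∉ Q := fun h5 => by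
      have := hr _ ⟨subset_closure hzU, h5⟩
      rw [h'.left_inv z hzb] at this
      linarith
    rcases hcov _ hzU with h5 | ⟨y, hy, hyσ, hyz⟩
    · exact absurd (Or.inl ⟨h5.1, h5.2.le⟩) hzQ
    · have hyT : y ∈ T := ⟨hy, hyσ⟩
      have hys : s < ‖ψ y‖ := not_le.1 fun h5 => hzQ (Or.inr ⟨y, ⟨hy, hyσ.le, h5⟩, hyz⟩)
      have hψy : ψ y ≠ 0 := fun h6 => by rw [h6, norm_zero] at hyσ; linarith
      have h7 := abs_lt.1 (hs (ψ y) hys (h.norm_inv_lt hy))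
      obtain ⟨h8, h9⟩ := hexpe y hyT
      rw [← hyz]
      change _ ≤ ‖Ψ (q y)‖ ∧ ‖Ψ (q y)‖ ≤ _
      rw [hΨout y hyT, houtq y hyT, norm_mul, hxc _ hψy]
      constructor
      · calc Real.exp (-η') = Real.exp (-(η' - η)) * Real.exp (-η) := by
              rw [← Real.exp_add]; congr 1; ring
          _ ≤ _ := by gcongr; exact h7.1.le
      · calc _ ≤ Real.exp (η' - η) * Real.exp η := by gcongr; exact h7.2.le
          _ = Real.exp η' := by rw [← Real.exp_add]; congr 1; ring
  obtain ⟨L, hL, hLζ⟩ := exists_eq_mul_exp_of_boundary (f := fun z => Ψ (φ' z))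
    (ρ := ρ' / ρ * Real.exp (t * (Y 0).re)) (d := d 0) hη
    (fun z hz => ((hΨd _ (hφ'.mapsTo hz)).comp z
      (hφ'.hasDerivAt hz).differentiableAt).differentiableWithinAt)
    (by simp only [hφ'.map_zero, hΨ0])
    (fun z hz hz0 => hΨne _ (hφ'.mapsTo hz) fun h5 => hz0
      (hφ'.injOn hz hb01 (h5.trans hφ'.map_zero.symm)))
    (by positivity) (hd 0 h.zero_mem (by rw [h.inv_zero]; norm_num)).2 hderiv hbd hζ
  have hζb : ζ ∈ Metric.ball (0 : ℂ) 1 := mem_ball_zero_iff.2 (by linarith)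
  -- On the moved outer part `|Ψ|` is at least `(7/10) exp(-|t| X - η)`, whereas `|Ψ(φ' ζ)| ≤ (1/2)
  -- exp(7 η)`. The smallness assumption excludes this, since `exp(1/10) < 14/10`.
  have hzin : φ' ζ ∈ U ∧ ‖ψ (φ' ζ)‖ < 8 / 10 := by
    rcases hcov _ (hφ'.mapsTo hζb) with h5 | ⟨y, hy, hyσ, hyz⟩
    · exact h5
    · exfalso
      have hyT : y ∈ T := ⟨hy, hyσ⟩
      have hyz' : q y = φ' ζ := hyz
      rw [← hyz', hΨout y hyT, houtq y hyT] at hLζ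
      have h1 := congrArg norm hLζ
      rw [norm_mul, norm_mul, norm_mul, Complex.norm_exp (t * x (ψ y)), Complex.norm_exp L] at h1
      have h2 : L.re ≤ 7 * η := (Complex.re_le_norm L).trans hL
      have h3 : -(|t| * X) ≤ (t * x (ψ y)).re := by
        have h4 := hX (ψ y) hyσ.le (h.norm_inv_lt hy).le
        have h5 : |(t * x (ψ y)).re| ≤ |t| * X := by
          rw [Complex.re_ofReal_mul, abs_mul]
          gcongr
        exact (abs_le.1 h5).1
      have h4 := (hexpe y hyT).1
      have h5 : 7 / 10 * Real.exp (-(|t| * X)) * Real.exp (-η) ≤ 1 / 2 * Real.exp (7 * η) := by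
        calc _ ≤ ‖ψ y‖ * Real.exp (t * x (ψ y)).re * ‖Complex.exp (e (q y))‖ := by gcongr
          _ = ‖ζ‖ * Real.exp L.re := h1
          _ ≤ _ := by gcongr
      have h6 : Real.exp (|t| * X + 8 * η) < 14 / 10 := by
        refine (Real.exp_le_exp.2 hsmall).trans_lt ?_
        have := Real.exp_bound_div_one_sub_of_interval (x := 1 / 10) (by norm_num) (by norm_num)
        refine this.trans_lt (by norm_num)
      have h7 : Real.exp (|t| * X + 8 * η) * (Real.exp (-(|t| * X)) * Real.exp (-η))
          = Real.exp (7 * η) := by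
        rw [← Real.exp_add, ← Real.exp_add]; congr 1; ring
      have h8 : 0 < Real.exp (-(|t| * X)) * Real.exp (-η) := by positivity
      nlinarith
  refine ⟨hzin.1, hzin.2, L - d (φ' ζ), ?_, ?_⟩
  · refine (norm_sub_le _ _).trans ?_
    linarith [(hd _ hzin.1 (by linarith [hzin.2])).2]
  · simp only [hΨin _ hzin, hinner] at hLζ
    rw [Complex.exp_sub, ← mul_div_assoc, ← hLζ, mul_div_cancel_right₀ _ (Complex.exp_ne_zero _)]

/-! ### First variation of the interior uniformization -/

/-- From the implicit equation for the moved uniformization to its first order expansion. -/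
theorem IsUniformization.exists_expansion_of_eq {U : Set ℂ} {φ ψ : ℂ → ℂ}
    (h : IsUniformization U φ ψ) {Y : ℂ → ℂ} (hY : DifferentiableOn ℂ Y (Metric.ball 0 1)) {c : ℝ}
    (hc : 0 ≤ c) : ∃ C, 0 ≤ C ∧ ∃ δ > 0, ∀ t : ℝ, |t| < δ → ∀ ζ : ℂ, ‖ζ‖ ≤ 1 / 2 → ∀ z ∈ U,
      ‖ψ z‖ < 8 / 10 → ∀ L : ℂ, ‖L‖ ≤ c * t ^ 2 →
      ψ z * Complex.exp (t * Y (ψ z)) = ζ * Complex.exp L →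
      ‖z - φ ζ + t * (deriv φ ζ * ζ * Y ζ)‖ ≤ C * t ^ 2 := by
  have hsub : ∀ {s : ℝ}, s < 1 → Metric.closedBall (0 : ℂ) s ⊆ Metric.ball 0 1 := fun hs =>
    Metric.closedBall_subset_ball hs
  obtain ⟨Y₀, hY₀⟩ := (isCompact_closedBall (0 : ℂ) (8 / 10)).exists_bound_of_continuousOn
    (hY.continuousOn.mono (hsub (by norm_num)))
  obtain ⟨Y₁, hY₁⟩ := (isCompact_closedBall (0 : ℂ) (8 / 10)).exists_bound_of_continuousOn
    ((hY.deriv Metric.isOpen_ball).continuousOn.mono (hsub (by norm_num)))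
  obtain ⟨P₀, hP₀⟩ := (isCompact_closedBall (0 : ℂ) (9 / 10)).exists_bound_of_continuousOn
    (h.differentiableOn.continuousOn.mono (hsub (by norm_num)))
  obtain ⟨P₁, hP₁⟩ := (isCompact_closedBall (0 : ℂ) (9 / 10)).exists_bound_of_continuousOn
    ((h.differentiableOn.deriv Metric.isOpen_ball).continuousOn.mono (hsub (by norm_num)))
  have h0 : ∀ {s : ℝ}, 0 ≤ s → (0 : ℂ) ∈ Metric.closedBall (0 : ℂ) s := fun hs =>
    Metric.mem_closedBall_self hs
  have hY₀0 : 0 ≤ Y₀ := (norm_nonneg _).trans (hY₀ 0 (h0 (by norm_num)))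
  have hY₁0 : 0 ≤ Y₁ := (norm_nonneg _).trans (hY₁ 0 (h0 (by norm_num)))
  have hP₀0 : 0 ≤ P₀ := (norm_nonneg _).trans (hP₀ 0 (h0 (by norm_num)))
  have hP₁0 : 0 ≤ P₁ := (norm_nonneg _).trans (hP₁ 0 (h0 (by norm_num)))
  set k := c + Y₀ with hk
  set C₂ := 1 / 2 * k ^ 2 + 1 / 2 * c + 1 / 2 * (Y₁ * k) with hC₂
  have hk0 : 0 ≤ k := by positivity
  refine ⟨4 * P₀ / (4 / 10) ^ 2 * k ^ 2 + P₁ * C₂, by positivity, min 1 (1 / (4 * (k + 1))),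
    by positivity, fun t ht ζ hζ z hz hψz L hL heq => ?_⟩
  rw [lt_min_iff, lt_div_iff₀ (by positivity)] at ht
  obtain ⟨ht1, htk⟩ := ht
  have ht2 : t ^ 2 ≤ |t| := by
    rw [← sq_abs]; nlinarith [abs_nonneg t]
  set ω := ψ z with hω
  have hωb : ω ∈ Metric.closedBall (0 : ℂ) (8 / 10) := by simpa using hψz.le
  have hζb : ζ ∈ Metric.closedBall (0 : ℂ) (8 / 10) := by
    rw [mem_closedBall_zero_iff]; linarith
  -- The equation becomes `ω = ζ exp u` with `u = O(t)`. Replacing `Y ω` by `Y ζ` costs another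
  -- `O(t)`, so `ω = ζ - t ζ Y ζ + O(t²)`; applying `φ` gives the expansion of `z`.
  set u := L - t * Y ω with hu
  have hωu : ω = ζ * Complex.exp u := by
    rw [hu, Complex.exp_sub, ← mul_div_assoc, ← heq, mul_div_cancel_right₀ _ (Complex.exp_ne_zero _)]
  have huk : ‖u‖ ≤ k * |t| := by
    refine (norm_sub_le _ _).trans ?_
    rw [norm_mul, Complex.norm_real, Real.norm_eq_abs]
    have h1 := hY₀ ω hωb
    calc ‖L‖ + |t| * ‖Y ω‖ ≤ c * |t| + |t| * Y₀ := by
          refine add_le_add (hL.trans (by gcongr)) (by gcongr)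
      _ = _ := by ring
  have hu1 : ‖u‖ ≤ 1 := huk.trans (by nlinarith [abs_nonneg t])
  have hωζ : ‖ω - ζ‖ ≤ k * |t| := by
    have e : ω - ζ = ζ * (Complex.exp u - 1) := by rw [hωu]; ring
    rw [e, norm_mul]
    have := Complex.norm_exp_sub_one_le hu1
    nlinarith [norm_nonneg ζ, norm_nonneg u]
  have hYL : ‖Y ω - Y ζ‖ ≤ Y₁ * (k * |t|) := by
    refine ((convex_closedBall (0 : ℂ) (8 / 10)).norm_image_sub_le_of_norm_deriv_le
      (fun w hw => hY.differentiableAt (Metric.isOpen_ball.mem_nhds (hsub (by norm_num) hw)))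
      hY₁ hζb hωb).trans ?_
    gcongr
  have hmain : ‖ω - ζ + t * (ζ * Y ζ)‖ ≤ C₂ * t ^ 2 := by
    have e : ω - ζ + t * (ζ * Y ζ)
        = ζ * (Complex.exp u - 1 - u) + ζ * L - ζ * (t * (Y ω - Y ζ)) := by
      rw [show ω - ζ = ζ * Complex.exp u - ζ by rw [← hωu]]
      simp only [hu]; ring
    rw [e]
    refine (norm_sub_le _ _).trans ((add_le_add_left (norm_add_le _ _) _).trans ?_)
    rw [norm_mul, norm_mul, norm_mul, norm_mul, Complex.norm_real, Real.norm_eq_abs]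
    have h1 := Complex.norm_exp_sub_one_sub_id_le hu1
    calc _ ≤ 1 / 2 * (k * |t|) ^ 2 + 1 / 2 * (c * t ^ 2) + 1 / 2 * (|t| * (Y₁ * (k * |t|))) := by
          have h2 : ‖u‖ ^ 2 ≤ (k * |t|) ^ 2 := by gcongr
          gcongr
          exact h1.trans h2
      _ = _ := by rw [mul_pow, sq_abs, ← sq_abs t]; ring
  have hball : Metric.ball ζ (4 / 10) ⊆ Metric.closedBall 0 (9 / 10) := fun w hw => by
    rw [mem_ball_iff_norm] at hw
    rw [mem_closedBall_zero_iff]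
    have := norm_sub_norm_le w ζ
    linarith
  have htaylor := norm_sub_sub_deriv_le (h.differentiableOn.mono (hball.trans (hsub (by norm_num))))
    (fun w hw => hP₀ w (hball hw)) (show ω ∈ Metric.ball ζ (4 / 10) by
      rw [mem_ball_iff_norm]
      nlinarith [abs_nonneg t])
  have e : z - φ ζ + t * (deriv φ ζ * ζ * Y ζ)
      = (φ ω - φ ζ - deriv φ ζ * (ω - ζ)) + deriv φ ζ * (ω - ζ + t * (ζ * Y ζ)) := by
    rw [hω, h.right_inv z hz]; ring
  rw [e]
  refine (norm_add_le _ _).trans ?_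
  rw [norm_mul]
  calc _ ≤ 4 * P₀ / (4 / 10) ^ 2 * (k * |t|) ^ 2 + P₁ * (C₂ * t ^ 2) := by
        refine add_le_add (htaylor.trans (by gcongr)) ?_
        gcongr
        exact hP₁ ζ (by rw [mem_closedBall_zero_iff]; linarith)
    _ = _ := by rw [mul_pow, sq_abs]; ring

/-- First variation of the interior uniformization under the flow of a vector field. -/
theorem IsEnclosing.exists_variation_bound {K : Set ℂ} (hK : IsEnclosing K) {φ ψ : ℂ → ℂ}
    (h : IsUniformization (interiorDomain K) φ ψ) {v : ℂ[T;T⁻¹]} {a b ε : ℝ} {M : NNReal}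
    (hbox : IsFlowBox v a b ε M) (hKa : K ⊆ closedAnnulus a b)
    (hS : ∀ z ∈ interiorDomain K, 1 / 2 ≤ ‖ψ z‖ → closedAnnulus a b ∈ 𝓝 z)
    {x Y : ℂ → ℂ} (hx : DifferentiableOn ℂ x {0}ᶜ) (hxr : ∀ z, ‖z‖ = 1 → (x z).re = 0)
    (hY : DifferentiableOn ℂ Y (Metric.ball 0 1)) (hY0 : (Y 0).im = 0)
    (hE : ∀ ζ ∈ Metric.ball (0 : ℂ) 1, ζ ≠ 0 →
      fieldAt v (φ ζ) = ζ * deriv φ ζ * (x ζ - Y ζ)) :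
    ∃ C, 0 ≤ C ∧ ∃ δ > 0, δ ≤ ε ∧ ∀ t, |t| < δ → IsEnclosing (flowMap v t '' K) ∧ (t ≠ 0 →
      ∀ φ', IsInteriorMap (interiorDomain (flowMap v t '' K)) φ' → ∀ ζ : ℂ, ‖ζ‖ ≤ 1 / 2 →
        ‖φ' ζ - φ ζ + t * (deriv φ ζ * ζ * Y ζ)‖ ≤ C * t ^ 2) := by
  -- The nested radii: the overlap lives on the shell from `1/2` to `95/100`, the splitting is exact
  -- from `6/10` to `9/10`, and the pieces are glued between `7/10` and `8/10`.
  obtain ⟨C₁, hC₁, δ₁, hδ₁, hδ₁ε, H₁⟩ := h.exists_overlap hbox (s₁ := 1 / 2) (s₂ := 95 / 100)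
    (by norm_num) (by norm_num) (fun z hz hz1 _ => hS z hz hz1) hx hY hE
  obtain ⟨B, hB, HB⟩ := h.exists_splitting (s₁ := 1 / 2) (c₁ := 6 / 10) (c₂ := 9 / 10)
    (s₂ := 95 / 100) (by norm_num) (by norm_num) (by norm_num) (by norm_num)
  obtain ⟨δ₂, hδ₂, -, H₂⟩ := hK.exists_cover h hbox (s₁ := 6 / 10) (σ₁ := 7 / 10) (σ₂ := 8 / 10)
    (s₂ := 9 / 10) (by norm_num) (by norm_num) (by norm_num) (by norm_num) (by norm_num) hKa
    (fun z hz hz1 => hS z hz (by linarith))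
  obtain ⟨X₀, hX₀⟩ := (isCompact_closedAnnulus (7 / 10) 1).exists_bound_of_continuousOn
    (f := fun z => (x z).re) ((Complex.continuous_re.comp_continuousOn hx.continuousOn).mono
      fun z hz h0 => zero_notMem_closedAnnulus (by norm_num : (0 : ℝ) < 7 / 10)
        ((show z = 0 from h0) ▸ hz))
  set X := max X₀ 0
  have hX0 : 0 ≤ X := le_max_right _ _
  -- The `+ 1` makes the error bound `k t²` strictly positive for `t ≠ 0`, as the comparison
  -- requires.
  set k := B * C₁ + 1 with hk
  have hk0 : 0 < k := by positivity
  obtain ⟨C, hC, δ₃, hδ₃, H₃⟩ := h.exists_expansion_of_eq hY (c := 8 * k) (by positivity)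
  -- The last bound on `t` gives `|t| X + 8 k t² ≤ 1/10`, since `t² ≤ |t|`.
  refine ⟨C, hC, min δ₁ (min δ₂ (min δ₃ (min 1 (1 / (10 * (X + 8 * k)))))), by positivity,
    (min_le_left _ _).trans hδ₁ε, fun t ht => ?_⟩
  rw [lt_min_iff, lt_min_iff, lt_min_iff, lt_min_iff, lt_div_iff₀ (by positivity)] at ht
  obtain ⟨ht1, ht2, ht3, ht4, ht5⟩ := ht
  obtain ⟨hK', hin, hout, hcov⟩ := H₂ t ht2
  refine ⟨hK', fun ht0 φ' hφ' ζ hζ => ?_⟩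
  obtain ⟨D, hD, HD⟩ := H₁ t ht1
  obtain ⟨d, e, hd, he, hde⟩ := HB D (C₁ * t ^ 2) hD fun z hz hz1 hz2 => (HD z hz hz1.le hz2.le).1
  have hη : B * (C₁ * t ^ 2) ≤ k * t ^ 2 := by
    rw [hk]; nlinarith [sq_nonneg t]
  have ht' : t ^ 2 ≤ |t| := by
    rw [← sq_abs]; nlinarith [abs_nonneg t]
  obtain ⟨hzU, hzψ, L, hL, hLeq⟩ := h.exists_eq_mul_exp hbox hKa
    (fun z hz hz1 => hS z hz (by linarith)) (ht1.trans_le hδ₁ε) hK' hin hout hcov hx hxr hY hY0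
    (d := d) (e := e) (η := k * t ^ 2) (X := X) (by positivity)
    (fun z hz hz1 => ⟨(hd z hz hz1).1, (hd z hz hz1).2.trans hη⟩)
    (fun z hz => ⟨(he z hz).1, (he z hz).2.trans hη⟩)
    (fun z hz hz1 hz2 => by
      rw [(HD z hz (by linarith) (by linarith)).2, hde z hz hz1 hz2, Complex.exp_sub, mul_assoc,
        div_mul_cancel₀ _ (Complex.exp_ne_zero _)])
    (fun ω hω hω1 => (hX₀ ω ⟨hω, hω1⟩).trans (le_max_left _ _))
    (by nlinarith [abs_nonneg t]) hφ' hζ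
  refine H₃ t ht3 ζ hζ _ hzU hzψ L ?_ hLeq
  rwa [mul_assoc]

/-! ## Taylor coefficients -/

theorem norm_iteratedDeriv_le_of_norm_le {f : ℂ → ℂ} {s r C : ℝ} (n : ℕ) (hr : 0 < r) (hrs : r < s)
    (hf : DifferentiableOn ℂ f (Metric.ball 0 s)) (hC : ∀ z, ‖z‖ ≤ r → ‖f z‖ ≤ C) :
    ‖iteratedDeriv n f 0‖ ≤ n.factorial * C / r ^ n := by
  refine Complex.norm_iteratedDeriv_le_of_forall_mem_sphere_norm_le n hr ?_ fun z hz => hC z ?_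
  · refine DifferentiableOn.diffContOnCl ?_
    rw [closure_ball (0 : ℂ) hr.ne']
    exact hf.mono (Metric.closedBall_subset_ball hrs)
  · exact (mem_sphere_zero_iff_norm.1 hz).le

/-- A first order expansion of holomorphic functions, uniform near `0`, can be differentiated. -/
theorem hasDerivAt_iteratedDeriv {f : ℝ → ℂ → ℂ} {W : ℂ → ℂ} {s r C δ : ℝ} (n : ℕ) (hr : 0 < r)
    (hrs : r < s) (hδ : 0 < δ) (hf : ∀ t, |t| < δ → DifferentiableOn ℂ (f t) (Metric.ball 0 s))
    (hW : DifferentiableOn ℂ W (Metric.ball 0 s))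
    (hC : ∀ t, |t| < δ → ∀ z, ‖z‖ ≤ r → ‖f t z - f 0 z - t * W z‖ ≤ C * t ^ 2) :
    HasDerivAt (fun t => iteratedDeriv n (f t) 0) (iteratedDeriv n W 0) 0 := by
  have hs0 : (0 : ℂ) ∈ Metric.ball (0 : ℂ) s := Metric.mem_ball_self (hr.trans hrs)
  have hcd : ∀ g : ℂ → ℂ, DifferentiableOn ℂ g (Metric.ball 0 s) → ContDiffAt ℂ n g 0 := fun g hg =>
    ((hg.contDiffOn Metric.isOpen_ball).contDiffAt (Metric.isOpen_ball.mem_nhds hs0))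
  have h00 : |(0 : ℝ)| < δ := by simpa using hδ
  rw [hasDerivAt_iff_isLittleO]
  have h1 : (fun t : ℝ => iteratedDeriv n (f t) 0 - iteratedDeriv n (f 0) 0
      - (t - 0) • iteratedDeriv n W 0) =O[𝓝 0] fun t : ℝ => t ^ 2 := by
    refine Asymptotics.IsBigO.of_bound (n.factorial * C / r ^ n) ?_
    filter_upwards [Metric.ball_mem_nhds (0 : ℝ) hδ] with t ht
    have ht' : |t| < δ := by simpa using ht
    have h2 : iteratedDeriv n (f t) 0 - iteratedDeriv n (f 0) 0 - (t - 0) • iteratedDeriv n W 0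
        = iteratedDeriv n (fun z => f t z - f 0 z - t * W z) 0 := by
      rw [iteratedDeriv_fun_sub ((hcd _ (hf t ht')).sub (hcd _ (hf 0 h00)))
        (contDiffAt_const.mul (hcd W hW)), iteratedDeriv_fun_sub (hcd _ (hf t ht')) (hcd _ (hf 0 h00)),
        iteratedDeriv_const_mul_field]
      simp
    rw [h2]
    refine (norm_iteratedDeriv_le_of_norm_le n hr hrs
      (((hf t ht').sub (hf 0 h00)).sub (hW.const_mul _)) (hC t ht')).trans_eq ?_
    rw [Real.norm_of_nonneg (sq_nonneg t)]
    ring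
  refine h1.trans_isLittleO ?_
  simpa using! (Asymptotics.isLittleO_pow_pow (one_lt_two : 1 < 2) :
    (fun x : ℝ => x ^ 2) =o[𝓝 0] fun x => x ^ 1)

theorem exists_entire_mul_pow (v : ℂ[T;T⁻¹]) : ∃ (N : ℕ) (P : ℂ → ℂ), Differentiable ℂ P ∧
    ∀ z, z ≠ 0 → fieldAt v z * z ^ N = P z := by
  obtain ⟨N, hN⟩ : ∃ N : ℕ, ∀ n ∈ v.coeff.support, 0 ≤ n + N := by
    refine ⟨v.coeff.support.sup Int.natAbs, fun n hn => ?_⟩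
    have h1 : n.natAbs ≤ v.coeff.support.sup Int.natAbs := Finset.le_sup hn
    omega
  refine ⟨N, fun z => ∑ n ∈ v.coeff.support, v.coeff n * z ^ (n + N).toNat, by fun_prop,
    fun z hz => ?_⟩
  rw [fieldAt, Finsupp.sum, Finset.sum_mul]
  refine Finset.sum_congr rfl fun n hn => ?_
  rw [mul_assoc, ← zpow_natCast z N, ← zpow_add₀ hz, ← zpow_natCast z (n + N).toNat,
    Int.toNat_of_nonneg (hN n hn)]

/-! ## Bounds for uniformizations of continua in an annulus -/

section Bounds

variable {K : Set ℂ} (hK : IsEnclosing K) {φ : ℂ → ℂ} (hφ : IsInteriorMap (interiorDomain K) φ)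
  {m R : ℝ} (hKm : K ⊆ closedAnnulus m R)
include hK hφ hKm

theorem IsInteriorMap.norm_lt {z : ℂ} (hz : z ∈ Metric.ball (0 : ℂ) 1) : ‖φ z‖ < R + 1 :=
  hK.norm_lt (fun w hw => by linarith [(hKm hw).2]) _ (hφ.mapsTo hz)

/-- The Schwarz lemma for the inverse map on the disc of radius `m`, which lies inside `K`. -/
theorem IsInteriorMap.le_norm_deriv (hm : 0 < m) : m ≤ ‖deriv φ 0‖ := by
  obtain ⟨ψ, h⟩ := hφ.exists_isUniformization
  have hsub : Metric.ball (0 : ℂ) m ⊆ interiorDomain K :=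
    ball_subset_interiorDomain fun z hz => (hKm hz).1
  have h1 := Complex.norm_deriv_le_div_of_mapsTo_ball (h.inv_differentiableOn.mono hsub)
    (R₂ := 1) (fun z hz => by
      rw [h.inv_zero, mem_closedBall_zero_iff]
      exact (h.norm_inv_lt (hsub hz)).le) hm
  have h2 := congrArg norm (h.deriv_mul_deriv_inv hK.zero_mem)
  rw [h.inv_zero, norm_mul, norm_one] at h2
  rw [le_div_iff₀ hm] at h1
  nlinarith [norm_nonneg (deriv φ 0), norm_nonneg (deriv ψ 0)]

theorem IsInteriorMap.norm_deriv_le {z : ℂ} (hz : ‖z‖ < 1 / 2) : ‖deriv φ z‖ ≤ 2 * (R + 1) := by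
  have hsub : Metric.closedBall z (1 / 2) ⊆ Metric.ball 0 1 := fun w hw => by
    rw [mem_closedBall_iff_norm] at hw
    rw [mem_ball_zero_iff]
    have := norm_sub_norm_le w z
    linarith
  refine (Complex.norm_deriv_le_of_forall_mem_sphere_norm_le (C := R + 1) (R := 1 / 2) one_half_pos
    ?_ fun w hw => (hφ.norm_lt hK hKm (hsub (Metric.sphere_subset_closedBall hw))).le).trans_eq
    (by ring)
  refine DifferentiableOn.diffContOnCl ?_
  rw [closure_ball _ (by norm_num)]
  exact hφ.differentiableOn.mono hsub

/-- The derivative at `0` is at least `m`. On a disc whose radius depends only on `m` and `R`,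
Cauchy-type estimates keep both `φ(z)/z` and `φ'(z)` within `m / 2` of it. -/
theorem IsInteriorMap.near_zero (hm : 0 < m) {z : ℂ} (hz : ‖z‖ ≤ min (1 / 4) (m / (16 * (R + 1)))) :
    m / 2 ≤ ‖dslope φ 0 z‖ ∧ m / 2 ≤ ‖deriv φ z‖ := by
  rw [le_min_iff] at hz
  have hR : 0 < R + 1 := (norm_nonneg _).trans_lt
    (hφ.norm_lt hK hKm (Metric.mem_ball_self one_pos))
  have hz2 : (R + 1) * ‖z‖ ≤ m / 16 := by
    have := hz.2
    rw [le_div_iff₀ (by positivity)] at this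
    linarith
  have h0 := hφ.le_norm_deriv hK hKm hm
  have hzb : z ∈ Metric.ball (0 : ℂ) 1 := mem_ball_zero_iff.2 (by linarith [hz.1])
  constructor
  · rcases eq_or_ne z 0 with rfl | hz0
    · rw [dslope_same]; linarith
    · have h1 := norm_sub_sub_deriv_le hφ.differentiableOn
        (fun w hw => (hφ.norm_lt hK hKm hw).le) hzb
      rw [hφ.map_zero, sub_zero, sub_zero] at h1
      have hzn : 0 < ‖z‖ := norm_pos_iff.2 hz0
      have h2 : ‖dslope φ 0 z - deriv φ 0‖ ≤ m / 2 := by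
        have e : dslope φ 0 z - deriv φ 0 = (φ z - deriv φ 0 * z) / z := by
          rw [dslope_of_ne _ hz0, slope_def_field, hφ.map_zero]
          field_simp
          ring
        rw [e, norm_div, div_le_iff₀ hzn]
        refine h1.trans ?_
        nlinarith
      have h3 := norm_sub_norm_le (deriv φ 0) (dslope φ 0 z)
      rw [norm_sub_rev] at h3
      linarith
  · have h1 := norm_sub_le_of_bounded_on_ball (f := deriv φ) (z := 0) (w := z) (r := 1 / 2)
      (M := 2 * (R + 1)) ((hφ.differentiableOn.deriv Metric.isOpen_ball).mono
        (Metric.ball_subset_ball (by norm_num)))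
      (fun w hw => hφ.norm_deriv_le hK hKm (mem_ball_zero_iff.1 hw))
      (mem_ball_zero_iff.2 (by linarith [hz.1]))
    rw [sub_zero] at h1
    have h3 := norm_sub_norm_le (deriv φ 0) (deriv φ z)
    rw [norm_sub_rev] at h3
    have h4 : 2 * (2 * (R + 1)) / (1 / 2) * ‖z‖ = 8 * ((R + 1) * ‖z‖) := by ring
    linarith

end Bounds

/-! ## Differentiability of the coefficients -/

/-- The annulus has to contain `K` together with the outer part of its inside, and a neighbourhood
of each point of the latter, where the flow is used as a holomorphic map. -/
theorem IsEnclosing.exists_isFlowBox {K : Set ℂ} (hK : IsEnclosing K) {φ ψ : ℂ → ℂ}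
    (h : IsUniformization (interiorDomain K) φ ψ) (v : ℂ[T;T⁻¹]) : ∃ a b ε M,
    IsFlowBox v a b ε M ∧ K ⊆ closedAnnulus a b ∧
      ∀ z ∈ interiorDomain K, 1 / 2 ≤ ‖ψ z‖ → closedAnnulus a b ∈ 𝓝 z := by
  obtain ⟨m, hm, hKm⟩ := hK.exists_pos_le_norm
  obtain ⟨R, hR⟩ := hK.isCompact.isBounded.exists_norm_le
  obtain ⟨m', hm', hsub⟩ := Metric.isOpen_iff.1 (h.isOpen_sublevel (1 / 2)) 0
    ⟨h.zero_mem, by rw [h.inv_zero]; norm_num⟩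
  obtain ⟨ε, M, hbox⟩ := LoopMeasure.exists_isFlowBox v (a := min m m' / 2) (R + 1) (by positivity)
  refine ⟨_, _, ε, M, hbox, fun z hz => ⟨?_, by linarith [hR z hz]⟩, fun z hz hz1 => ?_⟩
  · have := min_le_left m m'
    have : 0 < min m m' := lt_min hm hm'
    linarith [hKm z hz]
  · have h1 : m' ≤ ‖z‖ := not_lt.1 fun h2 => absurd (hsub (mem_ball_zero_iff.2 h2)).2 (not_lt.2 hz1)
    have h2 := hK.norm_lt (R := R + 1) (fun w hw => by linarith [hR w hw]) z hz
    have h3 := min_le_right m m'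
    have h4 : 0 < min m m' := lt_min hm hm'
    refine mem_of_superset (((isOpen_lt continuous_const continuous_norm).inter
      (isOpen_lt continuous_norm continuous_const)).mem_nhds
      ⟨(by linarith : min m m' / 2 < ‖z‖), h2⟩) fun w hw => ⟨hw.1.le, hw.2.le⟩

/-- Writing `v = P / z ^ N`, the pulled-back field divided by `ζ φ'` is `A / ζ ^ (N + 1)` with `A =
P(φ) / ((φ/ζ)^N φ')` holomorphic, and the splitting applies. Only bounds on a small fixed disc are
claimed: they are uniform over all continua in the annulus, and they suffice for Taylor coefficients
at `0`. -/
theorem exists_tangential_field (v : ℂ[T;T⁻¹]) {m : ℝ} (R : ℝ) (hm : 0 < m) : ∃ r, 0 < r ∧ r < 1 / 2 ∧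
    ∃ C, 0 ≤ C ∧ ∀ K, IsEnclosing K → K ⊆ closedAnnulus m R →
      ∀ φ, IsInteriorMap (interiorDomain K) φ → ∃ x Y : ℂ → ℂ,
        DifferentiableOn ℂ x {0}ᶜ ∧ (∀ z, ‖z‖ = 1 → (x z).re = 0) ∧
        DifferentiableOn ℂ Y (Metric.ball 0 1) ∧ (Y 0).im = 0 ∧
        (∀ ζ, ‖ζ‖ ≤ r → ‖-(deriv φ ζ * ζ * Y ζ)‖ ≤ C) ∧
        ∀ ζ ∈ Metric.ball (0 : ℂ) 1, ζ ≠ 0 → fieldAt v (φ ζ) = ζ * deriv φ ζ * (x ζ - Y ζ) := by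
  obtain ⟨N, P, hP, hPv⟩ := exists_entire_mul_pow v
  set R₁ := |R| + 1 with hR₁
  set r := min (1 / 4) (m / (16 * R₁)) with hr
  have hr0 : 0 < r := by positivity
  have hr4 : r ≤ 1 / 4 := min_le_left _ _
  obtain ⟨C, hC, HC⟩ := exists_tangent_add_holomorphic (N + 1) hr0 (by linarith)
  obtain ⟨B, hB⟩ := (isCompact_closedBall (0 : ℂ) R₁).exists_bound_of_continuousOn
    hP.continuous.continuousOn
  have hB0 : 0 ≤ B := (norm_nonneg _).trans (hB 0 (Metric.mem_closedBall_self (by positivity)))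
  refine ⟨r, hr0, by linarith, 2 * R₁ * 1 * (C * (B / ((m / 2) ^ N * (m / 2)))), by positivity,
    fun K hK hKm φ hφ => ?_⟩
  have hKm' : K ⊆ closedAnnulus m |R| := fun z hz => ⟨(hKm hz).1, (hKm hz).2.trans (le_abs_self R)⟩
  have hdd : DifferentiableOn ℂ (deriv φ) (Metric.ball 0 1) :=
    hφ.differentiableOn.deriv Metric.isOpen_ball
  have hds : DifferentiableOn ℂ (dslope φ 0) (Metric.ball 0 1) :=
    (Complex.differentiableOn_dslope (Metric.ball_mem_nhds 0 one_pos)).2 hφ.differentiableOn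
  have hφne : ∀ ζ ∈ Metric.ball (0 : ℂ) 1, ζ ≠ 0 → φ ζ ≠ 0 := fun ζ hζ h0 h1 => h0
    (hφ.injOn hζ (Metric.mem_ball_self one_pos) (h1.trans hφ.map_zero.symm))
  have hds0 : ∀ ζ, ζ ≠ 0 → dslope φ 0 ζ = φ ζ / ζ := fun ζ hζ => by
    rw [dslope_of_ne _ hζ, slope_def_field, hφ.map_zero, sub_zero, sub_zero]
  have hdsne : ∀ ζ ∈ Metric.ball (0 : ℂ) 1, dslope φ 0 ζ ≠ 0 := fun ζ hζ => by
    rcases eq_or_ne ζ 0 with rfl | h0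
    · rw [dslope_same]; exact hφ.deriv_ne_zero hζ
    · rw [hds0 ζ h0]; exact div_ne_zero (hφne ζ hζ h0) h0
  set A : ℂ → ℂ := fun ζ => P (φ ζ) / (dslope φ 0 ζ ^ N * deriv φ ζ) with hA
  have hAd : DifferentiableOn ℂ A (Metric.ball 0 1) :=
    (hP.comp_differentiableOn hφ.differentiableOn).div ((hds.pow N).mul hdd) fun ζ hζ =>
      mul_ne_zero (pow_ne_zero _ (hdsne ζ hζ)) (hφ.deriv_ne_zero hζ)
  obtain ⟨x, Y, hx, hxr, hY, hY0, hYB, hYx⟩ := HC A (B / ((m / 2) ^ N * (m / 2))) hAd (by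
    intro ζ hζ
    have hζb : ζ ∈ Metric.ball (0 : ℂ) 1 := mem_ball_zero_iff.2 (by linarith)
    obtain ⟨h1, h2⟩ := hφ.near_zero hK hKm' hm hζ
    simp only [hA]
    rw [norm_div, norm_mul, norm_pow]
    have h3 := hB (φ ζ) (by
      rw [mem_closedBall_zero_iff]
      exact (hφ.norm_lt hK hKm' hζb).le)
    gcongr)
  refine ⟨x, Y, hx, hxr, hY, hY0, fun ζ hζ => ?_, fun ζ hζ h0 => ?_⟩
  · rw [norm_neg, norm_mul, norm_mul]
    have h1 := hφ.norm_deriv_le hK hKm' (z := ζ) (by linarith)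
    have h2 := hYB ζ hζ
    have h3 : ‖ζ‖ ≤ 1 := by linarith
    have h4 : 0 ≤ 2 * R₁ := by positivity
    gcongr
  · rw [hYx ζ hζ h0]
    simp only [hA]
    have h1 := hPv (φ ζ) (hφne ζ hζ h0)
    rw [← h1, hds0 ζ h0, div_pow]
    have h2 := hφne ζ hζ h0
    have h3 := hφ.deriv_ne_zero hζ
    field_simp
    ring

/-- A continuum enclosing `0` keeps enclosing it for a short time, and the Taylor coefficients of
its interior uniformization are differentiable in time, with locally uniform bounds. -/
theorem exists_hasDerivAt_iteratedDeriv_phiPlus (v : ℂ[T;T⁻¹]) {m : ℝ} (R : ℝ) (hm : 0 < m) (n : ℕ) :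
    ∃ C, ∀ K, IsEnclosing K → K ⊆ closedAnnulus m R → (∀ᶠ t in 𝓝 0, IsEnclosing (flowImage v t K)) ∧
      ‖iteratedDeriv n (phiPlus K) 0‖ ≤ C ∧
      ∃ c, ‖c‖ ≤ C ∧
        HasDerivAt (fun t => iteratedDeriv n (phiPlus (flowImage v t K)) 0) c 0 := by
  obtain ⟨r, hr, hr2, C, hC, H⟩ := exists_tangential_field v R hm
  refine ⟨max (n.factorial * (R + 1) / (1 / 2) ^ n) (n.factorial * C / r ^ n), fun K hK hKm => ?_⟩
  have hφ := hK.isInteriorMap_phiPlus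
  obtain ⟨ψ, h⟩ := hφ.exists_isUniformization
  obtain ⟨x, Y, hx, hxr, hY, hY0, hYC, hE⟩ := H K hK hKm _ hφ
  obtain ⟨a, b, ε, M, hbox, hKa, hS⟩ := hK.exists_isFlowBox h v
  obtain ⟨C', hC', δ, hδ, hδε, HV⟩ := hK.exists_variation_bound h hbox hKa hS hx hxr hY hY0 hE
  have hflow : ∀ t, |t| < δ → flowImage v t K = flowMap v t '' K := fun t ht =>
    hbox.flowImage_eq hKa (ht.trans_le hδε)
  have hbd : Metric.ball (0 : ℝ) δ ∈ 𝓝 0 := Metric.ball_mem_nhds 0 hδ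
  have hmem : ∀ t ∈ Metric.ball (0 : ℝ) δ, |t| < δ := fun t ht => by simpa using ht
  have hdd : DifferentiableOn ℂ (deriv (phiPlus K)) (Metric.ball 0 1) :=
    hφ.differentiableOn.deriv Metric.isOpen_ball
  have hWd : DifferentiableOn ℂ (fun ζ => -(deriv (phiPlus K) ζ * ζ * Y ζ)) (Metric.ball 0 1) :=
    ((hdd.mul differentiableOn_id).mul hY).neg
  refine ⟨?_, (norm_iteratedDeriv_le_of_norm_le n one_half_pos one_half_lt_one hφ.differentiableOn
    fun z hz => (hφ.norm_lt hK hKm (mem_ball_zero_iff.2 (by linarith))).le).trans (le_max_left _ _),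
    iteratedDeriv n (fun ζ => -(deriv (phiPlus K) ζ * ζ * Y ζ)) 0,
    (norm_iteratedDeriv_le_of_norm_le n hr (by linarith) hWd hYC).trans (le_max_right _ _), ?_⟩
  · filter_upwards [hbd] with t ht
    rw [hflow t (hmem t ht)]
    exact (HV t (hmem t ht)).1
  · refine hasDerivAt_iteratedDeriv (s := 1) (r := 1 / 2) (C := C') n one_half_pos one_half_lt_one hδ
      (fun t ht => ?_) hWd fun t ht z hz => ?_
    · rw [hflow t ht]
      exact (HV t ht).1.isInteriorMap_phiPlus.differentiableOn
    · rw [hbox.flowImage_zero hKa]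
      rcases eq_or_ne t 0 with rfl | ht0
      · rw [hbox.flowImage_zero hKa]; simp
      · have h1 := (HV t ht).2 ht0 _ (HV t ht).1.isInteriorMap_phiPlus z hz
        rw [hflow t ht]
        convert h1 using 2
        ring

/-! ## Inversion -/

theorem isPreconnected_norm_gt {R : ℝ} (hR : 0 < R) : IsPreconnected {z : ℂ | R < ‖z‖} := by
  have h1 : {z : ℂ | R < ‖z‖} = Complex.exp '' {w | Real.log R < w.re} := by
    ext z
    simp only [mem_ofPred_eq, mem_image]
    constructor
    · intro hz
      have hz0 : z ≠ 0 := norm_pos_iff.1 (hR.trans hz)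
      exact ⟨Complex.log z, by rw [Complex.log_re]; exact Real.log_lt_log hR hz, Complex.exp_log hz0⟩
    · rintro ⟨w, hw, rfl⟩
      rwa [Complex.norm_exp, ← Real.log_lt_iff_lt_exp hR]
  rw [h1]
  exact (convex_halfSpace_re_gt _).isPreconnected.image _ Complex.continuous_exp.continuousOn

/-- The image of a plane set under `z ↦ 1 / z`. -/
noncomputable def invSet (K : Set ℂ) : Set ℂ := (fun z => z⁻¹) '' K

theorem mem_invSet {K : Set ℂ} {z : ℂ} : z ∈ invSet K ↔ z⁻¹ ∈ K :=
  ⟨by rintro ⟨w, hw, rfl⟩; simpa using hw, fun h => ⟨_, h, inv_inv z⟩⟩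

theorem IsEnclosing.zero_notMem {K : Set ℂ} (h : IsEnclosing K) : (0 : ℂ) ∉ K := h.surrounds.1

section Exterior

variable {K : Set ℂ} (h : IsEnclosing K)
include h

/-- Every unbounded component of the complement meets the connected set `{|z| > R}`, which misses
`K`; hence there is only one. -/
theorem IsEnclosing.exteriorDomain_eq : ∃ R > 0, {z : ℂ | R < ‖z‖} ⊆ exteriorDomain K ∧
    ∀ z, R < ‖z‖ → exteriorDomain K = connectedComponentIn Kᶜ z := by
  obtain ⟨R, hR⟩ := h.isCompact.isBounded.exists_norm_le
  have hR1 : 0 < |R| + 1 := by positivity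
  have hpre := isPreconnected_norm_gt hR1
  have hsub : {z : ℂ | |R| + 1 < ‖z‖} ⊆ Kᶜ := fun z hz hzK => by
    have h1 : |R| + 1 < ‖z‖ := hz
    linarith [hR z hzK, le_abs_self R]
  have hunb : ¬ Bornology.IsBounded {z : ℂ | |R| + 1 < ‖z‖} := fun hb => by
    obtain ⟨C, hC⟩ := hb.exists_norm_le
    have h1 := hC ((max (|R| + 2) (C + 1) : ℝ) : ℂ) (by
      rw [mem_ofPred_eq, Complex.norm_real, Real.norm_eq_abs]
      have := le_abs_self (max (|R| + 2) (C + 1))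
      linarith [le_max_left (|R| + 2) (C + 1)])
    rw [Complex.norm_real, Real.norm_eq_abs] at h1
    linarith [le_abs_self (max (|R| + 2) (C + 1)), le_max_right (|R| + 2) (C + 1)]
  have hcomp : ∀ z, |R| + 1 < ‖z‖ → {w : ℂ | |R| + 1 < ‖w‖} ⊆ connectedComponentIn Kᶜ z :=
    fun z hz => hpre.subset_connectedComponentIn hz hsub
  refine ⟨|R| + 1, hR1, fun z hz => ⟨hsub hz, fun hb => hunb (hb.subset (hcomp z hz))⟩, fun z hz => ?_⟩
  ext w
  constructor
  · rintro ⟨hwK, hwb⟩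
    obtain ⟨u, hu, hu1⟩ : ∃ u ∈ connectedComponentIn Kᶜ w, |R| + 1 < ‖u‖ := by
      by_contra! hcon
      exact hwb (isBounded_iff_forall_norm_le.2 ⟨_, hcon⟩)
    rw [connectedComponentIn_eq (hcomp z hz hu1), ← connectedComponentIn_eq hu]
    exact mem_connectedComponentIn hwK
  · intro hw
    refine ⟨connectedComponentIn_subset _ _ hw, ?_⟩
    rw [← connectedComponentIn_eq hw]
    exact fun hb => hunb (hb.subset (hcomp z hz))

theorem IsEnclosing.isPreconnected_exteriorDomain : IsPreconnected (exteriorDomain K) := by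
  obtain ⟨R, hR, -, hR2⟩ := h.exteriorDomain_eq
  rw [hR2 ((R + 1 : ℝ) : ℂ) (by rw [Complex.norm_real]; exact (lt_add_one R).trans_le (le_abs_self _))]
  exact isPreconnected_connectedComponentIn

theorem IsEnclosing.isOpen_exteriorDomain : IsOpen (exteriorDomain K) := by
  obtain ⟨R, hR, -, hR2⟩ := h.exteriorDomain_eq
  rw [hR2 ((R + 1 : ℝ) : ℂ) (by rw [Complex.norm_real]; exact (lt_add_one R).trans_le (le_abs_self _))]
  exact h.isCompact.isClosed.isOpen_compl.connectedComponentIn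

theorem IsEnclosing.closure_exteriorDomain_subset :
    closure (exteriorDomain K) ⊆ exteriorDomain K ∪ K := by
  obtain ⟨R, hR, -, hR2⟩ := h.exteriorDomain_eq
  rw [hR2 ((R + 1 : ℝ) : ℂ) (by rw [Complex.norm_real]; exact (lt_add_one R).trans_le (le_abs_self _))]
  exact closure_connectedComponentIn_compl_subset h.isCompact.isClosed _

theorem IsEnclosing.disjoint_exteriorDomain : Disjoint (exteriorDomain K) (interiorDomain K) := by
  rw [Set.disjoint_left]
  rintro z ⟨-, hz⟩ hz'
  refine hz ?_
  rw [← connectedComponentIn_eq hz']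
  exact h.isBounded

/-- The inverted exterior domain with `0` (the image of infinity) added is open and connected, and
its frontier lies in the inverted continuum, so it is a full component of the complement. -/
theorem IsEnclosing.interiorDomain_invSet :
    interiorDomain (invSet K) = insert 0 {w | w⁻¹ ∈ exteriorDomain K} := by
  obtain ⟨R, hR, hR1, -⟩ := h.exteriorDomain_eq
  have h0V : (0 : ℂ) ∉ exteriorDomain K := fun h0 =>
    Set.disjoint_left.1 h.disjoint_exteriorDomain h0 h.zero_mem
  have hVK : exteriorDomain K ⊆ Kᶜ := fun z hz => hz.1
  have himg : {w | w⁻¹ ∈ exteriorDomain K} = (fun z => z⁻¹) '' exteriorDomain K := by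
    ext w
    exact ⟨fun hw => ⟨_, hw, inv_inv w⟩, by rintro ⟨z, hz, rfl⟩; simpa using hz⟩
  set V' := {w | w⁻¹ ∈ exteriorDomain K} with hV'
  have hpre : IsPreconnected V' := by
    rw [himg]
    exact h.isPreconnected_exteriorDomain.image _ (continuousOn_inv₀.mono fun z hz h0 =>
      h0V ((show z = 0 from h0) ▸ hz))
  have hsmall : ∀ w : ℂ, ‖w‖ < R⁻¹ → w ∈ insert 0 V' := fun w hw => by
    rcases eq_or_ne w 0 with rfl | hw0
    · exact Or.inl rfl
    · refine Or.inr (hR1 ?_)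
      rw [mem_ofPred_eq, norm_inv, lt_inv_comm₀ hR (norm_pos_iff.2 hw0)]
      exact hw
  have hcl0 : (0 : ℂ) ∈ closure V' := by
    rw [Metric.mem_closure_iff]
    intro ε hε
    have hm : 0 < min ε R⁻¹ / 2 := by positivity
    refine ⟨((min ε R⁻¹ / 2 : ℝ) : ℂ), ?_, ?_⟩
    · refine (hsmall _ ?_).resolve_left (by exact_mod_cast hm.ne')
      rw [Complex.norm_real, Real.norm_of_nonneg hm.le]
      linarith [min_le_right ε R⁻¹]
    · rw [dist_zero_left, Complex.norm_real, Real.norm_of_nonneg hm.le]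
      linarith [min_le_left ε R⁻¹]
  have hpre' : IsPreconnected (insert 0 V') :=
    hpre.subset_closure (subset_insert _ _) (insert_subset hcl0 subset_closure)
  have h0 : (0 : ℂ) ∉ invSet K := fun h1 => h.zero_notMem (by simpa using mem_invSet.1 h1)
  have hinvc : ∀ w : ℂ, w ≠ 0 → ContinuousAt (fun z : ℂ => z⁻¹) w := fun w hw => continuousAt_inv₀ hw
  apply subset_antisymm
  · have hopen : IsOpen (insert 0 V') := by
      rw [isOpen_iff_mem_nhds]
      intro w hw
      rcases eq_or_ne w 0 with rfl | hw0
      · filter_upwards [Metric.ball_mem_nhds (0 : ℂ) (inv_pos.2 hR)] with w hw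
        exact hsmall w (by simpa using hw)
      · have h1 : w⁻¹ ∈ exteriorDomain K := hw.resolve_left hw0
        filter_upwards [(hinvc w hw0).preimage_mem_nhds (h.isOpen_exteriorDomain.mem_nhds h1)] with u hu
        exact Or.inr hu
    refine isPreconnected_interiorDomain.subset_of_closure_inter_subset hopen
      ⟨0, mem_connectedComponentIn h0, mem_insert _ _⟩ ?_
    rintro w ⟨hw, hwI⟩
    rcases eq_or_ne w 0 with rfl | hw0
    · exact mem_insert _ _
    · right
      have h1 : w ∈ closure V' := by
        have h2 : insert (0 : ℂ) V' ⊆ closure V' := insert_subset hcl0 subset_closure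
        exact closure_minimal h2 isClosed_closure hw
      have h2 : w⁻¹ ∈ closure (exteriorDomain K) := by
        have := mem_closure_image (hinvc w hw0) h1
        refine closure_mono ?_ this
        rintro _ ⟨u, hu, rfl⟩
        exact hu
      exact (h.closure_exteriorDomain_subset h2).resolve_right fun h3 =>
        interiorDomain_subset hwI (mem_invSet.2 h3)
  · refine subset_interiorDomain hpre' (mem_insert _ _) ?_
    rw [Set.disjoint_left]
    rintro w (rfl | hw) hwK
    · exact h0 hwK
    · exact hVK hw (mem_invSet.1 hwK)

theorem IsEnclosing.invSet : IsEnclosing (invSet K) := by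
  have hc : ContinuousOn (fun z : ℂ => z⁻¹) K := continuousOn_inv₀.mono fun z hz h0 =>
    h.zero_notMem ((show z = 0 from h0) ▸ hz)
  refine ⟨h.isCompact.image_of_continuousOn hc, h.isConnected.image _ hc, fun h1 =>
    h.zero_notMem (by simpa using mem_invSet.1 h1), ?_⟩
  change Bornology.IsBounded (interiorDomain (LoopMeasure.invSet K))
  rw [h.interiorDomain_invSet]
  obtain ⟨m, hm, hmU⟩ := h.exists_ball_subset
  refine isBounded_iff_forall_norm_le.2 ⟨m⁻¹, ?_⟩
  rintro w (rfl | hw)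
  · rw [norm_zero]; positivity
  · by_contra! hcon
    refine Set.disjoint_left.1 h.disjoint_exteriorDomain hw (hmU ?_)
    rw [mem_ball_zero_iff, norm_inv]
    exact inv_lt_of_inv_lt₀ hm hcon

theorem IsEnclosing.mem_interiorDomain_invSet {w : ℂ} (hw : w ≠ 0) :
    w ∈ interiorDomain (LoopMeasure.invSet K) ↔ w⁻¹ ∈ exteriorDomain K := by
  rw [h.interiorDomain_invSet]
  exact ⟨fun h1 => h1.resolve_left hw, Or.inr⟩

theorem IsEnclosing.exists_isExteriorMap : ∃ Φ, IsExteriorMap (exteriorDomain K) Φ := by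
  have h' := h.invSet
  obtain ⟨φ, hφ⟩ := h'.exists_isInteriorMap
  have hinv : ∀ z : ℂ, 1 < ‖z‖ → z⁻¹ ∈ Metric.ball (0 : ℂ) 1 := fun z hz => by
    rw [mem_ball_zero_iff, norm_inv]
    exact inv_lt_one_of_one_lt₀ hz
  have hz0 : ∀ z : ℂ, 1 < ‖z‖ → z ≠ 0 := fun z hz => norm_pos_iff.1 (zero_lt_one.trans hz)
  have h01 : (0 : ℂ) ∈ Metric.ball (0 : ℂ) 1 := Metric.mem_ball_self one_pos
  have hφ0 : ∀ z : ℂ, 1 < ‖z‖ → φ z⁻¹ ≠ 0 := fun z hz h1 =>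
    inv_ne_zero (hz0 z hz) (hφ.injOn (hinv z hz) h01 (h1.trans hφ.map_zero.symm))
  refine ⟨fun z => (φ z⁻¹)⁻¹, ?_, ?_, ?_, ?_⟩
  · exact DifferentiableOn.inv (hφ.differentiableOn.comp
      (differentiableOn_inv.mono fun z hz => hz0 z hz) hinv) hφ0
  · intro z hz w hw hzw
    exact inv_injective (hφ.injOn (hinv z hz) (hinv w hw) (inv_injective hzw))
  · ext w
    constructor
    · rintro ⟨z, hz, rfl⟩
      exact (h.mem_interiorDomain_invSet (hφ0 z hz)).1 (hφ.mapsTo (hinv z hz))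
    · intro hw
      have hw0 : w ≠ 0 := fun h0 =>
        Set.disjoint_left.1 h.disjoint_exteriorDomain hw (h0 ▸ h.zero_mem)
      have h1 := (h.mem_interiorDomain_invSet (inv_ne_zero hw0)).2 (by rwa [inv_inv])
      rw [← hφ.image_eq] at h1
      obtain ⟨u, hu, huw⟩ := h1
      have hu0 : u ≠ 0 := fun h0 => inv_ne_zero hw0 (by rw [← huw, h0, hφ.map_zero])
      refine ⟨u⁻¹, ?_, by simp only [inv_inv, huw]⟩
      rw [mem_ofPred_eq, norm_inv]
      exact (one_lt_inv₀ (norm_pos_iff.2 hu0)).2 (mem_ball_zero_iff.1 hu)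
  · obtain ⟨ρ, hρ, hρd⟩ := hφ.deriv_pos
    refine ⟨ρ⁻¹, inv_pos.2 hρ, ?_⟩
    have h1 := hasDerivAt_iff_tendsto_slope.1 (hφ.hasDerivAt h01)
    have h2 := (h1.comp tendsto_inv₀_cobounded').inv₀ (hφ.deriv_ne_zero h01)
    rw [hρd] at h2
    push_cast
    refine h2.congr fun z => ?_
    simp only [Function.comp, slope_def_field, hφ.map_zero, sub_zero, inv_div]
    rw [div_eq_mul_inv, div_eq_mul_inv, mul_comm]

/-- By uniqueness of the normalized interior map, this identifies `phiMinusInv K` with `phiPlus` of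
the inverted continuum. Every statement on `ρ_∞` and `l_n` thereby becomes one on `ρ₀` and `u_n`. -/
theorem IsEnclosing.isInteriorMap_phiMinusInv :
    IsInteriorMap (interiorDomain (LoopMeasure.invSet K)) (phiMinusInv K) ∧
      deriv (phiMinusInv K) 0 = ((rhoInfty K)⁻¹ : ℝ) := by
  have hΦ : IsExteriorMap (exteriorDomain K) (phiMinus K) :=
    Classical.epsilon_spec h.exists_isExteriorMap
  obtain ⟨ρ, hρ, hlim⟩ := hΦ.tendsto
  have hρI : rhoInfty K = ρ := by
    rw [rhoInfty, hlim.limUnder_eq, Complex.ofReal_re]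
  have hinv : ∀ w ∈ Metric.ball (0 : ℂ) 1, w ≠ 0 → 1 < ‖w⁻¹‖ := fun w hw hw0 => by
    rw [norm_inv]
    exact (one_lt_inv₀ (norm_pos_iff.2 hw0)).2 (mem_ball_zero_iff.1 hw)
  have hmaps : ∀ z : ℂ, 1 < ‖z‖ → phiMinus K z ∈ exteriorDomain K := fun z hz =>
    hΦ.image_eq ▸ mem_image_of_mem _ hz
  have h0V : (0 : ℂ) ∉ exteriorDomain K := fun h0 =>
    Set.disjoint_left.1 h.disjoint_exteriorDomain h0 h.zero_mem
  have hne : ∀ z : ℂ, 1 < ‖z‖ → phiMinus K z ≠ 0 := fun z hz h1 => h0V (h1 ▸ hmaps z hz)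
  have hval : ∀ w, w ≠ 0 → phiMinusInv K w = (phiMinus K w⁻¹)⁻¹ := fun w hw => if_neg hw
  have hval0 : phiMinusInv K 0 = 0 := if_pos rfl
  have hderiv : HasDerivAt (phiMinusInv K) ((ρ : ℂ)⁻¹) 0 := by
    rw [hasDerivAt_iff_tendsto_slope]
    have h1 := (hlim.comp tendsto_inv₀_nhdsNE_zero).inv₀ (by exact_mod_cast hρ.ne')
    refine h1.congr' ?_
    filter_upwards [self_mem_nhdsWithin] with w hw
    simp only [Function.comp, slope_def_field, hval w hw, hval0, sub_zero, inv_div]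
    rw [div_eq_mul_inv, div_eq_mul_inv, mul_comm]
  refine ⟨⟨?_, ?_, ?_, hval0, ρ⁻¹, inv_pos.2 hρ, by rw [hderiv.deriv]; push_cast; rfl⟩, by
    rw [hderiv.deriv, hρI]; push_cast; rfl⟩
  · intro w hw
    rcases eq_or_ne w 0 with rfl | hw0
    · exact hderiv.differentiableAt.differentiableWithinAt
    · have h1 : DifferentiableAt ℂ (phiMinus K) w⁻¹ := hΦ.differentiableOn.differentiableAt
        ((isOpen_lt continuous_const continuous_norm).mem_nhds (hinv w hw hw0))
      have h2 : DifferentiableAt ℂ (fun w => (phiMinus K w⁻¹)⁻¹) w :=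
        (DifferentiableAt.fun_comp' w h1 (differentiableAt_inv hw0)).inv (hne _ (hinv w hw hw0))
      refine (h2.congr_of_eventuallyEq ?_).differentiableWithinAt
      filter_upwards [isOpen_compl_singleton.mem_nhds hw0] with u hu
      exact hval u hu
  · have hne0 : ∀ w ∈ Metric.ball (0 : ℂ) 1, w ≠ 0 → phiMinusInv K w ≠ 0 := fun w hw hw0 => by
      rw [hval w hw0]
      exact inv_ne_zero (hne _ (hinv w hw hw0))
    intro z hz w hw hzw
    rcases eq_or_ne z 0 with rfl | hz0 <;> rcases eq_or_ne w 0 with rfl | hw0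
    · rfl
    · exact absurd (hzw.symm.trans hval0) (hne0 w hw hw0)
    · exact absurd (hzw.trans hval0) (hne0 z hz hz0)
    · rw [hval z hz0, hval w hw0] at hzw
      exact inv_injective (hΦ.injOn (hinv z hz hz0) (hinv w hw hw0) (inv_injective hzw))
  · ext u
    constructor
    · rintro ⟨w, hw, rfl⟩
      rcases eq_or_ne w 0 with rfl | hw0
      · rw [hval0]
        exact h.invSet.zero_mem
      · rw [hval w hw0, h.mem_interiorDomain_invSet (inv_ne_zero (hne _ (hinv w hw hw0))), inv_inv]
        exact hmaps _ (hinv w hw hw0)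
    · intro hu
      rcases eq_or_ne u 0 with rfl | hu0
      · exact ⟨0, Metric.mem_ball_self one_pos, hval0⟩
      · rw [h.mem_interiorDomain_invSet hu0, ← hΦ.image_eq] at hu
        obtain ⟨z, hz, hzu⟩ := hu
        have hz0 : z ≠ 0 := norm_pos_iff.1 (zero_lt_one.trans hz)
        refine ⟨z⁻¹, ?_, ?_⟩
        · rw [mem_ball_zero_iff, norm_inv]
          exact inv_lt_one_of_one_lt₀ hz
        · rw [hval _ (inv_ne_zero hz0), inv_inv, hzu, inv_inv]

theorem IsEnclosing.phiMinusInv_eventuallyEq :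
    phiMinusInv K =ᶠ[𝓝 0] phiPlus (LoopMeasure.invSet K) := by
  filter_upwards [Metric.ball_mem_nhds (0 : ℂ) one_pos] with z hz
  exact h.isInteriorMap_phiMinusInv.1.eqOn h.invSet.isInteriorMap_phiPlus hz

theorem IsEnclosing.rhoInfty_eq : rhoInfty K = (rhoZero (LoopMeasure.invSet K))⁻¹ := by
  have h1 := h.isInteriorMap_phiMinusInv.2
  rw [h.phiMinusInv_eventuallyEq.deriv_eq] at h1
  rw [rhoZero, h1, Complex.ofReal_re, inv_inv]

theorem IsEnclosing.lCoeff_eq (n : ℕ+) : lCoeff n K = uCoeff n (LoopMeasure.invSet K) := by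
  rw [lCoeff, uCoeff, h.rhoInfty_eq, (h.phiMinusInv_eventuallyEq.iteratedDeriv_eq _)]
  push_cast
  rw [div_eq_mul_inv _ (rhoZero _ : ℂ)]

end Exterior

/-! ## Vector fields under inversion -/

theorem fieldAt_add (v w : ℂ[T;T⁻¹]) (z : ℂ) : fieldAt (v + w) z = fieldAt v z + fieldAt w z := by
  simp only [fieldAt, AddMonoidAlgebra.coeff_add]
  exact Finsupp.sum_add_index' (by simp) (by intros; ring)

theorem fieldAt_C_mul_T (n : ℤ) (c z : ℂ) :
    fieldAt (LaurentPolynomial.C c * LaurentPolynomial.T n) z = c * z ^ n := by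
  rw [← LaurentPolynomial.single_eq_C_mul_T, fieldAt, AddMonoidAlgebra.coeff_single,
    Finsupp.sum_single_index (by simp)]

/-- With `u = 1/z`, the equation `z' = v(z)` becomes `u' = -u² v(1/u)`, and `a z ^ n` turns into `-a
u ^ (2 - n)`. -/
theorem exists_inverted_field (v : ℂ[T;T⁻¹]) :
    ∃ v' : ℂ[T;T⁻¹], ∀ z, z ≠ 0 → fieldAt v' z = -z ^ 2 * fieldAt v z⁻¹ := by
  induction v using LaurentPolynomial.induction_on' with
  | add p q hp hq =>
    obtain ⟨p', hp'⟩ := hp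
    obtain ⟨q', hq'⟩ := hq
    refine ⟨p' + q', fun z hz => ?_⟩
    rw [fieldAt_add, fieldAt_add, hp' z hz, hq' z hz]
    ring
  | C_mul_T n a =>
    refine ⟨LaurentPolynomial.C (-a) * LaurentPolynomial.T (2 - n), fun z hz => ?_⟩
    rw [fieldAt_C_mul_T, fieldAt_C_mul_T, zpow_sub₀ hz, inv_zpow]
    simp only [zpow_ofNat]
    ring

theorem FlowsTo.inv {v v' : ℂ[T;T⁻¹]} (hv : ∀ z, z ≠ 0 → fieldAt v' z = -z ^ 2 * fieldAt v z⁻¹)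
    {t : ℝ} {z w : ℂ} (h : FlowsTo v t z w) : FlowsTo v' t z⁻¹ w⁻¹ := by
  obtain ⟨x, hx0, hxt, hx⟩ := h
  refine ⟨fun s => (x s)⁻¹, by simp [hx0], by simp [hxt], fun s hs => ?_⟩
  obtain ⟨h1, h2⟩ := hx s hs
  refine ⟨inv_ne_zero h1, ?_⟩
  have h3 := h2.inv h1
  rw [hv _ (inv_ne_zero h1), inv_inv]
  have e : -(x s)⁻¹ ^ 2 * fieldAt v (x s) = -fieldAt v (x s) / x s ^ 2 := by
    rw [inv_pow]; ring
  rw [e]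
  exact h3

theorem flowImage_invSet {v v' : ℂ[T;T⁻¹]}
    (hv : ∀ z, z ≠ 0 → fieldAt v' z = -z ^ 2 * fieldAt v z⁻¹) (t : ℝ) (K : Set ℂ) :
    flowImage v' t (invSet K) = invSet (flowImage v t K) := by
  have hv' : ∀ z, z ≠ 0 → fieldAt v z = -z ^ 2 * fieldAt v' z⁻¹ := fun z hz => by
    rw [hv _ (inv_ne_zero hz), inv_inv]
    field_simp
  ext w
  rw [mem_invSet]
  constructor
  · rintro ⟨z, hz, hzw⟩
    exact ⟨z⁻¹, mem_invSet.1 hz, hzw.inv hv'⟩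
  · rintro ⟨z, hz, hzw⟩
    have := hzw.inv hv
    rw [inv_inv] at this
    exact ⟨z⁻¹, ⟨z, hz, rfl⟩, this⟩

/-! ## Functionals differentiable along flows -/

/-- `F` is bounded and differentiable along every flow, with bounded derivative, at the continua
enclosing `0` in a given annulus. -/
def IsFlowRegular (F : Set ℂ → ℂ) : Prop :=
  ∀ (v : ℂ[T;T⁻¹]) (m R : ℝ), 0 < m → ∃ C, ∀ K, IsEnclosing K → K ⊆ closedAnnulus m R →
    ‖F K‖ ≤ C ∧ ∃ c, ‖c‖ ≤ C ∧ HasDerivAt (fun t => F (flowImage v t K)) c 0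

theorem IsEnclosing.exists_subset_closedAnnulus {K : Set ℂ} (hK : IsEnclosing K) :
    ∃ m R, 0 < m ∧ K ⊆ closedAnnulus m R := by
  obtain ⟨m, hm, hKm⟩ := hK.exists_pos_le_norm
  obtain ⟨R, hR⟩ := hK.isCompact.isBounded.exists_norm_le
  exact ⟨m, R, hm, fun z hz => ⟨hKm z hz, hR z hz⟩⟩

theorem IsEnclosing.flowImage_zero {K : Set ℂ} (hK : IsEnclosing K) (v : ℂ[T;T⁻¹]) :
    flowImage v 0 K = K := by
  obtain ⟨m, R, hm, hKm⟩ := hK.exists_subset_closedAnnulus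
  obtain ⟨ε, M, hbox⟩ := LoopMeasure.exists_isFlowBox v R hm
  exact hbox.flowImage_zero hKm

theorem IsEnclosing.eventually_flowImage {K : Set ℂ} (hK : IsEnclosing K) (v : ℂ[T;T⁻¹]) :
    ∀ᶠ t in 𝓝 0, IsEnclosing (flowImage v t K) := by
  obtain ⟨m, R, hm, hKm⟩ := hK.exists_subset_closedAnnulus
  obtain ⟨C, hC⟩ := exists_hasDerivAt_iteratedDeriv_phiPlus v R hm 0
  exact (hC K hK hKm).1

theorem isFlowRegular_iteratedDeriv (n : ℕ) :
    IsFlowRegular fun K => iteratedDeriv n (phiPlus K) 0 := fun v m R hm => by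
  obtain ⟨C, hC⟩ := exists_hasDerivAt_iteratedDeriv_phiPlus v R hm n
  exact ⟨C, fun K hK hKm => (hC K hK hKm).2⟩

namespace IsFlowRegular

variable {F G : Set ℂ → ℂ}

theorem const (a : ℂ) : IsFlowRegular fun _ => a := fun _ _ _ _ =>
  ⟨‖a‖, fun _ _ _ => ⟨le_rfl, 0, by simp, hasDerivAt_const _ _⟩⟩

/-- Agreement at enclosing continua is enough, because a short flow keeps a continuum enclosing. -/
theorem congr (hF : IsFlowRegular F) (h : ∀ K, IsEnclosing K → G K = F K) : IsFlowRegular G := by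
  intro v m R hm
  obtain ⟨C, hC⟩ := hF v m R hm
  refine ⟨C, fun K hK hKm => ?_⟩
  obtain ⟨h1, c, hc, hd⟩ := hC K hK hKm
  refine ⟨by rwa [h K hK], c, hc, hd.congr_of_eventuallyEq ?_⟩
  filter_upwards [hK.eventually_flowImage v] with t ht
  exact h _ ht

theorem add (hF : IsFlowRegular F) (hG : IsFlowRegular G) : IsFlowRegular fun K => F K + G K := by
  intro v m R hm
  obtain ⟨C, hC⟩ := hF v m R hm
  obtain ⟨C', hC'⟩ := hG v m R hm
  refine ⟨C + C', fun K hK hKm => ?_⟩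
  obtain ⟨h1, c, hc, hd⟩ := hC K hK hKm
  obtain ⟨h1', c', hc', hd'⟩ := hC' K hK hKm
  exact ⟨norm_add_le_of_le h1 h1', c + c', norm_add_le_of_le hc hc', hd.add hd'⟩

theorem mul (hF : IsFlowRegular F) (hG : IsFlowRegular G) : IsFlowRegular fun K => F K * G K := by
  intro v m R hm
  obtain ⟨C, hC⟩ := hF v m R hm
  obtain ⟨C', hC'⟩ := hG v m R hm
  refine ⟨2 * (C * C'), fun K hK hKm => ?_⟩
  obtain ⟨h1, c, hc, hd⟩ := hC K hK hKm
  obtain ⟨h1', c', hc', hd'⟩ := hC' K hK hKm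
  have h0 : 0 ≤ C := (norm_nonneg _).trans h1
  have h0' : 0 ≤ C' := (norm_nonneg _).trans h1'
  have h2 : ∀ {x y : ℂ}, ‖x‖ ≤ C → ‖y‖ ≤ C' → ‖x * y‖ ≤ C * C' := fun hx hy => by
    rw [norm_mul]; gcongr
  refine ⟨(h2 h1 h1').trans (by nlinarith [mul_nonneg h0 h0']), c * G K + F K * c', ?_, ?_⟩
  · refine (norm_add_le_of_le (h2 hc h1') (h2 h1 hc')).trans_eq (by ring)
  · have h3 := hd.mul hd'
    rw [hK.flowImage_zero] at h3
    exact h3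

theorem conj (hF : IsFlowRegular F) : IsFlowRegular fun K => starRingEnd ℂ (F K) := by
  intro v m R hm
  obtain ⟨C, hC⟩ := hF v m R hm
  refine ⟨C, fun K hK hKm => ?_⟩
  obtain ⟨h1, c, hc, hd⟩ := hC K hK hKm
  exact ⟨by rwa [RCLike.norm_conj], starRingEnd ℂ c, by rwa [RCLike.norm_conj],
    Complex.conjCLE.toContinuousLinearMap.hasFDerivAt.comp_hasDerivAt _ hd⟩

theorem inv (hF : IsFlowRegular F) (h : ∀ m R, 0 < m → ∃ k > 0, ∀ K, IsEnclosing K →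
    K ⊆ closedAnnulus m R → k ≤ ‖F K‖) : IsFlowRegular fun K => (F K)⁻¹ := by
  intro v m R hm
  obtain ⟨C, hC⟩ := hF v m R hm
  obtain ⟨k, hk, hkF⟩ := h m R hm
  refine ⟨max k⁻¹ (C / k ^ 2), fun K hK hKm => ?_⟩
  obtain ⟨h1, c, hc, hd⟩ := hC K hK hKm
  have h2 := hkF K hK hKm
  have h3 : F K ≠ 0 := norm_pos_iff.1 (hk.trans_le h2)
  refine ⟨?_, -c / F K ^ 2, ?_, ?_⟩
  · rw [norm_inv]
    exact (inv_anti₀ hk h2).trans (le_max_left _ _)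
  · rw [norm_div, norm_neg, norm_pow]
    refine le_trans ?_ (le_max_right _ _)
    have := (norm_nonneg c).trans hc
    gcongr
  · have h4 := hd.inv (by rwa [hK.flowImage_zero])
    rw [hK.flowImage_zero] at h4
    exact h4

/-- Inversion conjugates the flow of `v` to that of the inverted field and maps annuli to annuli;
the inner radius is `(|R| + 1)⁻¹` since `R` is arbitrary. -/
theorem comp_invSet (hF : IsFlowRegular F) : IsFlowRegular fun K => F (invSet K) := by
  intro v m R hm
  obtain ⟨v', hv'⟩ := exists_inverted_field v
  obtain ⟨C, hC⟩ := hF v' (|R| + 1)⁻¹ m⁻¹ (by positivity)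
  refine ⟨C, fun K hK hKm => ?_⟩
  obtain ⟨h1, c, hc, hd⟩ := hC (invSet K) hK.invSet (fun w hw => by
    have h2 := hKm (mem_invSet.1 hw)
    have h3 : w ≠ 0 := fun h0 => hK.invSet.zero_notMem (h0 ▸ hw)
    have h4 : 0 < ‖w‖ := norm_pos_iff.2 h3
    rw [closedAnnulus, mem_ofPred_eq, norm_inv] at h2
    constructor
    · rw [inv_le_comm₀ (by positivity) h4]
      linarith [h2.2, le_abs_self R]
    · exact (le_inv_comm₀ h4 hm).2 h2.1)
  refine ⟨h1, c, hc, ?_⟩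
  simpa only [flowImage_invSet hv'] using hd

end IsFlowRegular

/-! ## Test functions are regular -/

theorem IsEnclosing.ofReal_rhoZero {K : Set ℂ} (hK : IsEnclosing K) :
    (rhoZero K : ℂ) = deriv (phiPlus K) 0 := by
  obtain ⟨ρ, -, hρ⟩ := hK.isInteriorMap_phiPlus.deriv_pos
  rw [rhoZero, hρ, Complex.ofReal_re]

theorem IsEnclosing.rhoZero_pos {K : Set ℂ} (hK : IsEnclosing K) : 0 < rhoZero K := by
  obtain ⟨ρ, hρ0, hρ⟩ := hK.isInteriorMap_phiPlus.deriv_pos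
  rwa [rhoZero, hρ, Complex.ofReal_re]

theorem IsEnclosing.le_rhoZero {K : Set ℂ} (hK : IsEnclosing K) {m R : ℝ} (hm : 0 < m)
    (hKm : K ⊆ closedAnnulus m R) : m ≤ rhoZero K := by
  have h1 := hK.isInteriorMap_phiPlus.le_norm_deriv hK hKm hm
  rwa [← hK.ofReal_rhoZero, Complex.norm_real, Real.norm_of_nonneg hK.rhoZero_pos.le] at h1

theorem isFlowRegular_rhoZero : IsFlowRegular fun K => (rhoZero K : ℂ) :=
  (isFlowRegular_iteratedDeriv 1).congr fun K hK => by
    rw [iteratedDeriv_one, hK.ofReal_rhoZero]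

theorem isFlowRegular_inv_rhoZero : IsFlowRegular fun K => (rhoZero K : ℂ)⁻¹ :=
  isFlowRegular_rhoZero.inv fun m R hm => ⟨m, hm, fun _ hK hKm => by
    rw [Complex.norm_real]
    exact (hK.le_rhoZero hm hKm).trans (le_abs_self _)⟩

theorem isFlowRegular_rhoInfty : IsFlowRegular fun K => (rhoInfty K : ℂ) :=
  isFlowRegular_inv_rhoZero.comp_invSet.congr fun K hK => by
    rw [hK.rhoInfty_eq]; push_cast; rfl

theorem isFlowRegular_uCoeff (n : ℕ+) : IsFlowRegular (uCoeff n) :=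
  (((isFlowRegular_iteratedDeriv (n + 1)).mul (.const ((Nat.factorial (n + 1) : ℂ)⁻¹))).mul
    isFlowRegular_inv_rhoZero).congr fun K _ => by
      rw [uCoeff, div_eq_mul_inv, div_eq_mul_inv]

theorem isFlowRegular_lCoeff (n : ℕ+) : IsFlowRegular (lCoeff n) :=
  (isFlowRegular_uCoeff n).comp_invSet.congr fun _ hK => hK.lCoeff_eq n

theorem isFlowRegular_eval (p : MvPolynomial CoeffVar ℂ) :
    IsFlowRegular fun K => MvPolynomial.eval (CoeffVar.value K) p := by
  induction p using MvPolynomial.induction_on with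
  | C a => simpa using IsFlowRegular.const a
  | add p q hp hq => simpa using hp.add hq
  | mul_X p i hp =>
    have hi : IsFlowRegular fun K => CoeffVar.value K i := by
      cases i with
      | u n => exact isFlowRegular_uCoeff n
      | uBar n => exact (isFlowRegular_uCoeff n).conj
      | l n => exact isFlowRegular_lCoeff n
      | lBar n => exact (isFlowRegular_lCoeff n).conj
    simpa using hp.mul hi

/-- The chain rule; compact support bounds `f` and its derivative on the whole plane, so the values
of the radii need no control here. -/
theorem isFlowRegular_comp_rho {f : ℝ × ℝ → ℂ} (hf : ContDiff ℝ 1 f) (hfc : HasCompactSupport f) :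
    IsFlowRegular fun K => f (rhoZero K, rhoInfty K) := by
  obtain ⟨B, hB⟩ := hf.continuous.bounded_above_of_compact_support hfc
  obtain ⟨B', hB'⟩ := (hf.continuous_fderiv (by norm_num)).bounded_above_of_compact_support (hfc.fderiv ℝ)
  intro v m R hm
  obtain ⟨C₁, h₁⟩ := isFlowRegular_rhoZero v m R hm
  obtain ⟨C₂, h₂⟩ := isFlowRegular_rhoInfty v m R hm
  refine ⟨max B (B' * max C₁ C₂), fun K hK hKm => ⟨(hB _).trans (le_max_left _ _), ?_⟩⟩
  obtain ⟨-, c₁, hc₁, hd₁⟩ := h₁ K hK hKm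
  obtain ⟨-, c₂, hc₂, hd₂⟩ := h₂ K hK hKm
  have hr₁ : HasDerivAt (fun t => rhoZero (flowImage v t K)) c₁.re 0 :=
    Complex.reCLM.hasFDerivAt.comp_hasDerivAt (f := fun t => (rhoZero (flowImage v t K) : ℂ)) _ hd₁
  have hr₂ : HasDerivAt (fun t => rhoInfty (flowImage v t K)) c₂.re 0 :=
    Complex.reCLM.hasFDerivAt.comp_hasDerivAt (f := fun t => (rhoInfty (flowImage v t K) : ℂ)) _ hd₂
  have hdf := ((hf.differentiable (by norm_num)).differentiableAt
    (x := (rhoZero (flowImage v 0 K), rhoInfty (flowImage v 0 K)))).hasFDerivAt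
  refine ⟨_, ?_, hdf.comp_hasDerivAt (f := fun t => (rhoZero (flowImage v t K),
    rhoInfty (flowImage v t K))) 0 (hr₁.prodMk hr₂)⟩
  refine (ContinuousLinearMap.le_opNorm _ _).trans (le_trans ?_ (le_max_right _ _))
  have h0 : 0 ≤ B' := (norm_nonneg _).trans (hB' 0)
  refine mul_le_mul (hB' _) ?_ (norm_nonneg _) h0
  rw [Prod.norm_def]
  exact max_le_max ((Complex.abs_re_le_norm _).trans hc₁) ((Complex.abs_re_le_norm _).trans hc₂)

theorem isFlowRegular_testFunction (p : MvPolynomial CoeffVar ℂ) {f : ℝ × ℝ → ℂ}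
    (hf : ContDiff ℝ 1 f) (hfc : HasCompactSupport f) : IsFlowRegular (testFunction p f) :=
  (isFlowRegular_eval p).mul (isFlowRegular_comp_rho hf hfc)

theorem IsFlowRegular.hasDerivAt_flowImage_neg {F : Set ℂ → ℂ} (hF : IsFlowRegular F) {K : Set ℂ}
    (hK : IsEnclosing K) (v : ℂ[T;T⁻¹]) :
    HasDerivAt (fun t => F (flowImage v (-t) K)) (realAction v F K) 0 := by
  obtain ⟨m, R, hm, hKm⟩ := hK.exists_subset_closedAnnulus
  obtain ⟨C, hC⟩ := hF v m R hm
  obtain ⟨-, c, -, hd⟩ := hC K hK hKm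
  rw [← neg_zero] at hd
  exact (HasDerivAt.scomp (0 : ℝ) hd (hasDerivAt_neg (0 : ℝ))).differentiableAt.hasDerivAt

/-! ## Continuity of the uniformization -/

/-- Convergence of plane sets in the Vietoris topology. -/
structure SetTendsto {ι : Type} (Ks : ι → Set ℂ) (l : Filter ι) (K : Set ℂ) : Prop where
  upper : ∀ V, IsOpen V → K ⊆ V → ∀ᶠ i in l, Ks i ⊆ V
  lower : ∀ V, IsOpen V → (K ∩ V).Nonempty → ∀ᶠ i in l, (Ks i ∩ V).Nonempty

theorem Loop.setTendsto (γ : Loop ℂ) : SetTendsto Loop.toSet (𝓝 γ) γ.toSet where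
  upper V hV h := (((TopologicalSpace.Compacts.isOpen_subsets_of_isOpen hV).preimage
    continuous_subtype_val).mem_nhds h : {γ' : Loop ℂ | γ'.toSet ⊆ V} ∈ 𝓝 γ)
  lower V hV h := (((TopologicalSpace.Compacts.isOpen_inter_nonempty_of_isOpen hV).preimage
    continuous_subtype_val).mem_nhds h : {γ' : Loop ℂ | (γ'.toSet ∩ V).Nonempty} ∈ 𝓝 γ)

namespace SetTendsto

variable {ι : Type} {Ks : ι → Set ℂ} {l : Filter ι} {K : Set ℂ}

theorem mono {l' : Filter ι} (h : SetTendsto Ks l K) (hl : l' ≤ l) : SetTendsto Ks l' K :=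
  ⟨fun V hV hK => hl (h.upper V hV hK), fun V hV hK => hl (h.lower V hV hK)⟩

theorem image (h : SetTendsto Ks l K) {V : Set ℂ} (hV : IsOpen V) (hKV : K ⊆ V) {g : ℂ → ℂ}
    (hg : ContinuousOn g V) : SetTendsto (fun i => g '' Ks i) l (g '' K) := by
  refine ⟨fun W hW hK => ?_, fun W hW hK => ?_⟩
  · filter_upwards [h.upper _ (hg.isOpen_inter_preimage hV hW)
      fun z hz => ⟨hKV hz, hK (mem_image_of_mem g hz)⟩] with i hi
    rintro _ ⟨z, hz, rfl⟩
    exact (hi hz).2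
  · obtain ⟨_, ⟨z, hz, rfl⟩, hzW⟩ := hK
    filter_upwards [h.lower _ (hg.isOpen_inter_preimage hV hW) ⟨z, hz, hKV hz, hzW⟩] with i hi
    obtain ⟨w, hw, -, hwW⟩ := hi
    exact ⟨g w, mem_image_of_mem g hw, hwW⟩

theorem invSet (h : SetTendsto Ks l K) (h0 : (0 : ℂ) ∉ K) :
    SetTendsto (fun i => invSet (Ks i)) l (LoopMeasure.invSet K) :=
  h.image isOpen_compl_singleton (fun _ hz h1 => h0 ((show _ = (0 : ℂ) from h1) ▸ hz))
    continuousOn_inv₀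

theorem exists_tendsto (h : SetTendsto Ks l K) (hKs : ∀ᶠ i in l, IsEnclosing (Ks i)) {p : ℂ}
    (hp : p ∈ K) : ∃ q : ι → ℂ, (∀ᶠ i in l, q i ∈ Ks i) ∧ Tendsto q l (𝓝 p) := by
  have h1 : ∀ i, ∃ q, IsEnclosing (Ks i) → q ∈ Ks i ∧ Metric.infDist p (Ks i) = dist p q := by
    intro i
    by_cases hi : IsEnclosing (Ks i)
    · obtain ⟨q, hq⟩ := hi.isCompact.exists_infDist_eq_dist hi.isConnected.nonempty p
      exact ⟨q, fun _ => hq⟩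
    · exact ⟨0, fun h => absurd h hi⟩
  choose q hq using h1
  refine ⟨q, hKs.mono fun i hi => (hq i hi).1, Metric.tendsto_nhds.2 fun ε hε => ?_⟩
  filter_upwards [hKs, h.lower _ Metric.isOpen_ball ⟨p, hp, Metric.mem_ball_self hε⟩] with i hi hi'
  obtain ⟨w, hw, hwp⟩ := hi'
  rw [dist_comm, ← (hq i hi).2]
  refine (Metric.infDist_le_dist_of_mem hw).trans_lt ?_
  rwa [dist_comm]

/-- **Carathéodory's kernel theorem**, for continua converging in the Vietoris topology. -/
theorem tendsto_iteratedDeriv_phiPlus_ultrafilter {l : Ultrafilter ι} (h : SetTendsto Ks l K)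
    (hK : IsEnclosing K) (hKs : ∀ᶠ i in (l : Filter ι), IsEnclosing (Ks i)) (n : ℕ) :
    Tendsto (fun i => iteratedDeriv n (phiPlus (Ks i)) 0) l (𝓝 (iteratedDeriv n (phiPlus K) 0)) := by
  set U := interiorDomain K
  have hinv : ∀ i, ∃ ψ, IsEnclosing (Ks i) →
      IsUniformization (interiorDomain (Ks i)) (phiPlus (Ks i)) ψ := fun i => by
    by_cases hi : IsEnclosing (Ks i)
    · obtain ⟨ψ, hψ⟩ := hi.isInteriorMap_phiPlus.exists_isUniformization
      exact ⟨ψ, fun _ => hψ⟩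
    · exact ⟨0, fun h => absurd h hi⟩
  choose ψ hψ using hinv
  have hunif : ∀ᶠ i in (l : Filter ι),
      IsUniformization (interiorDomain (Ks i)) (phiPlus (Ks i)) (ψ i) := hKs.mono hψ
  obtain ⟨m, R, hm, hKm⟩ := hK.exists_subset_closedAnnulus
  have hann : ∀ᶠ i in (l : Filter ι), Ks i ⊆ closedAnnulus (m / 2) (R + 1) := by
    filter_upwards [h.upper {z | m / 2 < ‖z‖ ∧ ‖z‖ < R + 1}
      ((isOpen_lt continuous_const continuous_norm).inter (isOpen_lt continuous_norm continuous_const))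
      fun z hz => ⟨by linarith [(hKm hz).1], by linarith [(hKm hz).2]⟩] with i hi z hz
    exact ⟨(hi hz).1.le, (hi hz).2.le⟩
  have h01 : (0 : ℂ) ∈ Metric.ball (0 : ℂ) 1 := Metric.mem_ball_self one_pos
  have hφd : ∀ᶠ i in (l : Filter ι), DifferentiableOn ℂ (phiPlus (Ks i)) (Metric.ball 0 1) :=
    hunif.mono fun i hi => hi.differentiableOn
  -- limits of the maps and of their inverses
  obtain ⟨φ', hφ'⟩ := exists_limit_of_locally_bounded l (F := fun i => phiPlus (Ks i))
    (U := Metric.ball 0 1) fun z hz => by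
      obtain ⟨r, hr, hrsub⟩ := Metric.isOpen_iff.1 Metric.isOpen_ball z hz
      refine ⟨r, hr, R + 2, ?_⟩
      filter_upwards [hKs, hunif, hann] with i hi hi' ha
      exact ⟨hi'.differentiableOn.mono hrsub, fun w hw => by
        have := hi'.toIsInteriorMap.norm_lt hi ha (hrsub hw)
        linarith⟩
  -- A path from `0` to `z` together with a closed disc about `z` is a compact connected subset of
  -- the inside. Upper convergence makes nearby continua avoid it, so it is inside them too.
  have hlocal : ∀ z ∈ U, ∃ r > 0, ∀ᶠ i in (l : Filter ι),
      Metric.ball z r ⊆ interiorDomain (Ks i) := by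
    intro z hz
    have hpc : IsPathConnected U := hK.isOpen.isConnected_iff_isPathConnected.1
      ⟨⟨0, hK.zero_mem⟩, isPreconnected_interiorDomain⟩
    obtain ⟨p, hp⟩ := hpc.joinedIn 0 hK.zero_mem z hz
    obtain ⟨r, hr, hrsub⟩ := Metric.isOpen_iff.1 hK.isOpen z hz
    set C := range p ∪ Metric.closedBall z (r / 2) with hC
    have hCc : IsCompact C := (isCompact_range p.continuous).union (isCompact_closedBall _ _)
    have hCU : C ⊆ U := union_subset (range_subset_iff.2 hp)
      ((Metric.closedBall_subset_ball (by linarith)).trans hrsub)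
    have hCpre : IsPreconnected C := (isPreconnected_range p.continuous).union z
      ⟨1, p.target⟩ (Metric.mem_closedBall_self (by linarith)) (convex_closedBall _ _).isPreconnected
    refine ⟨r / 2, by linarith, ?_⟩
    filter_upwards [h.upper Cᶜ hCc.isClosed.isOpen_compl fun w hw hwC =>
      interiorDomain_subset (hCU hwC) hw] with i hi
    refine (Metric.ball_subset_closedBall.trans subset_union_right).trans
      (subset_interiorDomain hCpre (Or.inl ⟨0, p.source⟩) ?_)
    exact Set.disjoint_left.2 fun w hw hwK => hi hwK hw
  obtain ⟨ψ', hψ'⟩ := exists_limit_of_locally_bounded l (F := ψ) (U := U) fun z hz => by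
    obtain ⟨r, hr, hrl⟩ := hlocal z hz
    refine ⟨r, hr, 1, ?_⟩
    filter_upwards [hunif, hrl] with i hi hi'
    exact ⟨hi.inv_differentiableOn.mono hi', fun w hw => (hi.norm_inv_lt (hi' hw)).le⟩
  have hφ'd : DifferentiableOn ℂ φ' (Metric.ball 0 1) := hφ'.differentiableOn hφd Metric.isOpen_ball
  have hψ'd : DifferentiableOn ℂ ψ' U := differentiableOn_of_tendstoLocallyUniformlyOn hK.isOpen hψ'
    fun z hz => by
      obtain ⟨r, hr, hrl⟩ := hlocal z hz
      refine ⟨r, hr, ?_⟩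
      filter_upwards [hunif, hrl] with i hi hi'
      exact hi.inv_differentiableOn.mono hi'
  have hφ'0 : φ' 0 = 0 := tendsto_nhds_unique ((hφ'.tendsto_at h01).congr'
    (hunif.mono fun i hi => hi.map_zero)) tendsto_const_nhds
  have hψ'0 : ψ' 0 = 0 := tendsto_nhds_unique ((hψ'.tendsto_at hK.zero_mem).congr'
    (hunif.mono fun i hi => hi.inv_zero)) tendsto_const_nhds
  have hit := fun n => ((tendstoLocallyUniformlyOn_iteratedDeriv Metric.isOpen_ball hφ' hφd
    n).1.tendsto_at h01)
  have hdlim : Tendsto (fun i => (rhoZero (Ks i) : ℂ)) l (𝓝 (deriv φ' 0)) := by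
    have h1 := hit 1
    simp only [iteratedDeriv_one] at h1
    exact h1.congr' (hKs.mono fun i hi => hi.ofReal_rhoZero.symm)
  have hdre : Tendsto (fun i => rhoZero (Ks i)) l (𝓝 (deriv φ' 0).re) :=
    Tendsto.comp (f := fun i => (rhoZero (Ks i) : ℂ)) (g := Complex.re)
      (Complex.continuous_re.tendsto _) hdlim
  have hdeq : deriv φ' 0 = ((deriv φ' 0).re : ℂ) := tendsto_nhds_unique hdlim
    ((Complex.continuous_ofReal.tendsto _).comp hdre)
  have hdpos : m / 2 ≤ (deriv φ' 0).re := by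
    refine ge_of_tendsto hdre ?_
    filter_upwards [hKs, hann] with i hi ha
    exact hi.le_rhoZero (by linarith) ha
  have hd0 : deriv φ' 0 ≠ 0 := fun h0 => by
    rw [h0, Complex.zero_re] at hdpos
    linarith
  have hinj : InjOn φ' (Metric.ball 0 1) := injOn_of_tendstoLocallyUniformlyOn Metric.isOpen_ball
    (convex_ball _ _).isPreconnected hφ' hφd (hunif.mono fun i hi => hi.injOn) h01 hd0
  -- By the maximum principle, modulus `1` at one point would give modulus `1` at `0`.
  have hψ'lt : ∀ z ∈ U, ‖ψ' z‖ < 1 := by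
    have hle : ∀ z ∈ U, ‖ψ' z‖ ≤ 1 := fun z hz => by
      obtain ⟨r, hr, hrl⟩ := hlocal z hz
      refine le_of_tendsto (hψ'.tendsto_at hz).norm ?_
      filter_upwards [hunif, hrl] with i hi hi'
      exact (hi.norm_inv_lt (hi' (Metric.mem_ball_self hr))).le
    intro z hz
    refine (hle z hz).lt_of_ne fun h1 => ?_
    have h2 := Complex.norm_eqOn_of_isPreconnected_of_isMaxOn isPreconnected_interiorDomain hK.isOpen
      hψ'd hz (fun w hw => by
        rw [mem_ofPred_eq, Function.comp, Function.comp, h1]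
        exact hle w hw) hK.zero_mem
    simp only [Function.comp, hψ'0, norm_zero, Function.const, h1] at h2
    exact zero_ne_one h2
  have hcomp : ∀ z ∈ U, φ' (ψ' z) = z := fun z hz => by
    have hzb : ψ' z ∈ Metric.ball (0 : ℂ) 1 := mem_ball_zero_iff.2 (hψ'lt z hz)
    have h1 : Tendsto (fun i => ψ i z) l (𝓝[Metric.ball 0 1] (ψ' z)) := by
      rw [nhdsWithin_eq_nhds.2 (Metric.isOpen_ball.mem_nhds hzb)]
      exact hψ'.tendsto_at hz
    have h2 := hφ'.tendsto_comp (hφ'd.continuousOn _ hzb) hzb h1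
    obtain ⟨r, hr, hrl⟩ := hlocal z hz
    refine tendsto_nhds_unique (h2.congr' ?_) tendsto_const_nhds
    filter_upwards [hunif, hrl] with i hi hi'
    exact hi.right_inv z (hi' (Metric.mem_ball_self hr))
  -- If the limit took a value `p` in `K`, lower convergence would give points `q i` of the
  -- approximating continua tending to `p`. The maps omit `q i`, so Hurwitz would make the limit
  -- constant. The converse inclusion is the limit of the inverse maps.
  have himg : φ' '' Metric.ball 0 1 = U := by
    apply subset_antisymm
    · refine subset_interiorDomain ((convex_ball _ _).isPreconnected.image _ hφ'd.continuousOn)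
        ⟨0, h01, hφ'0⟩ (Set.disjoint_left.2 ?_)
      rintro _ ⟨ζ, hζ, rfl⟩ hp
      obtain ⟨q, hq, hqp⟩ := h.exists_tendsto hKs hp
      have hconst : TendstoLocallyUniformlyOn (fun i (_ : ℂ) => q i) (fun _ => φ' ζ) l
          (Metric.ball 0 1) := by
        refine TendstoUniformlyOn.tendstoLocallyUniformlyOn (Metric.tendstoUniformlyOn_iff.2 ?_)
        intro ε hε
        filter_upwards [Metric.tendsto_nhds.1 hqp ε hε] with i hi x _
        rwa [dist_comm]
      have h1 := eventually_eq_zero_of_limit_nonvanishing Metric.isOpen_ball (hφ'.sub hconst)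
        (hφd.mono fun i hi => hi.sub_const _) (by
          filter_upwards [hunif, hq] with i hi hqi z hz h0
          have h2 := hi.toIsInteriorMap.mapsTo hz
          have h3 : phiPlus (Ks i) z = q i := sub_eq_zero.1 h0
          rw [h3] at h2
          exact interiorDomain_subset h2 hqi) hζ (sub_self _)
      exact not_eventually_const_of_injOn Metric.isOpen_ball hinj hζ
        (h1.mono fun z hz => sub_eq_zero.1 hz)
    · intro z hz
      exact ⟨ψ' z, mem_ball_zero_iff.2 (hψ'lt z hz), hcomp z hz⟩
  have hmap : IsInteriorMap U φ' := ⟨hφ'd, hinj, himg, hφ'0, (deriv φ' 0).re, by linarith, hdeq⟩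
  have heq : φ' =ᶠ[𝓝 0] phiPlus K := by
    filter_upwards [Metric.ball_mem_nhds (0 : ℂ) one_pos] with z hz
    exact hmap.eqOn hK.isInteriorMap_phiPlus hz
  rw [← heq.iteratedDeriv_eq]
  exact hit n

theorem tendsto_iteratedDeriv_phiPlus (h : SetTendsto Ks l K) (hK : IsEnclosing K)
    (hKs : ∀ᶠ i in l, IsEnclosing (Ks i)) (n : ℕ) :
    Tendsto (fun i => iteratedDeriv n (phiPlus (Ks i)) 0) l (𝓝 (iteratedDeriv n (phiPlus K) 0)) :=
  tendsto_iff_ultrafilter _ _ _ |>.2 fun _ hl =>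
    (h.mono hl).tendsto_iteratedDeriv_phiPlus_ultrafilter hK (hl hKs) n

theorem tendsto_rhoZero (h : SetTendsto Ks l K) (hK : IsEnclosing K)
    (hKs : ∀ᶠ i in l, IsEnclosing (Ks i)) :
    Tendsto (fun i => rhoZero (Ks i)) l (𝓝 (rhoZero K)) := by
  have h1 := h.tendsto_iteratedDeriv_phiPlus hK hKs 1
  simp only [iteratedDeriv_one] at h1
  exact (Complex.continuous_re.tendsto _).comp h1

theorem tendsto_rhoInfty (h : SetTendsto Ks l K) (hK : IsEnclosing K)
    (hKs : ∀ᶠ i in l, IsEnclosing (Ks i)) :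
    Tendsto (fun i => rhoInfty (Ks i)) l (𝓝 (rhoInfty K)) := by
  rw [hK.rhoInfty_eq]
  refine (((h.invSet hK.zero_notMem).tendsto_rhoZero hK.invSet (hKs.mono fun i hi => hi.invSet)).inv₀
    hK.invSet.rhoZero_pos.ne').congr' ?_
  filter_upwards [hKs] with i hi
  exact hi.rhoInfty_eq.symm

theorem tendsto_uCoeff (h : SetTendsto Ks l K) (hK : IsEnclosing K)
    (hKs : ∀ᶠ i in l, IsEnclosing (Ks i)) (n : ℕ+) :
    Tendsto (fun i => uCoeff n (Ks i)) l (𝓝 (uCoeff n K)) :=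
  ((h.tendsto_iteratedDeriv_phiPlus hK hKs _).div_const _).div
    ((Complex.continuous_ofReal.tendsto _).comp (h.tendsto_rhoZero hK hKs))
    (by exact_mod_cast hK.rhoZero_pos.ne')

theorem tendsto_lCoeff (h : SetTendsto Ks l K) (hK : IsEnclosing K)
    (hKs : ∀ᶠ i in l, IsEnclosing (Ks i)) (n : ℕ+) :
    Tendsto (fun i => lCoeff n (Ks i)) l (𝓝 (lCoeff n K)) := by
  rw [hK.lCoeff_eq]
  refine ((h.invSet hK.zero_notMem).tendsto_uCoeff hK.invSet (hKs.mono fun i hi => hi.invSet)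
    n).congr' ?_
  filter_upwards [hKs] with i hi
  exact (hi.lCoeff_eq n).symm

theorem tendsto_testFunction (h : SetTendsto Ks l K) (hK : IsEnclosing K)
    (hKs : ∀ᶠ i in l, IsEnclosing (Ks i)) (p : MvPolynomial CoeffVar ℂ) {f : ℝ × ℝ → ℂ}
    (hf : Continuous f) :
    Tendsto (fun i => testFunction p f (Ks i)) l (𝓝 (testFunction p f K)) := by
  refine Tendsto.mul ?_ ((hf.tendsto _).comp
    ((h.tendsto_rhoZero hK hKs).prodMk_nhds (h.tendsto_rhoInfty hK hKs)))
  induction p using MvPolynomial.induction_on with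
  | C a => simpa using tendsto_const_nhds
  | add p q hp hq => simpa using hp.add hq
  | mul_X p i hp =>
    have hi : Tendsto (fun j => CoeffVar.value (Ks j) i) l (𝓝 (CoeffVar.value K i)) := by
      cases i with
      | u n => exact h.tendsto_uCoeff hK hKs n
      | uBar n => exact (Complex.continuous_conj.tendsto _).comp (h.tendsto_uCoeff hK hKs n)
      | l n => exact h.tendsto_lCoeff hK hKs n
      | lBar n => exact (Complex.continuous_conj.tendsto _).comp (h.tendsto_lCoeff hK hKs n)
    simpa using hp.mul hi

end SetTendsto

/-! ## Stability of the condition of surrounding the origin -/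

/-- Failure to surround `0` is witnessed by a compact path from `0` to a far point; missing this
path is an open condition on the continuum. -/
theorem exists_compact_of_not_surroundsZero {K : Set ℂ} (hK : IsCompact K) (h0 : (0 : ℂ) ∉ K)
    (hs : ¬ SurroundsZero K) (R : ℝ) :
    ∃ S, IsCompact S ∧ IsPreconnected S ∧ 0 ∈ S ∧ Disjoint S K ∧ ∃ P ∈ S, R < ‖P‖ := by
  have hb : ¬ Bornology.IsBounded (interiorDomain K) := fun hb => hs ⟨h0, hb⟩
  have hP : ∃ P ∈ interiorDomain K, R < ‖P‖ := by
    by_contra! hcon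
    exact hb (isBounded_iff_forall_norm_le.2 ⟨R, hcon⟩)
  obtain ⟨P, hPU, hPR⟩ := hP
  have h0U : (0 : ℂ) ∈ interiorDomain K := mem_connectedComponentIn h0
  have hpc : IsPathConnected (interiorDomain K) :=
    (isOpen_interiorDomain hK.isClosed).isConnected_iff_isPathConnected.1
      ⟨⟨0, h0U⟩, isPreconnected_interiorDomain⟩
  obtain ⟨p, hp⟩ := hpc.joinedIn 0 h0U P hPU
  refine ⟨range p, isCompact_range p.continuous, isPreconnected_range p.continuous,
    ⟨0, p.source⟩, Set.disjoint_left.2 ?_, P, ⟨1, p.target⟩, hPR⟩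
  rintro _ ⟨t, rfl⟩ ht
  exact interiorDomain_subset (hp t) ht

/-- A compact set that avoids the origin and is a limit of continua surrounding the origin surrounds
the origin. -/
theorem SetTendsto.surroundsZero {ι : Type} {Ks : ι → Set ℂ} {l : Filter ι} [l.NeBot] {K : Set ℂ}
    (h : SetTendsto Ks l K) (hK : IsCompact K) (h0 : (0 : ℂ) ∉ K)
    (hKs : ∀ᶠ i in l, IsEnclosing (Ks i)) : SurroundsZero K := by
  by_contra hs
  obtain ⟨R, hR⟩ := hK.isBounded.exists_norm_le
  obtain ⟨S, hSc, hSp, hS0, hSK, P, hPS, hP⟩ :=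
    exists_compact_of_not_surroundsZero hK h0 hs (R + 1)
  -- Some approximating continuum misses `S` and lies in the ball of radius `R + 1`, so `P` would be
  -- inside it at distance greater than `R + 1` from `0`.
  obtain ⟨i, hi, hi1, hi2⟩ := (hKs.and ((h.upper _ (Metric.isOpen_ball (x := (0 : ℂ)) (ε := R + 1))
    fun z hz => mem_ball_zero_iff.2 (by linarith [hR z hz])).and
    (h.upper _ hSc.isClosed.isOpen_compl hSK.subset_compl_left))).exists
  have h1 := hi.norm_lt (R := R + 1) (fun z hz => mem_ball_zero_iff.1 (hi1 hz)) P
    (subset_interiorDomain hSp hS0 (Set.disjoint_left.2 fun z hz hzK => hi2 hzK hz) hPS)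
  linarith

theorem isOpen_loops_subset {V : Set ℂ} (hV : IsOpen V) : IsOpen {γ : Loop ℂ | γ.toSet ⊆ V} :=
  (TopologicalSpace.Compacts.isOpen_subsets_of_isOpen hV).preimage continuous_subtype_val

/-- A limit of surrounding loops surrounds as soon as it avoids `0`. The set is thus relatively
closed in the open set of loops avoiding `0`. -/
theorem measurableSet_loopsAroundZero : MeasurableSet loopsAroundZero := by
  have h1 : loopsAroundZero = {γ : Loop ℂ | γ.toSet ⊆ {0}ᶜ} ∩ closure loopsAroundZero := by
    ext γ
    constructor
    · intro hγ
      exact ⟨fun z hz h0 => hγ.1 ((show z = 0 from h0) ▸ hz), subset_closure hγ⟩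
    · rintro ⟨h0, hγ⟩
      have : (𝓝[loopsAroundZero] γ).NeBot := mem_closure_iff_nhdsWithin_neBot.1 hγ
      exact (γ.setTendsto.mono nhdsWithin_le_nhds).surroundsZero γ.1.isCompact
        (fun h => h0 h rfl) (eventually_mem_nhdsWithin.mono fun _ => Loop.isEnclosing)
  rw [h1]
  exact (isOpen_loops_subset isOpen_compl_singleton).measurableSet.inter isClosed_closure.measurableSet

theorem continuousOn_testFunction (p : MvPolynomial CoeffVar ℂ) {f : ℝ × ℝ → ℂ}
    (hf : Continuous f) :
    ContinuousOn (fun γ : Loop ℂ => testFunction p f γ.toSet) loopsAroundZero := fun γ hγ =>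
  (γ.setTendsto.mono nhdsWithin_le_nhds).tendsto_testFunction (Loop.isEnclosing hγ)
    (eventually_mem_nhdsWithin.mono fun _ => Loop.isEnclosing) p hf

/-! ## Transport of enclosing continua by a flow -/

namespace IsFlowBox

variable {v : ℂ[T;T⁻¹]} {a b ε : ℝ} {M : NNReal} (h : IsFlowBox v a b ε M) {K : Set ℂ}

include h

theorem norm_flowMap_time_sub_le {z : ℂ} (hz : z ∈ closedAnnulus a b) {s t : ℝ} (hs : |s| < ε)
    (ht : |t| < ε) : ‖flowMap v t z - flowMap v s z‖ ≤ M * |t - s| := by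
  refine (convex_ball (0 : ℝ) ε).norm_image_sub_le_of_norm_hasDerivWithin_le
    (f := fun s => flowMap v s z) (f' := fun s => fieldAt v (flowMap v s z))
    (fun τ hτ => (h.hasDerivAt z hz τ ?_).hasDerivWithinAt)
    (fun τ hτ => h.norm_le _ (h.mem z hz τ ?_)) (mem_ball_zero_iff.2 hs) (mem_ball_zero_iff.2 ht)
  · simpa using hτ
  · simpa using hτ

theorem continuousOn_flowMap {t : ℝ} (ht : |t| < ε) :
    ContinuousOn (flowMap v t) (closedAnnulus a b) :=
  (LipschitzOnWith.of_dist_le_mul (K := (Real.exp (M * |t|)).toNNReal) fun z hz w hw => by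
    rw [dist_eq_norm, dist_eq_norm, Real.coe_toNNReal _ (Real.exp_pos _).le]
    exact h.norm_flowMap_sub_le hw hz ht).continuousOn

theorem flowImage_subset (hK : K ⊆ closedAnnulus a b) {t : ℝ} (ht : |t| < ε) :
    flowImage v t K ⊆ closedAnnulus (a / 2) (b + a / 2) := by
  rw [h.flowImage_eq hK ht]
  rintro _ ⟨z, hz, rfl⟩
  exact h.mem z (hK hz) t ht

theorem isCompact_flowImage (hK : K ⊆ closedAnnulus a b) (hKc : IsCompact K) {t : ℝ}
    (ht : |t| < ε) : IsCompact (flowImage v t K) := by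
  rw [h.flowImage_eq hK ht]
  exact hKc.image_of_continuousOn ((h.continuousOn_flowMap ht).mono hK)

theorem setTendsto_flowImage (hK : K ⊆ closedAnnulus a b) (hKc : IsCompact K) {t : ℝ}
    (ht : |t| < ε) : SetTendsto (fun s => flowImage v s K) (𝓝 t) (flowImage v t K) := by
  have hev : ∀ᶠ s in 𝓝 t, |s| < ε := continuous_abs.continuousAt.eventually_lt_const ht
  have hd : ∀ δ > 0, ∀ᶠ s in 𝓝 t, ∀ z ∈ K, dist (flowMap v s z) (flowMap v t z) < δ := by
    intro δ hδ
    have h1 : Tendsto (fun s => M * |s - t|) (𝓝 t) (𝓝 0) := by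
      have : Continuous fun s => M * |s - t| := by fun_prop
      simpa using this.tendsto t
    filter_upwards [hev, h1.eventually_lt_const hδ] with s hs hs' z hz
    rw [dist_eq_norm]
    exact (h.norm_flowMap_time_sub_le (hK hz) ht hs).trans_lt hs'
  refine ⟨fun V hV hKV => ?_, fun V hV hKV => ?_⟩
  · obtain ⟨δ, hδ, hδV⟩ := (h.isCompact_flowImage hK hKc ht).exists_thickening_subset_open hV hKV
    filter_upwards [hev, hd δ hδ] with s hs hs'
    rw [h.flowImage_eq hK hs]
    rintro _ ⟨z, hz, rfl⟩
    refine hδV (Metric.mem_thickening_iff.2 ⟨_, ?_, hs' z hz⟩)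
    rw [h.flowImage_eq hK ht]
    exact mem_image_of_mem _ hz
  · rw [h.flowImage_eq hK ht] at hKV
    obtain ⟨_, ⟨z, hz, rfl⟩, hzV⟩ := hKV
    obtain ⟨δ, hδ, hδV⟩ := Metric.isOpen_iff.1 hV _ hzV
    filter_upwards [hev, hd δ hδ] with s hs hs'
    rw [h.flowImage_eq hK hs]
    exact ⟨_, mem_image_of_mem _ hz, hδV (hs' z hz)⟩

/-- The times at which the moved set is enclosing form an open set, by short-time stability, and a
relatively closed one, by stability under limits; the interval `|t| < ε` is connected. Allowing any
starting time `s` gives the implication in both directions of the flow. -/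
theorem surroundsZero_flowImage_of (hK : K ⊆ closedAnnulus a b) (hKc : IsCompact K)
    (hKcon : IsConnected K) {s : ℝ} (hs : |s| < ε) (hKs : SurroundsZero (flowImage v s K)) {t : ℝ}
    (ht : |t| < ε) : IsEnclosing (flowImage v t K) := by
  have henc : ∀ τ, |τ| < ε → SurroundsZero (flowImage v τ K) → IsEnclosing (flowImage v τ K) :=
    fun τ hτ hs => ⟨h.isCompact_flowImage hK hKc hτ, by
      rw [h.flowImage_eq hK hτ]
      exact hKcon.image _ ((h.continuousOn_flowMap hτ).mono hK), hs⟩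
  set W : Set ℝ := {τ | |τ| < ε ∧ IsEnclosing (flowImage v τ K)} with hW
  have hlt : ∀ τ, |τ| < ε → ∀ᶠ σ in 𝓝 τ, |σ| < ε := fun τ hτ =>
    continuous_abs.continuousAt.eventually_lt_const hτ
  have hWo : IsOpen W := by
    rw [isOpen_iff_mem_nhds]
    rintro τ ⟨hτ, hτe⟩
    have h1 : Tendsto (fun σ => σ - τ) (𝓝 τ) (𝓝 0) := by
      have : Continuous fun σ => σ - τ := by fun_prop
      simpa using this.tendsto τ
    filter_upwards [h1.eventually (hτe.eventually_flowImage v), hlt τ hτ] with σ hσ hσ'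
    refine ⟨hσ', ?_⟩
    rwa [h.flowImage_add hK hτ (by simpa using hσ'), add_sub_cancel] at hσ
  have hsub : Metric.ball (0 : ℝ) ε ⊆ W := by
    refine (convex_ball (0 : ℝ) ε).isPreconnected.subset_of_closure_inter_subset hWo
      ⟨s, by simpa using hs, hs, henc s hs hKs⟩ ?_
    rintro τ ⟨hτ, hτb⟩
    have hτ' : |τ| < ε := by simpa using hτb
    have : (𝓝[W] τ).NeBot := mem_closure_iff_nhdsWithin_neBot.1 hτ
    refine ⟨hτ', henc τ hτ' ?_⟩
    exact ((h.setTendsto_flowImage hK hKc hτ').mono nhdsWithin_le_nhds).surroundsZero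
      (h.isCompact_flowImage hK hKc hτ') (fun h0 => zero_notMem_closedAnnulus (half_pos h.pos)
        (h.flowImage_subset hK hτ' h0)) ((eventually_mem_nhdsWithin (s := W)).mono fun _ h => h.2)
  exact (hsub (by simpa using ht)).2

theorem isEnclosing_flowImage (hK : K ⊆ closedAnnulus a b) (hKe : IsEnclosing K) {t : ℝ}
    (ht : |t| < ε) : IsEnclosing (flowImage v t K) := by
  have h0 : |(0 : ℝ)| < ε := by simpa using h.time_pos
  refine h.surroundsZero_flowImage_of hK hKe.isCompact hKe.isConnected h0 ?_ ht
  rw [h.flowImage_zero hK]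
  exact hKe.surrounds

theorem isEnclosing_of_surroundsZero_flowImage (hK : K ⊆ closedAnnulus a b) (hKc : IsCompact K)
    (hKcon : IsConnected K) {t : ℝ} (ht : |t| < ε) (hs : SurroundsZero (flowImage v t K)) :
    IsEnclosing K := by
  have h0 : |(0 : ℝ)| < ε := by simpa using h.time_pos
  simpa only [h.flowImage_zero hK] using h.surroundsZero_flowImage_of hK hKc hKcon ht hs h0

/-- A functional regular along flows is Lipschitz along each flow, uniformly in an annulus. -/
theorem exists_lipschitz {F : Set ℂ → ℂ} (hF : IsFlowRegular F) :
    ∃ C, ∀ K, IsEnclosing K → K ⊆ closedAnnulus a b → ∀ s t, |s| < ε → |t| < ε →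
      ‖F (flowImage v t K) - F (flowImage v s K)‖ ≤ C * |t - s| := by
  obtain ⟨C, hC⟩ := hF v (a / 2) (b + a / 2) (half_pos h.pos)
  refine ⟨C, fun K hKe hK s t hs ht => ?_⟩
  -- The derivative at time `τ` is the derivative at time zero for the set already moved to time
  -- `τ`, which stays in the larger annulus where the bound holds.
  have hder : ∀ τ, |τ| < ε → ∃ c, ‖c‖ ≤ C ∧ HasDerivAt (fun t => F (flowImage v t K)) c τ := by
    intro τ hτ
    obtain ⟨-, c, hc, hd⟩ := hC _ (h.isEnclosing_flowImage hK hKe hτ) (h.flowImage_subset hK hτ)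
    refine ⟨c, hc, ?_⟩
    have h1 : HasDerivAt (fun σ => F (flowImage v (σ - τ) (flowImage v τ K))) c τ := by
      rw [← sub_self τ] at hd
      exact hd.comp_sub_const τ τ
    refine h1.congr_of_eventuallyEq ?_
    filter_upwards [continuous_abs.continuousAt.eventually_lt_const hτ] with σ hσ
    rw [h.flowImage_add hK hτ (by simpa using hσ), add_sub_cancel]
  choose! c hc hd using hder
  refine (convex_ball (0 : ℝ) ε).norm_image_sub_le_of_norm_hasDerivWithin_le
    (f := fun s => F (flowImage v s K)) (f' := c)
    (fun τ hτ => (hd τ ?_).hasDerivWithinAt)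
    (fun τ hτ => hc τ ?_) (mem_ball_zero_iff.2 hs) (mem_ball_zero_iff.2 ht)
  · simpa using hτ
  · simpa using hτ

end IsFlowBox

/-! ## Capacities and radii -/

/-- A crude substitute for the Koebe quarter theorem. The function `1 - φ / p` has no zero, so it
has a logarithm, whose real part is at most `log(1 + R/m)`. Borel–Carathéodory bounds its derivative
at `0`, which is `-φ'(0)/p`. The logarithmic loss is harmless in the use below. -/
theorem IsEnclosing.rhoZero_le {K : Set ℂ} (hK : IsEnclosing K) {m R : ℝ} (hm : 0 < m)
    (hR : 0 < R) {p : ℂ} (hp : p ∈ K) (hpm : ‖p‖ = m) (hKR : ∀ z ∈ K, ‖z‖ < R) :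
    rhoZero K ≤ 2 * m * Real.log (1 + R / m) := by
  set φ := phiPlus K
  have hφ : IsInteriorMap (interiorDomain K) φ := hK.isInteriorMap_phiPlus
  have hp0 : p ≠ 0 := norm_pos_iff.1 (hpm ▸ hm)
  have hd : DifferentiableOn ℂ (fun z => 1 - φ z / p) (Metric.ball 0 1) :=
    (hφ.differentiableOn.div_const p).const_sub 1
  have hne : ∀ z ∈ Metric.ball (0 : ℂ) 1, 1 - φ z / p ≠ 0 := fun z hz h0 => by
    have h1 : φ z = p := by
      rw [sub_eq_zero, eq_div_iff hp0, one_mul] at h0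
      exact h0.symm
    exact interiorDomain_subset (h1 ▸ hφ.mapsTo hz) hp
  obtain ⟨L, hL, hLe⟩ := exists_log_ball hd hne
  have h0 : (0 : ℂ) ∈ Metric.ball (0 : ℂ) 1 := Metric.mem_ball_self one_pos
  set A := Real.log (1 + R / m) with hA
  have hRm : 0 < R / m := div_pos hR hm
  have hApos : 0 < A := Real.log_pos (by linarith)
  have hLre : ∀ z ∈ Metric.ball (0 : ℂ) 1, (L z).re ≤ A := fun z hz => by
    rw [hA, Real.le_log_iff_exp_le (by linarith), ← Complex.norm_exp, hLe z hz]
    refine (norm_sub_le _ _).trans ?_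
    rw [norm_one, norm_div, hpm]
    gcongr
    exact (hK.norm_lt hKR _ (hφ.mapsTo hz)).le
  have hL0 : (L 0).re = 0 := by
    have h1 := congrArg norm (hLe 0 h0)
    rw [Complex.norm_exp, hφ.map_zero, zero_div, sub_zero, norm_one] at h1
    exact Real.exp_eq_one_iff _ |>.1 h1
  have hbc : ∀ z ∈ Metric.ball (0 : ℂ) 1, ‖L z - L 0‖ ≤ 2 * A * ‖z‖ / (1 - ‖z‖) := fun z hz =>
    Complex.borelCaratheodory_zero (f := fun z => L z - L 0) hApos (hL.sub_const _)
      (fun w hw => by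
        rw [mem_ofPred_eq, Complex.sub_re, hL0, sub_zero]
        exact hLre w hw) one_pos hz (sub_self _)
  have hLd : HasDerivAt L (deriv L 0) 0 :=
    (hL.differentiableAt (Metric.ball_mem_nhds _ one_pos)).hasDerivAt
  have hφd : HasDerivAt φ (deriv φ 0) 0 :=
    (hφ.differentiableOn.differentiableAt (Metric.ball_mem_nhds _ one_pos)).hasDerivAt
  have hderiv : deriv L 0 = -(deriv φ 0 / p) := by
    have h1 := hLd.cexp
    have h2 : HasDerivAt (fun z => Complex.exp (L z)) (-(deriv φ 0 / p)) 0 :=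
      ((hφd.div_const p).const_sub 1).congr_of_eventuallyEq (by
        filter_upwards [Metric.ball_mem_nhds (0 : ℂ) one_pos] with z hz using hLe z hz)
    have h3 := h1.unique h2
    rwa [hLe 0 h0, hφ.map_zero, zero_div, sub_zero, one_mul] at h3
  have hle : ‖deriv L 0‖ ≤ 2 * A := by
    have hslope := (hasDerivAt_iff_tendsto_slope.1 hLd).norm
    have hlim : Tendsto (fun z : ℂ => 2 * A / (1 - ‖z‖)) (𝓝[≠] 0) (𝓝 (2 * A)) := by
      have : ContinuousAt (fun z : ℂ => 2 * A / (1 - ‖z‖)) 0 :=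
        continuousAt_const.div (by fun_prop) (by simp)
      simpa using this.tendsto.mono_left nhdsWithin_le_nhds
    refine le_of_tendsto_of_tendsto hslope hlim ?_
    filter_upwards [nhdsWithin_le_nhds (Metric.ball_mem_nhds (0 : ℂ) one_pos),
      eventually_mem_nhdsWithin] with z hz hz0
    have hzn : 0 < ‖z‖ := norm_pos_iff.2 hz0
    rw [slope_def_field, sub_zero, norm_div, div_le_iff₀ hzn]
    exact (hbc z hz).trans_eq (by ring)
  rw [hderiv, norm_neg, norm_div, hpm, div_le_iff₀ hm] at hle
  have h5 := hK.ofReal_rhoZero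
  calc rhoZero K ≤ ‖(rhoZero K : ℂ)‖ := by rw [Complex.norm_real]; exact le_abs_self _
    _ = ‖deriv φ 0‖ := by rw [h5]
    _ ≤ _ := by linarith

/-- The fourth root is chosen so that the square of the logarithm is dominated by a square root. -/
theorem log_one_add_le {X : ℝ} (hX : 0 < X) : Real.log (1 + X) ≤ 4 * √√(1 + X) := by
  have h1 : 0 < √√(1 + X) := by positivity
  have h2 : Real.log (1 + X) = 4 * Real.log √√(1 + X) := by
    rw [Real.log_sqrt (by positivity), Real.log_sqrt (by positivity)]
    ring
  rw [h2]
  linarith [Real.log_le_sub_one_of_pos h1]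

/-- The continua of bounded capacity whose insides have conformal radius bounded below lie in a
fixed annulus. -/
theorem exists_annulus_of_rho {c C : ℝ} (hc : 0 < c) (hC : 0 < C) :
    ∃ m R, 0 < m ∧ 0 < R ∧ ∀ K, IsEnclosing K → c ≤ rhoZero K → rhoInfty K ≤ C →
      K ⊆ closedAnnulus m R := by
  set D := C / c with hD
  have hDpos : 0 < D := div_pos hC hc
  -- Comes from `X ≤ 128 D √(1 + X)` and `1 + X ≤ 2 X`, which give `X² ≤ 2 (128 D)² X`.
  set X₀ := 2 * (128 * D) ^ 2 with hX₀
  have hX₀pos : 0 < X₀ := by positivity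
  set L₀ := Real.log (1 + X₀) with hL₀
  have hL₀pos : 0 < L₀ := Real.log_pos (by linarith)
  refine ⟨c / (2 * L₀), 2 * C * L₀, by positivity, by positivity, fun K hK hρ0 hρi => ?_⟩
  obtain ⟨p, hp, hpmin⟩ := hK.isCompact.exists_isMinOn hK.isConnected.nonempty
    continuous_norm.continuousOn
  obtain ⟨q, hq, hqmax⟩ := hK.isCompact.exists_isMaxOn hK.isConnected.nonempty
    continuous_norm.continuousOn
  have hne : ∀ z ∈ K, 0 < ‖z‖ := fun z hz =>
    norm_pos_iff.2 fun h0 => hK.zero_notMem (h0 ▸ hz)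
  have hm := hne p hp
  have hM := hne q hq
  have hmM : ‖p‖ ≤ ‖q‖ := hqmax hp
  -- The factor `2` is there only because the lemma wants strict bounds on the moduli.
  have h1 := hK.rhoZero_le hm (mul_pos two_pos hM) hp rfl fun z hz => by
    have : ‖z‖ ≤ ‖q‖ := hqmax hz
    linarith
  have hq' : q⁻¹ ∈ invSet K := mem_image_of_mem _ hq
  have h2 := hK.invSet.rhoZero_le (m := ‖q‖⁻¹) (R := 2 * ‖p‖⁻¹) (inv_pos.2 hM)
    (mul_pos two_pos (inv_pos.2 hm)) hq' (norm_inv q) (by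
      rintro _ ⟨z, hz, rfl⟩
      have h3 : ‖p‖ ≤ ‖z‖ := hpmin hz
      rw [norm_inv]
      have := inv_anti₀ hm h3
      linarith [inv_pos.2 hm])
  set X := 2 * ‖q‖ / ‖p‖ with hX
  rw [show 2 * ‖p‖⁻¹ / ‖q‖⁻¹ = X by rw [hX]; field_simp] at h2
  set L := Real.log (1 + X) with hL
  have hX1 : 1 ≤ X := by
    rw [hX, le_div_iff₀ hm]
    linarith
  have hLpos : 0 < L := Real.log_pos (by linarith)
  have h3 : c ≤ 2 * ‖p‖ * L := hρ0.trans h1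
  have h4 : ‖q‖ ≤ 2 * C * L := by
    rw [hK.rhoInfty_eq, inv_le_comm₀ hK.invSet.rhoZero_pos hC] at hρi
    have h5 := hρi.trans h2
    rw [inv_le_iff_one_le_mul₀ hC] at h5
    field_simp at h5
    linarith
  -- The estimates for `K` and for its inversion bound the ratio of the largest to the smallest
  -- modulus by a power of its own logarithm, so the ratio is bounded; each modulus is then bounded
  -- separately.
  have h5 : X ≤ 8 * D * L ^ 2 := by
    have h6 : ‖q‖ * c ≤ 2 * C * L * (2 * ‖p‖ * L) := mul_le_mul h4 h3 hc.le (by positivity)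
    rw [hX, hD, div_le_iff₀ hm]
    have h7 : 8 * (C / c) * L ^ 2 * ‖p‖ = 2 * (2 * C * L * (2 * ‖p‖ * L)) / c := by
      field_simp
      ring
    rw [h7, le_div_iff₀ hc]
    linarith
  have h6 : L ^ 2 ≤ 16 * √(1 + X) := by
    have h7 := pow_le_pow_left₀ hLpos.le (log_one_add_le (by linarith : 0 < X)) 2
    rwa [mul_pow, Real.sq_sqrt (Real.sqrt_nonneg _), show (4 : ℝ) ^ 2 = 16 by norm_num] at h7
  have h7 : X ≤ 128 * D * √(1 + X) := by
    have := mul_le_mul_of_nonneg_left h6 (by positivity : 0 ≤ 8 * D)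
    linarith
  have h8 : X ≤ X₀ := by
    have h9 := pow_le_pow_left₀ (by linarith) h7 2
    rw [mul_pow _ √(1 + X), Real.sq_sqrt (by linarith)] at h9
    have h10 : X * X ≤ X₀ * X := by
      have := mul_le_mul_of_nonneg_left (by linarith : 1 + X ≤ 2 * X)
        (by positivity : 0 ≤ (128 * D) ^ 2)
      rw [hX₀]
      nlinarith
    exact le_of_mul_le_mul_right h10 (by linarith)
  have h9 : L ≤ L₀ := Real.log_le_log (by linarith) (by linarith)
  intro z hz
  have hzp : ‖p‖ ≤ ‖z‖ := hpmin hz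
  have hzq : ‖z‖ ≤ ‖q‖ := hqmax hz
  refine ⟨le_trans ?_ hzp, hzq.trans (h4.trans (by gcongr))⟩
  rw [div_le_iff₀ (by positivity)]
  refine h3.trans ?_
  have := mul_le_mul_of_nonneg_left h9 (by positivity : 0 ≤ 2 * ‖p‖)
  linarith

/-- Compactness of the support in the open quadrant gives a positive minimum of the first coordinate
and a maximum of the second. -/
theorem exists_annulus_of_testFunction_ne_zero (p : MvPolynomial CoeffVar ℂ) {f : ℝ × ℝ → ℂ}
    (hfc : HasCompactSupport f) (hfs : tsupport f ⊆ Ioi 0 ×ˢ Ioi 0) :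
    ∃ m R, 0 < m ∧ 0 < R ∧ ∀ K, IsEnclosing K → testFunction p f K ≠ 0 →
      K ⊆ closedAnnulus m R := by
  have hmem : ∀ K, testFunction p f K ≠ 0 → (rhoZero K, rhoInfty K) ∈ tsupport f := fun K hK =>
    subset_tsupport f (right_ne_zero_of_mul hK)
  rcases (tsupport f).eq_empty_or_nonempty with he | hne
  · exact ⟨1, 1, one_pos, one_pos, fun K _ h => by
      have := hmem K h
      rw [he] at this
      exact this.elim⟩
  obtain ⟨x, hx, hxmin⟩ := IsCompact.exists_isMinOn hfc hne continuous_fst.continuousOn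
  obtain ⟨y, hy, hymax⟩ := IsCompact.exists_isMaxOn hfc hne continuous_snd.continuousOn
  obtain ⟨m, R, hm, hR, h⟩ := exists_annulus_of_rho (c := x.1) (C := y.2) (hfs hx).1 (hfs hy).2
  exact ⟨m, R, hm, hR, fun K hK hne => h K hK (hxmin (hmem K hne)) (hymax (hmem K hne))⟩

/-! ## Images of loops -/

/-- The preimage loop is `g '' γ.toSet`: on it, `f` and `g` are mutually inverse homeomorphisms.
Continuity of `g` is needed only on the loop. -/
theorem Loop.mem_range_map {S T : Type*} [TopologicalSpace S] [TopologicalSpace T] [T2Space S]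
    [T2Space T] {f : S → T} (hf : Continuous f) (hinj : Function.Injective f) {γ : Loop T}
    {g : T → S} (hg : ContinuousOn g γ.toSet) (hfg : ∀ y ∈ γ.toSet, f (g y) = y) :
    γ ∈ range (Loop.map f hf hinj) := by
  obtain ⟨e⟩ := γ.2
  have hK : IsCompact γ.toSet := γ.1.isCompact
  have hfin : ∀ x ∈ g '' γ.toSet, f x ∈ γ.toSet := by
    rintro _ ⟨y, hy, rfl⟩
    rwa [hfg y hy]
  have hgf : ∀ x ∈ g '' γ.toSet, g (f x) = x := by
    rintro _ ⟨y, hy, rfl⟩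
    rw [hfg y hy]
  let e' : (g '' γ.toSet) ≃ₜ γ.toSet :=
    { toFun := fun x => ⟨f x, hfin x x.2⟩
      invFun := fun y => ⟨g y, mem_image_of_mem g y.2⟩
      left_inv := fun x => Subtype.ext (hgf x x.2)
      right_inv := fun y => Subtype.ext (hfg y y.2)
      continuous_toFun := (hf.comp continuous_subtype_val).subtype_mk _
      continuous_invFun := hg.domRestrict.subtype_mk _ }
  refine ⟨⟨⟨g '' γ.toSet, hK.image_of_continuousOn hg⟩, ⟨e'.trans e⟩⟩, ?_⟩
  refine Subtype.ext (TopologicalSpace.Compacts.ext ?_)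
  change f '' (g '' γ.toSet) = γ.toSet
  rw [image_image]
  exact (image_congr fun y hy => hfg y hy).trans (image_id' _)

theorem Loop.isEmbedding_map {S T : Type*} [TopologicalSpace S] [TopologicalSpace T] [T2Space T]
    {f : S → T} (hf : IsEmbedding f) : IsEmbedding (Loop.map f hf.continuous hf.injective) :=
  IsEmbedding.of_comp (Loop.continuous_map f hf.continuous hf.injective) continuous_subtype_val
    (hf.compacts_map.comp IsEmbedding.subtypeVal)

/-! ## Loops in an annulus -/

/-- An open annulus, as an open subset of the plane. -/
def openAnnulus (m R : ℝ) : TopologicalSpace.Opens ℂ :=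
  ⟨{z | m < ‖z‖ ∧ ‖z‖ < R}, (isOpen_lt continuous_const continuous_norm).inter
    (isOpen_lt continuous_norm continuous_const)⟩

theorem mem_openAnnulus {m R : ℝ} {z : ℂ} : z ∈ openAnnulus m R ↔ m < ‖z‖ ∧ ‖z‖ < R := Iff.rfl

theorem isConnected_openAnnulus {m R : ℝ} (hm : 0 < m) (hmR : m < R) :
    IsConnected (openAnnulus m R : Set ℂ) := by
  have h1 : (openAnnulus m R : Set ℂ) =
      Complex.exp '' ({w | Real.log m < w.re} ∩ {w | w.re < Real.log R}) := by
    ext z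
    simp only [SetLike.mem_coe, mem_openAnnulus, mem_image, mem_inter_iff, mem_ofPred_eq]
    constructor
    · rintro ⟨hz, hz'⟩
      have hz0 : z ≠ 0 := norm_pos_iff.1 (hm.trans hz)
      exact ⟨Complex.log z, by
        rw [Complex.log_re]
        exact ⟨Real.log_lt_log hm hz, Real.log_lt_log (hm.trans hz) hz'⟩, Complex.exp_log hz0⟩
    · rintro ⟨w, ⟨hw, hw'⟩, rfl⟩
      rw [Complex.norm_exp, ← Real.log_lt_iff_lt_exp hm, ← Real.lt_log_iff_exp_lt (hm.trans hmR)]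
      exact ⟨hw, hw'⟩
  rw [h1]
  have hlog := Real.log_lt_log hm hmR
  refine IsConnected.image ⟨⟨(((Real.log m + Real.log R) / 2 : ℝ) : ℂ), ?_⟩,
    ((convex_halfSpace_re_gt _).inter (convex_halfSpace_re_lt _)).isPreconnected⟩ _
    Complex.continuous_exp.continuousOn
  simp only [mem_inter_iff, mem_ofPred_eq, Complex.ofReal_re]
  constructor <;> linarith

theorem mem_range_map_subtype_val {U : TopologicalSpace.Opens ℂ} (hU : (U : Set ℂ).Nonempty)
    {γ : Loop ℂ} :
    γ ∈ range (Loop.map (Subtype.val : U → ℂ) continuous_subtype_val Subtype.val_injective) ↔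
      γ.toSet ⊆ U := by
  constructor
  · rintro ⟨γ', rfl⟩
    rw [Loop.toSet_map]
    rintro _ ⟨x, -, rfl⟩
    exact x.2
  · intro hγ
    classical
    obtain ⟨z₀, hz₀⟩ := hU
    refine Loop.mem_range_map _ _ (g := fun z => if h : z ∈ U then ⟨z, h⟩ else ⟨z₀, hz₀⟩) ?_ ?_
    · rw [continuousOn_iff_continuous_domRestrict, IsEmbedding.subtypeVal.continuous_iff]
      convert (continuous_subtype_val : Continuous fun x : γ.toSet => (x : ℂ)) using 1
      ext x
      simp [show (x : ℂ) ∈ U from hγ x.2]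
    · intro y hy
      simp [show y ∈ U from hγ hy]

/-! ## Finiteness of the measure -/

theorem SurroundsZero.mul_left {K : Set ℂ} (h : SurroundsZero K) {c : ℂ} (hc : c ≠ 0) :
    SurroundsZero ((fun z => c * z) '' K) := by
  have h0 : (0 : ℂ) ∉ (fun z => c * z) '' K := by
    rintro ⟨z, hz, h1⟩
    rcases mul_eq_zero.1 h1 with h2 | h2
    · exact hc h2
    · exact h.1 (h2 ▸ hz)
  refine ⟨h0, ?_⟩
  have h1 := (Homeomorph.mulLeft₀ c hc).image_connectedComponentIn (s := Kᶜ) (x := 0) h.1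
  rw [image_compl_eq (Homeomorph.mulLeft₀ c hc).bijective] at h1
  simp only [Homeomorph.coe_mulLeft₀, mul_zero] at h1
  rw [← h1]
  exact h.2.image (c • ContinuousLinearMap.id ℂ ℂ)

namespace LoopMeasureFamily

variable {μ : LoopMeasureFamily}

/-- A dilation is a conformal embedding of the plane onto itself, so restricting to its image
restricts nothing. -/
theorem ConformalRestriction.map_loop_mul_left (hμ : μ.ConformalRestriction) {c : ℂ} (hc : c ≠ 0) :
    (μ ℂ).map (Loop.map (fun z => c * z) (continuous_const_mul c) (mul_right_injective₀ hc)) =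
      μ ℂ := by
  have h1 := hμ ℂ ℂ (fun z => c * z)
    (Differentiable.mdifferentiable (by fun_prop)) (mul_right_injective₀ hc)
  rw [h1, range_eq_univ.2, Measure.restrict_univ]
  intro γ
  refine Loop.mem_range_map _ _ (g := fun z => c⁻¹ * z) (by fun_prop) fun y _ => ?_
  rw [mul_inv_cancel_left₀ hc]

/-- The loops that surround the origin, stay in `{|z| < t}` and leave `{|z| < s}`. -/
def crossing (s t : ℝ) : Set (Loop ℂ) :=
  {γ | γ.toSet ⊆ {z | 0 < ‖z‖ ∧ ‖z‖ < t} ∧ ¬ γ.toSet ⊆ {z | ‖z‖ < s} ∧ SurroundsZero γ.toSet}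

/-- Only the inequality is needed, and it holds for the measure of a preimage without measurability
of the crossing set. -/
theorem ConformalRestriction.measure_crossing_mul_le (hμ : μ.ConformalRestriction) {c : ℝ}
    (hc : 0 < c) (s t : ℝ) : μ ℂ (crossing (c * s) (c * t)) ≤ μ ℂ (crossing s t) := by
  have hc' : ((c⁻¹ : ℝ) : ℂ) ≠ 0 := by exact_mod_cast (inv_pos.2 hc).ne'
  have hnorm : ∀ z : ℂ, ‖((c⁻¹ : ℝ) : ℂ) * z‖ = c⁻¹ * ‖z‖ := fun z => by
    rw [norm_mul, Complex.norm_real, Real.norm_of_nonneg (inv_pos.2 hc).le]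
  have hlt : ∀ {x r : ℝ}, c⁻¹ * x < r ↔ x < c * r := fun {x r} => by
    rw [inv_mul_lt_iff₀ hc]
  have h1 := Measure.le_map_apply (μ := μ ℂ) (s := crossing s t)
    (Loop.continuous_map (fun z : ℂ => ((c⁻¹ : ℝ) : ℂ) * z) (continuous_const_mul _)
      (mul_right_injective₀ hc')).aemeasurable
  rw [hμ.map_loop_mul_left hc'] at h1
  refine (measure_mono ?_).trans h1
  rintro γ ⟨h2, h3, h4⟩
  refine ⟨?_, fun h5 => h3 fun z hz => ?_, h4.mul_left hc'⟩
  · rw [Loop.toSet_map]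
    rintro _ ⟨z, hz, rfl⟩
    obtain ⟨h5, h6⟩ := h2 hz
    rw [mem_ofPred_eq, hnorm, hlt]
    exact ⟨mul_pos (inv_pos.2 hc) h5, h6⟩
  · have h6 := h5 (mem_image_of_mem _ hz)
    rw [mem_ofPred_eq, hnorm, hlt] at h6
    exact h6

/-- Nontriviality gives finite measure for one crossing set with ratio `A / a > 1`, and dilations
for all its scaled copies. A loop that leaves radius `m` and stays below `m (A/a)^(n+1)` either
stays below `m (A/a)^n` or lies in one further copy. -/
theorem ConformalRestriction.measure_loops_lt_top (hμ : μ.ConformalRestriction)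
    (hμ' : μ.IsNontrivial) {m : ℝ} (hm : 0 < m) (R : ℝ) : μ ℂ (crossing m R) < ⊤ := by
  obtain ⟨a, A, ha, haA, -, hfin⟩ := hμ'
  have hfin' : μ ℂ (crossing a A) < ⊤ := hfin
  have hq : 1 < A / a := (one_lt_div ha).2 haA
  have key : ∀ n : ℕ, μ ℂ (crossing m (m * (A / a) ^ n)) < ⊤ := by
    intro n
    induction n with
    | zero =>
      convert ENNReal.zero_lt_top
      rw [pow_zero, mul_one]
      convert measure_empty
      refine eq_empty_of_forall_notMem fun γ hγ => hγ.2.1 fun z hz => (hγ.1 hz).2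
      infer_instance
    | succ n ih =>
      have h1 := (hμ.measure_crossing_mul_le (c := m * (A / a) ^ n / a) (by positivity) a A).trans_lt
        hfin'
      rw [div_mul_cancel₀ _ ha.ne'] at h1
      refine (measure_mono ?_).trans_lt ((measure_union_le _ _).trans_lt (ENNReal.add_lt_top.2 ⟨ih, h1⟩))
      rintro γ ⟨h2, h3, h4⟩
      by_cases h5 : γ.toSet ⊆ {z | ‖z‖ < m * (A / a) ^ n}
      · exact Or.inl ⟨fun z hz => ⟨(h2 hz).1, h5 hz⟩, h3, h4⟩
      · refine Or.inr ⟨fun z hz => ⟨(h2 hz).1, (h2 hz).2.trans_eq ?_⟩, h5, h4⟩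
        rw [pow_succ]
        field_simp
  obtain ⟨n, hn⟩ := pow_unbounded_of_one_lt (R / m) hq
  refine (measure_mono ?_).trans_lt (key n)
  rintro γ ⟨h2, h3, h4⟩
  refine ⟨fun z hz => ⟨(h2 hz).1, (h2 hz).2.trans ?_⟩, h3, h4⟩
  rw [div_lt_iff₀ hm] at hn
  linarith

end LoopMeasureFamily

/-! ### Change of variables and differentiation under the integral sign -/

namespace LoopMeasureFamily.ConformalRestriction

variable {μ : LoopMeasureFamily} (hμ : μ.ConformalRestriction)
  {S : Type} [TopologicalSpace S] [T2Space S] [ConnectedSpace S] [ChartedSpace ℂ S]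
  [IsManifold 𝓘(ℂ) 1 S] {f : S → ℂ} (hf : MDifferentiable 𝓘(ℂ) 𝓘(ℂ) f)
  (hinj : Function.Injective f)

include hμ

/-- Conformal restriction read as a change of variables: since `G` vanishes off the loops in the
image, restricting the measure does not change its integral. -/
theorem integral_comp_map {G : Loop ℂ → ℂ} (hG : Measurable G)
    (hsupp : Function.support G ⊆ range (Loop.map f hf.continuous hinj)) :
    ∫ γ, G (Loop.map f hf.continuous hinj γ) ∂μ S = ∫ γ, G γ ∂μ ℂ := by
  rw [← integral_map (Loop.continuous_map f hf.continuous hinj).aemeasurable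
    hG.aestronglyMeasurable, hμ S ℂ f hf hinj]
  exact setIntegral_eq_integral_of_forall_compl_eq_zero fun γ hγ => by
    by_contra h0
    exact hγ (hsupp h0)

end LoopMeasureFamily.ConformalRestriction

open scoped Classical in
/-- The extension by zero of a functional of the sets surrounding the origin. -/
noncomputable def extendZero (F : Set ℂ → ℂ) (K : Set ℂ) : ℂ := if SurroundsZero K then F K else 0

theorem extendZero_of_surroundsZero {F : Set ℂ → ℂ} {K : Set ℂ} (h : SurroundsZero K) :
    extendZero F K = F K := if_pos h

theorem extendZero_of_not_surroundsZero {F : Set ℂ → ℂ} {K : Set ℂ} (h : ¬ SurroundsZero K) :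
    extendZero F K = 0 := if_neg h

theorem extendZero_toSet (F : Set ℂ → ℂ) :
    (fun γ : Loop ℂ => extendZero F γ.toSet) =
      loopsAroundZero.indicator fun γ => F γ.toSet := by
  classical
  ext γ
  by_cases h : SurroundsZero γ.toSet
  · rw [extendZero_of_surroundsZero h, indicator_of_mem (show γ ∈ loopsAroundZero from h)]
  · rw [extendZero_of_not_surroundsZero h, indicator_of_notMem (show γ ∉ loopsAroundZero from h)]

theorem measurable_extendZero {F : Set ℂ → ℂ}
    (hF : ContinuousOn (fun γ : Loop ℂ => F γ.toSet) loopsAroundZero) :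
    Measurable fun γ : Loop ℂ => extendZero F γ.toSet := by
  classical
  rw [extendZero_toSet, ← piecewise_eq_indicator]
  exact hF.measurable_piecewise continuousOn_const measurableSet_loopsAroundZero

/-- A functional of loops that is regular along flows and vanishes off an annulus has an integrable
derivative of integral zero along each flow. -/
theorem integrable_realAction {μ : LoopMeasureFamily} (hμ : μ.ConformalRestriction)
    (hμ' : μ.IsNontrivial) {F : Set ℂ → ℂ} (hF : IsFlowRegular F)
    (hFc : ContinuousOn (fun γ : Loop ℂ => F γ.toSet) loopsAroundZero) {m R : ℝ} (hm : 0 < m)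
    (hR : 0 < R) (hsupp : ∀ K, IsEnclosing K → F K ≠ 0 → K ⊆ closedAnnulus m R) (v : ℂ[T;T⁻¹]) :
    Integrable (fun γ : Loop ℂ => realAction v F γ.toSet) μ.muZero ∧
      ∫ γ : Loop ℂ, realAction v F γ.toSet ∂μ.muZero = 0 := by
  -- The margins: `F` lives on loops with `m ≤ |z| ≤ R`, the surface `A` is `m/2 < |z| < R + m`, and
  -- the flow is controlled on `m/4 ≤ |z| ≤ R + m`.
  obtain ⟨ε, M, h⟩ := exists_isFlowBox v (R + m) (a := m / 4) (by linarith)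
  set A := openAnnulus (m / 2) (R + m) with hA
  have hAsub : (A : Set ℂ) ⊆ closedAnnulus (m / 4) (R + m) := fun z hz =>
    ⟨by linarith [hz.1], hz.2.le⟩
  have hcon := isConnected_openAnnulus (half_pos hm) (show m / 2 < R + m by linarith)
  have : ConnectedSpace A := isConnected_iff_connectedSpace.1 hcon
  have hMpos : (0 : ℝ) < M := h.bound_pos
  -- In this time points move by less than `m / 2`, so every loop in the support of `F` is the
  -- flowed image of a loop in `A`.
  set δ := min ε (m / (2 * M)) with hδ
  have hδpos : 0 < δ := lt_min h.time_pos (by positivity)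
  have hδε : ∀ {t : ℝ}, |t| < δ → |-t| < ε := fun ht => by
    rw [abs_neg]
    exact ht.trans_le (min_le_left _ _)
  -- the embeddings of the annulus given by the flow
  have hq : ∀ t : ℝ, |t| < δ → MDifferentiable 𝓘(ℂ) 𝓘(ℂ) fun z : A => flowMap v (-t) z :=
    fun t ht z => by
      have h1 : DifferentiableAt ℂ (flowMap v (-t)) z :=
        h.differentiableAt_flowMap (Filter.mem_of_superset (A.2.mem_nhds z.2) hAsub) (hδε ht)
      exact h1.mdifferentiableAt.comp z (contMDiff_subtype_val.mdifferentiable one_ne_zero z)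
  have hqinj : ∀ t : ℝ, |t| < δ → Function.Injective fun z : A => flowMap v (-t) z :=
    fun t ht z w hzw => Subtype.ext (h.injOn (hδε ht) (hAsub z.2) (hAsub w.2) hzw)
  set j : Loop A → Loop ℂ := Loop.map Subtype.val continuous_subtype_val Subtype.val_injective
    with hj
  have hjsub : ∀ γ, (j γ).toSet ⊆ closedAnnulus (m / 4) (R + m) := fun γ => by
    rw [hj, Loop.toSet_map]
    rintro _ ⟨z, -, rfl⟩
    exact hAsub z.2
  have hjemb : MeasurableEmbedding j := by
    refine (Loop.isEmbedding_map IsEmbedding.subtypeVal).measurableEmbedding ?_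
    have h1 : range j = {γ : Loop ℂ | γ.toSet ⊆ A} :=
      Set.ext fun γ => mem_range_map_subtype_val hcon.nonempty
    exact h1 ▸ (isOpen_loops_subset A.2).measurableSet
  have hjmap : (μ A).map j = (μ ℂ).restrict (range j) :=
    hμ A ℂ Subtype.val (contMDiff_subtype_val.mdifferentiable one_ne_zero) Subtype.val_injective
  -- the functional along the flow
  set H : ℝ → Loop A → ℂ := fun t γ => extendZero F (flowImage v (-t) (j γ).toSet) with hH
  have hHeq : ∀ (t : ℝ) (ht : |t| < δ), H t = fun γ =>
      extendZero F (Loop.map _ (hq t ht).continuous (hqinj t ht) γ).toSet := fun t ht => by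
    ext γ
    rw [Loop.toSet_map, hH]
    dsimp only
    rw [h.flowImage_eq (hjsub γ) (hδε ht), hj, Loop.toSet_map, image_image]
  have hHmeas : ∀ t, |t| < δ → Measurable (H t) := fun t ht => by
    rw [hHeq t ht]
    exact (measurable_extendZero hFc).comp (Loop.continuous_map _ _ _).measurable
  have hsub : ∀ γ : Loop ℂ, extendZero F γ.toSet ≠ 0 → γ.toSet ⊆ closedAnnulus m R := by
    intro γ hγ
    by_cases hs : SurroundsZero γ.toSet
    · rw [extendZero_of_surroundsZero hs] at hγ
      exact hsupp _ (Loop.isEnclosing hs) hγ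
    · exact absurd (extendZero_of_not_surroundsZero hs) hγ
  -- The integral is independent of `t`: each flow map is a conformal embedding of the same surface
  -- `A` whose image contains every loop on which `F` is nonzero.
  have hHint : ∀ t, |t| < δ → ∫ γ, H t γ ∂μ A = ∫ γ : Loop ℂ, extendZero F γ.toSet ∂μ ℂ := by
    intro t ht
    rw [hHeq t ht]
    refine hμ.integral_comp_map (hq t ht) (hqinj t ht) (measurable_extendZero hFc) fun γ hγ => ?_
    have hγA : γ.toSet ⊆ closedAnnulus (m / 4) (R + m) := fun z hz =>
      ⟨by linarith [(hsub γ hγ hz).1], by linarith [(hsub γ hγ hz).2]⟩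
    have ht' : |t| < ε := ht.trans_le (min_le_left _ _)
    have hback : ∀ z ∈ γ.toSet, flowMap v t z ∈ A := fun z hz => by
      have h1 := h.norm_sub_le z (hγA hz) t ht'
      have h2 : M * |t| < m / 2 := by
        have := ht.trans_le (min_le_right _ _)
        rw [lt_div_iff₀ (by positivity)] at this
        linarith
      have h3 := hsub γ hγ hz
      have h4 := norm_sub_norm_le z (flowMap v t z)
      rw [norm_sub_rev] at h4
      have h5 := norm_sub_norm_le (flowMap v t z) z
      exact ⟨by linarith [h3.1], by linarith [h3.2]⟩
    classical
    obtain ⟨z₀, hz₀⟩ := hcon.nonempty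
    refine Loop.mem_range_map _ _
      (g := fun z => if h : flowMap v t z ∈ A then ⟨flowMap v t z, h⟩ else ⟨z₀, hz₀⟩) ?_ ?_
    · rw [continuousOn_iff_continuous_domRestrict, IsEmbedding.subtypeVal.continuous_iff]
      convert! ((h.continuousOn_flowMap ht').mono hγA).domRestrict using 1
      ext x
      simp [hback x x.2]
    · intro z hz
      simp only [hback z hz, dif_pos]
      exact h.flowMap_neg_flowMap (hγA hz) ht'
  -- derivatives and bounds
  obtain ⟨C, hC⟩ := h.exists_lipschitz hF
  obtain ⟨C', hC'⟩ := hF v (m / 4) (R + m) h.pos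
  -- A set of finite measure that carries all the functionals `H t`, so constants on it serve as
  -- dominating functions.
  set B : Set (Loop A) := j ⁻¹' loopsAroundZero with hB
  have hBmeas : MeasurableSet B := hjemb.measurable measurableSet_loopsAroundZero
  have hBfin : μ A B < ⊤ := by
    rw [hB, ← Measure.map_apply hjemb.measurable measurableSet_loopsAroundZero, hjmap,
      Measure.restrict_apply measurableSet_loopsAroundZero]
    refine (measure_mono ?_).trans_lt (hμ.measure_loops_lt_top hμ' (half_pos hm) (R + m))
    rintro γ ⟨hγ, hγA⟩
    have hγA' : γ.toSet ⊆ A := (mem_range_map_subtype_val hcon.nonempty).1 hγA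
    refine ⟨fun z hz => ⟨(half_pos hm).trans (hγA' hz).1, (hγA' hz).2⟩, fun h1 => ?_, hγ⟩
    obtain ⟨z, hz⟩ := γ.isConnected.nonempty
    exact lt_asymm (h1 hz) (hγA' hz).1
  -- The flow does not turn a loop that fails to surround `0` into one that surrounds it, so one set
  -- `B` works for all `t`.
  have hHzero : ∀ γ ∉ B, ∀ t, |t| < δ → H t γ = 0 := fun γ hγ t ht =>
    extendZero_of_not_surroundsZero fun hs => hγ
      (h.isEnclosing_of_surroundsZero_flowImage (hjsub γ) (j γ).1.isCompact (j γ).isConnected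
        (hδε ht) hs).surrounds
  have hHF : ∀ γ ∈ B, ∀ t, |t| < δ → H t γ = F (flowImage v (-t) (j γ).toSet) := fun γ hγ t ht =>
    extendZero_of_surroundsZero
      (h.isEnclosing_flowImage (hjsub γ) (Loop.isEnclosing hγ) (hδε ht)).surrounds
  set D : Set ℂ → ℂ := extendZero (realAction v F) with hD
  have hball : Metric.ball (0 : ℝ) δ ∈ 𝓝 0 := Metric.ball_mem_nhds _ hδpos
  have habs : ∀ {t : ℝ}, t ∈ Metric.ball (0 : ℝ) δ → |t| < δ := fun ht => by simpa using ht
  have h0δ : |(0 : ℝ)| < δ := by simpa using hδpos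
  have hder : ∀ γ, HasDerivAt (H · γ) (D (j γ).toSet) 0 := by
    intro γ
    by_cases hγ : γ ∈ B
    · rw [hD, extendZero_of_surroundsZero hγ]
      refine (hF.hasDerivAt_flowImage_neg (Loop.isEnclosing hγ) v).congr_of_eventuallyEq ?_
      filter_upwards [hball] with t ht using hHF γ hγ t (habs ht)
    · rw [hD, extendZero_of_not_surroundsZero hγ]
      refine (hasDerivAt_const (0 : ℝ) (0 : ℂ)).congr_of_eventuallyEq ?_
      filter_upwards [hball] with t ht using hHzero γ hγ t (habs ht)
  -- The derivative is a pointwise limit of measurable difference quotients; the times `δ / (n + 2)`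
  -- are nonzero and strictly below `δ`.
  have hDmeas : Measurable fun γ => D (j γ).toSet := by
    have hu : ∀ n : ℕ, |δ / (n + 2)| < δ := fun n => by
      rw [abs_of_pos (by positivity), div_lt_iff₀ (by positivity)]
      nlinarith [(Nat.cast_nonneg n : (0 : ℝ) ≤ n)]
    have hlim : Tendsto (fun n : ℕ => δ / ((n : ℝ) + 2)) atTop (𝓝[≠] 0) := by
      refine tendsto_nhdsWithin_iff.2 ⟨?_, Eventually.of_forall fun n => ?_⟩
      · exact tendsto_const_nhds.div_atTop
          (tendsto_atTop_add_const_right _ _ tendsto_natCast_atTop_atTop)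
      · exact (by positivity : (0 : ℝ) < δ / (n + 2)).ne'
    refine measurable_of_tendsto_metrizable
      (f := fun (n : ℕ) γ => slope (H · γ) 0 (δ / (n + 2))) (fun n => ?_)
      (tendsto_pi_nhds.2 fun γ => (hasDerivAt_iff_tendsto_slope.1 (hder γ)).comp hlim)
    simp only [slope_def_module]
    exact ((hHmeas _ (hu n)).sub (hHmeas 0 h0δ)).const_smul _
  have hmain := hasDerivAt_integral_of_dominated_loc_of_lip (μ := μ A) (F := H) (x₀ := (0 : ℝ))
    (F' := fun γ => D (j γ).toSet) (bound := B.indicator fun _ => C) hball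
    (by filter_upwards [hball] with t ht using (hHmeas t (habs ht)).aestronglyMeasurable)
    (Integrable.mono' (g := B.indicator fun _ => C')
      ((integrable_indicator_iff hBmeas).2 (integrableOn_const hBfin.ne))
      (hHmeas 0 h0δ).aestronglyMeasurable (Eventually.of_forall fun γ => by
        by_cases hγ : γ ∈ B
        · rw [indicator_of_mem hγ, hHF γ hγ 0 h0δ, neg_zero, h.flowImage_zero (hjsub γ)]
          exact (hC' _ (Loop.isEnclosing hγ) (hjsub γ)).1
        · rw [indicator_of_notMem hγ, hHzero γ hγ 0 h0δ, norm_zero]))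
    hDmeas.aestronglyMeasurable
    (Eventually.of_forall fun γ => LipschitzOnWith.of_dist_le_mul fun t ht s hs => by
      rw [Real.coe_nnabs, dist_eq_norm, dist_eq_norm]
      by_cases hγ : γ ∈ B
      · rw [indicator_of_mem hγ, hHF γ hγ t (habs ht), hHF γ hγ s (habs hs)]
        refine (hC _ (Loop.isEnclosing hγ) (hjsub γ) (-s) (-t) (hδε (habs hs))
          (hδε (habs ht))).trans ?_
        rw [show -t - -s = -(t - s) by ring, abs_neg, Real.norm_eq_abs]
        gcongr
        exact le_abs_self C
      · rw [hHzero γ hγ t (habs ht), hHzero γ hγ s (habs hs), sub_self, norm_zero]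
        positivity)
    ((integrable_indicator_iff hBmeas).2 (integrableOn_const hBfin.ne))
    (Eventually.of_forall hder)
  -- The derivative of a function of `t` that is constant near `0`.
  have hzero : ∫ γ, D (j γ).toSet ∂μ A = 0 := by
    refine hmain.2.unique ((hasDerivAt_const (0 : ℝ)
      (∫ γ : Loop ℂ, extendZero F γ.toSet ∂μ ℂ)).congr_of_eventuallyEq ?_)
    filter_upwards [hball] with t ht using hHint t (habs ht)
  -- back to the plane
  have hDsupp : Function.support (fun γ : Loop ℂ => D γ.toSet) ⊆ range j := by
    intro γ hγ
    refine (mem_range_map_subtype_val hcon.nonempty).2 ?_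
    by_contra hcon'
    refine hγ ?_
    by_cases hs : SurroundsZero γ.toSet
    · dsimp only
      rw [hD, extendZero_of_surroundsZero hs]
      have he := Loop.isEnclosing hs
      refine (hF.hasDerivAt_flowImage_neg he v).unique
        ((hasDerivAt_const (0 : ℝ) (0 : ℂ)).congr_of_eventuallyEq ?_)
      obtain ⟨m', R', hm', hγm⟩ := he.exists_subset_closedAnnulus
      obtain ⟨ε', M', h'⟩ := exists_isFlowBox v R' hm'
      -- A loop that leaves `A` leaves the closed annulus `m ≤ |z| ≤ R`, and does so for all small
      -- times, since the complement is open. Hence `F` vanishes along the flow for small times, and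
      -- so does its derivative.
      have h1 := (h'.setTendsto_flowImage hγm he.isCompact (t := 0) (by simpa using h'.time_pos)).lower
        (closedAnnulus m R)ᶜ (isCompact_closedAnnulus m R).isClosed.isOpen_compl (by
          rw [he.flowImage_zero]
          by_contra h2
          refine hcon' fun z hz => ?_
          have h3 : z ∈ closedAnnulus m R := by_contra fun h3 => h2 ⟨z, hz, h3⟩
          exact ⟨by linarith [h3.1], by linarith [h3.2]⟩)
      have hneg : Tendsto (fun t : ℝ => -t) (𝓝 0) (𝓝 0) := by
        simpa using (continuous_neg (G := ℝ)).tendsto 0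
      filter_upwards [hneg.eventually h1, hneg.eventually (he.eventually_flowImage v)] with t ht ht'
      by_contra h0
      obtain ⟨z, hz, hzm⟩ := ht
      exact hzm (hsupp _ ht' h0 hz)
    · exact extendZero_of_not_surroundsZero hs
  have hDind := extendZero_toSet (realAction v F)
  constructor
  · rw [LoopMeasureFamily.muZero, ← IntegrableOn, ← integrable_indicator_iff
      measurableSet_loopsAroundZero, ← hDind, ← integrableOn_iff_integrable_of_support_subset hDsupp,
      IntegrableOn, ← hjmap, hjemb.integrable_map_iff]
    exact hmain.1
  · rw [LoopMeasureFamily.muZero, ← integral_indicator measurableSet_loopsAroundZero, ← hDind,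
      ← setIntegral_eq_integral_of_forall_compl_eq_zero (s := range j) (fun γ hγ => by
        by_contra h0
        exact hγ (hDsupp h0)), ← hjmap, hjemb.integral_map]
    exact hzero

end LoopMeasure

/-! ### The complexified action and the theorem -/

open LoopMeasure
theorem mainTheorem1 (μ : LoopMeasureFamily) (hμ : μ.ConformalRestriction) (hμ' : μ.IsNontrivial)
    (p : MvPolynomial CoeffVar ℂ) (f : ℝ × ℝ → ℂ) (hf : ContDiff ℝ 1 f)
    (hfc : HasCompactSupport f) (hfs : tsupport f ⊆ Ioi 0 ×ˢ Ioi 0)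
    (v w : ℂ[T;T⁻¹]) :
    (∀ x : ℂ[T;T⁻¹], ∀ γ ∈ loopsAroundZero,
      DifferentiableAt ℝ (fun t : ℝ => testFunction p f (flowImage x (-t) γ.toSet)) 0) ∧
    Integrable (fun γ : Loop ℂ => wittAction v w (testFunction p f) γ.toSet) μ.muZero ∧
    ∫ γ : Loop ℂ, wittAction v w (testFunction p f) γ.toSet ∂μ.muZero = 0 := by
  have hF := isFlowRegular_testFunction p hf hfc
  obtain ⟨m, R, hm, hR, hsupp⟩ := exists_annulus_of_testFunction_ne_zero p hfc hfs
  have key := integrable_realAction hμ hμ' hF (continuousOn_testFunction p hf.continuous) hm hR hsupp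
  have hhol := ((key v).1.sub ((key (Complex.I • v)).1.const_mul Complex.I)).const_mul (1 / 2 : ℂ)
  have hanti := ((key w).1.add ((key (Complex.I • w)).1.const_mul Complex.I)).const_mul (1 / 2 : ℂ)
  refine ⟨fun x γ hγ => (hF.hasDerivAt_flowImage_neg (Loop.isEnclosing hγ) x).differentiableAt,
    hhol.add hanti, ?_⟩
  refine (integral_add hhol hanti).trans ?_
  simp only [Pi.sub_apply, Pi.add_apply]
  rw [integral_const_mul, integral_const_mul,
    integral_sub (key v).1 ((key (Complex.I • v)).1.const_mul Complex.I),
    integral_add (key w).1 ((key (Complex.I • w)).1.const_mul Complex.I),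
    integral_const_mul, integral_const_mul, (key v).2, (key w).2, (key (Complex.I • v)).2,
    (key (Complex.I • w)).2]
  simp
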